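/- **Theorem.** There is a deterministic deletion-only data structure for unit-disk range emptiness queries, given by three fixed programs (construction, query, deletion) of a real RAM, and there is a constant $K$ such that the following holds for every real $\lambda>0$, every integer $n\ge 0$ and every set $Q$ of $n$ distinct points of the Euclidean plane. The machine performs exact real operations $+,-,\times,\div,\sqrt{\ }$ and comparisons, and operations on integer words that just suffice to address its memory, at unit cost per operation; it has no rounding operation from reals to integers. Write $L=\lfloor\log_2(n+2)\rfloor$. 1. *Space.* Throughout the construction and all operations, the programs use only the first $K(n+1)$ cells of an integer memory and of a real memory (and a fixed number of registers), i.e. $O(n)$ space. 2. *Construction.* Given $\lambda$, $n$ and the coordinates of the points in any order, the data structure is built in at most $K(n+1)L=O(n\log n)$ time. 3. *Operations.* After the construction, every sequence of the following two operations, in any order, is carried out correctly, where $Q'$ denotes the current set, initially $Q$: - *Unit-disk range emptiness query:* given any point $p$ of the plane, determine whether there is a point $q\in Q'$ with $|pq|\le\lambda$, and if so, return such a point $q$. Each query takes at most $KL=O(\log n)$ time in the worst case. - *Deletion:* given a point $q\in Q'$, delete it from $Q'$. A deletion takes $O(\log n)$ amortized time: for every sequence that contains $k$ deletions, the construction and these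 $k$ deletions together take at most $K(n+1)L+K\,k\,L$ time. -/

import Mathlib

namespace RealRAM

/-!
A random access machine over the reals (a "real RAM") with a step count.

A machine has finitely many registers per program and two memories, one for integers and one for
real numbers.  It is run with a bound `M`: each memory has the `M` cells `0, …, M - 1`, and an
integer word holds a value `< M`.  An access outside the memory and an integer overflow are faults:
a faulting run has no result.  Exact real arithmetic `+, -, *, /, √` and real comparisons have unit
cost.  There is no rounding and no other way to turn a real number into an integer.
-/

/-- Contents of the registers and of the memories. -/
structure State where
  intReg : ℕ → ℕ
  realReg : ℕ → ℝ
  intMem : ℕ → ℕ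
  realMem : ℕ → ℝ

/-- Integer expressions; `load a` reads the integer memory at address `a`. -/
inductive IntExpr where
  | const (k : ℕ)
  | reg (i : ℕ)
  | load (a : IntExpr)
  | add (a b : IntExpr)
  | sub (a b : IntExpr)
  | mul (a b : IntExpr)
  | div (a b : IntExpr)

namespace IntExpr

/-- The value of an integer expression (truncated subtraction, integer division). -/
def eval (s : State) : IntExpr → ℕ
  | const k => k
  | reg i => s.intReg i
  | load a => s.intMem (a.eval s)
  | add a b => a.eval s + b.eval s
  | sub a b => a.eval s - b.eval s
  | mul a b => a.eval s * b.eval s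
  | div a b => a.eval s / b.eval s

/-- Evaluation does not fault: every address is inside the memory, every value fits a word. -/
def Ok (M : ℕ) (s : State) : IntExpr → Prop
  | const k => k < M
  | reg _ => True
  | load a => a.Ok M s ∧ a.eval s < M
  | add a b => a.Ok M s ∧ b.Ok M s ∧ a.eval s + b.eval s < M
  | sub a b => a.Ok M s ∧ b.Ok M s
  | mul a b => a.Ok M s ∧ b.Ok M s ∧ a.eval s * b.eval s < M
  | div a b => a.Ok M s ∧ b.Ok M s

/-- Number of unit steps of the evaluation. -/
def cost : IntExpr → ℕ
  | const _ => 1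
  | reg _ => 1
  | load a => a.cost + 1
  | add a b => a.cost + b.cost + 1
  | sub a b => a.cost + b.cost + 1
  | mul a b => a.cost + b.cost + 1
  | div a b => a.cost + b.cost + 1

end IntExpr

/-- Real expressions; `load a` reads the real memory at the integer address `a`.  The constants
of a program are rational. -/
inductive RealExpr where
  | const (c : ℚ)
  | reg (i : ℕ)
  | load (a : IntExpr)
  | add (a b : RealExpr)
  | sub (a b : RealExpr)
  | mul (a b : RealExpr)
  | div (a b : RealExpr)
  | sqrt (a : RealExpr)

namespace RealExpr

/-- The value of a real expression.  Division by `0` and the root of a negative number return `0`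
(a program can recognise these cases by one comparison). -/
noncomputable def eval (s : State) : RealExpr → ℝ
  | const c => (c : ℝ)
  | reg i => s.realReg i
  | load a => s.realMem (a.eval s)
  | add a b => a.eval s + b.eval s
  | sub a b => a.eval s - b.eval s
  | mul a b => a.eval s * b.eval s
  | div a b => a.eval s / b.eval s
  | sqrt a => Real.sqrt (a.eval s)

/-- Evaluation does not fault. -/
def Ok (M : ℕ) (s : State) : RealExpr → Prop
  | const _ => True
  | reg _ => True
  | load a => a.Ok M s ∧ a.eval s < M
  | add a b => a.Ok M s ∧ b.Ok M s
  | sub a b => a.Ok M s ∧ b.Ok M s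
  | mul a b => a.Ok M s ∧ b.Ok M s
  | div a b => a.Ok M s ∧ b.Ok M s
  | sqrt a => a.Ok M s

/-- Number of unit steps of the evaluation. -/
def cost : RealExpr → ℕ
  | const _ => 1
  | reg _ => 1
  | load a => a.cost + 1
  | add a b => a.cost + b.cost + 1
  | sub a b => a.cost + b.cost + 1
  | mul a b => a.cost + b.cost + 1
  | div a b => a.cost + b.cost + 1
  | sqrt a => a.cost + 1

end RealExpr

/-- Tests. -/
inductive Test where
  | intLt (a b : IntExpr)
  | intEq (a b : IntExpr)
  | realLt (a b : RealExpr)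
  | realLe (a b : RealExpr)
  | neg (c : Test)
  | conj (c d : Test)
  | disj (c d : Test)

namespace Test

/-- The outcome of a test. -/
def Holds (s : State) : Test → Prop
  | intLt a b => a.eval s < b.eval s
  | intEq a b => a.eval s = b.eval s
  | realLt a b => a.eval s < b.eval s
  | realLe a b => a.eval s ≤ b.eval s
  | neg c => ¬ c.Holds s
  | conj c d => c.Holds s ∧ d.Holds s
  | disj c d => c.Holds s ∨ d.Holds s

/-- Evaluation does not fault. -/
def Ok (M : ℕ) (s : State) : Test → Prop
  | intLt a b => a.Ok M s ∧ b.Ok M s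
  | intEq a b => a.Ok M s ∧ b.Ok M s
  | realLt a b => a.Ok M s ∧ b.Ok M s
  | realLe a b => a.Ok M s ∧ b.Ok M s
  | neg c => c.Ok M s
  | conj c d => c.Ok M s ∧ d.Ok M s
  | disj c d => c.Ok M s ∧ d.Ok M s

/-- Number of unit steps of the evaluation. -/
def cost : Test → ℕ
  | intLt a b => a.cost + b.cost + 1
  | intEq a b => a.cost + b.cost + 1
  | realLt a b => a.cost + b.cost + 1
  | realLe a b => a.cost + b.cost + 1
  | neg c => c.cost + 1
  | conj c d => c.cost + d.cost + 1
  | disj c d => c.cost + d.cost + 1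

end Test

/-- Programs. -/
inductive Program where
  | skip
  | setInt (i : ℕ) (e : IntExpr)
  | setReal (i : ℕ) (e : RealExpr)
  | storeInt (a e : IntExpr)
  | storeReal (a : IntExpr) (e : RealExpr)
  | seq (c d : Program)
  | cond (b : Test) (c d : Program)
  | loop (b : Test) (c : Program)

/-- `Exec M c s t s'`: with memory and word bound `M`, the program `c` started in the state `s`
halts after `t` steps, without a fault, in the state `s'`. -/
inductive Exec (M : ℕ) : Program → State → ℕ → State → Prop
  | skip (s : State) : Exec M .skip s 1 s
  | setInt (i : ℕ) (e : IntExpr) (s : State) (he : e.Ok M s) :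
      Exec M (.setInt i e) s (e.cost + 1)
        { s with intReg := Function.update s.intReg i (e.eval s) }
  | setReal (i : ℕ) (e : RealExpr) (s : State) (he : e.Ok M s) :
      Exec M (.setReal i e) s (e.cost + 1)
        { s with realReg := Function.update s.realReg i (e.eval s) }
  | storeInt (a e : IntExpr) (s : State) (ha : a.Ok M s) (hM : a.eval s < M) (he : e.Ok M s) :
      Exec M (.storeInt a e) s (a.cost + e.cost + 1)
        { s with intMem := Function.update s.intMem (a.eval s) (e.eval s) }
  | storeReal (a : IntExpr) (e : RealExpr) (s : State) (ha : a.Ok M s) (hM : a.eval s < M)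
      (he : e.Ok M s) :
      Exec M (.storeReal a e) s (a.cost + e.cost + 1)
        { s with realMem := Function.update s.realMem (a.eval s) (e.eval s) }
  | seq {c d : Program} {s s' s'' : State} {t t' : ℕ} (hc : Exec M c s t s')
      (hd : Exec M d s' t' s'') : Exec M (.seq c d) s (t + t') s''
  | condTrue {b : Test} {c d : Program} {s s' : State} {t : ℕ} (hok : b.Ok M s)
      (hb : b.Holds s) (hc : Exec M c s t s') : Exec M (.cond b c d) s (b.cost + t + 1) s'
  | condFalse {b : Test} {c d : Program} {s s' : State} {t : ℕ} (hok : b.Ok M s)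
      (hb : ¬ b.Holds s) (hd : Exec M d s t s') : Exec M (.cond b c d) s (b.cost + t + 1) s'
  | loopTrue {b : Test} {c : Program} {s s' s'' : State} {t t' : ℕ} (hok : b.Ok M s)
      (hb : b.Holds s) (hc : Exec M c s t s') (hl : Exec M (.loop b c) s' t' s'') :
      Exec M (.loop b c) s (b.cost + t + t' + 1) s''
  | loopFalse {b : Test} {c : Program} {s : State} (hok : b.Ok M s) (hb : ¬ b.Holds s) :
      Exec M (.loop b c) s (b.cost + 1) s

end RealRAM

namespace UnitDisk

open RealRAM

/-- The Euclidean plane. -/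
abbrev Plane : Type := EuclideanSpace ℝ (Fin 2)

/-- The three programs of a deletion-only data structure. -/
structure DataStructure where
  build : Program
  query : Program
  delete : Program

/-- The input of the construction: the number `n` of points in integer register `0`, the radius in
real register `0`, the coordinates of the `i`-th point in the real memory cells `2 i` and `2 i + 1`,
and zeros everywhere else. -/
noncomputable def input (lam : ℝ) {n : ℕ} (P : Fin n → Plane) : State where
  intReg := Function.update (fun _ => 0) 0 n
  realReg := Function.update (fun _ => 0) 0 lam
  intMem := fun _ => 0
  realMem := fun a =>
    if h : a / 2 < n then (if a % 2 = 0 then P ⟨a / 2, h⟩ 0 else P ⟨a / 2, h⟩ 1) else 0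

/-- Pass a point as argument: its coordinates are put into the real registers `0` and `1`, and the
rest of the state is kept. -/
noncomputable def withArg (s : State) (p : Plane) : State :=
  { s with realReg := Function.update (Function.update s.realReg 0 (p 0)) 1 (p 1) }

/-- The final state `s` of a query answers the unit-disk range emptiness query `p` for the point
set `Q`: integer register `0` tells whether some point of `Q` has distance at most `lam` from `p`,
and if so, the real registers `0` and `1` hold the coordinates of such a point. -/
def Answers (lam : ℝ) (Q : Set Plane) (p : Plane) (s : State) : Prop :=
  (s.intReg 0 = 1 ∧ ∃ q ∈ Q, dist p q ≤ lam ∧ s.realReg 0 = q 0 ∧ s.realReg 1 = q 1) ∨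
  (s.intReg 0 = 0 ∧ ∀ q ∈ Q, ¬ dist p q ≤ lam)

/-- The operations. -/
inductive Operation where
  | query (p : Plane)
  | delete (q : Plane)

/-- Every deletion in the sequence deletes a point of the current set, which is `Q` at first. -/
def Legal : Set Plane → List Operation → Prop
  | _, [] => True
  | Q, .query _ :: ops => Legal Q ops
  | Q, .delete q :: ops => q ∈ Q ∧ Legal (Q \ {q}) ops

/-- The number of deletions in a sequence of operations. -/
def deletions : List Operation → ℕ
  | [] => 0
  | .query _ :: ops => deletions ops
  | .delete _ :: ops => deletions ops + 1

/-- `Serves M D lam T Q s ops d`: from the state `s`, where the current set is `Q`, the data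
structure carries out the operations `ops` one after the other on the memory left by the preceding
ones; each query is answered correctly for the then current set in at most `T` steps, and the
deletions take `d` steps in total. -/
inductive Serves (M : ℕ) (D : DataStructure) (lam : ℝ) (T : ℕ) :
    Set Plane → State → List Operation → ℕ → Prop
  | nil (Q : Set Plane) (s : State) : Serves M D lam T Q s [] 0
  | query {Q : Set Plane} {s s' : State} {p : Plane} {t d : ℕ} {ops : List Operation}
      (hrun : Exec M D.query (withArg s p) t s') (ht : t ≤ T) (hans : Answers lam Q p s')
      (hops : Serves M D lam T Q s' ops d) : Serves M D lam T Q s (.query p :: ops) d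
  | delete {Q : Set Plane} {s s' : State} {q : Plane} {t d : ℕ} {ops : List Operation}
      (hrun : Exec M D.delete (withArg s q) t s')
      (hops : Serves M D lam T (Q \ {q}) s' ops d) :
      Serves M D lam T Q s (.delete q :: ops) (t + d)

end UnitDisk

open RealRAM UnitDisk

/-!
The data structure maintains the upper envelope of the circles of radius `lam` around the points,
cell by cell.

*Reduction to envelopes.* If the points are seen from four directions (the two coordinate axes,
both ways), then a query point `p` is either very close to a point `q` within reach or well above
it in one of the directions (`exists_dir`). The points of one direction are divided into rows of
height `lam / 10`, and each row into cells of width `lam / 10`. There is no rounding operation, so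
rows and cells are formed greedily along sorted lists (`greedy`), and they are found by binary
search (`locate`). If `q` is very close to `p`, then all points of its cell are within reach. If
`q` is within reach and well below `p`, then the point of its cell whose upper semicircle is
maximal at the abscissa of `p` is within reach as well (`near_of_arc_le`). A query therefore
probes, in each direction, the constantly many cells that are hit by a grid around `p`
(`Layout.exists_probe`) and asks for the maximal semicircle in each.

*One envelope for all cells.* Two semicircles of one cell cross at most once in the window of
abscissae that matters. Continued outside of the window by lines whose slopes depend on the rank in
the sorted order, and with the windows of different cells far apart on one line, all these
functions cross pairwise exactly once, in the order of their ranks (`Layout.singleCrossing`), and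
the functions of other cells do not interfere in the window of a cell (`Layout.same_cell`). The
crossings are computed with square roots.

*Deletions.* The envelope of such functions is kept in the deletion-only tree of Hershberger and
Suri. Each node of a complete binary tree carries the envelope of the functions below it, which is
an initial piece of the envelope of the left child followed by a final piece of that of the right
child; the two are joined at a bridge. A single doubly linked list represents the envelope of the
root, and each node stores the two links that are hidden by its bridge, so that a join can be
undone (`TreeMem.undo`); this takes linear space. A deletion undoes the joins on the path from the
root to the leaf and then joins again from the leaf to the root. If the deleted function was an end
of a bridge, the search for the new bridge starts at the old one and moves in one direction only
(`sweep_restart`). The number of its steps is at most a constant plus the growth of the envelopes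
of the node and of its child, and the total length of all envelopes is at most `N (log N + 1)`
(`TreeOK.total_le`), so the potential `EnvData.total` yields the amortized bound
(`deletePos_runs`). A query descends from the root and compares its abscissa with those of the
bridges (`descend_runs`).

Programs are verified in a program logic with running times: `Runs` for total correctness with a
time bound, and the weakest precondition `wp` for programs without loops.
-/

namespace RealRAM

/-! ### A program logic with running times -/

/-- From `s`, the program `c` halts after `t` steps without a fault in a state `s'` such that
`Q t s'`. -/
def Runs (M : ℕ) (c : Program) (s : State) (Q : ℕ → State → Prop) : Prop :=
  ∃ t s', Exec M c s t s' ∧ Q t s'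

theorem Runs.mono {M : ℕ} {c : Program} {s : State} {Q R : ℕ → State → Prop}
    (h : Runs M c s Q) (hQR : ∀ t s', Q t s' → R t s') : Runs M c s R := by
  obtain ⟨t, s', he, hq⟩ := h
  exact ⟨t, s', he, hQR _ _ hq⟩

theorem Runs.seq {M : ℕ} {c d : Program} {s : State} {Q : ℕ → State → Prop}
    (h : Runs M c s (fun t s' => Runs M d s' (fun t' s'' => Q (t + t') s''))) :
    Runs M (.seq c d) s Q := by
  obtain ⟨t, s', he, t', s'', he', hq⟩ := h
  exact ⟨_, _, .seq he he', hq⟩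

theorem Runs.cond {M : ℕ} {b : Test} {c d : Program} {s : State} {Q : ℕ → State → Prop}
    (hok : b.Ok M s) (hc : b.Holds s → Runs M c s (fun t s' => Q (b.cost + t + 1) s'))
    (hd : ¬ b.Holds s → Runs M d s (fun t s' => Q (b.cost + t + 1) s')) :
    Runs M (.cond b c d) s Q := by
  by_cases hb : b.Holds s
  · obtain ⟨t, s', he, hq⟩ := hc hb
    exact ⟨_, _, .condTrue hok hb he, hq⟩
  · obtain ⟨t, s', he, hq⟩ := hd hb
    exact ⟨_, _, .condFalse hok hb he, hq⟩

/-- The rule for loops.  `I r t s` is the invariant; `r` decreases with every iteration and `t` is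
the time spent so far. -/
theorem Runs.loop {M : ℕ} {b : Test} {c : Program} (I : ℕ → ℕ → State → Prop)
    {Q : ℕ → State → Prop}
    (hok : ∀ r t s, I r t s → b.Ok M s)
    (hstep : ∀ r t s, I r t s → b.Holds s →
      Runs M c s (fun t' s' => ∃ r' < r, I r' (t + (b.cost + t' + 1)) s'))
    (hend : ∀ r t s, I r t s → ¬ b.Holds s → Q (t + (b.cost + 1)) s)
    {r : ℕ} {s : State} (h0 : I r 0 s) : Runs M (.loop b c) s Q := by
  suffices H : ∀ r t s, I r t s → Runs M (.loop b c) s (fun t' s' => Q (t + t') s') by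
    simpa using H r 0 s h0
  intro r
  induction r using Nat.strong_induction_on with
  | _ r ih =>
    intro t s hI
    by_cases hb : b.Holds s
    · obtain ⟨t1, s1, he, r', hr, hI'⟩ := hstep r t s hI hb
      obtain ⟨t2, s2, he2, hq⟩ := ih r' hr _ _ hI'
      refine ⟨_, _, .loopTrue (hok _ _ _ hI) hb he he2, ?_⟩
      convert hq using 1
      ring
    · exact ⟨_, _, .loopFalse (hok _ _ _ hI) hb, hend _ _ _ hI hb⟩

/-- Weakest precondition of a loop-free program. -/
def wp (M : ℕ) : Program → State → (State → Prop) → Prop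
  | .skip, s, Q => Q s
  | .setInt i e, s, Q =>
      e.Ok M s ∧ Q { s with intReg := Function.update s.intReg i (e.eval s) }
  | .setReal i e, s, Q =>
      e.Ok M s ∧ Q { s with realReg := Function.update s.realReg i (e.eval s) }
  | .storeInt a e, s, Q => (a.Ok M s ∧ a.eval s < M ∧ e.Ok M s) ∧
      Q { s with intMem := Function.update s.intMem (a.eval s) (e.eval s) }
  | .storeReal a e, s, Q => (a.Ok M s ∧ a.eval s < M ∧ e.Ok M s) ∧
      Q { s with realMem := Function.update s.realMem (a.eval s) (e.eval s) }
  | .seq c d, s, Q => wp M c s (fun s' => wp M d s' Q)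
  | .cond b c d, s, Q => b.Ok M s ∧ (b.Holds s → wp M c s Q) ∧ (¬ b.Holds s → wp M d s Q)
  | .loop _ _, _, _ => False

/-- An upper bound for the running time of a loop-free program. -/
def Program.bound : Program → ℕ
  | .skip => 1
  | .setInt _ e => e.cost + 1
  | .setReal _ e => e.cost + 1
  | .storeInt a e => a.cost + e.cost + 1
  | .storeReal a e => a.cost + e.cost + 1
  | .seq c d => c.bound + d.bound
  | .cond b c d => b.cost + c.bound + d.bound + 1
  | .loop _ _ => 0

theorem Runs.of_wp {M : ℕ} {c : Program} {s : State} {Q : ℕ → State → Prop}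
    (h : wp M c s (fun s' => ∀ t ≤ c.bound, Q t s')) : Runs M c s Q := by
  suffices H : ∀ (c : Program) (s : State) (R : State → Prop), wp M c s R →
      ∃ t s', Exec M c s t s' ∧ t ≤ c.bound ∧ R s' by
    obtain ⟨t, s', he, ht, hq⟩ := H c s _ h
    exact ⟨t, s', he, hq t ht⟩
  clear h
  intro c
  induction c with
  | skip => exact fun s R h => ⟨_, _, .skip s, le_rfl, h⟩
  | setInt i e => exact fun s R h => ⟨_, _, .setInt i e s h.1, le_rfl, h.2⟩
  | setReal i e => exact fun s R h => ⟨_, _, .setReal i e s h.1, le_rfl, h.2⟩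
  | storeInt a e => exact fun s R h => ⟨_, _, .storeInt a e s h.1.1 h.1.2.1 h.1.2.2, le_rfl, h.2⟩
  | storeReal a e => exact fun s R h => ⟨_, _, .storeReal a e s h.1.1 h.1.2.1 h.1.2.2, le_rfl, h.2⟩
  | seq c d ihc ihd =>
    intro s R h
    obtain ⟨t, s', he, ht, h'⟩ := ihc s _ h
    obtain ⟨t', s'', he', ht', h''⟩ := ihd s' _ h'
    exact ⟨_, _, .seq he he', Nat.add_le_add ht ht', h''⟩
  | cond b c d ihc ihd =>
    intro s R h
    by_cases hb : b.Holds s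
    · obtain ⟨t, s', he, ht, h'⟩ := ihc s _ (h.2.1 hb)
      exact ⟨_, _, .condTrue h.1 hb he, by simp only [Program.bound]; omega, h'⟩
    · obtain ⟨t, s', he, ht, h'⟩ := ihd s _ (h.2.2 hb)
      exact ⟨_, _, .condFalse h.1 hb he, by simp only [Program.bound]; omega, h'⟩
  | loop b c _ => exact fun s R h => h.elim

theorem wp_mono {M : ℕ} {c : Program} {s : State} {Q R : State → Prop} (h : wp M c s Q)
    (hQR : ∀ s', Q s' → R s') : wp M c s R := by
  induction c generalizing s Q R with
  | skip => exact hQR _ h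
  | setInt i e => exact ⟨h.1, hQR _ h.2⟩
  | setReal i e => exact ⟨h.1, hQR _ h.2⟩
  | storeInt a e => exact ⟨h.1, hQR _ h.2⟩
  | storeReal a e => exact ⟨h.1, hQR _ h.2⟩
  | seq c d ihc ihd => exact ihc h (fun s' h' => ihd h' hQR)
  | cond b c d ihc ihd => exact ⟨h.1, fun hb => ihc (h.2.1 hb) hQR, fun hb => ihd (h.2.2 hb) hQR⟩
  | loop b c _ => exact h.elim

/-! ### Records in memory -/

/-- The address of field `k < 16` of record `i`. -/
def ad (k i : ℕ) : ℕ := 16 * i + k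

/-- The expression for the address of field `k` of record `e`. -/
def addr (k : ℕ) (e : IntExpr) : IntExpr := .add (.mul (.const 16) e) (.const k)

@[simp] theorem eval_addr (s : State) (k : ℕ) (e : IntExpr) :
    (addr k e).eval s = ad k (e.eval s) := rfl

@[simp] theorem ok_addr (M : ℕ) (s : State) (k : ℕ) (e : IntExpr) :
    (addr k e).Ok M s ↔ 16 < M ∧ e.Ok M s ∧ ad k (e.eval s) < M := by
  simp only [addr, IntExpr.Ok, IntExpr.eval, ad]
  constructor
  · rintro ⟨⟨h1, h2, h3⟩, h4, h5⟩
    exact ⟨h1, h2, h5⟩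
  · rintro ⟨h1, h2, h5⟩
    exact ⟨⟨h1, h2, by omega⟩, by omega, h5⟩

@[simp] theorem cost_addr (k : ℕ) (e : IntExpr) : (addr k e).cost = e.cost + 4 := by
  simp only [addr, IntExpr.cost]
  ring

theorem ad_inj {k k' i i' : ℕ} (hk : k < 16) (hk' : k' < 16) :
    ad k i = ad k' i' ↔ k = k' ∧ i = i' := by
  simp only [ad]
  omega

@[simp] theorem update_ad_same {α : Type*} (g : ℕ → α) (k i j : ℕ) (e : α) :
    Function.update g (ad k j) e (ad k i) = if i = j then e else g (ad k i) := by
  have : ad k i = ad k j ↔ i = j := by simp only [ad]; omega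
  simp [Function.update_apply, this]

theorem update_ad_ne {α : Type*} (g : ℕ → α) {k k' : ℕ} (i j : ℕ) (e : α) (hk : k < 16)
    (hk' : k' < 16) (h : k' ≠ k) :
    Function.update g (ad k j) e (ad k' i) = g (ad k' i) := by
  rw [Function.update_of_ne]
  rw [Ne, ad_inj hk' hk]
  exact fun h' => h h'.1

/-- Field `k` of the records of the integer memory. -/
def State.int (s : State) (k : ℕ) : ℕ → ℕ := fun i => s.intMem (ad k i)

/-- Field `k` of the records of the real memory. -/
def State.real (s : State) (k : ℕ) : ℕ → ℝ := fun i => s.realMem (ad k i)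

/-- The integer register `i` as an expression. -/
abbrev ireg (i : ℕ) : IntExpr := .reg i

/-- The real register `i` as an expression. -/
abbrev rreg (i : ℕ) : RealExpr := .reg i

/-- The field `k` of the record `e` of the integer memory, as an expression. -/
abbrev ild (k : ℕ) (e : IntExpr) : IntExpr := .load (addr k e)

/-- The field `k` of the record `e` of the real memory, as an expression. -/
abbrev rld (k : ℕ) (e : IntExpr) : RealExpr := .load (addr k e)

/-- Store `e` in field `k` of the record `a` of the integer memory. -/
abbrev ist (k : ℕ) (a e : IntExpr) : Program := .storeInt (addr k a) e

/-- Store `e` in field `k` of the record `a` of the real memory. -/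
abbrev rst (k : ℕ) (a : IntExpr) (e : RealExpr) : Program := .storeReal (addr k a) e

end RealRAM

/-- Sequential composition of programs. -/
infixr:67 " ;; " => RealRAM.Program.seq

namespace UnitDisk

/-! ### Upper envelopes of functions that cross once -/

section Envelope

variable {ι : Type*} [LinearOrder ι]

/-- On the index set `D`, two functions `F a`, `F b` with `a < b` cross exactly once, at `c a b`:
`F a` is larger to the left and `F b` is larger to the right. -/
def SingleCrossing (D : Set ι) (F : ι → ℝ → ℝ) (c : ι → ι → ℝ) : Prop :=
  ∀ a ∈ D, ∀ b ∈ D, a < b → (∀ x < c a b, F b x < F a x) ∧ F a (c a b) = F b (c a b) ∧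
    ∀ x, c a b < x → F a x < F b x

/-- `F i` is maximal at `x` among the functions with index in `S`. -/
def MaxAt (F : ι → ℝ → ℝ) (S : Set ι) (i : ι) (x : ℝ) : Prop := ∀ b ∈ S, F b x ≤ F i x

/-- `f 1, …, f len` is the sequence of the indices of the upper envelope of the functions with
index in `S`, from left to right.  Consecutive functions of the sequence are maximal where they
cross. -/
structure Envelope (F : ι → ℝ → ℝ) (c : ι → ι → ℝ) (S : Set ι) (len : ℕ) (f : ℕ → ι) : Prop where
  mem : ∀ t, 1 ≤ t → t ≤ len → f t ∈ S
  lt : ∀ t, 1 ≤ t → t < len → f t < f (t + 1)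
  first : ∀ b ∈ S, 1 ≤ len ∧ f 1 ≤ b
  last : ∀ b ∈ S, b ≤ f len
  edge : ∀ t, 1 ≤ t → t < len → MaxAt F S (f t) (c (f t) (f (t + 1)))

variable {D S T : Set ι} {F : ι → ℝ → ℝ} {c : ι → ι → ℝ} {len : ℕ} {f : ℕ → ι}

theorem SingleCrossing.le_of_le (h : SingleCrossing D F c) {a b : ι} (ha : a ∈ D) (hb : b ∈ D)
    (hab : a < b) {x : ℝ} (hx : x ≤ c a b) : F b x ≤ F a x := by
  obtain ⟨h1, h2, h3⟩ := h a ha b hb hab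
  rcases hx.lt_or_eq with hx | rfl
  · exact (h1 x hx).le
  · exact h2.ge

theorem SingleCrossing.le_of_ge (h : SingleCrossing D F c) {a b : ι} (ha : a ∈ D) (hb : b ∈ D)
    (hab : a < b) {x : ℝ} (hx : c a b ≤ x) : F a x ≤ F b x := by
  obtain ⟨h1, h2, h3⟩ := h a ha b hb hab
  rcases hx.lt_or_eq with hx | rfl
  · exact (h3 x hx).le
  · exact h2.le

theorem SingleCrossing.le_cross (h : SingleCrossing D F c) {a b : ι} (ha : a ∈ D) (hb : b ∈ D)
    (hab : a < b) {x : ℝ} (hx : F b x ≤ F a x) : x ≤ c a b := by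
  by_contra hc
  exact absurd ((h a ha b hb hab).2.2 x (not_le.1 hc)) (not_lt.2 hx)

theorem SingleCrossing.cross_le (h : SingleCrossing D F c) {a b : ι} (ha : a ∈ D) (hb : b ∈ D)
    (hab : a < b) {x : ℝ} (hx : F a x ≤ F b x) : c a b ≤ x := by
  by_contra hc
  exact absurd ((h a ha b hb hab).1 x (not_le.1 hc)) (not_lt.2 hx)

theorem Envelope.lt_of_lt (h : Envelope F c S len f) {t u : ℕ} (ht : 1 ≤ t) (htu : t < u)
    (hu : u ≤ len) : f t < f u := by
  induction u, htu using Nat.le_induction with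
  | base => exact h.lt t ht (by omega)
  | succ u hu' ih => exact (ih (by omega)).trans (h.lt u (by omega) (by omega))

theorem Envelope.edge' (h : Envelope F c S len f) (hD : SingleCrossing D F c) (hS : S ⊆ D) {t : ℕ}
    (ht : 1 ≤ t) (htl : t < len) : MaxAt F S (f (t + 1)) (c (f t) (f (t + 1))) := by
  intro b hb
  rw [← (hD _ (hS (h.mem t ht htl.le)) _ (hS (h.mem (t + 1) (by omega) htl)) (h.lt t ht htl)).2.1]
  exact h.edge t ht htl b hb

theorem Envelope.cross_le_of_maxAt (h : Envelope F c S len f) (hD : SingleCrossing D F c)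
    (hS : S ⊆ D) {t : ℕ} {x : ℝ} (ht : 1 ≤ t) (htl : t < len) (hx : MaxAt F S (f (t + 1)) x) :
    c (f t) (f (t + 1)) ≤ x :=
  hD.cross_le (hS (h.mem t ht htl.le)) (hS (h.mem (t + 1) (by omega) htl)) (h.lt t ht htl)
    (hx _ (h.mem t ht htl.le))

theorem Envelope.le_cross_of_maxAt (h : Envelope F c S len f) (hD : SingleCrossing D F c)
    (hS : S ⊆ D) {t : ℕ} {x : ℝ} (ht : 1 ≤ t) (htl : t < len) (hx : MaxAt F S (f t) x) :
    x ≤ c (f t) (f (t + 1)) :=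
  hD.le_cross (hS (h.mem t ht htl.le)) (hS (h.mem (t + 1) (by omega) htl)) (h.lt t ht htl)
    (hx _ (h.mem (t + 1) (by omega) htl))

/-- The breakpoints of an envelope increase. -/
theorem Envelope.cross_mono (h : Envelope F c S len f) (hD : SingleCrossing D F c)
    (hS : S ⊆ D) {t u : ℕ} (ht : 1 ≤ t) (htu : t ≤ u) (hu : u < len) :
    c (f t) (f (t + 1)) ≤ c (f u) (f (u + 1)) := by
  induction u, htu using Nat.le_induction with
  | base => exact le_rfl
  | succ u hu' ih =>
    exact (ih (by omega)).trans
      (h.cross_le_of_maxAt hD hS (by omega) (by omega) (h.edge (u + 1) (by omega) hu))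

/-- Between its two breakpoints, a function of the envelope is maximal. -/
theorem Envelope.maxAt (h : Envelope F c S len f) (hD : SingleCrossing D F c)
    (hS : S ⊆ D) {t : ℕ} {x : ℝ} (ht : 1 ≤ t) (htl : t ≤ len)
    (hl : 1 < t → c (f (t - 1)) (f t) ≤ x) (hr : t < len → x ≤ c (f t) (f (t + 1))) :
    MaxAt F S (f t) x := by
  intro b hb
  have hft := h.mem t ht htl
  rcases lt_trichotomy b (f t) with hlt | rfl | hlt
  · by_cases ht1 : t = 1
    · subst ht1
      exact absurd (h.first b hb).2 (not_le.2 hlt)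
    · have hm := h.edge' hD hS (t := t - 1) (by omega) (by omega)
      rw [Nat.sub_add_cancel ht] at hm
      exact hD.le_of_ge (hS hb) (hS hft) hlt
        ((hD.cross_le (hS hb) (hS hft) hlt (hm b hb)).trans (hl (by omega)))
  · exact le_rfl
  · by_cases ht1 : t = len
    · subst ht1
      exact absurd (h.last b hb) (not_le.2 hlt)
    · have hm := h.edge t ht (by omega)
      exact hD.le_of_le (hS hft) (hS hb) hlt
        ((hr (by omega)).trans (hD.le_cross (hS hft) (hS hb) hlt (hm b hb)))

/-- The pair `(l, r)` is the bridge between the envelopes of `S` and `T`. -/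
def Bridge (F : ι → ℝ → ℝ) (c : ι → ι → ℝ) (S T : Set ι) (l r : ι) : Prop :=
  MaxAt F S l (c l r) ∧ MaxAt F T r (c l r)

/-- The sequence `f` up to index `t`, continued by `g` from index `u` on. -/
def splice {α : Type*} (f : ℕ → α) (t : ℕ) (g : ℕ → α) (u : ℕ) : ℕ → α :=
  fun k => if k ≤ t then f k else g (k - t - 1 + u)

theorem splice_le {α : Type*} {f g : ℕ → α} {t u k : ℕ} (h : k ≤ t) : splice f t g u k = f k :=
  if_pos h

theorem splice_add {α : Type*} {f g : ℕ → α} {t u : ℕ} (k : ℕ) :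
    splice f t g u (t + 1 + k) = g (k + u) := by
  rw [splice, if_neg (by omega)]
  congr 1
  omega

theorem Bridge.le_left (hD : SingleCrossing D F c) (hS : S ⊆ D) (hT : T ⊆ D)
    (hST : ∀ a ∈ S, ∀ b ∈ T, a < b) {l r : ι} (hl : l ∈ S) (hr : r ∈ T) (h : Bridge F c S T l r)
    {x : ℝ} (hx : x ≤ c l r) : ∀ b ∈ T, F b x ≤ F l x := by
  intro b hb
  refine hD.le_of_le (hS hl) (hT hb) (hST _ hl _ hb) (hx.trans ?_)
  refine hD.le_cross (hS hl) (hT hb) (hST _ hl _ hb) ?_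
  rw [(hD _ (hS hl) _ (hT hr) (hST _ hl _ hr)).2.1]
  exact h.2 b hb

theorem Bridge.le_right (hD : SingleCrossing D F c) (hS : S ⊆ D) (hT : T ⊆ D)
    (hST : ∀ a ∈ S, ∀ b ∈ T, a < b) {l r : ι} (hl : l ∈ S) (hr : r ∈ T) (h : Bridge F c S T l r)
    {x : ℝ} (hx : c l r ≤ x) : ∀ a ∈ S, F a x ≤ F r x := by
  intro b hb
  refine hD.le_of_ge (hS hb) (hT hr) (hST _ hb _ hr) (le_trans ?_ hx)
  refine hD.cross_le (hS hb) (hT hr) (hST _ hb _ hr) ?_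
  rw [← (hD _ (hS hl) _ (hT hr) (hST _ hl _ hr)).2.1]
  exact h.1 b hb

/-- Two envelopes are joined at a bridge. -/
theorem Envelope.splice (hD : SingleCrossing D F c) (hS : S ⊆ D) (hT : T ⊆ D)
    (hST : ∀ a ∈ S, ∀ b ∈ T, a < b) {lenS lenT : ℕ} {f g : ℕ → ι}
    (hf : Envelope F c S lenS f) (hg : Envelope F c T lenT g) {t u : ℕ} (ht : 1 ≤ t)
    (htl : t ≤ lenS) (hu : 1 ≤ u) (hul : u ≤ lenT) (hb : Bridge F c S T (f t) (g u)) :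
    Envelope F c (S ∪ T) (t + (lenT + 1 - u)) (splice f t g u) := by
  have hl := hf.mem t ht htl
  have hr := hg.mem u hu hul
  have key : ∀ k, 1 ≤ k → k ≤ t + (lenT + 1 - u) →
      (k ≤ t ∧ UnitDisk.splice f t g u k = f k) ∨
      ∃ j, k = t + 1 + j ∧ UnitDisk.splice f t g u k = g (j + u) ∧ j + u ≤ lenT := by
    intro k h1 h2
    by_cases hk : k ≤ t
    · exact .inl ⟨hk, splice_le hk⟩
    · obtain ⟨j, rfl⟩ : ∃ j, k = t + 1 + j := ⟨k - t - 1, by omega⟩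
      exact .inr ⟨j, rfl, splice_add j, by omega⟩
  have hlr : F (f t) (c (f t) (g u)) = F (g u) (c (f t) (g u)) :=
    (hD _ (hS hl) _ (hT hr) (hST _ hl _ hr)).2.1
  constructor
  · intro k h1 h2
    rcases key k h1 h2 with ⟨hk, he⟩ | ⟨j, -, he, hj⟩ <;> rw [he]
    · exact .inl (hf.mem k h1 (by omega))
    · exact .inr (hg.mem _ (by omega) hj)
  · intro k h1 h2
    rcases key k h1 h2.le with ⟨hk, he⟩ | ⟨j, rfl, he, hj⟩ <;> rw [he]
    · rcases key (k + 1) (by omega) (by omega) with ⟨hk', he'⟩ | ⟨j, hj, he', hj'⟩ <;> rw [he']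
      · exact hf.lt k h1 (by omega)
      · exact hST _ (hf.mem k h1 (by omega)) _ (hg.mem _ (by omega) hj')
    · rw [show t + 1 + j + 1 = t + 1 + (j + 1) by omega, splice_add,
        show j + 1 + u = j + u + 1 by omega]
      exact hg.lt _ (by omega) (by omega)
  · rintro b (hb' | hb')
    · rw [splice_le (by omega)]
      exact ⟨by omega, (hf.first b hb').2⟩
    · rw [splice_le (by omega)]
      exact ⟨by omega, (hST _ (hf.mem 1 le_rfl (by omega)) _ hb').le⟩
  · obtain ⟨j, hj⟩ : ∃ j, t + (lenT + 1 - u) = t + 1 + j := ⟨lenT - u, by omega⟩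
    rw [hj, splice_add, show j + u = lenT by omega]
    rintro b (hb' | hb')
    · exact (hST _ hb' _ (hg.mem _ (by omega) le_rfl)).le
    · exact hg.last b hb'
  · intro k h1 h2
    rcases key k h1 h2.le with ⟨hk, he⟩ | ⟨j, rfl, he, hj⟩ <;> rw [he]
    · rcases Nat.lt_or_ge k t with hkt | hkt
      · rw [splice_le (by omega)]
        have hx : c (f k) (f (k + 1)) ≤ c (f t) (g u) := by
          refine (hf.cross_mono hD hS h1 (u := t - 1) (by omega) (by omega)).trans ?_
          refine hf.cross_le_of_maxAt hD hS (by omega) (by omega) ?_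
          rw [Nat.sub_add_cancel ht]
          exact hb.1
        rintro b (hb' | hb')
        · exact hf.edge k h1 (by omega) b hb'
        · exact (hb.le_left hD hS hT hST hl hr hx b hb').trans (hf.edge k h1 (by omega) _ hl)
      · obtain rfl : k = t := by omega
        rw [show k + 1 = k + 1 + 0 by omega, splice_add, Nat.zero_add]
        rintro b (hb' | hb')
        · exact hb.1 b hb'
        · rw [hlr]
          exact hb.2 b hb'
    · rw [show t + 1 + j + 1 = t + 1 + (j + 1) by omega, splice_add,
        show j + 1 + u = j + u + 1 by omega]
      have hx : c (f t) (g u) ≤ c (g (j + u)) (g (j + u + 1)) := by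
        refine le_trans ?_ (hg.cross_mono hD hT hu (u := j + u) (by omega) (by omega))
        exact hg.le_cross_of_maxAt hD hT hu (by omega) hb.2
      rintro b (hb' | hb')
      · exact (hb.le_right hD hS hT hST hl hr hx b hb').trans (hg.edge _ (by omega) (by omega) _ hr)
      · exact hg.edge _ (by omega) (by omega) b hb'

/-! ### The search for a bridge -/

open Classical in
/-- One step of the search for the bridge, at the element `t` of `f` and the element `u` of `g`:
`1` is a step back in `f`, `2` is a step back in `g`, and `0` stops. -/
noncomputable def sweepAct (c : ι → ι → ℝ) (xs : ℝ) (f g : ℕ → ι) (t u : ℕ) : ℕ :=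
  if t ≠ 1 ∧ (xs < c (f (t - 1)) (f t) ∨ (c (f t) (g u) < c (f (t - 1)) (f t) ∧
      (u = 1 ∨ c (g (u - 1)) (g u) ≤ c (f (t - 1)) (f t)))) then 1
  else if u ≠ 1 ∧ c (f t) (g u) < c (g (u - 1)) (g u) then 2
  else 0

/-- The search has located the start value `xs` and moves to the left. -/
def SweepLocated (F : ι → ℝ → ℝ) (c : ι → ι → ℝ) (S T : Set ι) (xs : ℝ) (f g : ℕ → ι)
    (t u : ℕ) : Prop :=
  (1 < t → c (f (t - 1)) (f t) ≤ xs) ∧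
    ∃ x, MaxAt F S (f t) x ∧ MaxAt F T (g u) x ∧ c (f t) (g u) ≤ x

/-- The search is still locating the start value `xs`, where `g u` is above all functions. -/
def SweepLocating (F : ι → ℝ → ℝ) (c : ι → ι → ℝ) (S T : Set ι) (xs : ℝ) (len : ℕ) (f g : ℕ → ι)
    (t u : ℕ) : Prop :=
  (t < len → xs ≤ c (f t) (f (t + 1))) ∧ MaxAt F T (g u) xs ∧ ∀ b ∈ S, F b xs ≤ F (g u) xs

/-- The invariant of the search for the bridge.  The elements of `f` before `tmin` are never
reached. -/
def SweepInv (F : ι → ℝ → ℝ) (c : ι → ι → ℝ) (S T : Set ι) (xs : ℝ) (len : ℕ) (f : ℕ → ι)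
    (lenT : ℕ) (g : ℕ → ι) (tmin t u : ℕ) : Prop :=
  tmin ≤ t ∧ t ≤ len ∧ 1 ≤ u ∧ u ≤ lenT ∧
    (SweepLocated F c S T xs f g t u ∨ SweepLocating F c S T xs len f g t u)

/-- The search does not go back beyond `tmin`. -/
def SweepStop (F : ι → ℝ → ℝ) (c : ι → ι → ℝ) (T : Set ι) (xs : ℝ) (f : ℕ → ι) (tmin : ℕ) : Prop :=
  1 ≤ tmin ∧ (tmin ≠ 1 → c (f (tmin - 1)) (f tmin) ≤ xs ∧
    ∀ b ∈ T, F b (c (f (tmin - 1)) (f tmin)) ≤ F (f tmin) (c (f (tmin - 1)) (f tmin)))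

/-- A step of the search keeps the invariant and does not go back beyond `tmin`; if no step is
possible, the current pair is the bridge. -/
theorem sweep_step (hD : SingleCrossing D F c) (hS : S ⊆ D) (hT : T ⊆ D)
    (hST : ∀ a ∈ S, ∀ b ∈ T, a < b) {lenT : ℕ} {g : ℕ → ι}
    (hf : Envelope F c S len f) (hg : Envelope F c T lenT g) {xs : ℝ} {tmin t u : ℕ}
    (hterm : SweepStop F c T xs f tmin) (hI : SweepInv F c S T xs len f lenT g tmin t u) :
    (sweepAct c xs f g t u = 1 → SweepInv F c S T xs len f lenT g tmin (t - 1) u ∧ tmin < t) ∧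
    (sweepAct c xs f g t u = 2 → SweepInv F c S T xs len f lenT g tmin t (u - 1) ∧ 1 < u) ∧
    (sweepAct c xs f g t u = 0 → Bridge F c S T (f t) (g u)) := by
  obtain ⟨h1, h2, h3, h4, hI⟩ := hI
  have h0 := hterm.1
  have hft := hf.mem t (by omega) h2
  have hgu := hg.mem u h3 h4
  have hlt := hST _ hft _ hgu
  have hloc : SweepLocating F c S T xs len f g t u → (1 < t → c (f (t - 1)) (f t) ≤ xs) →
      SweepLocated F c S T xs f g t u := by
    rintro ⟨ha, hb, hc⟩ ht
    exact ⟨ht, xs, hf.maxAt hD hS (by omega) h2 ht ha, hb, hD.cross_le (hS hft) (hT hgu) hlt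
      (hc _ hft)⟩
  have back : t ≠ 1 → (f (t - 1) ∈ S ∧ f (t - 1) < f t ∧
      MaxAt F S (f (t - 1)) (c (f (t - 1)) (f t)) ∧ MaxAt F S (f t) (c (f (t - 1)) (f t))) := by
    intro ht1
    have a1 := hf.edge (t - 1) (by omega) (by omega)
    have a2 := hf.edge' hD hS (t := t - 1) (by omega) (by omega)
    have a3 := hf.lt (t - 1) (by omega) (by omega)
    rw [Nat.sub_add_cancel (by omega)] at a1 a2 a3
    exact ⟨hf.mem _ (by omega) (by omega), a3, a1, a2⟩
  have backg : u ≠ 1 → (g (u - 1) ∈ T ∧ g (u - 1) < g u ∧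
      MaxAt F T (g (u - 1)) (c (g (u - 1)) (g u)) ∧ MaxAt F T (g u) (c (g (u - 1)) (g u))) := by
    intro ht1
    have a1 := hg.edge (u - 1) (by omega) (by omega)
    have a2 := hg.edge' hD hT (t := u - 1) (by omega) (by omega)
    have a3 := hg.lt (u - 1) (by omega) (by omega)
    rw [Nat.sub_add_cancel (by omega)] at a1 a2 a3
    exact ⟨hg.mem _ (by omega) (by omega), a3, a1, a2⟩
  -- moving the current abscissa to the left within the interval of `g u`
  have hgmax : ∀ x y, MaxAt F T (g u) x → y ≤ x → (1 < u → c (g (u - 1)) (g u) ≤ y) →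
      MaxAt F T (g u) y := fun x y hx hy hu =>
    hg.maxAt hD hT h3 h4 hu (fun hul => hy.trans (hg.le_cross_of_maxAt hD hT h3 hul hx))
  have hfmax : ∀ x y, MaxAt F S (f t) x → y ≤ x → (1 < t → c (f (t - 1)) (f t) ≤ y) →
      MaxAt F S (f t) y := fun x y hx hy hu =>
    hf.maxAt hD hS (by omega) h2 hu
      (fun hul => hy.trans (hf.le_cross_of_maxAt hD hS (by omega) hul hx))
  refine ⟨fun ha => ?_, fun ha => ?_, fun ha => ?_⟩
  · have hcond : t ≠ 1 ∧ (xs < c (f (t - 1)) (f t) ∨ (c (f t) (g u) < c (f (t - 1)) (f t) ∧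
      (u = 1 ∨ c (g (u - 1)) (g u) ≤ c (f (t - 1)) (f t)))) := by
      by_contra hcon
      rw [sweepAct, if_neg hcon] at ha
      split_ifs at ha
      omega
    obtain ⟨ht1, hcond⟩ := hcond
    obtain ⟨hm, hlt', hm1, hm2⟩ := back ht1
    have htm : tmin < t := by
      refine lt_of_le_of_ne h1 ?_
      rintro rfl
      obtain ⟨q1, q2⟩ := hterm.2 ht1
      rcases hcond with hc | hc
      · linarith
      · have := hD.le_cross (hS hft) (hT hgu) hlt (q2 _ hgu)
        linarith [hc.1]
    refine ⟨⟨by omega, by omega, h3, h4, ?_⟩, htm⟩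
    by_cases hx : xs < c (f (t - 1)) (f t)
    · rcases hI with hI | hI
      · linarith [hI.1 (by omega)]
      · refine .inr ⟨fun _ => ?_, hI.2⟩
        rw [Nat.sub_add_cancel (by omega)]
        exact hx.le
    · have hcc := hcond.resolve_left hx
      have hI : SweepLocated F c S T xs f g t u :=
        hI.elim id (fun h => hloc h (fun _ => not_lt.1 hx))
      obtain ⟨q1, x, q2, q3, q4⟩ := hI
      left
      have hex : c (f (t - 1)) (f t) ≤ x := hD.cross_le (hS hm) (hS hft) hlt' (q2 _ hm)
      refine ⟨fun htt => ?_, c (f (t - 1)) (f t), hm1, ?_, ?_⟩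
      · have := hf.cross_mono hD hS (t := t - 1 - 1) (u := t - 1) (by omega) (by omega) (by omega)
        rw [Nat.sub_add_cancel (by omega), Nat.sub_add_cancel (by omega)] at this
        exact this.trans (q1 (by omega))
      · exact hgmax x _ q3 hex (fun hu => hcc.2.resolve_left (by omega))
      · refine hD.cross_le (hS hm) (hT hgu) (hST _ hm _ hgu) ?_
        refine (hm2 _ hm).trans ?_
        exact hD.le_of_ge (hS hft) (hT hgu) hlt hcc.1.le
  · have hcond : ¬ (t ≠ 1 ∧ (xs < c (f (t - 1)) (f t) ∨ (c (f t) (g u) < c (f (t - 1)) (f t) ∧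
      (u = 1 ∨ c (g (u - 1)) (g u) ≤ c (f (t - 1)) (f t))))) := by
      intro hcon
      rw [sweepAct, if_pos hcon] at ha
      omega
    have hcond2 : u ≠ 1 ∧ c (f t) (g u) < c (g (u - 1)) (g u) := by
      by_contra hcon
      rw [sweepAct, if_neg hcond, if_neg hcon] at ha
      omega
    obtain ⟨hu1, hlt2⟩ := hcond2
    obtain ⟨hm, hlt', hm1, hm2⟩ := backg hu1
    have hx : 1 < t → c (f (t - 1)) (f t) ≤ xs := fun ht =>
      not_lt.1 fun hh => hcond ⟨by omega, .inl hh⟩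
    have hI : SweepLocated F c S T xs f g t u := hI.elim id (fun h => hloc h hx)
    obtain ⟨q1, x, q2, q3, q4⟩ := hI
    have hex : c (g (u - 1)) (g u) ≤ x := hD.cross_le (hT hm) (hT hgu) hlt' (q3 _ hm)
    refine ⟨⟨h1, h2, by omega, by omega, .inl ⟨q1, c (g (u - 1)) (g u), ?_, hm1, ?_⟩⟩, by omega⟩
    · refine hfmax x _ q2 hex (fun ht => ?_)
      by_contra hh
      rw [not_le] at hh
      exact hcond ⟨by omega, .inr ⟨hlt2.trans hh, .inr hh.le⟩⟩
    · refine hD.cross_le (hS hft) (hT hm) (hST _ hft _ hm) ?_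
      exact (hD.le_of_ge (hS hft) (hT hgu) hlt hlt2.le).trans (hm1 _ hgu)
  · have hcond : ¬ (t ≠ 1 ∧ (xs < c (f (t - 1)) (f t) ∨ (c (f t) (g u) < c (f (t - 1)) (f t) ∧
      (u = 1 ∨ c (g (u - 1)) (g u) ≤ c (f (t - 1)) (f t))))) := by
      intro hcon
      rw [sweepAct, if_pos hcon] at ha
      omega
    have hcond2 : ¬ (u ≠ 1 ∧ c (f t) (g u) < c (g (u - 1)) (g u)) := by
      intro hcon
      rw [sweepAct, if_neg hcond, if_pos hcon] at ha
      omega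
    have hx : 1 < t → c (f (t - 1)) (f t) ≤ xs := fun ht =>
      not_lt.1 fun hh => hcond ⟨by omega, .inl hh⟩
    have hI : SweepLocated F c S T xs f g t u := hI.elim id (fun h => hloc h hx)
    obtain ⟨q1, x, q2, q3, q4⟩ := hI
    have he2 : 1 < u → c (g (u - 1)) (g u) ≤ c (f t) (g u) := fun hu =>
      not_lt.1 fun hh => hcond2 ⟨by omega, hh⟩
    refine ⟨hfmax x _ q2 q4 (fun ht => ?_), hgmax x _ q3 q4 he2⟩
    by_contra hh
    rw [not_le] at hh
    refine hcond ⟨by omega, .inr ⟨hh, ?_⟩⟩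
    by_cases hu : u = 1
    · exact .inl hu
    · exact .inr ((he2 (by omega)).trans hh.le)

/-- The start of the search for the first bridge between two envelopes: at their last elements. -/
theorem SweepInv.start (hD : SingleCrossing D F c) (hS : S ⊆ D) (hT : T ⊆ D)
    {lenT : ℕ} {g : ℕ → ι}
    (hf : Envelope F c S len f) (hg : Envelope F c T lenT g) (h1 : 1 ≤ len) (h2 : 1 ≤ lenT) :
    SweepInv F c S T (c (f (len - 1)) (f len)) len f lenT g 1 len lenT := by
  refine ⟨h1, le_rfl, h2, le_rfl, .inl ⟨fun _ => le_rfl, ?_⟩⟩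
  refine ⟨max (c (f len) (g lenT)) (max (c (f (len - 1)) (f len)) (c (g (lenT - 1)) (g lenT))),
    ?_, ?_, le_max_left _ _⟩
  · exact hf.maxAt hD hS h1 le_rfl (fun _ => (le_max_left _ _).trans (le_max_right _ _))
      (fun h => absurd h (lt_irrefl _))
  · exact hg.maxAt hD hT h2 le_rfl (fun _ => (le_max_right _ _).trans (le_max_right _ _))
      (fun h => absurd h (lt_irrefl _))

/-! ### Reflection -/

theorem SingleCrossing.dual (h : SingleCrossing D F c) :
    SingleCrossing (ι := ιᵒᵈ) D (fun a x => F a (-x)) (fun a b => - c b a) := by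
  intro a ha b hb hab
  obtain ⟨h1, h2, h3⟩ := h b hb a ha hab
  refine ⟨fun x hx => h3 (-x) ?_, ?_, fun x hx => h1 (-x) ?_⟩
  · linarith
  · simp only [neg_neg]
    exact h2.symm
  · linarith

theorem Envelope.dual (h : Envelope F c S len f) (hD : SingleCrossing D F c) (hS : S ⊆ D) :
    Envelope (ι := ιᵒᵈ) (fun a x => F a (-x)) (fun a b => - c b a) S len
      (fun t => f (len + 1 - t)) := by
  constructor
  · intro t h1 h2
    exact h.mem _ (by omega) (by omega)
  · intro t h1 h2
    have := h.lt (len + 1 - (t + 1)) (by omega) (by omega)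
    rw [show len + 1 - (t + 1) + 1 = len + 1 - t by omega] at this
    exact this
  · intro b hb
    refine ⟨(h.first b hb).1, ?_⟩
    rw [Nat.add_sub_cancel]
    exact h.last b hb
  · intro b hb
    have := h.first b hb
    rw [show len + 1 - len = 1 by omega]
    exact this.2
  · intro t h1 h2 b hb
    have := h.edge' hD hS (t := len + 1 - (t + 1)) (by omega) (by omega)
    rw [show len + 1 - (t + 1) + 1 = len + 1 - t by omega] at this
    simpa using this b hb

end Envelope

end UnitDisk

namespace UnitDisk

/-! ### Arcs of circles in a cell -/

/-- The height above the cell base of the upper semicircle of radius `lam` around `(s, w)`. -/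
noncomputable def arc (lam s w x : ℝ) : ℝ := w + √(lam * lam - (x - s) * (x - s))

/-- The half-width of the window of abscissae, relative to the cell base, in which arcs matter. -/
noncomputable def halfWindow (lam : ℝ) : ℝ := 9 / 10 * lam

/-- The function of a point: the arc in the window of its cell at `Z`, continued by a line of slope
`r` to the left and by a line of slope `-(S - r)` to the right. -/
noncomputable def arcFun (lam S s w Z r X : ℝ) : ℝ :=
  if X < Z - halfWindow lam then
    arc lam s w (-halfWindow lam) - r * (Z - halfWindow lam - X)
  else if Z + halfWindow lam < X then
    arc lam s w (halfWindow lam) - (S - r) * (X - (Z + halfWindow lam))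
  else arc lam s w (X - Z)

/-- The abscissa of the crossing of two functions `arcFun`. -/
noncomputable def arcCross (lam S s w Z r s' w' Z' r' : ℝ) : ℝ :=
  if Z < Z' then
    (arc lam s w (halfWindow lam) - arc lam s' w' (-halfWindow lam) +
      (S - r) * (Z + halfWindow lam) + r' * (Z' - halfWindow lam)) / ((S - r) + r')
  else if 0 ≤ arc lam s' w' (-halfWindow lam) - arc lam s w (-halfWindow lam) then
    Z - halfWindow lam -
      (arc lam s' w' (-halfWindow lam) - arc lam s w (-halfWindow lam)) / (r' - r)
  else if arc lam s' w' (halfWindow lam) - arc lam s w (halfWindow lam) ≤ 0 then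
    Z + halfWindow lam -
      (arc lam s' w' (halfWindow lam) - arc lam s w (halfWindow lam)) / (r' - r)
  else
    Z + ((s + s') / 2 - (w' - w) *
      √((lam * lam - ((s' - s) * (s' - s) + (w' - w) * (w' - w)) / 4) /
        ((s' - s) * (s' - s) + (w' - w) * (w' - w))))

/-- Strict concavity of the semicircle. -/
theorem sqrt_circle_strict {R x y a b : ℝ} (hx : x * x ≤ R * R) (hy : y * y ≤ R * R) (hxy : x ≠ y)
    (ha : 0 < a) (hb : 0 < b) (hab : a + b = 1) :
    a * √(R * R - x * x) + b * √(R * R - y * y) < √(R * R - (a * x + b * y) * (a * x + b * y)) := by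
  obtain rfl : b = 1 - a := by linarith
  set p := √(R * R - x * x) with hp
  set q := √(R * R - y * y) with hq
  have hp2 : p * p = R * R - x * x := Real.mul_self_sqrt (by linarith)
  have hq2 : q * q = R * R - y * y := Real.mul_self_sqrt (by linarith)
  apply Real.lt_sqrt_of_sq_lt
  have : 0 < a * (1 - a) * ((x - y) * (x - y) + (p - q) * (p - q)) := by
    have h1 : 0 < (x - y) * (x - y) := mul_self_pos.2 (sub_ne_zero.2 hxy)
    have h2 : 0 ≤ (p - q) * (p - q) := mul_self_nonneg _
    positivity
  have e : R * R - (a * x + (1 - a) * y) * (a * x + (1 - a) * y) -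
      (a * p + (1 - a) * q) ^ 2 = a * (1 - a) * ((x - y) * (x - y) + (p - q) * (p - q)) +
      a * (R * R - x * x - p * p) + (1 - a) * (R * R - y * y - q * q) := by ring
  rw [hp2, hq2] at e
  linarith

/-- The difference of two arcs increases strictly. -/
theorem arc_sub_strictMono {lam s w s' w' x y : ℝ} (hs : s < s') (hxy : x < y)
    (h1 : -lam ≤ x - s') (h2 : y - s ≤ lam) :
    arc lam s' w' x - arc lam s w x < arc lam s' w' y - arc lam s w y := by
  have hl : 0 < lam := by linarith
  have bound : ∀ z, -lam ≤ z → z ≤ lam → z * z ≤ lam * lam := fun z h h' => by nlinarith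
  have hd : 0 < (y - s) - (x - s') := by linarith
  -- `x - s` and `y - s'` are complementary convex combinations of `x - s'` and `y - s`
  set d := (y - s) - (x - s') with hd'
  have k1 := sqrt_circle_strict (R := lam) (x := x - s') (y := y - s) (a := (y - x) / d)
    (b := (s' - s) / d) (bound _ h1 (by linarith)) (bound _ (by linarith) h2) (by linarith)
    (by apply div_pos <;> linarith) (by apply div_pos <;> linarith)
    (by rw [← add_div, div_eq_one_iff_eq hd.ne']; rw [hd']; ring)
  have k2 := sqrt_circle_strict (R := lam) (x := x - s') (y := y - s) (a := (s' - s) / d)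
    (b := (y - x) / d) (bound _ h1 (by linarith)) (bound _ (by linarith) h2) (by linarith)
    (by apply div_pos <;> linarith) (by apply div_pos <;> linarith)
    (by rw [← add_div, div_eq_one_iff_eq hd.ne']; rw [hd']; ring)
  have e1 : (y - x) / d * (x - s') + (s' - s) / d * (y - s) = x - s := by
    field_simp
    rw [hd']
    ring
  have e2 : (s' - s) / d * (x - s') + (y - x) / d * (y - s) = y - s' := by
    field_simp
    rw [hd']
    ring
  rw [e1] at k1
  rw [e2] at k2
  have e3 : (y - x) / d + (s' - s) / d = 1 := by
    rw [← add_div, div_eq_one_iff_eq hd.ne']; rw [hd']; ring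
  have e4 := add_lt_add k1 k2
  set p := √(lam * lam - (x - s') * (x - s'))
  set q := √(lam * lam - (y - s) * (y - s))
  have e5 : (y - x) / d * p + (s' - s) / d * q + ((s' - s) / d * p + (y - x) / d * q) = p + q := by
    linear_combination (p + q) * e3
  simp only [arc]
  linarith

/-- Assumptions on two points in the order of their positions. -/
structure CellPair (lam S s w Z r s' w' Z' r' : ℝ) : Prop where
  lam_pos : 0 < lam
  s0 : 0 ≤ s
  s1 : s ≤ lam / 10
  w0 : 0 ≤ w
  w1 : w ≤ lam / 10
  s0' : 0 ≤ s'
  s1' : s' ≤ lam / 10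
  w0' : 0 ≤ w'
  w1' : w' ≤ lam / 10
  r1 : 1 ≤ r
  rS : r' + 1 ≤ S
  rr : r < r'
  cell : Z = Z' ∧ (s < s' ∨ s = s' ∧ w ≠ w') ∨ Z + 10 * lam ≤ Z'

theorem arc_nonneg {lam s w x : ℝ} (hw : 0 ≤ w) : 0 ≤ arc lam s w x :=
  add_nonneg hw (Real.sqrt_nonneg _)

theorem arc_le {lam s w x : ℝ} (hl : 0 < lam) (hw : w ≤ lam / 10) :
    arc lam s w x ≤ 11 / 10 * lam := by
  have : √(lam * lam - (x - s) * (x - s)) ≤ lam := by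
    rw [Real.sqrt_le_left hl.le]
    nlinarith [mul_self_nonneg (x - s)]
  simp only [arc]
  linarith

theorem continuous_arc (lam s w : ℝ) : Continuous (arc lam s w) := by
  unfold arc
  fun_prop

theorem arc_circle {lam s w x : ℝ} (h : (x - s) * (x - s) ≤ lam * lam) :
    (x - s) * (x - s) + (arc lam s w x - w) * (arc lam s w x - w) = lam * lam := by
  have := Real.mul_self_sqrt (sub_nonneg.2 h)
  simp only [arc, add_sub_cancel_left, this]
  ring

/-- The functions of two points in different cells cross once. -/
theorem arcFun_cross_far {lam S s w Z r s' w' Z' r' : ℝ}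
    (h : CellPair lam S s w Z r s' w' Z' r') (hZ : Z + 10 * lam ≤ Z') :
    let c := arcCross lam S s w Z r s' w' Z' r'
    (∀ x < c, arcFun lam S s' w' Z' r' x < arcFun lam S s w Z r x) ∧
    arcFun lam S s w Z r c = arcFun lam S s' w' Z' r' c ∧
    ∀ x, c < x → arcFun lam S s w Z r x < arcFun lam S s' w' Z' r' x := by
  obtain ⟨hl, s0, s1, w0, w1, s0', s1', w0', w1', r1, rS, rr, -⟩ := h
  intro c
  set A := arc lam s w (halfWindow lam) with hA
  set B := arc lam s' w' (-halfWindow lam) with hB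
  have hA0 : 0 ≤ A := arc_nonneg w0
  have hB0 : 0 ≤ B := arc_nonneg w0'
  have hA1 : A ≤ 11 / 10 * lam := arc_le hl w1
  have hB1 : B ≤ 11 / 10 * lam := arc_le hl w1'
  set H := halfWindow lam with hH
  have hH' : H = 9 / 10 * lam := rfl
  have hden : 0 < S - r + r' := by linarith
  have hc : c * (S - r + r') = A - B + (S - r) * (Z + H) + r' * (Z' - H) := by
    have : c = (A - B + (S - r) * (Z + H) + r' * (Z' - H)) / (S - r + r') := by
      simp only [c, arcCross]
      rw [if_pos (by linarith)]
    rw [this, div_mul_cancel₀ _ hden.ne']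
  have hc1 : Z + H ≤ c := by nlinarith
  have hc2 : c ≤ Z' - H := by nlinarith
  have left1 : ∀ x, x ≤ Z' - H → arcFun lam S s' w' Z' r' x = B - r' * (Z' - H - x) := by
    intro x hx
    rcases hx.lt_or_eq with hx | rfl
    · rw [arcFun, if_pos hx]
    · rw [arcFun, if_neg (by linarith), if_neg (by linarith)]
      simp only [hB]
      ring_nf
  have right1 : ∀ x, Z + H ≤ x → arcFun lam S s w Z r x = A - (S - r) * (x - (Z + H)) := by
    intro x hx
    rcases hx.lt_or_eq with hx | rfl
    · rw [arcFun, if_neg (by linarith), if_pos hx]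
    · rw [arcFun, if_neg (by linarith), if_neg (by linarith)]
      simp only [hA]
      ring_nf
  refine ⟨fun x hx => ?_, ?_, fun x hx => ?_⟩
  · rw [left1 x (by linarith)]
    by_cases h1 : Z + H ≤ x
    · rw [right1 x h1]
      nlinarith
    · rw [not_le] at h1
      by_cases h2 : x < Z - H
      · rw [arcFun, if_pos h2]
        have := arc_nonneg (lam := lam) (s := s) (x := -H) w0
        nlinarith
      · rw [arcFun, if_neg h2, if_neg (by linarith)]
        have := arc_nonneg (lam := lam) (s := s) (x := x - Z) w0
        nlinarith
  · rw [left1 c hc2, right1 c hc1]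
    linarith
  · rw [right1 x (by linarith)]
    by_cases h1 : x ≤ Z' - H
    · rw [left1 x h1]
      nlinarith
    · rw [not_le] at h1
      by_cases h2 : Z' + H < x
      · rw [arcFun, if_neg (by linarith), if_pos h2]
        have := arc_nonneg (lam := lam) (s := s') (x := H) w0'
        nlinarith
      · rw [arcFun, if_neg (by linarith), if_neg h2]
        have := arc_nonneg (lam := lam) (s := s') (x := x - Z') w0'
        nlinarith

/-- Two arcs that cross at `x` cross on the perpendicular bisector of their centres, above their
midpoint. -/
theorem arc_cross_formula {lam s w s' w' x : ℝ} (hs : s < s')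
    (h1 : (x - s) * (x - s) ≤ lam * lam) (h2 : (x - s') * (x - s') ≤ lam * lam)
    (he : arc lam s w x = arc lam s' w' x) :
    (s + s') / 2 - (w' - w) *
      √((lam * lam - ((s' - s) * (s' - s) + (w' - w) * (w' - w)) / 4) /
        ((s' - s) * (s' - s) + (w' - w) * (w' - w))) = x := by
  have c1 := arc_circle (w := w) h1
  have c2 := arc_circle (w := w') h2
  rw [← he] at c2
  have g1 : w ≤ arc lam s w x := le_add_of_nonneg_right (Real.sqrt_nonneg _)
  have g2 : w' ≤ arc lam s w x := by
    rw [he]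
    exact le_add_of_nonneg_right (Real.sqrt_nonneg _)
  set y := arc lam s w x with hy
  have hds : 0 < s' - s := by linarith
  set L := (s' - s) * (s' - s) + (w' - w) * (w' - w) with hL
  have hLpos : 0 < L := add_pos_of_pos_of_nonneg (mul_pos hds hds) (mul_self_nonneg _)
  set τ := (y - (w + w') / 2) / (s' - s) with hτ
  have hτ0 : 0 ≤ τ := div_nonneg (by linarith) hds.le
  have e1 : y - (w + w') / 2 = τ * (s' - s) := by
    rw [hτ, div_mul_cancel₀ _ hds.ne']
  have e2 : x - (s + s') / 2 = - (τ * (w' - w)) := by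
    have : (x - (s + s') / 2) * (s' - s) + (y - (w + w') / 2) * (w' - w) = 0 := by linarith
    rw [e1] at this
    have : (x - (s + s') / 2 + τ * (w' - w)) * (s' - s) = 0 := by linarith
    rcases mul_eq_zero.1 this with h | h
    · linarith
    · exact absurd h hds.ne'
  have e3 : τ * τ * L = lam * lam - L / 4 := by
    have hx : x - s = (s' - s) / 2 - τ * (w' - w) := by linarith
    have hyw : y - w = (w' - w) / 2 + τ * (s' - s) := by linarith
    rw [hx, hyw] at c1
    rw [← c1, hL]
    ring
  have e4 : (lam * lam - L / 4) / L = τ * τ := by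
    rw [← e3, mul_div_cancel_right₀ _ hLpos.ne']
  rw [e4, Real.sqrt_mul_self hτ0]
  linarith

/-- The functions of two points in the same cell cross once. -/
theorem arcFun_cross_near {lam S s w Z r s' w' r' : ℝ}
    (h : CellPair lam S s w Z r s' w' Z r') (hne : s < s' ∨ s = s' ∧ w ≠ w') :
    let c := arcCross lam S s w Z r s' w' Z r'
    (∀ x < c, arcFun lam S s' w' Z r' x < arcFun lam S s w Z r x) ∧
    arcFun lam S s w Z r c = arcFun lam S s' w' Z r' c ∧
    ∀ x, c < x → arcFun lam S s w Z r x < arcFun lam S s' w' Z r' x := by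
  obtain ⟨hl, s0, s1, w0, w1, s0', s1', w0', w1', r1, rS, rr, -⟩ := h
  intro c
  set H := halfWindow lam with hH
  have hH' : H = 9 / 10 * lam := rfl
  -- the difference of the two functions
  set D : ℝ → ℝ := fun x => arc lam s' w' x - arc lam s w x with hD
  have hmono : ∀ x y, -H ≤ x → x < y → y ≤ H → (D x < D y ∨ D x = D y ∧ D x ≠ 0) := by
    intro x y hx hxy hy
    rcases hne with hne | ⟨rfl, hne⟩
    · exact .inl (arc_sub_strictMono hne hxy (by linarith) (by linarith))
    · right
      simp only [hD, arc]
      exact ⟨by ring, fun h => hne (by linarith)⟩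
  have diff : ∀ x, arcFun lam S s' w' Z r' x - arcFun lam S s w Z r x =
      if x < Z - H then D (-H) - (r' - r) * (Z - H - x)
      else if Z + H < x then D H + (r' - r) * (x - (Z + H)) else D (x - Z) := by
    intro x
    simp only [arcFun, hD]
    split_ifs <;> ring
  suffices key : (∀ x < c, (if x < Z - H then D (-H) - (r' - r) * (Z - H - x)
      else if Z + H < x then D H + (r' - r) * (x - (Z + H)) else D (x - Z)) < 0) ∧
      ((if c < Z - H then D (-H) - (r' - r) * (Z - H - c)
      else if Z + H < c then D H + (r' - r) * (c - (Z + H)) else D (c - Z)) = 0) ∧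
      (∀ x, c < x → 0 < (if x < Z - H then D (-H) - (r' - r) * (Z - H - x)
      else if Z + H < x then D H + (r' - r) * (x - (Z + H)) else D (x - Z))) by
    obtain ⟨k1, k2, k3⟩ := key
    refine ⟨fun x hx => ?_, ?_, fun x hx => ?_⟩
    · have := k1 x hx
      rw [← diff] at this
      linarith
    · rw [← diff] at k2
      linarith
    · have := k3 x hx
      rw [← diff] at this
      linarith
  have hrr : 0 < r' - r := by linarith
  have hHpos : 0 < H := by linarith
  have hmono' : ∀ x y, -H ≤ x → x ≤ y → y ≤ H → D x ≤ D y := by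
    intro x y hx hxy hy
    rcases hxy.lt_or_eq with hxy | rfl
    · rcases hmono x y hx hxy hy with h | h
      · exact h.le
      · exact h.1.le
    · exact le_rfl
  by_cases h0 : 0 ≤ D (-H)
  · have hc : c = Z - H - D (-H) / (r' - r) := by
      simp only [c, arcCross, lt_irrefl, if_false]
      rw [if_pos h0]
    have hq : 0 ≤ D (-H) / (r' - r) := div_nonneg h0 hrr.le
    have hq2 : D (-H) / (r' - r) * (r' - r) = D (-H) := div_mul_cancel₀ _ hrr.ne'
    set q := D (-H) / (r' - r) with hqdef
    refine ⟨fun x hx => ?_, ?_, fun x hx => ?_⟩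
    · rw [if_pos (by linarith)]
      nlinarith
    · rcases hq.lt_or_eq with hq' | hq'
      · rw [if_pos (by linarith), hc]
        linarith
      · rw [if_neg (by linarith), if_neg (by linarith), show c - Z = -H by linarith, ← hq2, ← hq',
          zero_mul]
    · by_cases hx1 : x < Z - H
      · rw [if_pos hx1]
        nlinarith
      · rw [if_neg hx1]
        rw [not_lt] at hx1
        have pos : ∀ z, -H ≤ z → z ≤ H → (z ≠ -H ∨ 0 < D (-H)) → 0 < D z := by
          intro z hz1 hz2 hz
          rcases hz1.lt_or_eq with hz1 | rfl
          · rcases hmono (-H) z le_rfl hz1 hz2 with h | ⟨h, h'⟩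
            · linarith
            · rw [← h]
              exact lt_of_le_of_ne h0 h'.symm
          · exact hz.resolve_left (fun h => h rfl)
        split_ifs with hx2
        · have := pos H (by linarith) le_rfl (.inl (by linarith))
          nlinarith
        · refine pos _ (by linarith) (by linarith) ?_
          by_cases hzx : x - Z = -H
          · right
            have : 0 < q := by linarith
            rw [← hq2]
            positivity
          · exact .inl hzx
  · rw [not_le] at h0
    by_cases h1 : D H ≤ 0
    · have hc : c = Z + H - D H / (r' - r) := by
        simp only [c, arcCross, lt_irrefl, if_false]
        rw [if_neg (not_le.2 h0), if_pos h1]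
      have hq : D H / (r' - r) ≤ 0 := div_nonpos_of_nonpos_of_nonneg h1 hrr.le
      have hq2 : D H / (r' - r) * (r' - r) = D H := div_mul_cancel₀ _ hrr.ne'
      set q := D H / (r' - r) with hqdef
      have neg : ∀ z, -H ≤ z → z ≤ H → (z ≠ H ∨ D H < 0) → D z < 0 := by
        intro z hz1 hz2 hz
        rcases hz2.lt_or_eq with hz2 | rfl
        · rcases hmono z H hz1 hz2 le_rfl with h | ⟨h, h'⟩
          · linarith
          · rw [h] at h' ⊢
            exact lt_of_le_of_ne h1 h'
        · exact hz.resolve_left (fun h => h rfl)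
      refine ⟨fun x hx => ?_, ?_, fun x hx => ?_⟩
      · by_cases hx1 : x < Z - H
        · rw [if_pos hx1]
          nlinarith
        · rw [if_neg hx1]
          rw [not_lt] at hx1
          split_ifs with hx2
          · nlinarith
          · refine neg _ (by linarith) (by linarith) ?_
            by_cases hzx : x - Z = H
            · right
              have : q < 0 := by linarith
              rw [← hq2]
              nlinarith
            · exact .inl hzx
      · rw [if_neg (by linarith)]
        split_ifs with hx2
        · rw [hc]
          linarith
        · have : q = 0 := by linarith
          rw [show c - Z = H by linarith, ← hq2, this, zero_mul]
      · rw [if_neg (by linarith), if_pos (by linarith)]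
        nlinarith
    · rw [not_le] at h1
      have hss : s < s' := by
        rcases hne with hne | ⟨rfl, hne⟩
        · exact hne
        · simp only [hD, arc] at h0 h1
          linarith
      have hcont : ContinuousOn D (Set.Icc (-H) H) :=
        ((continuous_arc _ _ _).sub (continuous_arc _ _ _)).continuousOn
      obtain ⟨x0, ⟨hx1, hx2⟩, hx0⟩ :=
        intermediate_value_Icc (by linarith : -H ≤ H) hcont ⟨h0.le, h1.le⟩
      have hc : c = Z + x0 := by
        simp only [c, arcCross, lt_irrefl, if_false]
        rw [if_neg (not_le.2 h0), if_neg (not_le.2 h1)]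
        rw [arc_cross_formula (x := x0) hss (by nlinarith) (by nlinarith)
          (by simp only [hD] at hx0; linarith)]
      have smono : ∀ x y, -H ≤ x → x < y → y ≤ H → D x < D y := fun x y a b d =>
        arc_sub_strictMono hss b (by linarith) (by linarith)
      refine ⟨fun x hx => ?_, ?_, fun x hx => ?_⟩
      · by_cases hx3 : x < Z - H
        · rw [if_pos hx3]
          nlinarith
        · rw [if_neg hx3, if_neg (by linarith), ← hx0]
          exact smono _ _ (by linarith) (by linarith) (by linarith)
      · rw [hc, if_neg (by linarith), if_neg (by linarith), ← hx0]
        congr 1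
        ring
      · rw [if_neg (by linarith)]
        split_ifs with hx3
        · nlinarith
        · rw [← hx0]
          exact smono _ _ (by linarith) (by linarith) (by linarith)

theorem arcFun_cross {lam S s w Z r s' w' Z' r' : ℝ}
    (h : CellPair lam S s w Z r s' w' Z' r') :
    let c := arcCross lam S s w Z r s' w' Z' r'
    (∀ x < c, arcFun lam S s' w' Z' r' x < arcFun lam S s w Z r x) ∧
    arcFun lam S s w Z r c = arcFun lam S s' w' Z' r' c ∧
    ∀ x, c < x → arcFun lam S s w Z r x < arcFun lam S s' w' Z' r' x := by
  rcases h.cell with ⟨rfl, hne⟩ | hZ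
  · exact arcFun_cross_near h hne
  · exact arcFun_cross_far h hZ

end UnitDisk

namespace UnitDisk

/-! ### Deleting a function from an envelope -/

section Removed

variable {ι : Type*}

/-- The sequence `f'` of length `len'` arises from the sequence `f` of length `len` by the removal
of `q`: if `q` occurs in `f`, then it is replaced by a (possibly empty) sequence of new elements;
otherwise nothing changes. -/
def Removed (q : ι) (len : ℕ) (f : ℕ → ι) (len' : ℕ) (f' : ℕ → ι) : Prop :=
  ((∀ t, 1 ≤ t → t ≤ len → f t ≠ q) ∧ len' = len ∧ ∀ t, 1 ≤ t → t ≤ len → f' t = f t) ∨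
  ∃ t e, 1 ≤ t ∧ t ≤ len ∧ f t = q ∧ len' + 1 = len + e ∧ (∀ k, 1 ≤ k → k < t → f' k = f k) ∧
    ∀ k, t ≤ k → k < len → f' (k + e) = f (k + 1)

theorem Removed.len_le {q : ι} {len len' : ℕ} {f f' : ℕ → ι} (h : Removed q len f len' f') :
    len ≤ len' + 1 := by
  rcases h with ⟨-, h, -⟩ | ⟨t, e, -, -, -, h, -⟩ <;> omega

variable {D S T : Set ι} {F : ι → ℝ → ℝ} {c : ι → ι → ℝ}

theorem Bridge.dual {l r : ι} (h : Bridge F c S T l r) :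
    Bridge (ι := ιᵒᵈ) (fun a x => F a (-x)) (fun a b => - c b a) T S r l := by
  constructor
  · intro b hb
    simpa using h.2 b hb
  · intro b hb
    simpa using h.1 b hb

theorem Bridge.of_dual {l r : ι}
    (h : Bridge (ι := ιᵒᵈ) (fun a x => F a (-x)) (fun a b => - c b a) T S r l) :
    Bridge F c S T l r := by
  constructor
  · intro b hb
    simpa using h.2 b hb
  · intro b hb
    simpa using h.1 b hb

theorem Bridge.anti {S' T' : Set ι} {l r : ι} (h : Bridge F c S T l r) (hS : S' ⊆ S)
    (hT : T' ⊆ T) : Bridge F c S' T' l r :=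
  ⟨fun b hb => h.1 b (hS hb), fun b hb => h.2 b (hT hb)⟩

/-- How the joined sequence changes when an element is removed from the left part. -/
theorem Removed.splice_left {q : ι} {lenS lenS' lenT t e t1 u1 t' u' : ℕ} {f f' g : ℕ → ι}
    (hq : f t = q) (ht : 1 ≤ t) (htl : t ≤ t1) (ht1 : t1 ≤ lenS) (hlen : lenS' + 1 = lenS + e)
    (h1 : ∀ k, 1 ≤ k → k < t → f' k = f k)
    (h2 : ∀ k, t ≤ k → k < lenS → f' (k + e) = f (k + 1)) (hu1 : 1 ≤ u1) (hu1' : u1 ≤ lenT)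
    (h : (t < t1 ∧ t' + 1 = t1 + e ∧ u' = u1) ∨
      (t = t1 ∧ t ≤ t' + 1 ∧ t' ≤ lenS' ∧ 1 ≤ u' ∧ u' ≤ u1)) :
    Removed q (t1 + (lenT + 1 - u1)) (splice f t1 g u1) (t' + (lenT + 1 - u'))
      (splice f' t' g u') := by
  rcases h with ⟨h3, h4, rfl⟩ | ⟨rfl, h3, h4, h5, h6⟩
  · refine .inr ⟨t, e, ht, by omega, by rw [splice_le htl, hq], by omega, fun k a b => ?_,
      fun k a b => ?_⟩
    · rw [splice_le (by omega), splice_le (by omega), h1 k a b]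
    · by_cases hk : k < t1
      · rw [splice_le (by omega), splice_le (by omega), h2 k a (by omega)]
      · obtain ⟨j, rfl⟩ : ∃ j, k = t1 + j := ⟨k - t1, by omega⟩
        rw [show t1 + j + e = t' + 1 + j by omega, show t1 + j + 1 = t1 + 1 + j by omega,
          splice_add, splice_add]
  · refine .inr ⟨t, t' + 1 - t + (u1 - u'), ht, by omega, by rw [splice_le le_rfl, hq], by omega,
      fun k a b => ?_, fun k a b => ?_⟩
    · rw [splice_le (by omega), splice_le (by omega), h1 k a b]
    · obtain ⟨j, rfl⟩ : ∃ j, k = t + j := ⟨k - t, by omega⟩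
      rw [show t + j + (t' + 1 - t + (u1 - u')) = t' + 1 + (j + (u1 - u')) by omega,
        show t + j + 1 = t + 1 + j by omega, splice_add, splice_add]
      congr 1
      omega

/-- How the joined sequence changes when an element is removed from the right part. -/
theorem Removed.splice_right {q : ι} {lenT lenT' e u t1 u1 t' u' : ℕ} {f g g' : ℕ → ι}
    (hq : g u = q) (hu : u1 ≤ u) (hul : u ≤ lenT) (hu1 : 1 ≤ u1) (hlen : lenT' + 1 = lenT + e)
    (h1 : ∀ k, 1 ≤ k → k < u → g' k = g k)
    (h2 : ∀ k, u ≤ k → k < lenT → g' (k + e) = g (k + 1))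
    (h : (u1 < u ∧ u' = u1 ∧ t' = t1) ∨
      (u1 = u ∧ 1 ≤ u' ∧ u' ≤ u + e ∧ u' ≤ lenT' ∧ t1 ≤ t')) :
    Removed q (t1 + (lenT + 1 - u1)) (splice f t1 g u1) (t' + (lenT' + 1 - u'))
      (splice f t' g' u') := by
  rcases h with ⟨h3, rfl, rfl⟩ | ⟨rfl, h3, h4, h5, h6⟩
  · refine .inr ⟨t' + 1 + (u - u'), e, by omega, by omega, ?_, by omega, fun k a b => ?_,
      fun k a b => ?_⟩
    · rw [splice_add, ← hq]
      congr 1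
      omega
    · by_cases hk : k ≤ t'
      · rw [splice_le (by omega), splice_le (by omega)]
      · obtain ⟨j, rfl⟩ : ∃ j, k = t' + 1 + j := ⟨k - t' - 1, by omega⟩
        rw [splice_add, splice_add, h1 _ (by omega) (by omega)]
    · obtain ⟨j, rfl⟩ : ∃ j, k = t' + 1 + j := ⟨k - t' - 1, by omega⟩
      rw [show t' + 1 + j + e = t' + 1 + (j + e) by omega,
        show t' + 1 + j + 1 = t' + 1 + (j + 1) by omega, splice_add, splice_add,
        show j + e + u' = j + u' + e by omega, h2 _ (by omega) (by omega)]
      congr 1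
      omega
  · refine .inr ⟨t1 + 1, (t' - t1) + (u1 + e - u'), by omega, by omega, ?_, by omega,
      fun k a b => ?_, fun k a b => ?_⟩
    · rw [show t1 + 1 = t1 + 1 + 0 by omega, splice_add, Nat.zero_add, hq]
    · rw [splice_le (by omega), splice_le (by omega)]
    · obtain ⟨j, rfl⟩ : ∃ j, k = t1 + 1 + j := ⟨k - t1 - 1, by omega⟩
      rw [show t1 + 1 + j + (t' - t1 + (u1 + e - u')) = t' + 1 + (j + (u1 + e - u')) by omega,
        show t1 + 1 + j + 1 = t1 + 1 + (j + 1) by omega, splice_add, splice_add,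
        show j + (u1 + e - u') + u' = j + u1 + e by omega, h2 _ (by omega) (by omega)]
      congr 1
      omega

variable [LinearOrder ι]

theorem SingleCrossing.cross_eq (hD : SingleCrossing D F c) {a b : ι} (ha : a ∈ D) (hb : b ∈ D)
    (hab : a < b) : F a (c a b) = F b (c a b) := (hD a ha b hb hab).2.1

/-- When the left end `q` of a bridge is removed, the search for the new bridge starts at the old
bridge with the old successor of `q`; it does not reach the elements before the old predecessor. -/
theorem sweep_restart (hD : SingleCrossing D F c) (hS : S ⊆ D) (hT : T ⊆ D)
    (hST : ∀ a ∈ S, ∀ b ∈ T, a < b) {lenS lenS' lenT t e u : ℕ} {f f' g : ℕ → ι} {q : ι}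
    (hf : Envelope F c S lenS f) (hg : Envelope F c T lenT g) (hq : f t = q) (ht : 1 ≤ t)
    (htl : t ≤ lenS) (hlen : lenS' + 1 = lenS + e) (h1 : ∀ k, 1 ≤ k → k < t → f' k = f k)
    (h2 : ∀ k, t ≤ k → k < lenS → f' (k + e) = f (k + 1)) (hpos : 1 ≤ lenS') (hu : 1 ≤ u)
    (hul : u ≤ lenT) (hb : Bridge F c S T q (g u)) :
    SweepStop F c T (c q (g u)) f' (if t = 1 then 1 else t - 1) ∧
    SweepInv F c (S \ {q}) T (c q (g u)) lenS' f' lenT g (if t = 1 then 1 else t - 1)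
      (if t < lenS then t + e else lenS') u := by
  have hqS : q ∈ S := hq ▸ hf.mem t ht htl
  have hgu := hg.mem u hu hul
  refine ⟨⟨by split_ifs <;> omega, fun hne => ?_⟩, ?_⟩
  · have ht1 : t ≠ 1 := fun h => hne (if_pos h)
    rw [if_neg ht1] at hne ⊢
    rw [h1 (t - 1 - 1) (by omega) (by omega), h1 (t - 1) (by omega) (by omega)]
    have m1 := hf.edge' hD hS (t := t - 1 - 1) (by omega) (by omega)
    rw [Nat.sub_add_cancel (by omega)] at m1
    have hle : c (f (t - 1 - 1)) (f (t - 1)) ≤ c q (g u) := by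
      have a := hf.cross_mono hD hS (t := t - 1 - 1) (u := t - 1) (by omega) (by omega) (by omega)
      rw [Nat.sub_add_cancel (by omega), Nat.sub_add_cancel (by omega), hq] at a
      refine a.trans ?_
      have := hf.cross_le_of_maxAt hD hS (t := t - 1) (x := c q (g u)) (by omega) (by omega)
        (by rw [Nat.sub_add_cancel (by omega), hq]; exact hb.1)
      rwa [Nat.sub_add_cancel (by omega), hq] at this
    exact ⟨hle, fun b hb' => (hb.le_left hD hS hT hST hqS hgu hle b hb').trans (m1 q hqS)⟩
  · refine ⟨by split_ifs <;> omega, by split_ifs <;> omega, hu, hul, .inr ⟨?_, hb.2, ?_⟩⟩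
    · split_ifs with htl'
      · intro hlt
        rw [h2 t le_rfl htl', show t + e + 1 = t + 1 + e by omega, h2 (t + 1) (by omega) (by omega)]
        have a := hf.le_cross_of_maxAt hD hS ht htl' (x := c q (g u)) (by rw [hq]; exact hb.1)
        exact a.trans (hf.cross_mono hD hS ht (by omega) (by omega))
      · intro h
        exact absurd h (lt_irrefl _)
    · intro b hb'
      rw [← hD.cross_eq (hS hqS) (hT hgu) (hST _ hqS _ hgu)]
      exact hb.1 b hb'.1

/-- The mirror image of `sweep_restart`. -/
theorem sweep_restart_dual (hD : SingleCrossing D F c) (hS : S ⊆ D) (hT : T ⊆ D)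
    (hST : ∀ a ∈ S, ∀ b ∈ T, a < b) {lenS lenT lenT' t e u : ℕ} {f g g' : ℕ → ι} {q : ι}
    (hf : Envelope F c S lenS f) (hg : Envelope F c T lenT g) (hq : g u = q) (hu : 1 ≤ u)
    (hul : u ≤ lenT) (hlen : lenT' + 1 = lenT + e) (h1 : ∀ k, 1 ≤ k → k < u → g' k = g k)
    (h2 : ∀ k, u ≤ k → k < lenT → g' (k + e) = g (k + 1)) (hpos : 1 ≤ lenT') (ht : 1 ≤ t)
    (htl : t ≤ lenS) (hb : Bridge F c S T (f t) q) {T' : Set ι} (hT' : T' = T \ {q}) :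
    SweepStop (ι := ιᵒᵈ) (fun a x => F a (-x)) (fun a b => - c b a) S (- c (f t) q)
      (fun k => g' (lenT' + 1 - k)) (if u = lenT then 1 else lenT - u) ∧
    SweepInv (ι := ιᵒᵈ) (fun a x => F a (-x)) (fun a b => - c b a) T' S (- c (f t) q)
      lenT' (fun k => g' (lenT' + 1 - k)) lenS (fun k => f (lenS + 1 - k))
      (if u = lenT then 1 else lenT - u)
      (if 1 < u then lenT' + 2 - u else lenT') (lenS + 1 - t) := by
  subst hT'
  have e0 : lenS + 1 - (lenS + 1 - t) = t := by omega
  have := sweep_restart (ι := ιᵒᵈ) hD.dual hT hS (fun a ha b hb => hST b hb a ha)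
    (t := lenT + 1 - u) (e := e) (u := lenS + 1 - t) (lenS' := lenT')
    (f' := fun k => g' (lenT' + 1 - k)) (q := q)
    (hg.dual hD hT) (hf.dual hD hS)
    (by
      change g (lenT + 1 - (lenT + 1 - u)) = q
      rw [← hq]
      congr 1
      omega)
    (by omega) (by omega) hlen
    (by
      intro k a b
      change g' (lenT' + 1 - k) = g (lenT + 1 - k)
      rw [show lenT' + 1 - k = (lenT - k) + e by omega, h2 _ (by omega) (by omega)]
      congr 1
      omega)
    (by
      intro k a b
      change g' (lenT' + 1 - (k + e)) = g (lenT + 1 - (k + 1))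
      rw [show lenT' + 1 - (k + e) = lenT - k by omega, h1 _ (by omega) (by omega)]
      congr 1
      omega)
    hpos (by omega) (by omega)
    (by
      rw [e0]
      exact hb.dual)
  have e1 : (if lenT + 1 - u = 1 then 1 else lenT + 1 - u - 1) =
      if u = lenT then 1 else lenT - u := by
    split_ifs <;> omega
  have e2 : (if lenT + 1 - u < lenT then lenT + 1 - u + e else lenT') =
      if 1 < u then lenT' + 2 - u else lenT' := by
    split_ifs <;> omega
  rw [e1, e2, e0] at this
  exact this

end Removed

end UnitDisk

namespace UnitDisk

/-! ### The tree of envelopes -/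

/-- The envelopes of the nodes of the tree: node `v` has the sequence `seq v 1, …, seq v (len v)`,
which is followed and preceded by `0`. -/
structure EnvData where
  len : ℕ → ℕ
  seq : ℕ → ℕ → ℕ

/-- What the machine stores of the tree of envelopes.  The links `nxt` and `prv` between positions
represent the envelope of the root; the children of a node `v` share the links of `v` up to the
links of the bridge from `lf v` to `rt v`, and `sa v`, `sb v` are the links that are hidden by the
bridge.  The bridge is at the abscissa `xs v`, and `fst v`, `lst v` are the ends of the envelope. -/
structure TreeMem where
  nxt : ℕ → ℕ
  prv : ℕ → ℕ
  fst : ℕ → ℕ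
  lst : ℕ → ℕ
  lf : ℕ → ℕ
  rt : ℕ → ℕ
  sa : ℕ → ℕ
  sb : ℕ → ℕ
  xs : ℕ → ℝ

open Classical in
/-- Restore the links that are hidden by the bridge of `v`. -/
noncomputable def TreeMem.undo (T : TreeMem) (v : ℕ) : TreeMem :=
  if T.fst (2 * v) ≠ 0 ∧ T.fst (2 * v + 1) ≠ 0 then
    { T with
      nxt := Function.update T.nxt (T.lf v) (T.sa v)
      prv := Function.update T.prv (T.rt v) (T.sb v) }
  else T

/-- Set the bridge of `v`. -/
noncomputable def TreeMem.link (T : TreeMem) (v l r : ℕ) (x : ℝ) : TreeMem :=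
  { T with
    nxt := Function.update T.nxt l r
    prv := Function.update T.prv r l
    lf := Function.update T.lf v l
    rt := Function.update T.rt v r
    sa := Function.update T.sa v (T.nxt l)
    sb := Function.update T.sb v (T.prv r)
    xs := Function.update T.xs v x }

/-- Set the ends of the envelope of `v`. -/
def TreeMem.ends (T : TreeMem) (v : ℕ) : TreeMem :=
  { T with
    fst := Function.update T.fst v
      (if T.fst (2 * v) = 0 then T.fst (2 * v + 1) else T.fst (2 * v))
    lst := Function.update T.lst v
      (if T.lst (2 * v + 1) = 0 then T.lst (2 * v) else T.lst (2 * v + 1)) }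

/-- Set the envelope of `v`. -/
def EnvData.set (E : EnvData) (v n : ℕ) (f : ℕ → ℕ) : EnvData :=
  ⟨Function.update E.len v n, Function.update E.seq v f⟩

/-- The alive positions below the node `v` of height `k`; the leaf of position `a` is the node
`N + a`. -/
def under (N : ℕ) (al : Set ℕ) (k v : ℕ) : Set ℕ := {a | a ∈ al ∧ (N + a) / 2 ^ k = v}

theorem div_pow_succ (a k : ℕ) : a / 2 ^ (k + 1) = a / 2 ^ k / 2 := by
  rw [pow_succ, Nat.div_div_eq_div_mul]

theorem under_succ (N : ℕ) (al : Set ℕ) (k v : ℕ) :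
    under N al (k + 1) v = under N al k (2 * v) ∪ under N al k (2 * v + 1) := by
  ext a
  simp only [under, Set.mem_union, Set.mem_ofPred_eq, div_pow_succ, ← and_or_left]
  exact and_congr_right fun _ => by omega

theorem under_lt {N : ℕ} {al : Set ℕ} {k v : ℕ} : ∀ a ∈ under N al k (2 * v),
    ∀ b ∈ under N al k (2 * v + 1), a < b := by
  rintro a ⟨-, ha⟩ b ⟨-, hb⟩
  by_contra h
  have : (N + b) / 2 ^ k ≤ (N + a) / 2 ^ k := Nat.div_le_div_right (by omega)
  omega

section Tree

variable (N : ℕ) (F : ℕ → ℝ → ℝ) (c : ℕ → ℕ → ℝ)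

/-- The node `v` of height `k` has the envelope of the alive positions below it. -/
structure NodeOK (al : Set ℕ) (E : EnvData) (T : TreeMem) (k v : ℕ) : Prop where
  env : Envelope F c (under N al k v) (E.len v) (E.seq v)
  zero : E.seq v 0 = 0
  zero' : E.seq v (E.len v + 1) = 0
  fst : T.fst v = E.seq v 1
  lst : T.lst v = E.seq v (E.len v)
  links : ∀ t, 1 ≤ t → t ≤ E.len v →
    T.nxt (E.seq v t) = E.seq v (t + 1) ∧ T.prv (E.seq v t) = E.seq v (t - 1)

/-- The envelope of `v` is joined from the envelopes of its children of height `k`. -/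
structure JoinOK (al : Set ℕ) (E : EnvData) (T : TreeMem) (k v : ℕ) : Prop where
  left_empty : E.len (2 * v) = 0 → E.len v = E.len (2 * v + 1) ∧ E.seq v = E.seq (2 * v + 1)
  right_empty : E.len (2 * v) ≠ 0 → E.len (2 * v + 1) = 0 →
    E.len v = E.len (2 * v) ∧ E.seq v = E.seq (2 * v)
  bridge : E.len (2 * v) ≠ 0 → E.len (2 * v + 1) ≠ 0 → ∃ t u,
    1 ≤ t ∧ t ≤ E.len (2 * v) ∧ 1 ≤ u ∧ u ≤ E.len (2 * v + 1) ∧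
    T.lf v = E.seq (2 * v) t ∧ T.rt v = E.seq (2 * v + 1) u ∧
    T.sa v = E.seq (2 * v) (t + 1) ∧ T.sb v = E.seq (2 * v + 1) (u - 1) ∧
    T.xs v = c (E.seq (2 * v) t) (E.seq (2 * v + 1) u) ∧
    Bridge F c (under N al k (2 * v)) (under N al k (2 * v + 1))
      (E.seq (2 * v) t) (E.seq (2 * v + 1) u) ∧
    E.len v = t + (E.len (2 * v + 1) + 1 - u) ∧
    E.seq v = splice (E.seq (2 * v)) t (E.seq (2 * v + 1)) u

/-- The subtree of height `k` with root `v` is represented correctly. -/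
def TreeOK (al : Set ℕ) (E : EnvData) : ℕ → ℕ → TreeMem → Prop
  | 0, v, T => NodeOK N F c al E T 0 v
  | k + 1, v, T => NodeOK N F c al E T (k + 1) v ∧ JoinOK N F c al E T k v ∧
      TreeOK al E k (2 * v) (T.undo v) ∧ TreeOK al E k (2 * v + 1) (T.undo v)

/-- Everything on which the subtree of height `k` with root `v` depends is the same. -/
structure Agree (k v : ℕ) (al al' : Set ℕ) (E E' : EnvData) (T T' : TreeMem) : Prop where
  node : ∀ w j, j ≤ k → w / 2 ^ j = v → E.len w = E'.len w ∧ E.seq w = E'.seq w ∧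
    T.fst w = T'.fst w ∧ T.lst w = T'.lst w ∧ T.lf w = T'.lf w ∧ T.rt w = T'.rt w ∧
    T.sa w = T'.sa w ∧ T.sb w = T'.sb w ∧ T.xs w = T'.xs w
  pos : ∀ a, (N + a) / 2 ^ k = v → T.nxt a = T'.nxt a ∧ T.prv a = T'.prv a ∧ (a ∈ al ↔ a ∈ al')

variable {N F c} {al al' : Set ℕ} {E E' : EnvData} {T T' : TreeMem} {k v : ℕ}

theorem TreeOK.nodeOK (h : TreeOK N F c al E k v T) : NodeOK N F c al E T k v := by
  cases k with
  | zero => exact h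
  | succ k => exact h.1

theorem NodeOK.len_ne (h : NodeOK N F c al E T k v) (hal : ∀ a ∈ al, 1 ≤ a) :
    E.len v ≠ 0 ↔ T.fst v ≠ 0 := by
  rw [h.fst]
  constructor
  · intro h1
    have := hal _ (h.env.mem 1 le_rfl (by omega)).1
    omega
  · intro h1 h2
    apply h1
    have := h.zero'
    rwa [h2] at this

theorem NodeOK.lst_ne (h : NodeOK N F c al E T k v) (hal : ∀ a ∈ al, 1 ≤ a) :
    E.len v ≠ 0 ↔ T.lst v ≠ 0 := by
  rw [h.lst]
  constructor
  · intro h1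
    have := hal _ (h.env.mem (E.len v) (by omega) le_rfl).1
    omega
  · intro h1 h2
    apply h1
    have := h.zero
    rwa [h2]

theorem NodeOK.len_eq_zero (h : NodeOK N F c al E T k v) :
    E.len v = 0 ↔ under N al k v = ∅ := by
  constructor
  · intro h1
    rw [Set.eq_empty_iff_forall_notMem]
    intro a ha
    have := (h.env.first a ha).1
    omega
  · intro h1
    by_contra h2
    have := h.env.mem 1 le_rfl (by omega)
    rw [h1] at this
    exact this

theorem Agree.under_eq (h : Agree N k v al al' E E' T T') : under N al k v = under N al' k v := by
  ext a
  simp only [under, Set.mem_ofPred_eq]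
  constructor
  · rintro ⟨h1, h2⟩
    exact ⟨(h.pos a h2).2.2.1 h1, h2⟩
  · rintro ⟨h1, h2⟩
    exact ⟨(h.pos a h2).2.2.2 h1, h2⟩

theorem NodeOK.congr (h : NodeOK N F c al E T k v) (hA : Agree N k v al al' E E' T T') :
    NodeOK N F c al' E' T' k v := by
  obtain ⟨h1, h2, h3, h4, -⟩ := hA.node v 0 (Nat.zero_le _) (by simp)
  constructor
  · rw [← hA.under_eq, ← h1, ← h2]
    exact h.env
  · rw [← h2]
    exact h.zero
  · rw [← h1, ← h2]
    exact h.zero'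
  · rw [← h2, ← h3]
    exact h.fst
  · rw [← h1, ← h2, ← h4]
    exact h.lst
  · intro t ht htl
    rw [← h2]
    rw [← h1] at htl
    obtain ⟨p1, p2, -⟩ := hA.pos _ (h.env.mem t ht htl).2
    rw [← p1, ← p2]
    exact h.links t ht htl

theorem Agree.undo_node (hA : Agree N (k + 1) v al al' E E' T T') :
    Agree N (k + 1) v al al' E E' (T.undo v) (T'.undo v) := by
  obtain ⟨-, -, -, -, a5, a6, a7, a8, -⟩ := hA.node v 0 (Nat.zero_le _) (by simp)
  have b1 := (hA.node (2 * v) 1 (by omega) (by omega)).2.2.1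
  have b2 := (hA.node (2 * v + 1) 1 (by omega) (by omega)).2.2.1
  unfold TreeMem.undo
  rw [← b1, ← b2, ← a5, ← a6, ← a7, ← a8]
  split_ifs
  · refine ⟨hA.node, fun a ha => ?_⟩
    obtain ⟨h1, h2, h3⟩ := hA.pos a ha
    simp only [Function.update_apply, h1, h2]
    exact ⟨trivial, trivial, h3⟩
  · exact hA

theorem Agree.child (hA : Agree N (k + 1) v al al' E E' T T') {w : ℕ} (hw : w / 2 = v) :
    Agree N k w al al' E E' T T' := by
  refine ⟨fun x j hj hx => hA.node x (j + 1) (by omega) ?_, fun a ha => hA.pos a ?_⟩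
  · rw [div_pow_succ, hx, hw]
  · rw [div_pow_succ, ha, hw]

theorem TreeOK.congr (h : TreeOK N F c al E k v T) (hA : Agree N k v al al' E E' T T') :
    TreeOK N F c al' E' k v T' := by
  induction k generalizing v T T' with
  | zero => exact NodeOK.congr h hA
  | succ k ih =>
    obtain ⟨h1, h2, h3, h4⟩ := h
    refine ⟨h1.congr hA, ?_, ih h3 (hA.undo_node.child (by omega)),
      ih h4 (hA.undo_node.child (by omega))⟩
    obtain ⟨a1, a2, -, -, a5, a6, a7, a8, a9⟩ := hA.node v 0 (Nat.zero_le _) (by simp)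
    obtain ⟨b1, b2, -⟩ := hA.node (2 * v) 1 (by omega) (by omega)
    obtain ⟨c1, c2, -⟩ := hA.node (2 * v + 1) 1 (by omega) (by omega)
    have u1 := (hA.child (w := 2 * v) (by omega)).under_eq
    have u2 := (hA.child (w := 2 * v + 1) (by omega)).under_eq
    constructor
    · rw [← a1, ← a2, ← b1, ← c1, ← c2]
      exact h2.left_empty
    · rw [← a1, ← a2, ← b1, ← b2, ← c1]
      exact h2.right_empty
    · rw [← a1, ← a2, ← b1, ← b2, ← c1, ← c2, ← a5, ← a6, ← a7, ← a8, ← a9, ← u1, ← u2]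
      exact h2.bridge

/-- The children of a subtree. -/
theorem TreeOK.undo (h : TreeOK N F c al E (k + 1) v T) :
    TreeOK N F c al E k (2 * v) (T.undo v) ∧ TreeOK N F c al E k (2 * v + 1) (T.undo v) := h.2.2

theorem undo_fst (T : TreeMem) (v : ℕ) : (T.undo v).fst = T.fst := by
  unfold TreeMem.undo
  split_ifs <;> rfl

theorem div_two_pow_le (w j : ℕ) : w / 2 ^ j ≤ w := Nat.div_le_self _ _

/-- Joining two subtrees one of which is empty. -/
theorem TreeOK.join_empty (hal : ∀ a ∈ al, 1 ≤ a) (hv : 1 ≤ v)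
    (h1 : TreeOK N F c al E k (2 * v) T) (h2 : TreeOK N F c al E k (2 * v + 1) T)
    {w : ℕ} (hw : E.len (2 * v) = 0 ∧ w = 2 * v + 1 ∨
      E.len (2 * v) ≠ 0 ∧ E.len (2 * v + 1) = 0 ∧ w = 2 * v) :
    TreeOK N F c al (E.set v (E.len w) (E.seq w)) (k + 1) v (T.ends v) := by
  have n1 := h1.nodeOK
  have n2 := h2.nodeOK
  have agree : ∀ x, x = 2 * v ∨ x = 2 * v + 1 →
      Agree N k x al al E (E.set v (E.len w) (E.seq w)) T (T.ends v) := by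
    intro x hx
    refine ⟨fun y j hj hy => ?_, fun a _ => ⟨rfl, rfl, Iff.rfl⟩⟩
    have : y ≠ v := by
      have := div_two_pow_le y j
      omega
    simp [EnvData.set, TreeMem.ends, Function.update_of_ne this]
  have hund : (T.ends v).undo v = T.ends v := by
    unfold TreeMem.undo
    rw [if_neg]
    have e1 : (T.ends v).fst (2 * v) = T.fst (2 * v) :=
      Function.update_of_ne (by omega) _ _
    have e2 : (T.ends v).fst (2 * v + 1) = T.fst (2 * v + 1) :=
      Function.update_of_ne (by omega) _ _
    rw [e1, e2, ← n1.len_ne hal, ← n2.len_ne hal]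
    omega
  have eL : ∀ x, x ≠ v → (E.set v (E.len w) (E.seq w)).len x = E.len x := fun x hx =>
    Function.update_of_ne hx _ _
  have eS : ∀ x, x ≠ v → (E.set v (E.len w) (E.seq w)).seq x = E.seq x := fun x hx =>
    Function.update_of_ne hx _ _
  have eLv : (E.set v (E.len w) (E.seq w)).len v = E.len w := Function.update_self _ _ _
  have eSv : (E.set v (E.len w) (E.seq w)).seq v = E.seq w := Function.update_self _ _ _
  have f1 := n1.len_ne hal
  have f2 := n2.len_ne hal
  have l1 := n1.lst_ne hal
  have l2 := n2.lst_ne hal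
  refine ⟨?_, ⟨?_, ?_, ?_⟩, ?_, ?_⟩
  · have hw' : NodeOK N F c al E T k w ∧ under N al (k + 1) v = under N al k w ∧
        (T.ends v).fst v = T.fst w ∧ (T.ends v).lst v = T.lst w := by
      simp only [TreeMem.ends, Function.update_self]
      rcases hw with ⟨h, rfl⟩ | ⟨h, h', rfl⟩
      · refine ⟨n2, ?_, if_pos (by tauto), ?_⟩
        · rw [under_succ, n1.len_eq_zero.1 h, Set.empty_union]
        · split_ifs with h3
          · rw [h3]
            tauto
          · rfl
      · refine ⟨n1, ?_, if_neg (by tauto), if_pos (by tauto)⟩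
        rw [under_succ, n2.len_eq_zero.1 h', Set.union_empty]
    obtain ⟨hn, hu, hf, hl⟩ := hw'
    constructor
    · rw [eLv, eSv, hu]
      exact hn.env
    · rw [eSv]
      exact hn.zero
    · rw [eLv, eSv]
      exact hn.zero'
    · rw [eSv, hf]
      exact hn.fst
    · rw [eSv, eLv, hl]
      exact hn.lst
    · rw [eLv, eSv]
      exact hn.links
  · rw [eLv, eSv, eL _ (by omega), eL _ (by omega), eS _ (by omega)]
    intro h
    rcases hw with ⟨-, rfl⟩ | ⟨h', -⟩
    · exact ⟨rfl, rfl⟩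
    · exact absurd h h'
  · rw [eLv, eSv, eL _ (by omega), eL _ (by omega), eS _ (by omega)]
    intro h h0
    rcases hw with ⟨h', -⟩ | ⟨-, -, rfl⟩
    · exact absurd h' h
    · exact ⟨rfl, rfl⟩
  · rw [eL _ (by omega), eL _ (by omega)]
    intro h h'
    omega
  · rw [hund]
    exact h1.congr (agree _ (.inl rfl))
  · rw [hund]
    exact h2.congr (agree _ (.inr rfl))

variable {D : Set ℕ}

/-- Joining two nonempty subtrees at a bridge. -/
theorem TreeOK.join_bridge (hD : SingleCrossing D F c) (halD : al ⊆ D) (hal : ∀ a ∈ al, 1 ≤ a)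
    (hv : 1 ≤ v)
    (h1 : TreeOK N F c al E k (2 * v) T) (h2 : TreeOK N F c al E k (2 * v + 1) T)
    {t u : ℕ} (ht : 1 ≤ t) (htl : t ≤ E.len (2 * v)) (hu : 1 ≤ u) (hul : u ≤ E.len (2 * v + 1))
    (hb : Bridge F c (under N al k (2 * v)) (under N al k (2 * v + 1))
      (E.seq (2 * v) t) (E.seq (2 * v + 1) u)) :
    TreeOK N F c al (E.set v (t + (E.len (2 * v + 1) + 1 - u))
      (splice (E.seq (2 * v)) t (E.seq (2 * v + 1)) u)) (k + 1) v
      ((T.link v (E.seq (2 * v) t) (E.seq (2 * v + 1) u)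
        (c (E.seq (2 * v) t) (E.seq (2 * v + 1) u))).ends v) := by
  have n1 := h1.nodeOK
  have n2 := h2.nodeOK
  set l := E.seq (2 * v) t with hl
  set r := E.seq (2 * v + 1) u with hr
  set E2 := E.set v (t + (E.len (2 * v + 1) + 1 - u))
      (splice (E.seq (2 * v)) t (E.seq (2 * v + 1)) u) with hE2
  set T2 := (T.link v l r (c l r)).ends v with hT2
  have hlm : l ∈ under N al k (2 * v) := n1.env.mem t ht htl
  have hrm : r ∈ under N al k (2 * v + 1) := n2.env.mem u hu hul
  have sub : ∀ w, under N al k w ⊆ D := fun w a ha => halD ha.1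
  have eL : ∀ x, x ≠ v → E2.len x = E.len x := fun x hx => Function.update_of_ne hx _ _
  have eS : ∀ x, x ≠ v → E2.seq x = E.seq x := fun x hx => Function.update_of_ne hx _ _
  have eLv : E2.len v = t + (E.len (2 * v + 1) + 1 - u) := Function.update_self _ _ _
  have eSv : E2.seq v = splice (E.seq (2 * v)) t (E.seq (2 * v + 1)) u :=
    Function.update_self _ _ _
  have f1 := (n1.len_ne hal).1 (by omega)
  have f2 := (n2.len_ne hal).1 (by omega)
  have l2 := (n2.lst_ne hal).1 (by omega)
  have hfst : T2.fst v = T.fst (2 * v) := by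
    change Function.update T.fst v _ v = _
    rw [Function.update_self]
    exact if_neg f1
  have hlst : T2.lst v = T.lst (2 * v + 1) := by
    change Function.update T.lst v _ v = _
    rw [Function.update_self]
    exact if_neg l2
  have hnu : (T2.undo v).nxt = T.nxt ∧ (T2.undo v).prv = T.prv := by
    unfold TreeMem.undo
    have e1 : T2.fst (2 * v) = T.fst (2 * v) := Function.update_of_ne (by omega) _ _
    have e2 : T2.fst (2 * v + 1) = T.fst (2 * v + 1) := Function.update_of_ne (by omega) _ _
    rw [if_pos (by rw [e1, e2]; exact ⟨f1, f2⟩)]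
    simp [hT2, TreeMem.ends, TreeMem.link]
  have hother : (T2.undo v).fst = T2.fst ∧ (T2.undo v).lst = T2.lst ∧ (T2.undo v).lf = T2.lf ∧
      (T2.undo v).rt = T2.rt ∧ (T2.undo v).sa = T2.sa ∧ (T2.undo v).sb = T2.sb ∧
      (T2.undo v).xs = T2.xs := by
    unfold TreeMem.undo
    split_ifs <;> exact ⟨rfl, rfl, rfl, rfl, rfl, rfl, rfl⟩
  have agree : ∀ x, x = 2 * v ∨ x = 2 * v + 1 → Agree N k x al al E E2 T (T2.undo v) := by
    intro x hx
    refine ⟨fun y j hj hy => ?_, fun a _ => ⟨by rw [hnu.1], by rw [hnu.2], Iff.rfl⟩⟩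
    have : y ≠ v := by
      have := div_two_pow_le y j
      omega
    obtain ⟨o1, o2, o3, o4, o5, o6, o7⟩ := hother
    rw [eL y this, eS y this, o1, o2, o3, o4, o5, o6, o7]
    simp [hT2, TreeMem.ends, TreeMem.link, Function.update_of_ne this]
  refine ⟨?_, ⟨?_, ?_, ?_⟩, h1.congr (agree _ (.inl rfl)), h2.congr (agree _ (.inr rfl))⟩
  · constructor
    · rw [eLv, eSv, under_succ]
      exact Envelope.splice hD (sub _) (sub _) under_lt n1.env n2.env ht htl hu hul hb
    · rw [eSv, splice_le (Nat.zero_le _)]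
      exact n1.zero
    · rw [eLv, eSv, show t + (E.len (2 * v + 1) + 1 - u) + 1 =
        t + 1 + (E.len (2 * v + 1) + 1 - u) by omega, splice_add,
        show E.len (2 * v + 1) + 1 - u + u = E.len (2 * v + 1) + 1 by omega]
      exact n2.zero'
    · rw [eSv, splice_le ht, hfst]
      exact n1.fst
    · rw [eLv, eSv, show t + (E.len (2 * v + 1) + 1 - u) =
        t + 1 + (E.len (2 * v + 1) - u) by omega, splice_add,
        show E.len (2 * v + 1) - u + u = E.len (2 * v + 1) by omega, hlst]
      exact n2.lst
    · intro s hs hsl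
      rw [eLv] at hsl
      rw [eSv]
      have en : ∀ a, T2.nxt a = if a = l then r else T.nxt a := fun a =>
        Function.update_apply _ _ _ _
      have ep : ∀ a, T2.prv a = if a = r then l else T.prv a := fun a =>
        Function.update_apply _ _ _ _
      rw [en, ep]
      by_cases hst : s ≤ t
      · have hm := n1.env.mem s hs (by omega)
        have hsr : E.seq (2 * v) s ≠ r := fun h => by
          have := under_lt _ hm _ hrm
          omega
        rw [splice_le hst, splice_le (show s - 1 ≤ t by omega), if_neg hsr]
        refine ⟨?_, (n1.links s hs (by omega)).2⟩
        rcases hst.lt_or_eq with hst | rfl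
        · have := n1.env.lt_of_lt hs hst htl
          rw [if_neg (by omega), splice_le (by omega)]
          exact (n1.links s hs (by omega)).1
        · rw [if_pos rfl, show s + 1 = s + 1 + 0 by omega, splice_add, Nat.zero_add]
      · obtain ⟨j, rfl⟩ : ∃ j, s = t + 1 + j := ⟨s - t - 1, by omega⟩
        have hm := n2.env.mem (j + u) (by omega) (by omega)
        have hsl' : E.seq (2 * v + 1) (j + u) ≠ l := fun h => by
          have := under_lt _ hlm _ hm
          omega
        rw [splice_add, if_neg hsl', show t + 1 + j + 1 = t + 1 + (j + 1) by omega, splice_add,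
          show j + 1 + u = j + u + 1 by omega]
        refine ⟨(n2.links (j + u) (by omega) (by omega)).1, ?_⟩
        rcases Nat.eq_zero_or_pos j with rfl | hj
        · rw [Nat.zero_add, if_pos rfl, splice_le (by omega)]
          rfl
        · have := n2.env.lt_of_lt hu (show u < j + u by omega) (by omega)
          rw [if_neg (by omega), show t + 1 + j - 1 = t + 1 + (j - 1) by omega, splice_add,
            (n2.links (j + u) (by omega) (by omega)).2]
          congr 1
          omega
  · rw [eL _ (by omega)]
    intro h
    omega
  · rw [eL _ (by omega), eL _ (by omega)]
    intro _ h
    omega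
  · rw [eL _ (by omega), eL _ (by omega), eLv, eSv, eS _ (by omega), eS _ (by omega)]
    intro _ _
    refine ⟨t, u, ht, htl, hu, hul, ?_, ?_, ?_, ?_, ?_, hb, rfl, rfl⟩
    · exact Function.update_self _ _ _
    · exact Function.update_self _ _ _
    · change Function.update T.sa v (T.nxt l) v = _
      rw [Function.update_self]
      exact (n1.links t ht htl).1
    · change Function.update T.sb v (T.prv r) v = _
      rw [Function.update_self]
      exact (n2.links u hu hul).2
    · exact Function.update_self _ _ _

end Tree

end UnitDisk

namespace RealRAM

/-! ### Symbolic execution -/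

section Simp

variable (M : ℕ) (s : State)

@[simp] theorem eval_const (k : ℕ) : (IntExpr.const k).eval s = k := rfl
@[simp] theorem eval_reg (i : ℕ) : (IntExpr.reg i).eval s = s.intReg i := rfl
@[simp] theorem eval_add (a b : IntExpr) : (IntExpr.add a b).eval s = a.eval s + b.eval s := rfl
@[simp] theorem eval_sub (a b : IntExpr) : (IntExpr.sub a b).eval s = a.eval s - b.eval s := rfl
@[simp] theorem eval_mul (a b : IntExpr) : (IntExpr.mul a b).eval s = a.eval s * b.eval s := rfl
@[simp] theorem eval_div (a b : IntExpr) : (IntExpr.div a b).eval s = a.eval s / b.eval s := rfl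
@[simp] theorem eval_ild (k : ℕ) (e : IntExpr) : (ild k e).eval s = s.int k (e.eval s) := rfl

@[simp] theorem ok_const (k : ℕ) : (IntExpr.const k).Ok M s ↔ k < M := Iff.rfl
@[simp] theorem ok_reg (i : ℕ) : (IntExpr.reg i).Ok M s ↔ True := Iff.rfl
@[simp] theorem ok_add (a b : IntExpr) : (IntExpr.add a b).Ok M s ↔
    a.Ok M s ∧ b.Ok M s ∧ a.eval s + b.eval s < M := Iff.rfl
@[simp] theorem ok_sub (a b : IntExpr) : (IntExpr.sub a b).Ok M s ↔ a.Ok M s ∧ b.Ok M s := Iff.rfl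
@[simp] theorem ok_mul (a b : IntExpr) : (IntExpr.mul a b).Ok M s ↔
    a.Ok M s ∧ b.Ok M s ∧ a.eval s * b.eval s < M := Iff.rfl
@[simp] theorem ok_div (a b : IntExpr) : (IntExpr.div a b).Ok M s ↔ a.Ok M s ∧ b.Ok M s := Iff.rfl
@[simp] theorem ok_ild (k : ℕ) (e : IntExpr) : (ild k e).Ok M s ↔
    16 < M ∧ e.Ok M s ∧ ad k (e.eval s) < M := by
  change (addr k e).Ok M s ∧ (addr k e).eval s < M ↔ _
  rw [ok_addr, eval_addr]
  tauto

@[simp] theorem reval_const (c : ℚ) : (RealExpr.const c).eval s = c := rfl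
@[simp] theorem reval_reg (i : ℕ) : (RealExpr.reg i).eval s = s.realReg i := rfl
@[simp] theorem reval_add (a b : RealExpr) : (RealExpr.add a b).eval s = a.eval s + b.eval s := rfl
@[simp] theorem reval_sub (a b : RealExpr) : (RealExpr.sub a b).eval s = a.eval s - b.eval s := rfl
@[simp] theorem reval_mul (a b : RealExpr) : (RealExpr.mul a b).eval s = a.eval s * b.eval s := rfl
@[simp] theorem reval_div (a b : RealExpr) : (RealExpr.div a b).eval s = a.eval s / b.eval s := rfl
@[simp] theorem reval_sqrt (a : RealExpr) : (RealExpr.sqrt a).eval s = √(a.eval s) := rfl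
@[simp] theorem reval_rld (k : ℕ) (e : IntExpr) : (rld k e).eval s = s.real k (e.eval s) := rfl

@[simp] theorem rok_const (c : ℚ) : (RealExpr.const c).Ok M s ↔ True := Iff.rfl
@[simp] theorem rok_reg (i : ℕ) : (RealExpr.reg i).Ok M s ↔ True := Iff.rfl
@[simp] theorem rok_add (a b : RealExpr) : (RealExpr.add a b).Ok M s ↔ a.Ok M s ∧ b.Ok M s :=
  Iff.rfl
@[simp] theorem rok_sub (a b : RealExpr) : (RealExpr.sub a b).Ok M s ↔ a.Ok M s ∧ b.Ok M s :=
  Iff.rfl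
@[simp] theorem rok_mul (a b : RealExpr) : (RealExpr.mul a b).Ok M s ↔ a.Ok M s ∧ b.Ok M s :=
  Iff.rfl
@[simp] theorem rok_div (a b : RealExpr) : (RealExpr.div a b).Ok M s ↔ a.Ok M s ∧ b.Ok M s :=
  Iff.rfl
@[simp] theorem rok_sqrt (a : RealExpr) : (RealExpr.sqrt a).Ok M s ↔ a.Ok M s := Iff.rfl
@[simp] theorem rok_rld (k : ℕ) (e : IntExpr) : (rld k e).Ok M s ↔
    16 < M ∧ e.Ok M s ∧ ad k (e.eval s) < M := ok_ild M s k e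

@[simp] theorem holds_intLt (a b : IntExpr) : (Test.intLt a b).Holds s ↔ a.eval s < b.eval s :=
  Iff.rfl
@[simp] theorem holds_intEq (a b : IntExpr) : (Test.intEq a b).Holds s ↔ a.eval s = b.eval s :=
  Iff.rfl
@[simp] theorem holds_realLt (a b : RealExpr) : (Test.realLt a b).Holds s ↔ a.eval s < b.eval s :=
  Iff.rfl
@[simp] theorem holds_realLe (a b : RealExpr) : (Test.realLe a b).Holds s ↔ a.eval s ≤ b.eval s :=
  Iff.rfl
@[simp] theorem holds_neg (c : Test) : (Test.neg c).Holds s ↔ ¬ c.Holds s := Iff.rfl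
@[simp] theorem holds_conj (c d : Test) : (Test.conj c d).Holds s ↔ c.Holds s ∧ d.Holds s := Iff.rfl
@[simp] theorem holds_disj (c d : Test) : (Test.disj c d).Holds s ↔ c.Holds s ∨ d.Holds s := Iff.rfl

@[simp] theorem tok_intLt (a b : IntExpr) : (Test.intLt a b).Ok M s ↔ a.Ok M s ∧ b.Ok M s := Iff.rfl
@[simp] theorem tok_intEq (a b : IntExpr) : (Test.intEq a b).Ok M s ↔ a.Ok M s ∧ b.Ok M s := Iff.rfl
@[simp] theorem tok_realLt (a b : RealExpr) : (Test.realLt a b).Ok M s ↔ a.Ok M s ∧ b.Ok M s :=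
  Iff.rfl
@[simp] theorem tok_realLe (a b : RealExpr) : (Test.realLe a b).Ok M s ↔ a.Ok M s ∧ b.Ok M s :=
  Iff.rfl
@[simp] theorem tok_neg (c : Test) : (Test.neg c).Ok M s ↔ c.Ok M s := Iff.rfl
@[simp] theorem tok_conj (c d : Test) : (Test.conj c d).Ok M s ↔ c.Ok M s ∧ d.Ok M s := Iff.rfl
@[simp] theorem tok_disj (c d : Test) : (Test.disj c d).Ok M s ↔ c.Ok M s ∧ d.Ok M s := Iff.rfl

end Simp

@[simp] theorem int_mk_update (ir : ℕ → ℕ) (rr : ℕ → ℝ) (im : ℕ → ℕ) (rm : ℕ → ℝ) (k a e : ℕ) :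
    (State.mk ir rr (Function.update im (ad k a) e) rm).int k =
      Function.update ((State.mk ir rr im rm).int k) a e := by
  funext i
  change Function.update im (ad k a) e (ad k i) = _
  rw [update_ad_same, Function.update_apply]
  rfl

theorem int_mk_update_ne (ir : ℕ → ℕ) (rr : ℕ → ℝ) (im : ℕ → ℕ) (rm : ℕ → ℝ) {k k' : ℕ} (a e : ℕ)
    (hk : k < 16) (hk' : k' < 16) (h : k' ≠ k) :
    (State.mk ir rr (Function.update im (ad k a) e) rm).int k' =
      (State.mk ir rr im rm).int k' := by
  funext i
  exact update_ad_ne im i a e hk hk' h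

@[simp] theorem real_mk_update (ir : ℕ → ℕ) (rr : ℕ → ℝ) (im : ℕ → ℕ) (rm : ℕ → ℝ) (k a : ℕ)
    (e : ℝ) : (State.mk ir rr im (Function.update rm (ad k a) e)).real k =
      Function.update ((State.mk ir rr im rm).real k) a e := by
  funext i
  change Function.update rm (ad k a) e (ad k i) = _
  rw [update_ad_same, Function.update_apply]
  rfl

theorem real_mk_update_ne (ir : ℕ → ℕ) (rr : ℕ → ℝ) (im : ℕ → ℕ) (rm : ℕ → ℝ) {k k' : ℕ} (a : ℕ)
    (e : ℝ) (hk : k < 16) (hk' : k' < 16) (h : k' ≠ k) :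
    (State.mk ir rr im (Function.update rm (ad k a) e)).real k' =
      (State.mk ir rr im rm).real k' := by
  funext i
  exact update_ad_ne rm i a e hk hk' h

/-- The integer fields do not depend on the registers and on the real memory. -/
@[simp] theorem int_mk (s : State) (ir : ℕ → ℕ) (rr : ℕ → ℝ) (rm : ℕ → ℝ) (k : ℕ) :
    (State.mk ir rr s.intMem rm).int k = s.int k := rfl

@[simp] theorem real_mk (s : State) (ir : ℕ → ℕ) (rr : ℕ → ℝ) (im : ℕ → ℕ) (k : ℕ) :
    (State.mk ir rr im s.realMem).real k = s.real k := rfl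

theorem wp_seq {M : ℕ} {c d : Program} {s : State} {Q : State → Prop}
    (h : wp M c s (fun s' => wp M d s' Q)) : wp M (c ;; d) s Q := h

/-- Sequential composition with a loop-free program. -/
theorem Runs.seq_wp {M : ℕ} {c d : Program} {s : State} {Q : ℕ → State → Prop}
    (h : wp M c s (fun s' => Runs M d s' (fun t s'' => ∀ t' ≤ c.bound, Q (t' + t) s''))) :
    Runs M (c ;; d) s Q := by
  apply Runs.seq
  apply Runs.of_wp
  refine wp_mono h fun s' h' t ht => h'.mono fun t' s'' h'' => h'' t ht

end RealRAM

namespace UnitDisk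

/-! ### Computing a crossing -/

/-- The crossing abscissa of the positions `a` and `b`: the radius is in real register `10`, the
slope bound in real register `12`, and the parameters of the positions are in the fields `5`, `6`,
`7`, `8`. -/
noncomputable def crossing (s : State) (a b : ℕ) : ℝ :=
  arcCross (s.realReg 10) (s.realReg 12) (s.real 5 a) (s.real 6 a) (s.real 7 a) (s.real 8 a)
    (s.real 5 b) (s.real 6 b) (s.real 7 b) (s.real 8 b)

/-- The expression for `arc`, with the radius in real register `10`. -/
def arcExpr (s w x : RealExpr) : RealExpr :=
  .add w (.sqrt (.sub (.mul (rreg 10) (rreg 10)) (.mul (.sub x s) (.sub x s))))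

/-- The real register `20` gets the crossing abscissa of the positions in the integer registers
`a` and `b`. -/
def cross (a b : ℕ) : Program :=
  .setReal 21 (rld 5 (ireg a)) ;; .setReal 22 (rld 6 (ireg a)) ;;
  .setReal 23 (rld 7 (ireg a)) ;; .setReal 24 (rld 8 (ireg a)) ;;
  .setReal 25 (rld 5 (ireg b)) ;; .setReal 26 (rld 6 (ireg b)) ;;
  .setReal 27 (rld 7 (ireg b)) ;; .setReal 28 (rld 8 (ireg b)) ;;
  .setReal 29 (.mul (.const (9 / 10)) (rreg 10)) ;;
  .setReal 30 (.sub (arcExpr (rreg 25) (rreg 26) (.sub (.const 0) (rreg 29)))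
    (arcExpr (rreg 21) (rreg 22) (.sub (.const 0) (rreg 29)))) ;;
  .setReal 31 (.sub (arcExpr (rreg 25) (rreg 26) (rreg 29))
    (arcExpr (rreg 21) (rreg 22) (rreg 29))) ;;
  .cond (.realLt (rreg 23) (rreg 27))
    (.setReal 20 (.div (.add (.add (.sub (arcExpr (rreg 21) (rreg 22) (rreg 29))
        (arcExpr (rreg 25) (rreg 26) (.sub (.const 0) (rreg 29))))
      (.mul (.sub (rreg 12) (rreg 24)) (.add (rreg 23) (rreg 29))))
      (.mul (rreg 28) (.sub (rreg 27) (rreg 29)))) (.add (.sub (rreg 12) (rreg 24)) (rreg 28))))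
  (.cond (.realLe (.const 0) (rreg 30))
    (.setReal 20 (.sub (.sub (rreg 23) (rreg 29)) (.div (rreg 30) (.sub (rreg 28) (rreg 24)))))
  (.cond (.realLe (rreg 31) (.const 0))
    (.setReal 20 (.sub (.add (rreg 23) (rreg 29)) (.div (rreg 31) (.sub (rreg 28) (rreg 24)))))
    (.setReal 30 (.add
        (.mul (.sub (rreg 25) (rreg 21)) (.sub (rreg 25) (rreg 21)))
        (.mul (.sub (rreg 26) (rreg 22)) (.sub (rreg 26) (rreg 22)))) ;;
     .setReal 20 (.add (rreg 23) (.sub (.div (.add (rreg 21) (rreg 25)) (.const 2))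
      (.mul (.sub (rreg 26) (rreg 22)) (.sqrt (.div (.sub (.mul (rreg 10) (rreg 10))
        (.div (rreg 30) (.const 4))) (rreg 30)))))))))

theorem cross_wp {M a b : ℕ} {s : State} {Q : State → Prop} (hM : 16 < M)
    (ha : 16 * s.intReg a + 16 ≤ M) (hb : 16 * s.intReg b + 16 ≤ M)
    (h : ∀ g : ℕ → ℝ, g 20 = crossing s (s.intReg a) (s.intReg b) →
      (∀ i < 20, g i = s.realReg i) → Q { s with realReg := g }) :
    wp M (cross a b) s Q := by
  have ha' : ∀ k < 16, ad k (s.intReg a) < M := fun k hk => by simp only [ad]; omega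
  have hb' : ∀ k < 16, ad k (s.intReg b) < M := fun k hk => by simp only [ad]; omega
  have fr : ∀ i < 20, ∀ j, 20 ≤ j → ∀ (g : ℕ → ℝ) (e : ℝ), Function.update g j e i = g i :=
    fun i hi j hj g e => Function.update_of_ne (by omega) _ _
  simp [cross, wp, arcExpr, hM, ha', hb']
  refine ⟨fun h1 => ?_, fun h1 => ⟨fun h2 => ?_, fun h2 => ⟨fun h3 => ?_, fun h3 => ?_⟩⟩⟩
  all_goals
    refine h _ ?_ ?_
    rotate_left
    · intro i hi
      simp only [fr i hi _ (Nat.le_refl 20), fr i hi _ (by norm_num : 20 ≤ 21),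
        fr i hi _ (by norm_num : 20 ≤ 22), fr i hi _ (by norm_num : 20 ≤ 23),
        fr i hi _ (by norm_num : 20 ≤ 24), fr i hi _ (by norm_num : 20 ≤ 25),
        fr i hi _ (by norm_num : 20 ≤ 26), fr i hi _ (by norm_num : 20 ≤ 27),
        fr i hi _ (by norm_num : 20 ≤ 28), fr i hi _ (by norm_num : 20 ≤ 29),
        fr i hi _ (by norm_num : 20 ≤ 30), fr i hi _ (by norm_num : 20 ≤ 31)]
  · simp [crossing, arcCross, arc, halfWindow, h1]
  · simp [crossing, arcCross, arc, halfWindow, not_lt.2 h1, h2]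
  · simp [crossing, arcCross, arc, halfWindow, not_lt.2 h1, not_le.2 h2, h3]
  · simp [crossing, arcCross, arc, halfWindow, not_lt.2 h1, not_le.2 h2, not_le.2 h3]

end UnitDisk

namespace UnitDisk

/-! ### The machine representation of the tree -/

/-- The tree of envelopes in the memory of the machine. -/
noncomputable def treeOf (s : State) : TreeMem :=
  ⟨s.int 2, s.int 3, s.int 4, s.int 5, s.int 6, s.int 7, s.int 8, s.int 9, s.real 15⟩

@[simp] theorem treeOf_mk (s : State) (ir : ℕ → ℕ) (rr : ℕ → ℝ) :
    treeOf ⟨ir, rr, s.intMem, s.realMem⟩ = treeOf s := rfl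

/-- The programs on the tree keep the parameters of the positions, the real registers below `5` and
from `10` to `19`, and the integer registers below `n` and from `10` on. -/
structure Keeps (n : ℕ) (s s' : State) : Prop where
  intReg : ∀ i, i < n ∨ 10 ≤ i → s'.intReg i = s.intReg i
  realReg : ∀ i, i < 5 ∨ 10 ≤ i ∧ i < 20 → s'.realReg i = s.realReg i
  real : ∀ k < 15, s'.real k = s.real k

theorem Keeps.refl (n : ℕ) (s : State) : Keeps n s s :=
  ⟨fun _ _ => rfl, fun _ _ => rfl, fun _ _ => rfl⟩

theorem Keeps.trans {n : ℕ} {s s' s'' : State} (h : Keeps n s s') (h' : Keeps n s' s'') :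
    Keeps n s s'' :=
  ⟨fun i hi => (h'.intReg i hi).trans (h.intReg i hi),
    fun i hi => (h'.realReg i hi).trans (h.realReg i hi),
    fun k hk => (h'.real k hk).trans (h.real k hk)⟩

theorem Keeps.anti {m n : ℕ} {s s' : State} (h : Keeps n s s') (hmn : m ≤ n) : Keeps m s s' :=
  ⟨fun i hi => h.intReg i (by omega), h.realReg, h.real⟩

theorem Keeps.crossing {n : ℕ} {s s' : State} (h : Keeps n s s') : crossing s' = crossing s := by
  funext a b
  simp only [UnitDisk.crossing, h.realReg 10 (by norm_num), h.realReg 12 (by norm_num),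
    h.real 5 (by norm_num), h.real 6 (by norm_num), h.real 7 (by norm_num), h.real 8 (by norm_num)]

theorem crossing_mk {s : State} {ir : ℕ → ℕ} {rr : ℕ → ℝ} {im : ℕ → ℕ}
    (h10 : rr 10 = s.realReg 10) (h12 : rr 12 = s.realReg 12) :
    crossing ⟨ir, rr, im, s.realMem⟩ = crossing s := by
  funext a b
  simp only [crossing, real_mk, h10, h12]

/-! ### The program for the search for a bridge -/

/-- The crossing abscissa as seen from the left (`d = true`) or in the mirror image. -/
noncomputable def dirCross (d : Bool) (c : ℕ → ℕ → ℝ) (a b : ℕ) : ℝ :=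
  if d then c a b else - c b a

/-- The program for `dirCross`. -/
def crossDir (d : Bool) (a b : ℕ) : Program :=
  if d then cross a b else cross b a ;; .setReal 20 (.sub (.const 0) (rreg 20))

theorem crossDir_wp {d : Bool} {M a b : ℕ} {s : State} {Q : State → Prop} (hM : 16 < M)
    (ha : 16 * s.intReg a + 16 ≤ M) (hb : 16 * s.intReg b + 16 ≤ M)
    (h : ∀ g : ℕ → ℝ, g 20 = dirCross d (crossing s) (s.intReg a) (s.intReg b) →
      (∀ i < 20, g i = s.realReg i) → Q { s with realReg := g }) :
    wp M (crossDir d a b) s Q := by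
  cases d with
  | true =>
    exact cross_wp hM ha hb h
  | false =>
    refine wp_seq (cross_wp hM hb ha fun g h1 h2 => ?_)
    refine ⟨by simp, h _ ?_ ?_⟩
    · simp [h1, dirCross]
    · intro i hi
      dsimp only
      rw [Function.update_of_ne (by omega)]
      exact h2 i hi

/-- The field that leads back from a position: the previous position in the search to the left, the
next one in the mirror image. -/
def backField (d : Bool) : ℕ := if d then 3 else 2

theorem backField_lt (d : Bool) : backField d < 16 := by cases d <;> simp [backField]

/-- One step of the search for a bridge. -/
def sweepStep (d : Bool) : Program :=
  .setInt 7 (ild (backField d) (ireg 5)) ;; .setInt 8 (ild (backField d) (ireg 6)) ;;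
  crossDir d 7 5 ;; .setReal 6 (rreg 20) ;;
  crossDir d 8 6 ;; .setReal 7 (rreg 20) ;;
  crossDir d 5 6 ;;
  .cond (.conj (.neg (.intEq (ireg 7) (.const 0))) (.disj (.realLt (rreg 5) (rreg 6))
      (.conj (.realLt (rreg 20) (rreg 6)) (.disj (.intEq (ireg 8) (.const 0))
        (.realLe (rreg 7) (rreg 6))))))
    (.setInt 5 (ireg 7) ;; .setInt 9 (.const 1))
    (.cond (.conj (.neg (.intEq (ireg 8) (.const 0))) (.realLt (rreg 20) (rreg 7)))
      (.setInt 6 (ireg 8) ;; .setInt 9 (.const 2))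
      (.setInt 9 (.const 0)))

/-- The search for a bridge from the positions in the integer registers `5` and `6`, with the start
value in real register `5`. -/
def sweep (d : Bool) : Program :=
  .setInt 9 (.const 1) ;; .loop (.neg (.intEq (ireg 9) (.const 0))) (sweepStep d)

/-- The time for one step of a search. -/
def sweepBound : ℕ := (sweepStep true).bound + (sweepStep false).bound + 10

/-- The search runs on the sequence `f`. -/
structure SweepSeq (N : ℕ) (back : ℕ → ℕ) (len : ℕ) (f : ℕ → ℕ) : Prop where
  zero : f 0 = 0
  pos : ∀ t, 1 ≤ t → t ≤ len → 1 ≤ f t ∧ f t < N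
  back : ∀ t, 1 ≤ t → t ≤ len → back (f t) = f (t - 1)

theorem SweepSeq.lt {N : ℕ} {back : ℕ → ℕ} {len : ℕ} {f : ℕ → ℕ} (h : SweepSeq N back len f)
    {t : ℕ} (ht : 1 ≤ t) (htl : t ≤ len) : f (t - 1) < N := by
  have := (h.pos t ht htl).2
  rcases Nat.eq_or_lt_of_le ht with rfl | h1
  · rw [Nat.sub_self, h.zero]
    omega
  · exact (h.pos (t - 1) (by omega) (by omega)).2

theorem SweepSeq.eq_zero {N : ℕ} {back : ℕ → ℕ} {len : ℕ} {f : ℕ → ℕ} (h : SweepSeq N back len f)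
    {t : ℕ} (ht : 1 ≤ t) (htl : t ≤ len) : f (t - 1) = 0 ↔ t = 1 := by
  constructor
  · intro h0
    by_contra h1
    have := (h.pos (t - 1) (by omega) (by omega)).1
    omega
  · rintro rfl
    exact h.zero

theorem sweepStep_wp {d : Bool} {M N len lenT t u : ℕ} {f g : ℕ → ℕ} {xs : ℝ} {c : ℕ → ℕ → ℝ}
    {s : State} (hM : 32 * N + 100 ≤ M) (hf : SweepSeq N (s.int (backField d)) len f)
    (hg : SweepSeq N (s.int (backField d)) lenT g)
    (hc : crossing s = c) (hx : s.realReg 5 = xs) (h5 : s.intReg 5 = f t) (h6 : s.intReg 6 = g u)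
    (ht : 1 ≤ t) (htl : t ≤ len) (hu : 1 ≤ u) (hul : u ≤ lenT) :
    wp M (sweepStep d) s (fun s' => s'.intMem = s.intMem ∧ s'.realMem = s.realMem ∧
      Keeps 4 s s' ∧ s'.realReg 5 = xs ∧
      s'.intReg 9 = sweepAct (dirCross d c) xs f g t u ∧
      s'.intReg 5 = f (if sweepAct (dirCross d c) xs f g t u = 1 then t - 1 else t) ∧
      s'.intReg 6 = g (if sweepAct (dirCross d c) xs f g t u = 2 then u - 1 else u)) := by
  have hd := backField_lt d
  have ft := hf.pos t ht htl
  have gu := hg.pos u hu hul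
  have ft' := hf.lt ht htl
  have gu' := hg.lt hu hul
  have mem : ∀ k < 16, ∀ a < N, ad k a < M := fun k hk a ha => by simp only [ad]; omega
  have h16 : 16 < M := by omega
  have b5 := hf.back t ht htl
  have b6 := hg.back u hu hul
  simp only [sweepStep, wp]
  refine ⟨by simp [h16, h5, mem, hd, ft], by simp [h16, h6, mem, hd, gu], ?_⟩
  refine crossDir_wp h16 (by simp [h5, b5]; omega) (by simp [h5]; omega) fun g1 g1v g1k => ?_
  refine ⟨by simp, ?_⟩
  refine crossDir_wp h16 (by simp [h6, b6]; omega) (by simp [h6]; omega) fun g2 g2v g2k => ?_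
  refine ⟨by simp, ?_⟩
  refine crossDir_wp h16 (by simp [h5]; omega) (by simp [h6]; omega) fun g3 g3v g3k => ?_
  simp only [eval_ild, eval_reg, h5, h6, b5, b6, reval_reg, Function.update_self, ne_eq,
    int_mk, Nat.reduceEqDiff, not_false_eq_true, Function.update_of_ne]
    at g1v g2v g3v g1k g2k g3k ⊢
  rw [crossing_mk rfl rfl, hc] at g1v
  rw [crossing_mk (by simp [g1k]) (by simp [g1k]), hc] at g2v
  rw [crossing_mk (by simp [g2k, g1k]) (by simp [g2k, g1k]), hc] at g3v
  have r5 : g3 5 = xs := by simp [g3k, g2k, g1k, hx]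
  have r6 : g3 6 = g1 20 := by simp [g3k, g2k]
  have r7 : g3 7 = g2 20 := by simp [g3k]
  have z7 := hf.eq_zero ht htl
  have z8 := hg.eq_zero hu hul
  have kr : ∀ i, i < 5 ∨ 10 ≤ i ∧ i < 20 → g3 i = s.realReg i := by
    intro i hi
    rw [g3k i (by omega), Function.update_of_ne (by omega), g2k i (by omega),
      Function.update_of_ne (by omega), g1k i (by omega)]
  have ki : ∀ i, i < 4 ∨ 10 ≤ i → ∀ j, 5 ≤ j → j < 10 → i ≠ j := by omega
  have k4 : 4 < M := by omega
  have act1 : ∀ {P : Prop}, (P ↔ t ≠ 1 ∧ (xs < dirCross d c (f (t - 1)) (f t) ∨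
      (dirCross d c (f t) (g u) < dirCross d c (f (t - 1)) (f t) ∧
      (u = 1 ∨ dirCross d c (g (u - 1)) (g u) ≤ dirCross d c (f (t - 1)) (f t))))) →
      (P → sweepAct (dirCross d c) xs f g t u = 1) ∧ (¬ P → sweepAct (dirCross d c) xs f g t u =
        if u ≠ 1 ∧ dirCross d c (f t) (g u) < dirCross d c (g (u - 1)) (g u) then 2 else 0) :=
    fun hP => ⟨fun h => if_pos (hP.1 h), fun h => if_neg (fun h' => h (hP.2 h'))⟩
  refine ⟨by simp; omega, fun h => ?_, fun h => ⟨by simp; omega, fun h' => ?_, fun h' => ?_⟩⟩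
  · have hA := (act1 (by simp [r5, r6, r7, g1v, g2v, g3v, z7, z8])).1 h
    rw [hA]
    refine ⟨by simp, by simp; omega, trivial, trivial, ⟨?_, kr, fun _ _ => rfl⟩, r5, ?_, ?_, ?_⟩
    · intro i hi
      simp [ki i hi]
    · simp
    · simp
    · simp
  · have hA := (act1 (by simp [r5, r6, r7, g1v, g2v, g3v, z7, z8])).2 h
    rw [if_pos (by simpa [g2v, g3v, z8, r7] using h')] at hA
    rw [hA]
    refine ⟨by simp, by simp; omega, trivial, trivial, ⟨?_, kr, fun _ _ => rfl⟩, r5, ?_, ?_, ?_⟩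
    · intro i hi
      simp [ki i hi]
    · simp
    · simp
    · simp
  · have hA := (act1 (by simp [r5, r6, r7, g1v, g2v, g3v, z7, z8])).2 h
    rw [if_neg (by simpa [g2v, g3v, z8, r7] using h')] at hA
    rw [hA]
    refine ⟨by simp; omega, trivial, trivial, ⟨?_, kr, fun _ _ => rfl⟩, r5, ?_, ?_, ?_⟩
    · intro i hi
      simp [ki i hi]
    · simp
    · simp
    · simp

theorem sweepStep_bound (d : Bool) : (sweepStep d).bound + 10 ≤ sweepBound := by
  unfold sweepBound
  cases d <;> omega

/-- The search for a bridge, with any invariant `J` that the steps preserve. -/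
theorem sweep_runs {d : Bool} {M N len lenT tmin t0 u0 : ℕ} {f g : ℕ → ℕ} {xs : ℝ} {c : ℕ → ℕ → ℝ}
    {J R : ℕ → ℕ → Prop} {s : State} (hM : 32 * N + 100 ≤ M)
    (hf : SweepSeq N (s.int (backField d)) len f) (hg : SweepSeq N (s.int (backField d)) lenT g)
    (hc : crossing s = c) (hx : s.realReg 5 = xs) (h5 : s.intReg 5 = f t0)
    (h6 : s.intReg 6 = g u0) (hmin : 1 ≤ tmin)
    (hJ : ∀ t u, J t u → (tmin ≤ t ∧ t ≤ len ∧ 1 ≤ u ∧ u ≤ lenT) ∧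
      (sweepAct (dirCross d c) xs f g t u = 1 → J (t - 1) u ∧ tmin < t) ∧
      (sweepAct (dirCross d c) xs f g t u = 2 → J t (u - 1) ∧ 1 < u) ∧
      (sweepAct (dirCross d c) xs f g t u = 0 → R t u))
    (h0 : J t0 u0) :
    Runs M (sweep d) s (fun τ s' => ∃ t u, R t u ∧ J t u ∧ t ≤ t0 ∧ u ≤ u0 ∧
      s'.intReg 5 = f t ∧ s'.intReg 6 = g u ∧
      τ + sweepBound * (t + u) ≤ sweepBound * (t0 + u0 + 2) ∧
      s'.intMem = s.intMem ∧ s'.realMem = s.realMem ∧ Keeps 4 s s') := by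
  have hB := sweepStep_bound d
  refine Runs.seq_wp ⟨by simp; omega, ?_⟩
  refine Runs.loop (I := fun r τ s' => ∃ t u, J t u ∧ (s'.intReg 9 = 0 → R t u) ∧
    t ≤ t0 ∧ u ≤ u0 ∧
    s'.intReg 5 = f t ∧ s'.intReg 6 = g u ∧ s'.realReg 5 = xs ∧
    r = t + u + (if s'.intReg 9 = 0 then 0 else 1) ∧
    τ + sweepBound * r ≤ sweepBound * (t0 + u0 + 1) ∧
    s'.intMem = s.intMem ∧ s'.realMem = s.realMem ∧ Keeps 4 s s') (r := t0 + u0 + 1)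
    ?_ ?_ ?_ ?_
  · rintro r τ s' -
    simp
    omega
  · rintro r τ s' ⟨t, u, hJt, -, ht0, hu0, h5', h6', hx', hr, hτ, him, hrm, hk⟩ hb
    obtain ⟨⟨j1, j2, j3, j4⟩, a1, a2, a0⟩ := hJ t u hJt
    have hb' : s'.intReg 9 ≠ 0 := hb
    rw [if_neg hb'] at hr
    have hint : s'.int (backField d) = s.int (backField d) := by
      unfold State.int
      rw [him]
    refine Runs.of_wp (wp_mono (sweepStep_wp hM (hint ▸ hf) (hint ▸ hg)
      (hk.crossing.trans hc) hx' h5' h6' (by omega) j2 j3 j4) ?_)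
    rintro s'' ⟨b1, b2, b3, b4, b5, b6, b7⟩ τ' hτ'
    have hcost : ∀ r', r' + 1 = r → τ + ((Test.neg (.intEq (ireg 9) (.const 0))).cost + τ' + 1) +
        sweepBound * r' ≤ sweepBound * (t0 + u0 + 1) := by
      rintro r' rfl
      have : (Test.neg (.intEq (ireg 9) (.const 0))).cost = 4 := rfl
      rw [mul_add] at hτ
      omega
    have him' := b1.trans him
    have hrm' := b2.trans hrm
    have hk' := hk.trans b3
    have hact : sweepAct (dirCross d c) xs f g t u = 0 ∨ sweepAct (dirCross d c) xs f g t u = 1 ∨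
        sweepAct (dirCross d c) xs f g t u = 2 := by
      unfold sweepAct
      split_ifs <;> simp
    rcases hact with ha | ha | ha
    · rw [ha] at b5 b6 b7
      refine ⟨t + u, by omega, t, u, hJt, fun _ => a0 ha, ht0, hu0, b6, b7, b4, ?_,
        hcost _ (by omega), him', hrm', hk'⟩
      rw [if_pos b5, add_zero]
    · rw [ha] at b5 b6 b7
      obtain ⟨c1, c2⟩ := a1 ha
      refine ⟨t + u, by omega, t - 1, u, c1, fun h => by omega, by omega, hu0, b6, b7, b4, ?_,
        hcost _ (by omega), him', hrm', hk'⟩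
      rw [if_neg (by omega)]
      omega
    · rw [ha] at b5 b6 b7
      obtain ⟨c1, c2⟩ := a2 ha
      refine ⟨t + u, by omega, t, u - 1, c1, fun h => by omega, ht0, by omega, b6, b7, b4, ?_,
        hcost _ (by omega), him', hrm', hk'⟩
      rw [if_neg (by omega)]
      omega
  · rintro r τ s' ⟨t, u, hJt, hR, ht0, hu0, h5', h6', hx', hr, hτ, him, hrm, hk⟩ hb τ0 hτ0
    have hb' : s'.intReg 9 = 0 := not_not.1 hb
    rw [if_pos hb'] at hr
    refine ⟨t, u, hR hb', hJt, ht0, hu0, h5', h6', ?_, him, hrm, hk⟩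
    have h1 : (Test.neg (.intEq (ireg 9) (.const 0))).cost = 4 := rfl
    have h2 : (Program.setInt 9 (.const 1)).bound = 2 := rfl
    rw [h2] at hτ0
    rw [h1]
    subst hr
    rw [show t0 + u0 + 2 = t0 + u0 + 1 + 1 by omega, mul_add _ (t0 + u0 + 1)]
    rw [add_zero] at hτ
    omega
  · refine ⟨t0, u0, h0, by simp, le_rfl, le_rfl, by simp [h5], by simp [h6], hx, by simp, by simp,
      rfl, rfl, ?_, fun _ _ => rfl, fun _ _ => rfl⟩
    intro i hi
    dsimp only
    rw [Function.update_of_ne (by omega)]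

end UnitDisk

namespace UnitDisk

/-! ### Programs for a node of the tree -/

/-- The left child of the node in integer register `3`. -/
abbrev leftChild : IntExpr := .mul (.const 2) (ireg 3)

/-- The right child of the node in integer register `3`. -/
abbrev rightChild : IntExpr := .add (.mul (.const 2) (ireg 3)) (.const 1)

/-- The program for `TreeMem.undo`, for the node in integer register `3`. -/
def undoNode : Program :=
  .cond (.conj (.neg (.intEq (ild 4 leftChild) (.const 0)))
      (.neg (.intEq (ild 4 rightChild) (.const 0))))
    (ist 2 (ild 6 (ireg 3)) (ild 8 (ireg 3)) ;; ist 3 (ild 7 (ireg 3)) (ild 9 (ireg 3)))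
    .skip

/-- The program for `TreeMem.link`, for the node in integer register `3` and the bridge between the
positions in the integer registers `5` and `6`. -/
def linkNode : Program :=
  cross 5 6 ;; ist 8 (ireg 3) (ild 2 (ireg 5)) ;; ist 9 (ireg 3) (ild 3 (ireg 6)) ;;
  ist 2 (ireg 5) (ireg 6) ;; ist 3 (ireg 6) (ireg 5) ;; ist 6 (ireg 3) (ireg 5) ;;
  ist 7 (ireg 3) (ireg 6) ;; rst 15 (ireg 3) (rreg 20)

/-- The program for `TreeMem.ends`, for the node in integer register `3`. -/
def endsNode : Program :=
  .cond (.intEq (ild 4 leftChild) (.const 0)) (ist 4 (ireg 3) (ild 4 rightChild))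
    (ist 4 (ireg 3) (ild 4 leftChild)) ;;
  .cond (.intEq (ild 5 rightChild) (.const 0)) (ist 5 (ireg 3) (ild 5 leftChild))
    (ist 5 (ireg 3) (ild 5 rightChild))

theorem undoNode_wp {M N v : ℕ} {s : State} (hM : 32 * N + 100 ≤ M) (h3 : s.intReg 3 = v)
    (hv : v < N) (hb : (treeOf s).fst (2 * v) ≠ 0 → (treeOf s).fst (2 * v + 1) ≠ 0 →
      (treeOf s).lf v < N ∧ (treeOf s).rt v < N) :
    wp M undoNode s (fun s' => treeOf s' = (treeOf s).undo v ∧ s'.intReg = s.intReg ∧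
      Keeps 4 s s') := by
  have mem : ∀ k < 16, ∀ a < 2 * N, ad k a < M := fun k hk a ha => by simp only [ad]; omega
  have h16 : 16 < M := by omega
  refine ⟨?_, fun h => ?_, fun h => ?_⟩
  · simp [h16, h3, mem, show 2 * v < 2 * N by omega, show 2 * v + 1 < 2 * N by omega]
    omega
  · have h' : (treeOf s).fst (2 * v) ≠ 0 ∧ (treeOf s).fst (2 * v + 1) ≠ 0 := by
      simpa [treeOf, h3] using h
    obtain ⟨b1, b2⟩ := hb h'.1 h'.2
    have b1' : s.int 6 v < 2 * N := by change s.int 6 v < N at b1; omega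
    have b2' : s.int 7 v < 2 * N := by change s.int 7 v < N at b2; omega
    have hv' : v < 2 * N := by omega
    simp only [wp]
    refine ⟨by simp [h16, h3, mem, b1', hv'], ⟨?_, ?_, ?_⟩, ?_, ?_, ?_⟩
    · simp [h16, h3, mem, int_mk_update_ne, b2', hv']
    · simp [h3, mem, int_mk_update_ne, b2']
    · simp [h16, h3, mem, hv']
    · rw [TreeMem.undo, if_pos h']
      simp [treeOf, int_mk_update_ne, h3]
    · simp
    · exact ⟨fun _ _ => by simp, fun _ _ => rfl, fun _ _ => rfl⟩
  · have h' : ¬ ((treeOf s).fst (2 * v) ≠ 0 ∧ (treeOf s).fst (2 * v + 1) ≠ 0) := by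
      simpa [treeOf, h3] using h
    refine ⟨?_, rfl, Keeps.refl _ _⟩
    rw [TreeMem.undo, if_neg h']

theorem linkNode_wp {M N v l r : ℕ} {s : State} (hM : 32 * N + 100 ≤ M) (h3 : s.intReg 3 = v)
    (hv : v < N) (h5 : s.intReg 5 = l) (hl : l < N) (h6 : s.intReg 6 = r) (hr : r < N) :
    wp M linkNode s (fun s' => treeOf s' = (treeOf s).link v l r (crossing s l r) ∧
      s'.intReg = s.intReg ∧ Keeps 4 s s') := by
  have mem : ∀ k < 16, ∀ a < N, ad k a < M := fun k hk a ha => by simp only [ad]; omega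
  have h16 : 16 < M := by omega
  refine wp_seq (cross_wp h16 (by omega) (by omega) fun g g1 g2 => ?_)
  simp only [wp]
  simp [h3, h5, h6, g1, h16, mem, hv, hl, hr, int_mk_update_ne]
  refine ⟨?_, fun _ _ => rfl, ?_, ?_⟩
  · simp [treeOf, int_mk_update_ne, TreeMem.link]
  · exact fun i hi => g2 i (by omega)
  · intro k hk
    rw [real_mk_update_ne _ _ _ _ _ _ (by norm_num) (by omega) (by omega)]
    rfl

theorem endsNode_wp {M N v : ℕ} {s : State} (hM : 32 * N + 100 ≤ M) (h3 : s.intReg 3 = v)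
    (hv1 : 1 ≤ v) (hv : v < N) :
    wp M endsNode s (fun s' => treeOf s' = (treeOf s).ends v ∧ s'.intReg = s.intReg ∧
      Keeps 4 s s') := by
  have mem : ∀ k < 16, ∀ a < 2 * N, ad k a < M := fun k hk a ha => by simp only [ad]; omega
  have h16 : 16 < M := by omega
  have e1 : v < 2 * N := by omega
  have e2 : 2 * v < 2 * N := by omega
  have e3 : 2 * v + 1 < 2 * N := by omega
  have e4 : 2 * v < M := by omega
  have e5 : 2 * v + 1 < M := by omega
  have e6 : 2 < M := by omega
  have e7 : 1 < M := by omega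
  have e8 : 0 < M := by omega
  simp only [endsNode, wp]
  simp [h3, h16, mem, e1, e2, e3, e4, e5, e6, e7, e8, int_mk_update_ne]
  refine ⟨fun h => ⟨fun h' => ?_, fun h' => ?_⟩, fun h => ⟨fun h' => ?_, fun h' => ?_⟩⟩
  all_goals
    refine ⟨?_, fun _ _ => rfl, fun _ _ => rfl, fun _ _ => rfl⟩
    simp [treeOf, TreeMem.ends, int_mk_update_ne, h, h']

/-- Two trees differ only in the node `v` and in the links of the positions below `v`, which has
height `k`. -/
structure OnlyBelow (N k v : ℕ) (T T' : TreeMem) : Prop where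
  node : ∀ w ≠ v, T.fst w = T'.fst w ∧ T.lst w = T'.lst w ∧ T.lf w = T'.lf w ∧ T.rt w = T'.rt w ∧
    T.sa w = T'.sa w ∧ T.sb w = T'.sb w ∧ T.xs w = T'.xs w
  pos : ∀ a, (N + a) / 2 ^ k ≠ v → T.nxt a = T'.nxt a ∧ T.prv a = T'.prv a

theorem OnlyBelow.trans {N k v : ℕ} {T T' T'' : TreeMem} (h : OnlyBelow N k v T T')
    (h' : OnlyBelow N k v T' T'') : OnlyBelow N k v T T'' := by
  constructor
  · intro w hw
    obtain ⟨a1, a2, a3, a4, a5, a6, a7⟩ := h.node w hw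
    obtain ⟨b1, b2, b3, b4, b5, b6, b7⟩ := h'.node w hw
    exact ⟨a1.trans b1, a2.trans b2, a3.trans b3, a4.trans b4, a5.trans b5, a6.trans b6,
      a7.trans b7⟩
  · intro a ha
    exact ⟨(h.pos a ha).1.trans (h'.pos a ha).1, (h.pos a ha).2.trans (h'.pos a ha).2⟩

theorem OnlyBelow.ends (N k v : ℕ) (T : TreeMem) : OnlyBelow N k v T (T.ends v) := by
  refine ⟨fun w hw => ?_, fun a _ => ⟨rfl, rfl⟩⟩
  simp [TreeMem.ends, Function.update_of_ne hw]

theorem OnlyBelow.link {N k v l r : ℕ} (T : TreeMem) (x : ℝ) (hl : (N + l) / 2 ^ k = v)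
    (hr : (N + r) / 2 ^ k = v) : OnlyBelow N k v T (T.link v l r x) := by
  refine ⟨fun w hw => ?_, fun a ha => ?_⟩
  · simp [TreeMem.link, Function.update_of_ne hw]
  · have h1 : a ≠ l := fun h => ha (h ▸ hl)
    have h2 : a ≠ r := fun h => ha (h ▸ hr)
    simp [TreeMem.link, Function.update_of_ne h1, Function.update_of_ne h2]

theorem OnlyBelow.undo {N k v : ℕ} {T : TreeMem}
    (h : T.fst (2 * v) ≠ 0 → T.fst (2 * v + 1) ≠ 0 → (N + T.lf v) / 2 ^ k = v ∧
      (N + T.rt v) / 2 ^ k = v) : OnlyBelow N k v T (T.undo v) := by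
  unfold TreeMem.undo
  split_ifs with hc
  · obtain ⟨hl, hr⟩ := h hc.1 hc.2
    refine ⟨fun w hw => ⟨rfl, rfl, rfl, rfl, rfl, rfl, rfl⟩, fun a ha => ?_⟩
    have h1 : a ≠ T.lf v := fun h => ha (h ▸ hl)
    have h2 : a ≠ T.rt v := fun h => ha (h ▸ hr)
    simp [Function.update_of_ne h1, Function.update_of_ne h2]
  · exact ⟨fun w hw => ⟨rfl, rfl, rfl, rfl, rfl, rfl, rfl⟩, fun a ha => ⟨rfl, rfl⟩⟩

/-- A change below `v` does not affect a subtree that is disjoint from the subtree of `v`. -/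
theorem OnlyBelow.agree {N k v j x : ℕ} {T T' : TreeMem} (h : OnlyBelow N k v T T')
    {al al' : Set ℕ} {E E' : EnvData}
    (hE : ∀ w ≠ v, E.len w = E'.len w ∧ E.seq w = E'.seq w)
    (hal : ∀ a, (N + a) / 2 ^ k ≠ v → (a ∈ al ↔ a ∈ al'))
    (h1 : ∀ i ≤ j, v / 2 ^ i ≠ x) (h2 : ∀ a, (N + a) / 2 ^ j = x → (N + a) / 2 ^ k ≠ v) :
    Agree N j x al al' E E' T T' := by
  refine ⟨fun w i hi hw => ?_, fun a ha => ?_⟩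
  · have hwv : w ≠ v := by
      rintro rfl
      exact h1 i hi hw
    obtain ⟨e1, e2⟩ := hE w hwv
    exact ⟨e1, e2, h.node w hwv⟩
  · exact ⟨(h.pos a (h2 a ha)).1, (h.pos a (h2 a ha)).2, hal a (h2 a ha)⟩

end UnitDisk

namespace UnitDisk

/-! ### Joining at a node -/

/-- The setting of the tree programs: the positions in `D` carry functions that cross once, and the
memory has room for the tree with `N` leaves. -/
structure Setup (M N : ℕ) (D : Set ℕ) (F : ℕ → ℝ → ℝ) (c : ℕ → ℕ → ℝ) : Prop where
  mem : 32 * N + 100 ≤ M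
  sc : SingleCrossing D F c
  pos : ∀ a ∈ D, 1 ≤ a ∧ a < N

/-- From `s` to `s'`, the envelope of the node `v` of height `k + 1` has been joined from the
envelopes of its children. -/
structure Joined (N : ℕ) (F : ℕ → ℝ → ℝ) (c : ℕ → ℕ → ℝ) (al : Set ℕ) (E : EnvData) (k v n : ℕ)
    (f : ℕ → ℕ) (s s' : State) : Prop where
  tree : TreeOK N F c al (E.set v n f) (k + 1) v (treeOf s')
  only : OnlyBelow N (k + 1) v (treeOf s) (treeOf s')
  keeps : Keeps 4 s s'

variable {M N : ℕ} {D al : Set ℕ} {F : ℕ → ℝ → ℝ} {c : ℕ → ℕ → ℝ} {E : EnvData} {k v : ℕ}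
  {s : State}

theorem half_child (a k v : ℕ) (h : a / 2 ^ k = 2 * v ∨ a / 2 ^ k = 2 * v + 1) :
    a / 2 ^ (k + 1) = v := by
  rw [div_pow_succ]
  omega

theorem endsNode_join (hS : Setup M N D F c) (hal : al ⊆ D) (h3 : s.intReg 3 = v) (hv : 1 ≤ v)
    (hvN : v < N) (h1 : TreeOK N F c al E k (2 * v) (treeOf s))
    (h2 : TreeOK N F c al E k (2 * v + 1) (treeOf s)) {w : ℕ}
    (hw : E.len (2 * v) = 0 ∧ w = 2 * v + 1 ∨
      E.len (2 * v) ≠ 0 ∧ E.len (2 * v + 1) = 0 ∧ w = 2 * v) :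
    wp M endsNode s (Joined N F c al E k v (E.len w) (E.seq w) s) := by
  refine wp_mono (endsNode_wp hS.mem h3 hv hvN) ?_
  rintro s' ⟨e1, -, e3⟩
  refine ⟨?_, ?_, e3⟩
  · rw [e1]
    exact TreeOK.join_empty (fun a ha => (hS.pos a (hal ha)).1) hv h1 h2 hw
  · rw [e1]
    exact OnlyBelow.ends _ _ _ _

/-- Joining two nonempty children at the bridge between the positions in the integer registers `5`
and `6`. -/
theorem linkNode_join (hS : Setup M N D F c) (hal : al ⊆ D) (hc : crossing s = c)
    (h3 : s.intReg 3 = v) (hv : 1 ≤ v)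
    (hvN : v < N) (h1 : TreeOK N F c al E k (2 * v) (treeOf s))
    (h2 : TreeOK N F c al E k (2 * v + 1) (treeOf s)) {t u : ℕ} (ht : 1 ≤ t)
    (htl : t ≤ E.len (2 * v)) (hu : 1 ≤ u) (hul : u ≤ E.len (2 * v + 1))
    (h5 : s.intReg 5 = E.seq (2 * v) t) (h6 : s.intReg 6 = E.seq (2 * v + 1) u)
    (hb : Bridge F c (under N al k (2 * v)) (under N al k (2 * v + 1))
      (E.seq (2 * v) t) (E.seq (2 * v + 1) u)) :
    wp M (linkNode ;; endsNode) s (Joined N F c al E k v (t + (E.len (2 * v + 1) + 1 - u))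
      (splice (E.seq (2 * v)) t (E.seq (2 * v + 1)) u) s) := by
  have m1 := h1.nodeOK.env.mem t ht htl
  have m2 := h2.nodeOK.env.mem u hu hul
  have p1 := hS.pos _ (hal m1.1)
  have p2 := hS.pos _ (hal m2.1)
  refine wp_seq (wp_mono (linkNode_wp hS.mem h3 hvN h5 p1.2 h6 p2.2) ?_)
  rintro s' ⟨e1, e2, e3⟩
  refine wp_mono (endsNode_wp hS.mem (by rw [e2, h3]) hv hvN) ?_
  rintro s'' ⟨d1, d2, d3⟩
  rw [hc] at e1
  refine ⟨?_, ?_, e3.trans d3⟩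
  · rw [d1, e1]
    exact TreeOK.join_bridge hS.sc hal (fun a ha => (hS.pos a (hal ha)).1) hv h1 h2 ht htl hu hul hb
  · rw [d1, e1]
    exact (OnlyBelow.link _ _ (half_child _ _ _ (.inl m1.2)) (half_child _ _ _ (.inr m2.2))).trans
      (OnlyBelow.ends _ _ _ _)

theorem under_pos (hS : Setup M N D F c) (hal : al ⊆ D) {a w : ℕ} (ha : a ∈ under N al k w) :
    1 ≤ a ∧ a < N := hS.pos a (hal ha.1)

/-- The envelope of a node, traversed to the left. -/
theorem NodeOK.sweepSeq_left (hS : Setup M N D F c) (hal : al ⊆ D)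
    (h : NodeOK N F c al E (treeOf s) k v) :
    SweepSeq N (s.int (backField true)) (E.len v) (E.seq v) :=
  ⟨h.zero, fun t ht htl => under_pos hS hal (h.env.mem t ht htl),
    fun t ht htl => (h.links t ht htl).2⟩

/-- The envelope of a node, traversed to the right. -/
theorem NodeOK.sweepSeq_right (hS : Setup M N D F c) (hal : al ⊆ D)
    (h : NodeOK N F c al E (treeOf s) k v) :
    SweepSeq N (s.int (backField false)) (E.len v) (fun t => E.seq v (E.len v + 1 - t)) := by
  refine ⟨h.zero', fun t ht htl => under_pos hS hal (h.env.mem _ (by omega) (by omega)),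
    fun t ht htl => ?_⟩
  rw [show E.len v + 1 - (t - 1) = E.len v + 1 - t + 1 by omega]
  exact (h.links (E.len v + 1 - t) (by omega) (by omega)).1

theorem treeOf_eq {s s' : State} (h1 : s'.intMem = s.intMem) (h2 : s'.realMem = s.realMem) :
    treeOf s' = treeOf s := by
  simp only [treeOf]
  unfold State.int State.real
  rw [h1, h2]

theorem Joined.congr_left {n : ℕ} {f : ℕ → ℕ} {s s' s'' : State}
    (h : Joined N F c al E k v n f s' s'') (ht : treeOf s' = treeOf s) (hk : Keeps 4 s s') :
    Joined N F c al E k v n f s s'' :=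
  ⟨h.tree, ht ▸ h.only, hk.trans h.keeps⟩

/-- Exchange the integer registers `5` and `6`. -/
def swapEnds : Program :=
  .setInt 7 (ireg 5) ;; .setInt 5 (ireg 6) ;; .setInt 6 (ireg 7)

/-- Search to the left and join. -/
theorem sweepLeft_join (hS : Setup M N D F c) (hal : al ⊆ D) (hc : crossing s = c)
    (h3 : s.intReg 3 = v) (hv : 1 ≤ v)
    (hvN : v < N) (h1 : TreeOK N F c al E k (2 * v) (treeOf s))
    (h2 : TreeOK N F c al E k (2 * v + 1) (treeOf s)) {t0 u0 tmin : ℕ} {xs : ℝ}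
    (hx : s.realReg 5 = xs)
    (h5 : s.intReg 5 = E.seq (2 * v) t0) (h6 : s.intReg 6 = E.seq (2 * v + 1) u0)
    (hterm : SweepStop F c (under N al k (2 * v + 1)) xs (E.seq (2 * v)) tmin)
    (hinv : SweepInv F c (under N al k (2 * v)) (under N al k (2 * v + 1)) xs (E.len (2 * v))
      (E.seq (2 * v)) (E.len (2 * v + 1)) (E.seq (2 * v + 1)) tmin t0 u0) :
    Runs M (sweep true ;; linkNode ;; endsNode) s (fun τ s' => ∃ t u, tmin ≤ t ∧ t ≤ t0 ∧
      t ≤ E.len (2 * v) ∧ 1 ≤ u ∧ u ≤ u0 ∧ u ≤ E.len (2 * v + 1) ∧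
      Joined N F c al E k v (t + (E.len (2 * v + 1) + 1 - u))
        (splice (E.seq (2 * v)) t (E.seq (2 * v + 1)) u) s s' ∧
      τ + sweepBound * (t + u) ≤ sweepBound * (t0 + u0 + 2) + (linkNode ;; endsNode).bound) := by
  have n1 := h1.nodeOK
  have n2 := h2.nodeOK
  have sub : ∀ w, under N al k w ⊆ D := fun w a ha => hal ha.1
  have hmin := hterm.1
  apply Runs.seq
  refine (sweep_runs (N := N) (tmin := tmin) (R := fun t u => Bridge F c (under N al k (2 * v))
    (under N al k (2 * v + 1)) (E.seq (2 * v) t) (E.seq (2 * v + 1) u)) hS.mem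
    (n1.sweepSeq_left hS hal) (n2.sweepSeq_left hS hal) hc hx h5 h6 hmin
    (fun t u hJ => ⟨⟨hJ.1, hJ.2.1, hJ.2.2.1, hJ.2.2.2.1⟩,
      sweep_step hS.sc (sub _) (sub _) under_lt n1.env n2.env hterm hJ⟩) hinv).mono ?_
  rintro τ s' ⟨t, u, hb, hJ, ht0, hu0, h5', h6', hτ, him, hrm, hk⟩
  obtain ⟨j1, j2, j3, j4, -⟩ := hJ
  have ht := treeOf_eq him hrm
  refine Runs.of_wp (wp_mono (linkNode_join hS hal (hk.crossing.trans hc)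
    ((hk.intReg 3 (by norm_num)).trans h3) hv hvN (ht ▸ h1) (ht ▸ h2) (hmin.trans j1) j2 j3 j4
    h5' h6' hb) ?_)
  intro s'' hs'' τ' hτ'
  refine ⟨t, u, j1, ht0, j2, j3, hu0, j4, hs''.congr_left ht hk, ?_⟩
  omega

/-- Search to the right and join. -/
theorem sweepRight_join (hS : Setup M N D F c) (hal : al ⊆ D) (hc : crossing s = c)
    (h3 : s.intReg 3 = v) (hv : 1 ≤ v)
    (hvN : v < N) (h1 : TreeOK N F c al E k (2 * v) (treeOf s))
    (h2 : TreeOK N F c al E k (2 * v + 1) (treeOf s)) {t0 u0 tmin : ℕ} {xs : ℝ}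
    (hx : s.realReg 5 = xs)
    (h5 : s.intReg 5 = E.seq (2 * v + 1) (E.len (2 * v + 1) + 1 - t0))
    (h6 : s.intReg 6 = E.seq (2 * v) (E.len (2 * v) + 1 - u0))
    (hterm : SweepStop (ι := ℕᵒᵈ) (fun a x => F a (-x)) (fun a b => - c b a)
      (under N al k (2 * v)) xs (fun t => E.seq (2 * v + 1) (E.len (2 * v + 1) + 1 - t)) tmin)
    (hinv : SweepInv (ι := ℕᵒᵈ) (fun a x => F a (-x)) (fun a b => - c b a)
      (under N al k (2 * v + 1)) (under N al k (2 * v)) xs (E.len (2 * v + 1))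
      (fun t => E.seq (2 * v + 1) (E.len (2 * v + 1) + 1 - t)) (E.len (2 * v))
      (fun t => E.seq (2 * v) (E.len (2 * v) + 1 - t)) tmin t0 u0) :
    Runs M (sweep false ;; swapEnds ;; linkNode ;; endsNode) s (fun τ s' => ∃ t u, tmin ≤ t ∧
      t ≤ t0 ∧ t ≤ E.len (2 * v + 1) ∧ 1 ≤ u ∧ u ≤ u0 ∧ u ≤ E.len (2 * v) ∧
      Joined N F c al E k v ((E.len (2 * v) + 1 - u) + t)
        (splice (E.seq (2 * v)) (E.len (2 * v) + 1 - u) (E.seq (2 * v + 1))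
          (E.len (2 * v + 1) + 1 - t)) s s' ∧
      τ + sweepBound * (t + u) ≤
        sweepBound * (t0 + u0 + 2) + (swapEnds.bound + (linkNode ;; endsNode).bound)) := by
  have n1 := h1.nodeOK
  have n2 := h2.nodeOK
  have sub : ∀ w, under N al k w ⊆ D := fun w a ha => hal ha.1
  have hmin := hterm.1
  apply Runs.seq
  refine (sweep_runs (N := N) (tmin := tmin) (R := fun t u => Bridge (ι := ℕᵒᵈ)
    (fun a x => F a (-x)) (fun a b => - c b a) (under N al k (2 * v + 1))
    (under N al k (2 * v)) (E.seq (2 * v + 1) (E.len (2 * v + 1) + 1 - t))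
    (E.seq (2 * v) (E.len (2 * v) + 1 - u))) hS.mem
    (n2.sweepSeq_right hS hal) (n1.sweepSeq_right hS hal) hc hx h5 h6 hmin
    (fun t u hJ => ⟨⟨hJ.1, hJ.2.1, hJ.2.2.1, hJ.2.2.2.1⟩,
      sweep_step (ι := ℕᵒᵈ) hS.sc.dual (sub _) (sub _) (fun a ha b hb => under_lt b hb a ha)
        (n2.env.dual hS.sc (sub _)) (n1.env.dual hS.sc (sub _)) hterm hJ⟩) hinv).mono ?_
  rintro τ s' ⟨t, u, hb, hJ, ht0, hu0, h5', h6', hτ, him, hrm, hk⟩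
  obtain ⟨j1, j2, j3, j4, -⟩ := hJ
  have ht := treeOf_eq him hrm
  refine Runs.seq_wp ?_
  refine ⟨trivial, trivial, trivial, ?_⟩
  simp only [eval_reg]
  have ht1 : treeOf ⟨Function.update (Function.update (Function.update s'.intReg 7 (s'.intReg 5)) 5
      (Function.update s'.intReg 7 (s'.intReg 5) 6)) 6
      (Function.update (Function.update s'.intReg 7 (s'.intReg 5)) 5
      (Function.update s'.intReg 7 (s'.intReg 5) 6) 7), s'.realReg, s'.intMem, s'.realMem⟩ =
      treeOf s := ht
  have hk1 : Keeps 4 s ⟨Function.update (Function.update (Function.update s'.intReg 7 (s'.intReg 5)) 5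
      (Function.update s'.intReg 7 (s'.intReg 5) 6)) 6
      (Function.update (Function.update s'.intReg 7 (s'.intReg 5)) 5
      (Function.update s'.intReg 7 (s'.intReg 5) 6) 7), s'.realReg, s'.intMem, s'.realMem⟩ := by
    refine ⟨fun i hi => ?_, hk.realReg, hk.real⟩
    dsimp only
    rw [Function.update_of_ne (by omega), Function.update_of_ne (by omega),
      Function.update_of_ne (by omega)]
    exact hk.intReg i hi
  refine Runs.of_wp (wp_mono (linkNode_join hS hal (hk1.crossing.trans hc)
    ((hk1.intReg 3 (by norm_num)).trans h3) hv hvN (ht1 ▸ h1) (ht1 ▸ h2)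
    (t := E.len (2 * v) + 1 - u) (u := E.len (2 * v + 1) + 1 - t) (by omega) (by omega) (by omega)
    (by omega) (by simp [h6']) (by simp [h5']) hb.of_dual) ?_)
  intro s'' hs'' τ' hτ' τ1 hτ1
  refine ⟨t, u, j1, ht0, j2, j3, hu0, j4, ?_, ?_⟩
  · have := hs''.congr_left ht1 hk1
    rwa [show E.len (2 * v + 1) + 1 - (E.len (2 * v + 1) + 1 - t) = t by omega] at this
  · have : τ1 + τ' ≤ swapEnds.bound + (linkNode ;; endsNode).bound := Nat.add_le_add hτ1 hτ'
    omega

/-- Prepare the search for the first bridge of a node. -/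
def mergeStart : Program :=
  .setInt 5 (ild 5 leftChild) ;; .setInt 6 (ild 5 rightChild) ;; .setInt 7 (ild 3 (ireg 5)) ;;
  cross 7 5 ;; .setReal 5 (rreg 20)

/-- The program for the first join at the node in integer register `3`. -/
def mergeNode : Program :=
  .cond (.disj (.intEq (ild 4 leftChild) (.const 0)) (.intEq (ild 4 rightChild) (.const 0)))
    endsNode (mergeStart ;; sweep true ;; linkNode ;; endsNode)

/-- The time for a join, apart from the steps of the search. -/
def joinBound : ℕ :=
  sweepBound + (swapEnds.bound + (linkNode ;; endsNode).bound) + mergeStart.bound + 1000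

theorem joinBound_ge {x y : ℕ} (hx : x ≤ swapEnds.bound + (linkNode ;; endsNode).bound)
    (hy : y ≤ mergeStart.bound) : sweepBound + x + y + 1000 ≤ joinBound :=
  Nat.add_le_add_right (Nat.add_le_add (Nat.add_le_add_left hx _) hy) _

theorem childTest_ok {M : ℕ} {s : State} {f : ℕ} (hM : 32 * N + 100 ≤ M) (h3 : s.intReg 3 = v)
    (hf : f < 16) (hvN : v < N) : (ild f leftChild).Ok M s ∧ (ild f rightChild).Ok M s := by
  have mem : ∀ k < 16, ∀ a < 2 * N, ad k a < M := fun k hk a ha => by simp only [ad]; omega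
  simp [h3, mem, hf, show 2 * v < 2 * N by omega, show 2 * v + 1 < 2 * N by omega]
  omega

/-- The first join at a node searches from the last elements of both envelopes, hence in time linear
in their lengths. -/
theorem mergeNode_runs (hS : Setup M N D F c) (hal : al ⊆ D) (hc : crossing s = c)
    (h3 : s.intReg 3 = v) (hv : 1 ≤ v)
    (hvN : v < N) (h1 : TreeOK N F c al E k (2 * v) (treeOf s))
    (h2 : TreeOK N F c al E k (2 * v + 1) (treeOf s)) :
    Runs M mergeNode s (fun τ s' => ∃ n f, Joined N F c al E k v n f s s' ∧
      n ≤ E.len (2 * v) + E.len (2 * v + 1) ∧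
      τ ≤ joinBound * (E.len (2 * v) + E.len (2 * v + 1) + 4)) := by
  have n1 := h1.nodeOK
  have n2 := h2.nodeOK
  have hal1 : ∀ a ∈ al, 1 ≤ a := fun a ha => (hS.pos a (hal ha)).1
  have f1 := n1.len_ne hal1
  have f2 := n2.len_ne hal1
  have sub : ∀ w, under N al k w ⊆ D := fun w a ha => hal ha.1
  have mem : ∀ k < 16, ∀ a < N, ad k a < M := fun k hk a ha => by
    have := hS.mem
    simp only [ad]
    omega
  have h16 : 16 < M := by have := hS.mem; omega
  have hok := childTest_ok (f := 4) hS.mem h3 (by norm_num) hvN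
  have hok5 := childTest_ok (f := 5) hS.mem h3 (by norm_num) hvN
  refine Runs.cond ⟨⟨hok.1, by simp; omega⟩, hok.2, by simp; omega⟩ (fun h => ?_) (fun h => ?_)
  · have h' : (treeOf s).fst (2 * v) = 0 ∨ (treeOf s).fst (2 * v + 1) = 0 := by
      simpa [treeOf, h3] using h
    obtain ⟨w, hw, hwl⟩ : ∃ w, (E.len (2 * v) = 0 ∧ w = 2 * v + 1 ∨
        E.len (2 * v) ≠ 0 ∧ E.len (2 * v + 1) = 0 ∧ w = 2 * v) ∧
        E.len w ≤ E.len (2 * v) + E.len (2 * v + 1) := by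
      by_cases h0 : E.len (2 * v) = 0
      · exact ⟨_, .inl ⟨h0, rfl⟩, by omega⟩
      · exact ⟨_, .inr ⟨h0, by tauto, rfl⟩, by omega⟩
    refine Runs.of_wp (wp_mono (endsNode_join hS hal h3 hv hvN h1 h2 hw) ?_)
    refine fun s' hs' t ht => ⟨_, _, hs', hwl, ?_⟩
    have c1 : (Test.disj (.intEq (ild 4 leftChild) (.const 0))
      (.intEq (ild 4 rightChild) (.const 0))).cost ≤ 100 := by decide
    have c2 := joinBound_ge ((ht.trans (Nat.le_add_left _ _)).trans (Nat.le_add_left _ _))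
      (Nat.zero_le _)
    have c3 : 0 ≤ joinBound * (E.len (2 * v) + E.len (2 * v + 1)) := Nat.zero_le _
    rw [mul_add]
    omega
  · have h' : (treeOf s).fst (2 * v) ≠ 0 ∧ (treeOf s).fst (2 * v + 1) ≠ 0 := by
      simpa [treeOf, h3] using h
    rw [← f1, ← f2] at h'
    obtain ⟨l1, l2⟩ := h'
    have e1 : (treeOf s).lst (2 * v) = E.seq (2 * v) (E.len (2 * v)) := n1.lst
    have e2 : (treeOf s).lst (2 * v + 1) = E.seq (2 * v + 1) (E.len (2 * v + 1)) := n2.lst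
    have e3 := (n1.links (E.len (2 * v)) (by omega) le_rfl).2
    have p1 := (n1.sweepSeq_left hS hal).pos (E.len (2 * v)) (by omega) le_rfl
    have p2 := (n1.sweepSeq_left hS hal).lt (t := E.len (2 * v)) (by omega) le_rfl
    have hM := hS.mem
    apply Runs.seq_wp
    simp only [mergeStart, wp]
    simp only [treeOf] at e1 e2 e3
    simp only [eval_ild, eval_reg, eval_mul, eval_const, eval_add, h3, e1, e2, e3, ne_eq,
      Function.update_self, Function.update_of_ne, Nat.reduceEqDiff, not_false_eq_true, int_mk,
      reval_reg]
    refine ⟨hok5.1, (childTest_ok (f := 5) hM (by simp [h3]) (by norm_num) hvN).2,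
      by simp [h16, mem, p1], ?_⟩
    refine cross_wp h16 (by simp; omega) (by simp; omega) fun g g1 g2 => ⟨trivial, ?_⟩
    simp [crossing_mk, hc] at g1
    have hk : Keeps 4 s ⟨Function.update (Function.update (Function.update s.intReg 5
        (E.seq (2 * v) (E.len (2 * v)))) 6 (E.seq (2 * v + 1) (E.len (2 * v + 1)))) 7
        (E.seq (2 * v) (E.len (2 * v) - 1)), Function.update g 5 (g 20), s.intMem, s.realMem⟩ := by
      refine ⟨fun i hi => ?_, fun i hi => ?_, fun _ _ => rfl⟩
      · dsimp only
        rw [Function.update_of_ne (by omega), Function.update_of_ne (by omega),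
          Function.update_of_ne (by omega)]
      · dsimp only
        rw [Function.update_of_ne (by omega)]
        exact g2 i (by omega)
    have ht := treeOf_eq (s := s) (s' := ⟨Function.update (Function.update
        (Function.update s.intReg 5
        (E.seq (2 * v) (E.len (2 * v)))) 6 (E.seq (2 * v + 1) (E.len (2 * v + 1)))) 7
        (E.seq (2 * v) (E.len (2 * v) - 1)), Function.update g 5 (g 20), s.intMem, s.realMem⟩)
        rfl rfl
    refine (sweepLeft_join hS hal (hk.crossing.trans hc) ((hk.intReg 3 (by norm_num)).trans h3) hv
      hvN (ht ▸ h1) (ht ▸ h2) (t0 := E.len (2 * v)) (u0 := E.len (2 * v + 1)) (tmin := 1)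
      (xs := c (E.seq (2 * v) (E.len (2 * v) - 1)) (E.seq (2 * v) (E.len (2 * v))))
      (by simp [g1]) (by simp) (by simp) ⟨le_rfl, fun h => absurd rfl h⟩
      (SweepInv.start hS.sc (sub _) (sub _) n1.env n2.env (by omega) (by omega))).mono ?_
    rintro τ s' ⟨t, u, -, -, htl, hu1, -, hul, hj, hτ⟩ τ' hτ'
    refine ⟨_, _, hj.congr_left ht hk, by omega, ?_⟩
    have c1 : (Test.disj (.intEq (ild 4 leftChild) (.const 0))
      (.intEq (ild 4 rightChild) (.const 0))).cost ≤ 100 := by decide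
    have c2 := joinBound_ge (Nat.le_add_left (linkNode ;; endsNode).bound swapEnds.bound) hτ'
    have c3 : sweepBound * (E.len (2 * v) + E.len (2 * v + 1) + 2) ≤
      joinBound * (E.len (2 * v) + E.len (2 * v + 1) + 2) := Nat.mul_le_mul_right _ (by omega)
    rw [show E.len (2 * v) + E.len (2 * v + 1) + 4 =
      (E.len (2 * v) + E.len (2 * v + 1) + 2) + 1 + 1 by omega, mul_add, mul_add]
    omega

end UnitDisk

namespace UnitDisk

/-! ### Rejoining at a node after a removal -/

section Removed

variable {ι : Type*} {q : ι} {len len' : ℕ} {f f' : ℕ → ι}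

theorem Removed.congr {h h' : ℕ → ι} (hr : Removed q len f len' f')
    (h1 : ∀ t, 1 ≤ t → t ≤ len → f t = h t) (h2 : ∀ t, 1 ≤ t → t ≤ len' → f' t = h' t) :
    Removed q len h len' h' := by
  rcases hr with ⟨a1, rfl, a3⟩ | ⟨t, e, a1, a2, a3, a4, a5, a6⟩
  · refine .inl ⟨fun t ht htl => h1 t ht htl ▸ a1 t ht htl, rfl, fun t ht htl => ?_⟩
    rw [← h1 t ht htl, ← h2 t ht htl]
    exact a3 t ht htl
  · refine .inr ⟨t, e, a1, a2, h1 t a1 a2 ▸ a3, a4, fun k hk hkt => ?_, fun k hk hkt => ?_⟩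
    · rw [← h1 k hk (by omega), ← h2 k hk (by omega)]
      exact a5 k hk hkt
    · rw [← h1 (k + 1) (by omega) (by omega), ← h2 (k + e) (by omega) (by omega)]
      exact a6 k hk hkt

theorem Removed.unchanged (h : Removed q len f len' f') (hq : ∀ t, 1 ≤ t → t ≤ len → f t ≠ q) :
    len' = len ∧ ∀ t, 1 ≤ t → t ≤ len → f' t = f t := by
  rcases h with ⟨-, h2, h3⟩ | ⟨t, e, a1, a2, a3, -⟩
  · exact ⟨h2, h3⟩
  · exact absurd a3 (hq t a1 a2)

/-- If an element is removed and nothing remains, then it was the only one. -/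
theorem Removed.only (h : Removed q len f 0 f') (hlen : len ≠ 0) : len = 1 ∧ f 1 = q := by
  rcases h with ⟨-, h2, -⟩ | ⟨t, e, a1, a2, a3, a4, -⟩
  · omega
  · obtain rfl : t = 1 := by omega
    exact ⟨by omega, a3⟩

theorem splice_congr {f f' g g' : ℕ → ι} {t u lenT : ℕ} (hul : u ≤ lenT)
    (h1 : ∀ k, 1 ≤ k → k ≤ t → f k = f' k) (h2 : ∀ k, u ≤ k → k ≤ lenT → g k = g' k) :
    ∀ k, 1 ≤ k → k ≤ t + (lenT + 1 - u) → splice f t g u k = splice f' t g' u k := by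
  intro k hk hkl
  by_cases hkt : k ≤ t
  · rw [splice_le hkt, splice_le hkt]
    exact h1 k hk hkt
  · obtain ⟨j, rfl⟩ : ∃ j, k = t + 1 + j := ⟨k - t - 1, by omega⟩
    rw [splice_add, splice_add]
    exact h2 _ (by omega) (by omega)

/-- The left part consisted of the removed element only. -/
theorem Removed.left_gone {f g : ℕ → ι} {u lenT : ℕ} (hq : f 1 = q) (hu : 1 ≤ u) (hul : u ≤ lenT) :
    Removed q (1 + (lenT + 1 - u)) (splice f 1 g u) lenT g := by
  refine .inr ⟨1, u - 1, le_rfl, by omega, ?_, by omega, fun k h1 h2 => by omega,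
    fun k h1 h2 => ?_⟩
  · rw [splice_le le_rfl, hq]
  · obtain ⟨j, rfl⟩ : ∃ j, k = 1 + j := ⟨k - 1, by omega⟩
    rw [show 1 + j + 1 = 1 + 1 + j by omega, splice_add]
    congr 1
    omega

/-- The right part consisted of the removed element only. -/
theorem Removed.right_gone {f g : ℕ → ι} {t lenS : ℕ} (hq : g 1 = q) (htl : t ≤ lenS) :
    Removed q (t + 1) (splice f t g 1) lenS f := by
  refine .inr ⟨t + 1, lenS - t, by omega, le_rfl, ?_, by omega, fun k h1 h2 => ?_,
    fun k h1 h2 => by omega⟩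
  · rw [show t + 1 = t + 1 + 0 by omega, splice_add, Nat.zero_add, hq]
  · rw [splice_le (by omega)]

end Removed

variable {M N : ℕ} {D al : Set ℕ} {F : ℕ → ℝ → ℝ} {c : ℕ → ℕ → ℝ} {E E0 : EnvData} {k v : ℕ}
  {s : State}

/-- The part of `NodeOK` that does not refer to the memory. -/
structure EnvOK (N : ℕ) (F : ℕ → ℝ → ℝ) (c : ℕ → ℕ → ℝ) (al : Set ℕ) (E : EnvData) (k v : ℕ) :
    Prop where
  env : Envelope F c (under N al k v) (E.len v) (E.seq v)
  zero : E.seq v 0 = 0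
  zero' : E.seq v (E.len v + 1) = 0

theorem NodeOK.envOK {T : TreeMem} (h : NodeOK N F c al E T k v) : EnvOK N F c al E k v :=
  ⟨h.env, h.zero, h.zero'⟩

/-- The removal of `q` from the joined envelope when a child is empty afterwards. -/
theorem JoinOK.removed_empty {T : TreeMem} {q : ℕ} (hj : JoinOK N F c al E0 T k v)
    (o1 : EnvOK N F c al E0 k (2 * v)) (o2 : EnvOK N F c al E0 k (2 * v + 1))
    (r1 : Removed q (E0.len (2 * v)) (E0.seq (2 * v)) (E.len (2 * v)) (E.seq (2 * v)))
    (r2 : Removed q (E0.len (2 * v + 1)) (E0.seq (2 * v + 1)) (E.len (2 * v + 1))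
      (E.seq (2 * v + 1))) {w : ℕ}
    (hw : E.len (2 * v) = 0 ∧ w = 2 * v + 1 ∨
      E.len (2 * v) ≠ 0 ∧ E.len (2 * v + 1) = 0 ∧ w = 2 * v) :
    Removed q (E0.len v) (E0.seq v) (E.len w) (E.seq w) := by
  rcases hw with ⟨h0, rfl⟩ | ⟨h0, h0', rfl⟩
  · by_cases hE : E0.len (2 * v) = 0
    · obtain ⟨e1, e2⟩ := hj.left_empty hE
      rw [e1, e2]
      exact r2
    · rw [h0] at r1
      obtain ⟨hl, hq⟩ := r1.only hE
      have hqm : q ∈ under N al k (2 * v) := hq ▸ o1.env.mem 1 le_rfl (by omega)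
      obtain ⟨u1, u2⟩ := r2.unchanged fun t ht htl h => by
        have := under_lt q hqm _ (o2.env.mem t ht htl)
        omega
      by_cases hE' : E0.len (2 * v + 1) = 0
      · obtain ⟨e1, e2⟩ := hj.right_empty hE hE'
        rw [e1, e2, u1, hE']
        exact r1.congr (fun _ _ _ => rfl) fun t ht htl => by omega
      · obtain ⟨t, u, ht, htl, hu, hul, -, -, -, -, -, -, e1, e2⟩ := hj.bridge hE hE'
        obtain rfl : t = 1 := by omega
        rw [e1, e2, u1]
        refine (Removed.left_gone hq hu hul).congr (fun _ _ _ => rfl) fun t ht htl => ?_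
        exact (u2 t ht htl).symm
  · have hE : E0.len (2 * v) ≠ 0 := by
      intro hE
      obtain ⟨u1, -⟩ := r1.unchanged fun t ht htl => by omega
      omega
    by_cases hE' : E0.len (2 * v + 1) = 0
    · obtain ⟨e1, e2⟩ := hj.right_empty hE hE'
      rw [e1, e2]
      exact r1
    · rw [h0'] at r2
      obtain ⟨hl, hq⟩ := r2.only hE'
      have hqm : q ∈ under N al k (2 * v + 1) := hq ▸ o2.env.mem 1 le_rfl (by omega)
      obtain ⟨u1, u2⟩ := r1.unchanged fun t ht htl h => by
        have := under_lt _ (o1.env.mem t ht htl) q hqm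
        omega
      obtain ⟨t, u, ht, htl, hu, hul, -, -, -, -, -, -, e1, e2⟩ := hj.bridge hE hE'
      obtain rfl : u = 1 := by omega
      rw [e1, e2, u1, hl]
      refine (Removed.right_gone hq htl).congr (fun _ _ _ => rfl) fun t ht htl => ?_
      exact (u2 t ht htl).symm

/-- Prepare the search for a new bridge after the removal of the left end of the bridge. -/
def redoLeft : Program :=
  .setInt 5 (ild 8 (ireg 3)) ;;
  .cond (.intEq (ireg 5) (.const 0)) (.setInt 5 (ild 5 leftChild)) .skip ;;
  .setInt 6 (ild 7 (ireg 3)) ;; .setReal 5 (rld 15 (ireg 3))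

/-- Prepare the search for a new bridge after the removal of the right end of the bridge. -/
def redoRight : Program :=
  .setInt 5 (ild 9 (ireg 3)) ;;
  .cond (.intEq (ireg 5) (.const 0)) (.setInt 5 (ild 4 rightChild)) .skip ;;
  .setInt 6 (ild 6 (ireg 3)) ;; .setReal 5 (.sub (.const 0) (rld 15 (ireg 3)))

theorem redoLeft_wp (hM : 32 * N + 100 ≤ M) (h3 : s.intReg 3 = v) (hvN : v < N) :
    wp M redoLeft s (fun s' => s'.intReg 5 = (if (treeOf s).sa v = 0 then (treeOf s).lst (2 * v)
        else (treeOf s).sa v) ∧ s'.intReg 6 = (treeOf s).rt v ∧ s'.realReg 5 = (treeOf s).xs v ∧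
      treeOf s' = treeOf s ∧ Keeps 4 s s') := by
  have mem : ∀ k < 16, ∀ a < 2 * N, ad k a < M := fun k hk a ha => by simp only [ad]; omega
  have h16 : 16 < M := by omega
  simp only [redoLeft, wp]
  simp [h3, h16, mem, treeOf, show v < 2 * N by omega, show 2 * v < 2 * N by omega,
    show 2 < M by omega, show 0 < M by omega, show 2 * v < M by omega]
  refine ⟨fun h => ?_, fun h => ?_⟩
  all_goals
    refine ⟨by simp [h], ?_, ?_, fun _ _ => rfl⟩
    · intro i hi
      dsimp only
      repeat rw [Function.update_of_ne (by omega)]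
    · intro i hi
      dsimp only
      rw [Function.update_of_ne (by omega)]

theorem redoRight_wp (hM : 32 * N + 100 ≤ M) (h3 : s.intReg 3 = v) (hvN : v < N) :
    wp M redoRight s (fun s' => s'.intReg 5 = (if (treeOf s).sb v = 0 then
        (treeOf s).fst (2 * v + 1) else (treeOf s).sb v) ∧ s'.intReg 6 = (treeOf s).lf v ∧
      s'.realReg 5 = - (treeOf s).xs v ∧ treeOf s' = treeOf s ∧ Keeps 4 s s') := by
  have mem : ∀ k < 16, ∀ a < 2 * N, ad k a < M := fun k hk a ha => by simp only [ad]; omega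
  have h16 : 16 < M := by omega
  simp only [redoRight, wp]
  simp [h3, h16, mem, treeOf, show v < 2 * N by omega,
    show 2 < M by omega, show 0 < M by omega, show 2 * v < M by omega, show 1 < M by omega,
    show 2 * v + 1 < 2 * N by omega, show 2 * v + 1 < M by omega]
  refine ⟨fun h => ?_, fun h => ?_⟩
  all_goals
    refine ⟨by simp [h], ?_, ?_, fun _ _ => rfl⟩
    · intro i hi
      dsimp only
      repeat rw [Function.update_of_ne (by omega)]
    · intro i hi
      dsimp only
      rw [Function.update_of_ne (by omega)]

end UnitDisk

namespace UnitDisk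

variable {M N : ℕ} {D al : Set ℕ} {F : ℕ → ℝ → ℝ} {c : ℕ → ℕ → ℝ} {E E0 : EnvData} {k v q : ℕ}
  {s : State}

/-- The situation before the node `v` is joined again after the removal of `q`: the envelopes `E0`
are those before the removal, and the children have been treated already. -/
structure Rejoin (M N : ℕ) (D : Set ℕ) (F : ℕ → ℝ → ℝ) (c : ℕ → ℕ → ℝ) (al : Set ℕ)
    (E0 E : EnvData) (k v q : ℕ) (s : State) : Prop where
  setup : Setup M N D F c
  sub : al ⊆ D
  cross : crossing s = c
  reg3 : s.intReg 3 = v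
  reg2 : s.intReg 2 = q
  pos : 1 ≤ v
  lt : v < N
  old_left : EnvOK N F c al E0 k (2 * v)
  old_right : EnvOK N F c al E0 k (2 * v + 1)
  join : JoinOK N F c al E0 (treeOf s) k v
  left : TreeOK N F c (al \ {q}) E k (2 * v) (treeOf s)
  right : TreeOK N F c (al \ {q}) E k (2 * v + 1) (treeOf s)
  rem_left : Removed q (E0.len (2 * v)) (E0.seq (2 * v)) (E.len (2 * v)) (E.seq (2 * v))
  rem_right : Removed q (E0.len (2 * v + 1)) (E0.seq (2 * v + 1)) (E.len (2 * v + 1))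
    (E.seq (2 * v + 1))

/-- The result of joining again: the node `w` is the child that contained `q`. -/
def Rejoined (N : ℕ) (F : ℕ → ℝ → ℝ) (c : ℕ → ℕ → ℝ) (al : Set ℕ)
    (E0 E : EnvData) (k v w q B : ℕ) (s : State) (τ : ℕ) (s' : State) : Prop :=
  ∃ n f, Joined N F c (al \ {q}) E k v n f s s' ∧ Removed q (E0.len v) (E0.seq v) n f ∧
    τ + sweepBound * (E0.len w + E0.len v) ≤ sweepBound * (E.len w + n + 5) + B

theorem under_diff_self {w : ℕ} : under N (al \ {q}) k w = under N al k w \ {q} := by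
  ext a
  simp only [under, Set.mem_ofPred_eq, Set.mem_sdiff]
  tauto

theorem under_diff_ne {w : ℕ} (h : q ∉ under N al k w) :
    under N (al \ {q}) k w = under N al k w := by
  rw [under_diff_self, Set.sdiff_singleton_eq_self h]

theorem Envelope.inj {S : Set ℕ} {len : ℕ} {f : ℕ → ℕ} (h : Envelope F c S len f) {t u : ℕ}
    (ht : 1 ≤ t) (htl : t ≤ len) (hu : 1 ≤ u) (hul : u ≤ len) (he : f t = f u) : t = u := by
  rcases lt_trichotomy t u with h1 | h1 | h1
  · have := h.lt_of_lt ht h1 hul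
    omega
  · exact h1
  · have := h.lt_of_lt hu h1 htl
    omega

theorem Removed.len_ne {ι : Type*} {q : ι} {len len' : ℕ} {f f' : ℕ → ι}
    (h : Removed q len f len' f') (h' : len' ≠ 0) : len ≠ 0 := by
  rcases h with ⟨-, h2, -⟩ | ⟨t, e, a1, a2, -⟩ <;> omega

/-- The left end of the bridge has been removed. -/
theorem Rejoin.left_end (R : Rejoin M N D F c al E0 E k v q s) (hl : E.len (2 * v) ≠ 0)
    (hr : E.len (2 * v + 1) ≠ 0) (hlf : (treeOf s).lf v = q) :
    Runs M (redoLeft ;; sweep true ;; linkNode ;; endsNode) s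
      (Rejoined N F c al E0 E k v (2 * v) q
        (redoLeft.bound + (linkNode ;; endsNode).bound) s) := by
  obtain ⟨hS, hal, hc, h3, h2, hv, hvN, o1, o2, hj, t1, t2, r1, r2⟩ := R
  have hal' : al \ {q} ⊆ D := fun a ha => hal ha.1
  have sub : ∀ w, under N al k w ⊆ D := fun w a ha => hal ha.1
  obtain ⟨t, u, ht, htl, hu, hul, b1, b2, b3, b4, b5, hb, e1, e2⟩ :=
    hj.bridge (r1.len_ne hl) (r2.len_ne hr)
  have hq : E0.seq (2 * v) t = q := b1.symm.trans hlf
  have hqm : q ∈ under N al k (2 * v) := hq ▸ o1.env.mem t ht htl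
  have hqr : q ∉ under N al k (2 * v + 1) := fun h => lt_irrefl _ (under_lt q hqm q h)
  obtain ⟨u1, u2⟩ := r2.unchanged fun t ht htl h => hqr (h ▸ o2.env.mem t ht htl)
  obtain ⟨e, a4, a5, a6⟩ : ∃ e, E.len (2 * v) + 1 = E0.len (2 * v) + e ∧
      (∀ k, 1 ≤ k → k < t → E.seq (2 * v) k = E0.seq (2 * v) k) ∧
      ∀ k, t ≤ k → k < E0.len (2 * v) → E.seq (2 * v) (k + e) = E0.seq (2 * v) (k + 1) := by
    rcases r1 with ⟨a1, -⟩ | ⟨t', e, a1, a2, a3, a4, a5, a6⟩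
    · exact absurd hq (a1 t ht htl)
    · obtain rfl : t' = t := o1.env.inj a1 a2 ht htl (a3.trans hq.symm)
      exact ⟨e, a4, a5, a6⟩
  have n1 := t1.nodeOK
  have n2 := t2.nodeOK
  have env2 := n2.env
  rw [under_diff_ne hqr] at env2
  have hgu := u2 u hu hul
  rw [hq] at hb b5
  obtain ⟨hterm, hinv⟩ := sweep_restart hS.sc (sub _) (sub _) under_lt o1.env env2 hq ht htl a4 a5 a6
    (Nat.one_le_iff_ne_zero.2 hl) hu (by omega) (hgu ▸ hb)
  rw [← under_diff_self, ← under_diff_ne hqr] at hinv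
  rw [← under_diff_ne hqr] at hterm
  rw [hgu] at hterm hinv
  apply Runs.seq_wp
  refine wp_mono (redoLeft_wp hS.mem h3 hvN) ?_
  rintro s1 ⟨g5, g6, gx, gt, gk⟩
  have hstart : s1.intReg 5 =
      E.seq (2 * v) (if t < E0.len (2 * v) then t + e else E.len (2 * v)) := by
    rw [g5, b3]
    split_ifs with h0 h1 h1
    · have := (under_pos hS hal (o1.env.mem (t + 1) (by omega) (by omega))).1
      omega
    · exact n1.lst
    · exact (a6 t le_rfl h1).symm
    · obtain rfl : t = E0.len (2 * v) := by omega
      exact absurd o1.zero' h0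
  refine (sweepLeft_join hS hal' (gk.crossing.trans hc) ((gk.intReg 3 (by norm_num)).trans h3) hv
    hvN (gt ▸ t1) (gt ▸ t2) (gx.trans b5) hstart (g6.trans (b2.trans hgu.symm)) hterm hinv).mono ?_
  rintro τ s' ⟨t', u', c1, c2, c3, c4, c5, c6, hJ, hτ⟩ τ' hτ'
  refine ⟨_, _, hJ.congr_left gt gk, ?_, ?_⟩
  · rw [e1, e2, u1]
    refine (Removed.splice_left hq ht le_rfl htl a4 a5 a6 hu hul
      (.inr ⟨rfl, ?_, c3, c4, c5⟩) (g := E.seq (2 * v + 1))).congr ?_ (fun _ _ _ => rfl)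
    · split_ifs at c1 <;> omega
    · exact splice_congr hul (fun _ _ _ => rfl) fun k hk hkl => u2 k (by omega) hkl
  · have key : (E0.len (2 * v) + E0.len v) + ((if t < E0.len (2 * v) then t + e else E.len (2 * v)) +
        u + 2) ≤ (E.len (2 * v) + (t' + (E.len (2 * v + 1) + 1 - u')) + 5) + (t' + u') := by
      rw [e1, u1]
      split_ifs at c1 ⊢ <;> omega
    have := Nat.mul_le_mul_left sweepBound key
    rw [mul_add _ (E0.len (2 * v) + E0.len v), mul_add _ (_ + _ + 5)] at this
    omega

/-- The right end of the bridge has been removed. -/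
theorem Rejoin.right_end (R : Rejoin M N D F c al E0 E k v q s) (hl : E.len (2 * v) ≠ 0)
    (hr : E.len (2 * v + 1) ≠ 0) (hrt : (treeOf s).rt v = q) :
    Runs M (redoRight ;; sweep false ;; swapEnds ;; linkNode ;; endsNode) s
      (Rejoined N F c al E0 E k v (2 * v + 1) q
        (redoRight.bound + (swapEnds.bound + (linkNode ;; endsNode).bound)) s) := by
  obtain ⟨hS, hal, hc, h3, h2, hv, hvN, o1, o2, hj, t1, t2, r1, r2⟩ := R
  have hal' : al \ {q} ⊆ D := fun a ha => hal ha.1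
  have sub : ∀ w, under N al k w ⊆ D := fun w a ha => hal ha.1
  obtain ⟨t, u, ht, htl, hu, hul, b1, b2, b3, b4, b5, hb, e1, e2⟩ :=
    hj.bridge (r1.len_ne hl) (r2.len_ne hr)
  have hq : E0.seq (2 * v + 1) u = q := b2.symm.trans hrt
  have hqm : q ∈ under N al k (2 * v + 1) := hq ▸ o2.env.mem u hu hul
  have hql : q ∉ under N al k (2 * v) := fun h => lt_irrefl _ (under_lt q h q hqm)
  obtain ⟨u1, u2⟩ := r1.unchanged fun t ht htl h => hql (h ▸ o1.env.mem t ht htl)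
  obtain ⟨e, a4, a5, a6⟩ : ∃ e, E.len (2 * v + 1) + 1 = E0.len (2 * v + 1) + e ∧
      (∀ k, 1 ≤ k → k < u → E.seq (2 * v + 1) k = E0.seq (2 * v + 1) k) ∧
      ∀ k, u ≤ k → k < E0.len (2 * v + 1) →
        E.seq (2 * v + 1) (k + e) = E0.seq (2 * v + 1) (k + 1) := by
    rcases r2 with ⟨a1, -⟩ | ⟨t', e, a1, a2, a3, a4, a5, a6⟩
    · exact absurd hq (a1 u hu hul)
    · obtain rfl : t' = u := o2.env.inj a1 a2 hu hul (a3.trans hq.symm)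
      exact ⟨e, a4, a5, a6⟩
  have n1 := t1.nodeOK
  have n2 := t2.nodeOK
  have hft := u2 t ht htl
  rw [hq, ← hft] at hb b5
  rw [← under_diff_ne hql] at hb
  obtain ⟨hterm, hinv⟩ := sweep_restart_dual hS.sc (fun a ha => sub _ (under_diff_ne hql ▸ ha))
    (sub _) (under_diff_ne hql ▸ under_lt) n1.env o2.env hq hu hul
    a4 a5 a6 (Nat.one_le_iff_ne_zero.2 hr) ht (by omega) hb under_diff_self
  apply Runs.seq_wp
  refine wp_mono (redoRight_wp hS.mem h3 hvN) ?_
  rintro s1 ⟨g5, g6, gx, gt, gk⟩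
  have hstart : s1.intReg 5 = E.seq (2 * v + 1) (E.len (2 * v + 1) + 1 -
      (if 1 < u then E.len (2 * v + 1) + 2 - u else E.len (2 * v + 1))) := by
    rw [g5, b4]
    split_ifs with h0 h1 h1
    · have := (under_pos hS hal (o2.env.mem (u - 1) (by omega) (by omega))).1
      omega
    · rw [show E.len (2 * v + 1) + 1 - E.len (2 * v + 1) = 1 by omega]
      exact n2.fst
    · rw [show E.len (2 * v + 1) + 1 - (E.len (2 * v + 1) + 2 - u) = u - 1 by omega]
      exact (a5 (u - 1) (by omega) (by omega)).symm
    · obtain rfl : u = 1 := by omega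
      exact absurd o2.zero h0
  refine (sweepRight_join hS hal' (gk.crossing.trans hc) ((gk.intReg 3 (by norm_num)).trans h3) hv
    hvN (gt ▸ t1) (gt ▸ t2) (gx.trans (congrArg _ b5)) hstart (u0 := E.len (2 * v) + 1 - t) ?_
    hterm hinv).mono ?_
  · rw [show E.len (2 * v) + 1 - (E.len (2 * v) + 1 - t) = t by omega]
    exact g6.trans (b1.trans hft.symm)
  rintro τ s' ⟨t', u', c1, c2, c3, c4, c5, c6, hJ, hτ⟩ τ' hτ'
  have hmin := hterm.1
  have hJ' := hJ.congr_left gt gk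
  have e3 : E.len (2 * v) + 1 - u' + t' =
    (E.len (2 * v) + 1 - u') + (E.len (2 * v + 1) + 1 - (E.len (2 * v + 1) + 1 - t')) := by omega
  rw [e3] at hJ'
  refine ⟨_, _, hJ', ?_, ?_⟩
  · rw [e1, e2]
    refine (Removed.splice_right hq le_rfl hul hu a4 a5 a6 (f := E.seq (2 * v))
      (.inr ⟨rfl, by omega, ?_, by omega, by omega⟩)).congr ?_ (fun _ _ _ => rfl)
    · split_ifs at c1 <;> omega
    · exact splice_congr hul (fun k hk hkl => u2 k hk (by omega)) fun k hk hkl => rfl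
  · have key : (E0.len (2 * v + 1) + E0.len v) +
        ((if 1 < u then E.len (2 * v + 1) + 2 - u else E.len (2 * v + 1)) +
        (E.len (2 * v) + 1 - t) + 2) ≤ (E.len (2 * v + 1) + ((E.len (2 * v) + 1 - u') +
        (E.len (2 * v + 1) + 1 - (E.len (2 * v + 1) + 1 - t'))) + 5) + (t' + u') := by
      rw [e1]
      split_ifs at c1 ⊢ <;> omega
    have := Nat.mul_le_mul_left sweepBound key
    rw [mul_add _ (E0.len (2 * v + 1) + E0.len v), mul_add _ (_ + _ + 5)] at this
    omega

end UnitDisk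

namespace UnitDisk

/-- If none of the ends of the bridge is removed, then the bridge remains, and the joined sequence
changes in the same way as its parts. -/
theorem Removed.splice_keep {ι : Type*} {q : ι} {lenS lenS' lenT lenT' t u : ℕ} {f f' g g' : ℕ → ι}
    (r1 : Removed q lenS f lenS' f') (r2 : Removed q lenT g lenT' g')
    (hq : (∀ k, 1 ≤ k → k ≤ lenS → f k ≠ q) ∨ ∀ k, 1 ≤ k → k ≤ lenT → g k ≠ q)
    (hf : ∀ k, 1 ≤ k → k ≤ lenS → f k = q → ∀ k', 1 ≤ k' → k' ≤ lenS → f k' = q → k = k')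
    (hg : ∀ k, 1 ≤ k → k ≤ lenT → g k = q → ∀ k', 1 ≤ k' → k' ≤ lenT → g k' = q → k = k')
    (ht : 1 ≤ t) (htl : t ≤ lenS) (hu : 1 ≤ u) (hul : u ≤ lenT) (hft : f t ≠ q) (hgu : g u ≠ q) :
    ∃ t' u', (1 ≤ t' ∧ t' ≤ lenS' ∧ f' t' = f t) ∧ (1 ≤ u' ∧ u' ≤ lenT' ∧ g' u' = g u) ∧
      Removed q (t + (lenT + 1 - u)) (splice f t g u) (t' + (lenT' + 1 - u'))
        (splice f' t' g' u') := by
  have hidden : (∀ k, 1 ≤ k → k ≤ t → f k ≠ q) → (∀ k, u ≤ k → k ≤ lenT → g k ≠ q) →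
      ∀ k, 1 ≤ k → k ≤ t + (lenT + 1 - u) → splice f t g u k ≠ q := by
    intro h1 h2 k hk hkl
    by_cases hkt : k ≤ t
    · rw [splice_le hkt]
      exact h1 k hk hkt
    · obtain ⟨j, rfl⟩ : ∃ j, k = t + 1 + j := ⟨k - t - 1, by omega⟩
      rw [splice_add]
      exact h2 _ (by omega) (by omega)
  rcases r1 with ⟨a1, rfl, a2⟩ | ⟨t2, e, a1, a2, a3, a4, a5, a6⟩
  · rcases r2 with ⟨b1, rfl, b2⟩ | ⟨u2, e, b1, b2, b3, b4, b5, b6⟩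
    · refine ⟨t, u, ⟨ht, htl, a2 t ht htl⟩, ⟨hu, hul, b2 u hu hul⟩, .inl ⟨?_, rfl, ?_⟩⟩
      · exact hidden (fun k h1 h2 => a1 k h1 (by omega)) fun k h1 h2 => b1 k (by omega) h2
      · exact splice_congr hul (fun k h1 h2 => a2 k h1 (by omega)) fun k h1 h2 => b2 k (by omega) h2
    · have hne : u2 ≠ u := by
        rintro rfl
        exact hgu b3
      rcases lt_or_gt_of_ne hne with h | h
      · refine ⟨t, u - 1 + e, ⟨ht, htl, a2 t ht htl⟩, ⟨by omega, by omega, ?_⟩,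
          .inl ⟨?_, by omega, ?_⟩⟩
        · rw [b6 _ (by omega) (by omega)]
          congr 1
          omega
        · refine hidden (fun k h1 h2 => a1 k h1 (by omega)) fun k h1 h2 h3 => ?_
          have := hg u2 b1 b2 b3 k (by omega) h2 h3
          omega
        · intro k hk hkl
          by_cases hkt : k ≤ t
          · rw [splice_le hkt, splice_le hkt]
            exact a2 k hk (by omega)
          · obtain ⟨j, rfl⟩ : ∃ j, k = t + 1 + j := ⟨k - t - 1, by omega⟩
            rw [splice_add, splice_add, show j + (u - 1 + e) = j + u - 1 + e by omega,
              b6 _ (by omega) (by omega)]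
            congr 1
            omega
      · refine ⟨t, u, ⟨ht, htl, a2 t ht htl⟩, ⟨hu, by omega, b5 u hu h⟩, ?_⟩
        refine (Removed.splice_right b3 (u1 := u) h.le b2 hu b4 b5 b6 (f := f) (t1 := t)
          (.inl ⟨h, rfl, rfl⟩)).congr (fun _ _ _ => rfl) ?_
        intro k hk hkl
        by_cases hkt : k ≤ t
        · rw [splice_le hkt, splice_le hkt]
          exact (a2 k hk (by omega)).symm
        · obtain ⟨j, rfl⟩ : ∃ j, k = t + 1 + j := ⟨k - t - 1, by omega⟩
          rw [splice_add, splice_add]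
  · have hg' := hq.resolve_left fun h => h t2 a1 a2 a3
    rcases r2 with ⟨b1, rfl, b2⟩ | ⟨u2, e, b1, b2, b3, b4, b5, b6⟩
    swap
    · exact absurd b3 (hg' u2 b1 b2)
    have hne : t2 ≠ t := by
      rintro rfl
      exact hft a3
    rcases lt_or_gt_of_ne hne with h | h
    · have e1 : f' (t - 1 + e) = f t := by
        rw [a6 _ (by omega) (by omega), Nat.sub_add_cancel ht]
      refine ⟨t - 1 + e, u, ⟨by omega, by omega, e1⟩, ⟨hu, hul, b2 u hu hul⟩, ?_⟩
      refine (Removed.splice_left a3 a1 (t1 := t) h.le htl a4 a5 a6 hu hul (g := g)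
          (.inl ⟨h, by omega, rfl⟩)).congr (fun _ _ _ => rfl) ?_
      exact splice_congr hul (fun _ _ _ => rfl) fun k h1 h2 => (b2 k (by omega) h2).symm
    · refine ⟨t, u, ⟨ht, by omega, a5 t ht h⟩, ⟨hu, hul, b2 u hu hul⟩, .inl ⟨?_, rfl, ?_⟩⟩
      · refine hidden (fun k h1 h2 h3 => ?_) fun k h1 h2 => b1 k (by omega) h2
        have := hf t2 a1 a2 a3 k h1 (by omega) h3
        omega
      · exact splice_congr hul (fun k h1 h2 => a5 k h1 (by omega)) fun k h1 h2 => b2 k (by omega) h2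

variable {M N : ℕ} {D al : Set ℕ} {F : ℕ → ℝ → ℝ} {c : ℕ → ℕ → ℝ} {E E0 : EnvData} {k v q : ℕ}
  {s : State}

/-- The part of `redoNode` for a bridge that remains. -/
def keepBridge : Program := .setInt 5 (ild 6 (ireg 3)) ;; .setInt 6 (ild 7 (ireg 3))

/-- The ends of the bridge have not been removed. -/
theorem Rejoin.keep (R : Rejoin M N D F c al E0 E k v q s) (hl : E.len (2 * v) ≠ 0)
    (hr : E.len (2 * v + 1) ≠ 0) (hlf : (treeOf s).lf v ≠ q) (hrt : (treeOf s).rt v ≠ q) :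
    Runs M (keepBridge ;; linkNode ;; endsNode) s (fun τ s' => ∃ n f,
      Joined N F c (al \ {q}) E k v n f s s' ∧ Removed q (E0.len v) (E0.seq v) n f ∧
      τ ≤ keepBridge.bound + (linkNode ;; endsNode).bound) := by
  obtain ⟨hS, hal, hc, h3, h2, hv, hvN, o1, o2, hj, t1, t2, r1, r2⟩ := R
  have hal' : al \ {q} ⊆ D := fun a ha => hal ha.1
  obtain ⟨t, u, ht, htl, hu, hul, b1, b2, b3, b4, b5, hb, e1, e2⟩ :=
    hj.bridge (r1.len_ne hl) (r2.len_ne hr)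
  obtain ⟨t', u', ⟨c1, c2, c3⟩, ⟨c4, c5, c6⟩, hrem⟩ := Removed.splice_keep r1 r2 (t := t) (u := u) (by
      by_cases h : ∀ k, 1 ≤ k → k ≤ E0.len (2 * v) → E0.seq (2 * v) k ≠ q
      · exact .inl h
      · push Not at h
        obtain ⟨k1, k2, k3, k4⟩ := h
        refine .inr fun k hk hkl h => ?_
        have := under_lt _ (o1.env.mem k1 k2 k3) _ (o2.env.mem k hk hkl)
        omega)
    (fun k a1 a2 a3 k' a4 a5 a6 => o1.env.inj a1 a2 a4 a5 (a3.trans a6.symm))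
    (fun k a1 a2 a3 k' a4 a5 a6 => o2.env.inj a1 a2 a4 a5 (a3.trans a6.symm))
    ht htl hu hul (b1 ▸ hlf) (b2 ▸ hrt)
  have hM := hS.mem
  have mem : ∀ k < 16, ∀ a < N, ad k a < M := fun k hk a ha => by simp only [ad]; omega
  have h16 : 16 < M := by omega
  have hk : Keeps 4 s ⟨Function.update (Function.update s.intReg 5 (s.int 6 v)) 6 (s.int 7 v),
      s.realReg, s.intMem, s.realMem⟩ := by
    refine ⟨fun i hi => ?_, fun i hi => rfl, fun _ _ => rfl⟩
    dsimp only
    rw [Function.update_of_ne (by omega), Function.update_of_ne (by omega)]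
  have hT := treeOf_eq (s := s) (s' := ⟨Function.update (Function.update s.intReg 5 (s.int 6 v)) 6
    (s.int 7 v), s.realReg, s.intMem, s.realMem⟩) rfl rfl
  apply Runs.seq_wp
  refine ⟨by simp [h3, h16, mem, hvN], by simp [h3, h16, mem, hvN], ?_⟩
  simp only [eval_ild, eval_reg, h3, ne_eq, Function.update_of_ne, Nat.reduceEqDiff,
    not_false_eq_true, int_mk]
  refine Runs.of_wp (wp_mono (linkNode_join hS hal' (hk.crossing.trans hc)
    ((hk.intReg 3 (by norm_num)).trans h3) hv hvN (hT ▸ t1) (hT ▸ t2) c1 c2 c4 c5 ?_ ?_ ?_) ?_)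
  · simp [c3, ← b1, treeOf]
  · simp [c6, ← b2, treeOf]
  · rw [c3, c6]
    exact hb.anti (fun a ha => ⟨ha.1.1, ha.2⟩) fun a ha => ⟨ha.1.1, ha.2⟩
  · intro s' hs' τ hτ τ' hτ'
    refine ⟨_, _, hs'.congr_left hT hk, ?_, by omega⟩
    rw [e1, e2]
    exact hrem

/-- Join again at the node in integer register `3` after the removal of the position in integer
register `2` from one of the children. -/
def redoNode : Program :=
  .cond (.disj (.intEq (ild 4 leftChild) (.const 0)) (.intEq (ild 4 rightChild) (.const 0)))
    endsNode
  (.cond (.intEq (ild 6 (ireg 3)) (ireg 2)) (redoLeft ;; sweep true ;; linkNode ;; endsNode)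
  (.cond (.intEq (ild 7 (ireg 3)) (ireg 2))
    (redoRight ;; sweep false ;; swapEnds ;; linkNode ;; endsNode)
    (keepBridge ;; linkNode ;; endsNode)))

/-- The time for joining a node again, apart from the steps of the search. -/
def redoBound : ℕ :=
  redoLeft.bound + redoRight.bound + keepBridge.bound +
    (swapEnds.bound + (linkNode ;; endsNode).bound) + 1000

theorem redoBound_ge {x y z w : ℕ} (hx : x ≤ redoLeft.bound) (hy : y ≤ redoRight.bound)
    (hz : z ≤ keepBridge.bound) (hw : w ≤ swapEnds.bound + (linkNode ;; endsNode).bound) :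
    x + y + z + w + 1000 ≤ redoBound :=
  Nat.add_le_add_right (Nat.add_le_add (Nat.add_le_add (Nat.add_le_add hx hy) hz) hw) _

theorem redoNode_runs (R : Rejoin M N D F c al E0 E k v q s) {w : ℕ}
    (hw : q ∈ under N al k w) (hwv : w = 2 * v ∨ w = 2 * v + 1) :
    Runs M redoNode s (Rejoined N F c al E0 E k v w q redoBound s) := by
  have hal' : al \ {q} ⊆ D := fun a ha => R.sub ha.1
  have hal1 : ∀ a ∈ al \ {q}, 1 ≤ a := fun a ha => (R.setup.pos a (hal' ha)).1
  have f1 := R.left.nodeOK.len_ne hal1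
  have f2 := R.right.nodeOK.len_ne hal1
  have hM := R.setup.mem
  have hvN := R.lt
  have mem : ∀ k < 16, ∀ a < N, ad k a < M := fun k hk a ha => by simp only [ad]; omega
  have h16 : 16 < M := by omega
  have h3 := R.reg3
  have hlen : E0.len w ≤ E.len w + 1 := by
    rcases hwv with rfl | rfl
    · exact R.rem_left.len_le
    · exact R.rem_right.len_le
  have hok := childTest_ok (f := 4) R.setup.mem R.reg3 (by norm_num) R.lt
  have c1 : (Test.disj (.intEq (ild 4 leftChild) (.const 0))
      (.intEq (ild 4 rightChild) (.const 0))).cost ≤ 100 := by decide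
  have c2 : (Test.intEq (ild 6 (ireg 3)) (ireg 2)).cost ≤ 100 := by decide
  have c3 : (Test.intEq (ild 7 (ireg 3)) (ireg 2)).cost ≤ 100 := by decide
  -- the branches without a search
  have easy : ∀ {τ n s' f B}, Joined N F c (al \ {q}) E k v n f s s' →
      Removed q (E0.len v) (E0.seq v) n f → τ ≤ B → Rejoined N F c al E0 E k v w q B s τ s' := by
    intro τ n s' f B hJ hr hτ
    refine ⟨n, f, hJ, hr, ?_⟩
    have := Nat.mul_le_mul_left sweepBound
      (show E0.len w + E0.len v ≤ E.len w + n + 5 by have := hr.len_le; omega)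
    omega
  have weaken : ∀ {τ τ' B B' s'}, Rejoined N F c al E0 E k v w q B s τ s' → τ' + B ≤ B' + τ →
      Rejoined N F c al E0 E k v w q B' s τ' s' := by
    rintro τ τ' B B' s' ⟨n, f, hJ, hr, hτ⟩ h
    exact ⟨n, f, hJ, hr, by omega⟩
  refine Runs.cond ⟨⟨hok.1, by simp; omega⟩, hok.2, by simp; omega⟩ (fun h => ?_) (fun h => ?_)
  · have h' : (treeOf s).fst (2 * v) = 0 ∨ (treeOf s).fst (2 * v + 1) = 0 := by
      simpa [treeOf, h3] using h
    obtain ⟨x, hx⟩ : ∃ x, (E.len (2 * v) = 0 ∧ x = 2 * v + 1 ∨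
        E.len (2 * v) ≠ 0 ∧ E.len (2 * v + 1) = 0 ∧ x = 2 * v) := by
      by_cases h0 : E.len (2 * v) = 0
      · exact ⟨_, .inl ⟨h0, rfl⟩⟩
      · exact ⟨_, .inr ⟨h0, by tauto, rfl⟩⟩
    refine Runs.of_wp (wp_mono (endsNode_join R.setup hal' h3 R.pos hvN R.left R.right hx) ?_)
    refine fun s' hs' t ht => easy hs' (R.join.removed_empty R.old_left R.old_right R.rem_left
      R.rem_right hx) ?_
    have : t ≤ swapEnds.bound + (linkNode ;; endsNode).bound :=
      (ht.trans (Nat.le_add_left _ _)).trans (Nat.le_add_left _ _)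
    have := redoBound_ge (Nat.zero_le _) (Nat.zero_le _) (Nat.zero_le _) this
    omega
  · have h' : (treeOf s).fst (2 * v) ≠ 0 ∧ (treeOf s).fst (2 * v + 1) ≠ 0 := by
      simpa [treeOf, h3] using h
    rw [← f1, ← f2] at h'
    obtain ⟨l1, l2⟩ := h'
    obtain ⟨t, u, ht, htl, hu, hul, b1, b2, -⟩ :=
      R.join.bridge (R.rem_left.len_ne l1) (R.rem_right.len_ne l2)
    refine Runs.cond (by simp [h3, h16, mem, hvN]) (fun h => ?_) (fun h => ?_)
    · have hlf : (treeOf s).lf v = q := by simpa [treeOf, h3, R.reg2] using h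
      have hqm : q ∈ under N al k (2 * v) := hlf ▸ b1 ▸ R.old_left.env.mem t ht htl
      obtain rfl : w = 2 * v := hw.2.symm.trans hqm.2
      refine (R.left_end l1 l2 hlf).mono fun τ s' hR => weaken hR ?_
      have := redoBound_ge le_rfl (Nat.zero_le _) (Nat.zero_le _) (Nat.le_add_left (linkNode ;; endsNode).bound _)
      omega
    · have hlf : (treeOf s).lf v ≠ q := by simpa [treeOf, h3, R.reg2] using h
      refine Runs.cond (by simp [h3, h16, mem, hvN]) (fun h => ?_) (fun h => ?_)
      · have hrt : (treeOf s).rt v = q := by simpa [treeOf, h3, R.reg2] using h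
        have hqm : q ∈ under N al k (2 * v + 1) := hrt ▸ b2 ▸ R.old_right.env.mem u hu hul
        obtain rfl : w = 2 * v + 1 := hw.2.symm.trans hqm.2
        refine (R.right_end l1 l2 hrt).mono fun τ s' hR => weaken hR ?_
        have := redoBound_ge (Nat.zero_le _) le_rfl (Nat.zero_le _) le_rfl
        omega
      · have hrt : (treeOf s).rt v ≠ q := by simpa [treeOf, h3, R.reg2] using h
        refine (R.keep l1 l2 hlf hrt).mono ?_
        rintro τ s' ⟨n, f, hJ, hr, hτ⟩
        refine easy hJ hr ?_
        have := redoBound_ge (Nat.zero_le _) (Nat.zero_le _) le_rfl (Nat.le_add_left (linkNode ;; endsNode).bound _)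
        omega

end UnitDisk

namespace UnitDisk

/-! ### Deleting a position from the tree -/

/-- The total length of the envelopes of a tree with `N` leaves. -/
def EnvData.total (E : EnvData) (N : ℕ) : ℕ := ∑ x ∈ Finset.Ico 1 (2 * N), E.len x

theorem EnvData.total_set (E : EnvData) {N v : ℕ} (n : ℕ) (f : ℕ → ℕ) (hv1 : 1 ≤ v)
    (hv : v < 2 * N) :
    (E.set v n f).total N + E.len v = E.total N + n := by
  have hm : v ∈ Finset.Ico 1 (2 * N) := Finset.mem_Ico.2 ⟨hv1, hv⟩
  unfold EnvData.total
  rw [← Finset.add_sum_erase _ _ hm, ← Finset.add_sum_erase _ E.len hm]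
  have e1 : (E.set v n f).len v = n := Function.update_self _ _ _
  have e2 : ∑ x ∈ (Finset.Ico 1 (2 * N)).erase v, (E.set v n f).len x =
      ∑ x ∈ (Finset.Ico 1 (2 * N)).erase v, E.len x :=
    Finset.sum_congr rfl fun x hx => Function.update_of_ne (Finset.ne_of_mem_erase hx) _ _
  rw [e1, e2]
  omega

variable {M N K : ℕ} {D al al' : Set ℕ} {F : ℕ → ℝ → ℝ} {c : ℕ → ℕ → ℝ} {E E' : EnvData}
  {k v q : ℕ} {s : State} {T T' : TreeMem}

theorem JoinOK.congr (h : JoinOK N F c al E T k v) (h1 : T.lf v = T'.lf v) (h2 : T.rt v = T'.rt v)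
    (h3 : T.sa v = T'.sa v) (h4 : T.sb v = T'.sb v) (h5 : T.xs v = T'.xs v) :
    JoinOK N F c al E T' k v := by
  refine ⟨h.left_empty, h.right_empty, ?_⟩
  rw [← h1, ← h2, ← h3, ← h4, ← h5]
  exact h.bridge

theorem OnlyBelow.join {w j : ℕ} (ho : OnlyBelow N k v T T') (hw : w ≠ v)
    (h : JoinOK N F c al E T j w) : JoinOK N F c al E T' j w := by
  obtain ⟨-, -, a1, a2, a3, a4, a5⟩ := ho.node w hw
  exact h.congr a1 a2 a3 a4 a5

theorem path_succ_lt {a j : ℕ} (h : 1 ≤ a / 2 ^ (j + 1)) : a / 2 ^ (j + 1) < a / 2 ^ j := by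
  rw [div_pow_succ] at h ⊢
  omega

/-- The nodes on a path to the root are different. -/
theorem path_inj {a i j : ℕ} (h : a / 2 ^ i = a / 2 ^ j) (h1 : 1 ≤ a / 2 ^ i) : i = j := by
  have key : ∀ i d, 1 ≤ a / 2 ^ i → a / 2 ^ i ≠ a / 2 ^ (i + d + 1) := by
    intro i d h1 h2
    have : a / 2 ^ (i + d + 1) ≤ a / 2 ^ (i + 1) :=
      Nat.div_le_div_left (Nat.pow_le_pow_right (by norm_num) (by omega)) (by positivity)
    have := path_succ_lt (a := a) (j := i) (by omega)
    omega
  rcases lt_trichotomy i j with h2 | h2 | h2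
  · obtain ⟨d, rfl⟩ := Nat.exists_eq_add_of_lt h2
    exact absurd h (key i d h1)
  · exact h2
  · obtain ⟨d, rfl⟩ := Nat.exists_eq_add_of_lt h2
    exact absurd h.symm (key j d (h ▸ h1))

theorem path_pos (hN : N = 2 ^ K) {a j : ℕ} (hj : j ≤ K) : 1 ≤ (N + a) / 2 ^ j := by
  rw [Nat.one_le_div_iff (by positivity)]
  have : 2 ^ j ≤ 2 ^ K := Nat.pow_le_pow_right (by norm_num) hj
  omega

theorem path_lt (hN : N = 2 ^ K) {a j : ℕ} (ha : a < N) : (N + a) / 2 ^ (j + 1) < N := by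
  rw [div_pow_succ]
  have := Nat.div_le_self (N + a) (2 ^ j)
  have : 1 ≤ N := by rw [hN]; exact Nat.one_le_two_pow
  omega

theorem path_root (hN : N = 2 ^ K) {a : ℕ} (ha : a < N) : (N + a) / 2 ^ K = 1 := by
  rw [← hN, Nat.add_div_left _ (by omega), Nat.div_eq_of_lt ha]

/-- A change below a node of the path does not affect the siblings of the path above. -/
theorem OnlyBelow.sibling (hN : N = 2 ^ K) {i x : ℕ}
    (ho : OnlyBelow N k ((N + q) / 2 ^ k) T T')
    (hE : ∀ w ≠ (N + q) / 2 ^ k, E.len w = E'.len w ∧ E.seq w = E'.seq w)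
    (hal : ∀ a, (N + a) / 2 ^ k ≠ (N + q) / 2 ^ k → (a ∈ al ↔ a ∈ al'))
    (hki : k ≤ i) (hiK : i < K) (hx : x / 2 = (N + q) / 2 ^ (i + 1)) (hxi : x ≠ (N + q) / 2 ^ i)
    (h : TreeOK N F c al E i x T) : TreeOK N F c al' E' i x T' := by
  refine h.congr (ho.agree hE hal ?_ ?_)
  · intro i' hi' h1
    rw [Nat.div_div_eq_div_mul, ← pow_add] at h1
    have h2 : (N + q) / 2 ^ (k + i' + 1) = (N + q) / 2 ^ (i + 1) := by
      rw [← hx, ← h1, div_pow_succ]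
    have := path_inj h2 (h2 ▸ path_pos hN (by omega))
    obtain rfl : k + i' = i := by omega
    exact hxi h1.symm
  · intro a ha h1
    obtain ⟨d, rfl⟩ := Nat.exists_eq_add_of_le hki
    apply hxi
    rw [← ha, pow_add, ← Nat.div_div_eq_div_mul, ← Nat.div_div_eq_div_mul, h1]

/-- The path to the leaf of `q` has been undone down to the height `j`. -/
structure PathOpen (N K : ℕ) (F : ℕ → ℝ → ℝ) (c : ℕ → ℕ → ℝ) (al : Set ℕ) (E : EnvData) (q j : ℕ)
    (T : TreeMem) : Prop where
  node : TreeOK N F c al E j ((N + q) / 2 ^ j) T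
  sib : ∀ i x, j ≤ i → i < K → x / 2 = (N + q) / 2 ^ (i + 1) → x ≠ (N + q) / 2 ^ i →
    TreeOK N F c al E i x T
  join : ∀ i, j ≤ i → i < K → JoinOK N F c al E T i ((N + q) / 2 ^ (i + 1))
  env : ∀ i x, j ≤ i → i < K → x / 2 = (N + q) / 2 ^ (i + 1) → EnvOK N F c al E i x

theorem TreeOK.bridge_under (hal : ∀ a ∈ al, 1 ≤ a) (h : TreeOK N F c al E (k + 1) v T)
    (h1 : T.fst (2 * v) ≠ 0) (h2 : T.fst (2 * v + 1) ≠ 0) :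
    T.lf v ∈ under N al k (2 * v) ∧ T.rt v ∈ under N al k (2 * v + 1) := by
  obtain ⟨t1, t2⟩ := h.undo
  have n1 := t1.nodeOK
  have n2 := t2.nodeOK
  rw [← undo_fst T v] at h1 h2
  obtain ⟨t, u, ht, htl, hu, hul, b1, b2, -⟩ :=
    h.2.1.bridge ((n1.len_ne hal).2 h1) ((n2.len_ne hal).2 h2)
  rw [b1, b2]
  exact ⟨n1.env.mem t ht htl, n2.env.mem u hu hul⟩

theorem TreeOK.only_undo (hal : ∀ a ∈ al, 1 ≤ a) (h : TreeOK N F c al E (k + 1) v T) :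
    OnlyBelow N (k + 1) v T (T.undo v) := by
  refine OnlyBelow.undo fun h1 h2 => ?_
  obtain ⟨b1, b2⟩ := h.bridge_under hal h1 h2
  exact ⟨half_child _ _ _ (.inl b1.2), half_child _ _ _ (.inr b2.2)⟩

/-- Undoing the join at a node of the path restores the lists of both children; one of them is the
next node of the path. -/
theorem PathOpen.step (hN : N = 2 ^ K) (hal : ∀ a ∈ al, 1 ≤ a) {j : ℕ}
    (h : PathOpen N K F c al E q (j + 1) T) :
    PathOpen N K F c al E q j (T.undo ((N + q) / 2 ^ (j + 1))) := by
  have ho := h.node.only_undo hal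
  obtain ⟨t1, t2⟩ := h.node.undo
  have child : ∀ x, x / 2 = (N + q) / 2 ^ (j + 1) →
      TreeOK N F c al E j x (T.undo ((N + q) / 2 ^ (j + 1))) := by
    intro x hx
    rcases (show x = 2 * ((N + q) / 2 ^ (j + 1)) ∨ x = 2 * ((N + q) / 2 ^ (j + 1)) + 1 by omega)
      with rfl | rfl
    · exact t1
    · exact t2
  constructor
  · exact child _ (by rw [div_pow_succ])
  · intro i x hji hiK hx hxi
    rcases hji.lt_or_eq with h1 | rfl
    · exact ho.sibling hN (fun w _ => ⟨rfl, rfl⟩) (fun a _ => Iff.rfl) h1 hiK hx hxi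
        (h.sib i x h1 hiK hx hxi)
    · exact child x hx
  · intro i hji hiK
    rcases hji.lt_or_eq with h1 | rfl
    · refine ho.join (fun he => ?_) (h.join i h1 hiK)
      have := path_inj he (path_pos hN (by omega))
      omega
    · obtain ⟨b1, b2, b3, b4, b5⟩ : T.lf = (T.undo ((N + q) / 2 ^ (j + 1))).lf ∧
          T.rt = (T.undo ((N + q) / 2 ^ (j + 1))).rt ∧
          T.sa = (T.undo ((N + q) / 2 ^ (j + 1))).sa ∧
          T.sb = (T.undo ((N + q) / 2 ^ (j + 1))).sb ∧
          T.xs = (T.undo ((N + q) / 2 ^ (j + 1))).xs := by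
        unfold TreeMem.undo
        split_ifs <;> exact ⟨rfl, rfl, rfl, rfl, rfl⟩
      exact h.node.2.1.congr (congrFun b1 _) (congrFun b2 _) (congrFun b3 _) (congrFun b4 _)
        (congrFun b5 _)
  · intro i x hji hiK hx
    rcases hji.lt_or_eq with h1 | rfl
    · exact h.env i x h1 hiK hx
    · exact (child x hx).nodeOK.envOK

/-- Undo the joins on the path to the leaf of the position in integer register `2`. -/
def openPath : Program :=
  .setInt 1 (ireg 10) ;;
  .loop (.intLt (.const 1) (ireg 1))
    (.setInt 3 (.div (.add (ireg 10) (ireg 2)) (ireg 1)) ;; undoNode ;;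
      .setInt 1 (.div (ireg 1) (.const 2)))

/-- The time for one step of `openPath`. -/
def openBound : ℕ := undoNode.bound + 100

theorem openPath_runs (hS : Setup M N D F c) (hN : N = 2 ^ K) (hal : al ⊆ D) (hq : q < N)
    (hT : TreeOK N F c al E K 1 (treeOf s)) (h10 : s.intReg 10 = N) (h2 : s.intReg 2 = q) :
    Runs M openPath s (fun τ s' => PathOpen N K F c al E q 0 (treeOf s') ∧ Keeps 0 s s' ∧
      s'.intReg 2 = q ∧ τ ≤ openBound * (K + 1)) := by
  have hM := hS.mem
  have hal1 : ∀ a ∈ al, 1 ≤ a := fun a ha => (hS.pos a (hal ha)).1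
  have h100 : undoNode.bound + 100 ≤ openBound := le_rfl
  refine Runs.seq_wp ⟨trivial, ?_⟩
  refine Runs.loop (I := fun r τ s' => r ≤ K ∧ PathOpen N K F c al E q r (treeOf s') ∧
    Keeps 0 s s' ∧ s'.intReg 2 = q ∧ s'.intReg 1 = 2 ^ r ∧ τ + openBound * r ≤ openBound * K)
    (r := K) ?_ ?_ ?_ ?_
  · rintro r τ s' -
    simp
    omega
  · rintro r τ s' ⟨hr, hp, hk, hr2, hr1, hτ⟩ hb
    have hb' : 1 < s'.intReg 1 := hb
    obtain ⟨j, rfl⟩ : ∃ j, r = j + 1 := by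
      refine ⟨r - 1, ?_⟩
      rcases Nat.eq_zero_or_pos r with rfl | h
      · rw [hr1] at hb'
        simp at hb'
      · omega
    have hr10 : s'.intReg 10 = N := (hk.intReg 10 (by norm_num)).trans h10
    have hvN : (N + q) / 2 ^ (j + 1) < N := path_lt hN hq
    set s1 : State := { s' with intReg := Function.update s'.intReg 3 ((N + q) / 2 ^ (j + 1)) }
      with hs1
    have ht1 : treeOf s1 = treeOf s' := treeOf_eq rfl rfl
    refine Runs.of_wp ⟨by simp [hr10, hr2]; omega, ?_⟩
    have e1 : IntExpr.eval s' (.div (.add (ireg 10) (ireg 2)) (ireg 1)) =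
        (N + q) / 2 ^ (j + 1) := by
      simp [hr10, hr2, hr1]
    rw [e1]
    refine wp_seq (wp_mono (undoNode_wp (s := s1) hM (by simp [hs1]) hvN ?_) ?_)
    · rw [ht1]
      intro g1 g2
      obtain ⟨b1, b2⟩ := hp.node.bridge_under hal1 g1 g2
      exact ⟨(under_pos hS hal b1).2, (under_pos hS hal b2).2⟩
    rintro s2 ⟨g1, g2, g3⟩
    refine ⟨by simp; omega, fun t ht => ⟨j, by omega, by omega, ?_, ?_, ?_, ?_, ?_⟩⟩
    · rw [treeOf_mk, g1, ht1]
      exact hp.step hN hal1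
    · refine hk.trans ⟨fun i hi => ?_, g3.realReg, g3.real⟩
      dsimp only
      rw [Function.update_of_ne (by omega), g2]
      exact Function.update_of_ne (by omega) _ _
    · simp [g2, hs1, hr2]
    · simp [g2, hs1, hr1, pow_succ]
    · have c1 : (Test.intLt (.const 1) (ireg 1)).cost = 3 := rfl
      have c2 : (IntExpr.div (.add (ireg 10) (ireg 2)) (ireg 1)).cost = 5 := rfl
      have c3 : (IntExpr.div (ireg 1) (.const 2)).cost = 3 := rfl
      simp only [Program.bound] at ht
      rw [mul_add] at hτ
      omega
  · rintro r τ s' ⟨hr, hp, hk, hr2, hr1, hτ⟩ hb t ht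
    have hb' : ¬ 1 < s'.intReg 1 := hb
    have : r = 0 := by
      by_contra h
      have := Nat.one_lt_two_pow h
      omega
    subst this
    refine ⟨hp, hk, hr2, ?_⟩
    have c1 : (Test.intLt (.const 1) (ireg 1)).cost = 3 := rfl
    have c2 : (ireg 10).cost = 1 := rfl
    simp only [Program.bound] at ht
    rw [mul_add]
    omega
  · refine ⟨le_rfl, ⟨?_, ?_, ?_, ?_⟩, ⟨fun i hi => ?_, fun _ _ => rfl, fun _ _ => rfl⟩, ?_, ?_, ?_⟩
    · rw [path_root hN hq]
      exact hT
    · intro i x h1 h2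
      omega
    · intro i h1 h2
      omega
    · intro i x h1 h2
      omega
    · exact Function.update_of_ne (by omega) _ _
    · simpa using h2
    · simp [h10, hN]
    · omega

end UnitDisk

namespace UnitDisk

variable {M N K : ℕ} {D al al' : Set ℕ} {F : ℕ → ℝ → ℝ} {c : ℕ → ℕ → ℝ} {E E' E0 : EnvData}
  {k v q : ℕ} {s : State} {T T' : TreeMem}

/-- The path to the leaf of `q` has been joined again up to the height `j`, after the removal of
`q`.  The envelopes before the removal are `E0`. -/
structure PathClosed (N K : ℕ) (F : ℕ → ℝ → ℝ) (c : ℕ → ℕ → ℝ) (al : Set ℕ) (E0 E : EnvData)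
    (q j : ℕ) (T : TreeMem) : Prop where
  node : TreeOK N F c (al \ {q}) E j ((N + q) / 2 ^ j) T
  sib : ∀ i x, j ≤ i → i < K → x / 2 = (N + q) / 2 ^ (i + 1) → x ≠ (N + q) / 2 ^ i →
    TreeOK N F c (al \ {q}) E i x T
  join : ∀ i, j ≤ i → i < K → JoinOK N F c al E0 T i ((N + q) / 2 ^ (i + 1))
  env : ∀ i x, j ≤ i → i < K → x / 2 = (N + q) / 2 ^ (i + 1) → EnvOK N F c al E0 i x
  rem : Removed q (E0.len ((N + q) / 2 ^ j)) (E0.seq ((N + q) / 2 ^ j))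
    (E.len ((N + q) / 2 ^ j)) (E.seq ((N + q) / 2 ^ j))
  same : ∀ x, (∀ i ≤ j, x ≠ (N + q) / 2 ^ i) → E.len x = E0.len x ∧ E.seq x = E0.seq x

theorem mem_diff_iff_of_path {a : ℕ} (h : (N + a) / 2 ^ k ≠ (N + q) / 2 ^ k) :
    a ∈ al ↔ a ∈ al \ {q} := by
  refine ⟨fun ha => ⟨ha, ?_⟩, fun ha => ha.1⟩
  rintro rfl
  exact h rfl

/-- The tree with the leaf `v` made empty. -/
def TreeMem.clear (T : TreeMem) (v : ℕ) : TreeMem :=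
  { T with fst := Function.update T.fst v 0, lst := Function.update T.lst v 0 }

theorem OnlyBelow.clear (N k v : ℕ) (T : TreeMem) : OnlyBelow N k v T (T.clear v) := by
  refine ⟨fun w hw => ?_, fun a _ => ⟨rfl, rfl⟩⟩
  simp [TreeMem.clear, Function.update_of_ne hw]

theorem under_leaf (hq : q ∈ al) : under N al 0 (N + q) = {q} := by
  ext a
  simp only [under, pow_zero, Nat.div_one, Set.mem_ofPred_eq, Set.mem_singleton_iff]
  constructor
  · rintro ⟨-, h⟩
    omega
  · rintro rfl
    exact ⟨hq, rfl⟩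

theorem EnvOK.leaf (hq : q ∈ al) (h : EnvOK N F c al E 0 (N + q)) :
    E.len (N + q) = 1 ∧ E.seq (N + q) 1 = q := by
  have he := h.env
  rw [under_leaf hq] at he
  have h1 := (he.first q rfl).1
  have h2 : E.seq (N + q) 1 = q := he.mem 1 le_rfl h1
  refine ⟨?_, h2⟩
  by_contra h3
  have h4 := he.lt 1 le_rfl (by omega)
  have h5 : E.seq (N + q) (1 + 1) = q := he.mem 2 (by omega) (by omega)
  omega

/-- Emptying the leaf of `q`. -/
theorem PathOpen.clear (hN : N = 2 ^ K) (hq : q ∈ al)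
    (h : PathOpen N K F c al E0 q 0 T) :
    PathClosed N K F c al E0 (E0.set (N + q) 0 fun _ => 0) q 0 (T.clear (N + q)) := by
  have e0 : (N + q) / 2 ^ 0 = N + q := by simp
  have ho : OnlyBelow N 0 ((N + q) / 2 ^ 0) T (T.clear (N + q)) := by
    rw [e0]
    exact OnlyBelow.clear N 0 (N + q) T
  have eL : ∀ x, x ≠ N + q → (E0.set (N + q) 0 fun _ => 0).len x = E0.len x := fun x hx =>
    Function.update_of_ne hx _ _
  have eS : ∀ x, x ≠ N + q → (E0.set (N + q) 0 fun _ => 0).seq x = E0.seq x := fun x hx =>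
    Function.update_of_ne hx _ _
  have eLv : (E0.set (N + q) 0 fun _ => 0).len (N + q) = 0 := Function.update_self _ _ _
  have eSv : (E0.set (N + q) 0 fun _ => 0).seq (N + q) = fun _ => 0 := Function.update_self _ _ _
  have hleaf := EnvOK.leaf hq (e0 ▸ h.node.nodeOK.envOK)
  constructor
  · rw [e0]
    change NodeOK _ _ _ _ _ _ _ _
    have hu : under N (al \ {q}) 0 (N + q) = ∅ := by
      rw [under_diff_self, under_leaf hq, sdiff_self]
      rfl
    constructor
    · rw [eLv, hu]
      exact ⟨fun t h1 h2 => by omega, fun t h1 h2 => by omega, fun b hb => hb.elim,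
        fun b hb => hb.elim, fun t h1 h2 => by omega⟩
    · rw [eSv]
    · rw [eSv]
    · rw [eSv]
      simp [TreeMem.clear]
    · rw [eSv]
      simp [TreeMem.clear]
    · intro t h1 h2
      rw [eLv] at h2
      omega
  · intro i x h1 h2 h3 h4
    refine ho.sibling hN (fun w hw => ?_) (fun a ha => mem_diff_iff_of_path ha) (Nat.zero_le _)
      h2 h3 h4 (h.sib i x h1 h2 h3 h4)
    rw [e0] at hw
    rw [eL w hw, eS w hw]
    exact ⟨rfl, rfl⟩
  · intro i h1 h2
    refine ho.join (fun he => ?_) (h.join i h1 h2)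
    have := path_inj he (path_pos hN (by omega))
    omega
  · exact h.env
  · rw [e0, eLv, hleaf.1]
    exact .inr ⟨1, 0, le_rfl, le_rfl, hleaf.2, rfl, fun k h1 h2 => by omega,
      fun k h1 h2 => by omega⟩
  · intro x hx
    have := hx 0 le_rfl
    rw [e0] at this
    exact ⟨eL x this, eS x this⟩

theorem PathClosed.rejoin (hS : Setup M N D F c) (hN : N = 2 ^ K) (hal : al ⊆ D) (hqN : q < N)
    {j : ℕ} (hj : j < K) (h : PathClosed N K F c al E0 E q j (treeOf s))
    (hc : crossing s = c) (h3 : s.intReg 3 = (N + q) / 2 ^ (j + 1)) (h2 : s.intReg 2 = q) :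
    Rejoin M N D F c al E0 E j ((N + q) / 2 ^ (j + 1)) q s := by
  have child : ∀ x, x / 2 = (N + q) / 2 ^ (j + 1) →
      TreeOK N F c (al \ {q}) E j x (treeOf s) ∧
      Removed q (E0.len x) (E0.seq x) (E.len x) (E.seq x) := by
    intro x hx
    by_cases hxj : x = (N + q) / 2 ^ j
    · subst hxj
      exact ⟨h.node, h.rem⟩
    · obtain ⟨e1, e2⟩ := h.same x (fun i hi he => by
        have h1 : (N + q) / 2 ^ (i + 1) = (N + q) / 2 ^ (j + 1) := by
          rw [← hx, he, div_pow_succ]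
        have := path_inj h1 (h1 ▸ path_pos hN (by omega))
        obtain rfl : i = j := by omega
        exact hxj he)
      refine ⟨h.sib j x le_rfl hj hx hxj, ?_⟩
      rw [e1, e2]
      refine .inl ⟨fun t ht htl hq => hxj ?_, rfl, fun _ _ _ => rfl⟩
      have := ((h.env j x le_rfl hj hx).env.mem t ht htl).2
      rw [hq] at this
      exact this.symm
  obtain ⟨a1, a2⟩ := child (2 * ((N + q) / 2 ^ (j + 1))) (by omega)
  obtain ⟨b1, b2⟩ := child (2 * ((N + q) / 2 ^ (j + 1)) + 1) (by omega)
  exact ⟨hS, hal, hc, h3, h2, path_pos hN (by omega), path_lt hN hqN, h.env j _ le_rfl hj (by omega),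
    h.env j _ le_rfl hj (by omega), h.join j le_rfl hj, a1, b1, a2, b2⟩

theorem PathClosed.step (hN : N = 2 ^ K) {j n : ℕ} {f : ℕ → ℕ} {s s' : State}
    (h : PathClosed N K F c al E0 E q j (treeOf s))
    (hJ : Joined N F c (al \ {q}) E j ((N + q) / 2 ^ (j + 1)) n f s s')
    (hr : Removed q (E0.len ((N + q) / 2 ^ (j + 1))) (E0.seq ((N + q) / 2 ^ (j + 1))) n f) :
    PathClosed N K F c al E0 (E.set ((N + q) / 2 ^ (j + 1)) n f) q (j + 1) (treeOf s') := by
  set v := (N + q) / 2 ^ (j + 1) with hv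
  have eL : ∀ x, x ≠ v → (E.set v n f).len x = E.len x := fun x hx => Function.update_of_ne hx _ _
  have eS : ∀ x, x ≠ v → (E.set v n f).seq x = E.seq x := fun x hx => Function.update_of_ne hx _ _
  have eLv : (E.set v n f).len v = n := Function.update_self _ _ _
  have eSv : (E.set v n f).seq v = f := Function.update_self _ _ _
  constructor
  · exact hJ.tree
  · intro i x h1 h2 h3 h4
    exact hJ.only.sibling hN (fun w hw => ⟨(eL w hw).symm, (eS w hw).symm⟩) (fun a _ => Iff.rfl)
      h1 h2 h3 h4 (h.sib i x (by omega) h2 h3 h4)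
  · intro i h1 h2
    refine hJ.only.join (fun he => ?_) (h.join i (by omega) h2)
    have := path_inj he (path_pos hN (by omega))
    omega
  · exact fun i x h1 => h.env i x (by omega)
  · rw [← hv, eLv, eSv]
    exact hr
  · intro x hx
    have h1 := hx (j + 1) le_rfl
    rw [eL x h1, eS x h1]
    exact h.same x fun i hi => hx i (by omega)

/-- Join the nodes on the path from the leaf of the position in integer register `2` again. -/
def closePath : Program :=
  .setInt 3 (.add (ireg 10) (ireg 2)) ;; ist 4 (ireg 3) (.const 0) ;; ist 5 (ireg 3) (.const 0) ;;
  .setInt 3 (.div (ireg 3) (.const 2)) ;;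
  .loop (.intLt (.const 0) (ireg 3))
    (redoNode ;; .setInt 3 (.div (ireg 3) (.const 2)))

/-- The time for one step of `closePath`, apart from the steps of the searches. -/
def closeBound : ℕ := 5 * sweepBound + redoBound + 100

/-- The searches on the path are paid for by the change of the total length of the envelopes: up to a
constant, the number of steps at a node is at most the growth of the envelopes of the node and of its
child on the path.  Thus each node of the path counts twice. -/
theorem closePath_runs (hS : Setup M N D F c) (hN : N = 2 ^ K) (hal : al ⊆ D) (hq : q ∈ al)
    (hc : crossing s = c) (hP : PathOpen N K F c al E q 0 (treeOf s)) (h10 : s.intReg 10 = N)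
    (h2 : s.intReg 2 = q) :
    Runs M closePath s (fun τ s' => ∃ E', TreeOK N F c (al \ {q}) E' K 1 (treeOf s') ∧
      Keeps 0 s s' ∧ τ + 2 * sweepBound * E.total N ≤
        closeBound * (K + 2) + 2 * sweepBound * E'.total N) := by
  have hM := hS.mem
  have hqN := (hS.pos q (hal hq)).2
  have mem : ∀ k < 16, ∀ a < 2 * N, ad k a < M := fun k hk a ha => by simp only [ad]; omega
  have h16 : 16 < M := by omega
  have hcb : 5 * sweepBound + redoBound + 100 ≤ closeBound := le_rfl
  unfold closePath
  apply Runs.seq_wp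
  refine ⟨by simp [h10, h2]; omega, ?_⟩
  apply Runs.seq_wp
  refine ⟨by simp [h10, h2, h16]; exact ⟨mem _ (by norm_num) _ (by omega), by omega⟩, ?_⟩
  apply Runs.seq_wp
  refine ⟨by simp [h10, h2, h16]; exact ⟨mem _ (by norm_num) _ (by omega), by omega⟩, ?_⟩
  apply Runs.seq_wp
  refine ⟨by simp; omega, ?_⟩
  simp only [eval_addr, eval_reg, eval_const, eval_add, eval_div, Function.update_self, h10, h2,
    Function.update_idem]
  set s1 : State := ⟨Function.update s.intReg 3 ((N + q) / 2), s.realReg,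
    Function.update (Function.update s.intMem (ad 4 (N + q)) 0) (ad 5 (N + q)) 0, s.realMem⟩
    with hs1
  have hk1 : Keeps 0 s s1 := by
    refine ⟨fun i hi => ?_, fun _ _ => rfl, fun _ _ => rfl⟩
    rw [hs1]
    exact Function.update_of_ne (by omega) _ _
  have hT1 : treeOf s1 = (treeOf s).clear (N + q) := by
    simp [hs1, treeOf, TreeMem.clear, int_mk_update_ne]
  have hP1 := hP.clear hN hq
  rw [← hT1] at hP1
  have hleaf := EnvOK.leaf hq (by simpa using hP.node.nodeOK.envOK)
  have htot := E.total_set (N := N) (v := N + q) 0 (fun _ => 0) (by omega) (by omega)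
  have h23 : s1.intReg 2 = q := by
    simp [hs1, h2]
  refine Runs.loop (I := fun r τ s' => ∃ j E', j ≤ K ∧ r = K - j ∧
    PathClosed N K F c al E E' q j (treeOf s') ∧
    Keeps 0 s s' ∧ s'.intReg 2 = q ∧ s'.intReg 3 = (N + q) / 2 ^ (j + 1) ∧
    τ + sweepBound * (2 * E.total N + E'.len ((N + q) / 2 ^ j)) ≤
      closeBound * j + sweepBound * (2 * E'.total N + E.len ((N + q) / 2 ^ j) + 1))
    (r := K) ?_ ?_ ?_ ?_
  · rintro r τ s' -
    simp
    omega
  · rintro r τ s' ⟨j, E', hj, hr, hp, hk, hr2, hr3, hτ⟩ hb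
    have hb' : 0 < s'.intReg 3 := hb
    have hjK : j < K := by
      refine lt_of_le_of_ne hj ?_
      rintro rfl
      rw [hr3, div_pow_succ, path_root hN hqN] at hb'
      omega
    have hR := hp.rejoin hS hN hal hqN hjK (hk.crossing.trans hc) hr3 hr2
    apply Runs.seq
    refine (redoNode_runs hR (w := (N + q) / 2 ^ j) ⟨hq, rfl⟩
      (by rw [div_pow_succ]; omega)).mono ?_
    rintro t s2 ⟨n, f, hJ, hrem, ht⟩
    have hv : (N + q) / 2 ^ (j + 1) < 2 * N := (path_lt hN hqN).trans_le (by omega)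
    have htot' := E'.total_set (v := (N + q) / 2 ^ (j + 1)) n f (path_pos hN (by omega)) hv
    have hsame := (hp.same ((N + q) / 2 ^ (j + 1)) (fun i hi he => by
      have := path_inj he (path_pos hN (by omega))
      omega)).1
    refine Runs.of_wp ⟨by simp; omega, ?_⟩
    intro t' ht'
    refine ⟨K - (j + 1), by omega, j + 1, E'.set ((N + q) / 2 ^ (j + 1)) n f, hjK, rfl, ?_, ?_, ?_,
      ?_, ?_⟩
    · rw [treeOf_mk]
      exact hp.step hN hJ hrem
    · refine (hk.trans (hJ.keeps.anti (by norm_num))).trans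
        ⟨fun i hi => Function.update_of_ne (by omega) _ _, fun _ _ => rfl, fun _ _ => rfl⟩
    · have := hJ.keeps.intReg 2 (by norm_num)
      simp [this, hr2]
    · have := hJ.keeps.intReg 3 (by norm_num)
      simp only [Function.update_self, eval_div, eval_reg, eval_const, this, hr3]
      exact (div_pow_succ _ _).symm
    · have c1 : (Test.intLt (.const 0) (ireg 3)).cost = 3 := rfl
      have c3 : (IntExpr.div (ireg 3) (.const 2)).cost = 3 := rfl
      have e1 : (E'.set ((N + q) / 2 ^ (j + 1)) n f).len ((N + q) / 2 ^ (j + 1)) = n :=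
        Function.update_self _ _ _
      simp only [Program.bound] at ht'
      rw [e1]
      rw [hsame] at htot'
      have key : sweepBound * (2 * E'.total N + 2 * n) = sweepBound *
        (2 * (E'.set ((N + q) / 2 ^ (j + 1)) n f).total N +
          2 * E.len ((N + q) / 2 ^ (j + 1))) := by
        congr 1
        omega
      simp only [mul_add, mul_one, mul_left_comm sweepBound 2] at hτ ht key ⊢
      omega
  · rintro r τ s' ⟨j, E', hj, hr, hp, hk, hr2, hr3, hτ⟩ hb t1 ht1 t2 ht2 t3 ht3 t4 ht4
    have hb' : ¬ 0 < s'.intReg 3 := hb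
    obtain rfl : j = K := by
      by_contra hjK
      have := path_pos hN (a := q) (j := j + 1) (by omega)
      omega
    refine ⟨E', ?_, hk, ?_⟩
    · have := hp.node
      rwa [path_root hN hqN] at this
    · have hle := hp.rem.len_le
      have c0 : (Test.intLt (.const 0) (ireg 3)).cost = 3 := rfl
      have c1 : (IntExpr.div (ireg 3) (.const 2)).cost = 3 := rfl
      have c2 : (IntExpr.add (ireg 10) (ireg 2)).cost = 3 := rfl
      have c3 : (addr 4 (ireg 3)).cost = 5 := rfl
      have c4 : (addr 5 (ireg 3)).cost = 5 := rfl
      have c5 : (IntExpr.const 0).cost = 1 := rfl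
      simp only [Program.bound] at ht1 ht2 ht3 ht4
      have key := Nat.mul_le_mul_left sweepBound hle
      simp only [mul_add, mul_one, mul_left_comm sweepBound 2, mul_assoc] at hτ key ⊢
      omega
  · refine ⟨0, _, Nat.zero_le _, rfl, hP1, hk1, h23, ?_, ?_⟩
    · simp [hs1]
    · have e1 : (E.set (N + q) 0 fun _ => 0).len (N + q) = 0 := Function.update_self _ _ _
      simp only [pow_zero, Nat.div_one, e1, hleaf.1]
      rw [hleaf.1] at htot
      have : 2 * E.total N + 0 = 2 * (E.set (N + q) 0 fun _ => 0).total N + 1 + 1 := by omega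
      rw [this]
      omega

/-- Delete the position in integer register `2`. -/
def deletePos : Program := openPath ;; closePath

/-- The time for one step of a deletion, apart from the steps of the searches. -/
def deleteBound : ℕ := openBound + closeBound

theorem deletePos_runs (hS : Setup M N D F c) (hN : N = 2 ^ K) (hal : al ⊆ D) (hq : q ∈ al)
    (hc : crossing s = c) (hT : TreeOK N F c al E K 1 (treeOf s)) (h10 : s.intReg 10 = N)
    (h2 : s.intReg 2 = q) :
    Runs M deletePos s (fun τ s' => ∃ E', TreeOK N F c (al \ {q}) E' K 1 (treeOf s') ∧
      Keeps 0 s s' ∧ τ + 2 * sweepBound * E.total N ≤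
        deleteBound * (K + 2) + 2 * sweepBound * E'.total N) := by
  apply Runs.seq
  refine (openPath_runs hS hN hal (hS.pos q (hal hq)).2 hT h10 h2).mono ?_
  rintro τ s1 ⟨hP, hk, hr2, hτ⟩
  refine (closePath_runs hS hN hal hq (hk.crossing.trans hc) hP
    ((hk.intReg 10 (by norm_num)).trans h10) hr2).mono ?_
  rintro τ' s2 ⟨E', hT', hk', hτ'⟩
  refine ⟨E', hT', hk.trans hk', ?_⟩
  have : openBound * (K + 1) ≤ openBound * (K + 2) := Nat.mul_le_mul_left _ (by omega)
  rw [deleteBound, Nat.add_mul]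
  omega

end UnitDisk

namespace UnitDisk

/-! ### Building the tree -/

variable {M N K m : ℕ} {D al al' : Set ℕ} {F : ℕ → ℝ → ℝ} {c : ℕ → ℕ → ℝ} {E E' : EnvData}
  {j k v q : ℕ} {s : State} {T T' : TreeMem}

theorem Envelope.len_le_pow (h : Envelope F c (under N al j v) (E.len v) (E.seq v)) :
    E.len v ≤ 2 ^ j := by
  by_contra hc
  have hp := Nat.one_le_two_pow (n := j)
  have key : ∀ t, 1 ≤ t → t ≤ E.len v → E.seq v 1 + (t - 1) ≤ E.seq v t := by
    intro t ht
    induction t, ht using Nat.le_induction with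
    | base => simp
    | succ t ht ih =>
      intro h1
      have := ih (by omega)
      have := h.lt t ht (by omega)
      omega
  have h1 := key (E.len v) (by omega) le_rfl
  have m1 := (h.mem 1 le_rfl (by omega)).2
  have m2 := (h.mem (E.len v) (by omega) le_rfl).2
  have h2 : (N + E.seq v 1 + 2 ^ j) / 2 ^ j ≤ (N + E.seq v (E.len v)) / 2 ^ j :=
    Nat.div_le_div_right (by omega)
  rw [Nat.add_div_right _ (by positivity)] at h2
  omega

theorem TreeOK.descend (h : TreeOK N F c al E k v T) {w i : ℕ} (hi : i ≤ k)
    (hw : w / 2 ^ i = v) : ∃ T', TreeOK N F c al E (k - i) w T' := by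
  induction i generalizing k v T with
  | zero =>
    rw [pow_zero, Nat.div_one] at hw
    subst hw
    exact ⟨T, h⟩
  | succ i ih =>
    obtain ⟨k, rfl⟩ : ∃ k', k = k' + 1 := ⟨k - 1, by omega⟩
    obtain ⟨t1, t2⟩ := h.undo
    rw [div_pow_succ] at hw
    rw [Nat.add_sub_add_right]
    rcases (show w / 2 ^ i = 2 * v ∨ w / 2 ^ i = 2 * v + 1 by omega) with h1 | h1
    · exact ih t1 (by omega) h1
    · exact ih t2 (by omega) h1

/-- The envelopes of one level have at most `N` elements altogether. -/
theorem TreeOK.total_le (hN : N = 2 ^ K) (h : TreeOK N F c al E K 1 T) :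
    E.total N ≤ N * (K + 1) := by
  have key : ∀ i ≤ K + 1, ∑ x ∈ Finset.Ico 1 (2 ^ i), E.len x ≤ N * i := by
    intro i hi
    induction i with
    | zero => simp
    | succ i ih =>
      rw [← Finset.sum_Ico_consecutive _ (Nat.one_le_two_pow (n := i))
        (Nat.pow_le_pow_right (by norm_num) (Nat.le_succ i))]
      have h1 : ∑ x ∈ Finset.Ico (2 ^ i) (2 ^ (i + 1)), E.len x ≤
          ∑ x ∈ Finset.Ico (2 ^ i) (2 ^ (i + 1)), 2 ^ (K - i) := by
        refine Finset.sum_le_sum fun x hx => ?_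
        rw [Finset.mem_Ico] at hx
        obtain ⟨T', hT'⟩ := h.descend (w := x) (i := i) (by omega) (by
          rw [Nat.div_eq_iff (by positivity)]
          rw [pow_succ] at hx
          omega)
        exact hT'.nodeOK.env.len_le_pow
      rw [Finset.sum_const, Nat.card_Ico, smul_eq_mul, pow_succ,
        show 2 ^ i * 2 - 2 ^ i = 2 ^ i by omega, ← pow_add, Nat.add_sub_cancel' (by omega),
        ← hN] at h1
      have := ih (by omega)
      rw [mul_add]
      rw [pow_succ]
      omega
  have := key (K + 1) le_rfl
  rwa [pow_succ, mul_comm _ 2, ← hN] at this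

/-- The leaves of the tree for the positions `1, …, m`. -/
structure LeavesOK (N m : ℕ) (T : TreeMem) : Prop where
  nxt : ∀ a < N, T.nxt a = 0
  prv : ∀ a < N, T.prv a = 0
  fst : ∀ a < N, T.fst (N + a) = if a ≤ m then a else 0
  lst : ∀ a < N, T.lst (N + a) = if a ≤ m then a else 0

/-- The envelopes of the leaves. -/
def leafData (N m : ℕ) : EnvData :=
  ⟨fun v => if N < v ∧ v ≤ N + m then 1 else 0,
    fun v t => if N < v ∧ v ≤ N + m ∧ t = 1 then v - N else 0⟩

theorem LeavesOK.tree (hT : LeavesOK N m T) {a : ℕ} (ha : a < N) :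
    TreeOK N F c {a | 1 ≤ a ∧ a ≤ m} (leafData N m) 0 (N + a) T := by
  change NodeOK _ _ _ _ _ _ _ _
  have h1 := hT.fst a ha
  have h2 := hT.lst a ha
  by_cases h : 1 ≤ a ∧ a ≤ m
  · have hL : (leafData N m).len (N + a) = 1 := if_pos ⟨by omega, by omega⟩
    have hs : ∀ t, (leafData N m).seq (N + a) t = if t = 1 then a else 0 := by
      intro t
      simp only [leafData]
      split_ifs <;> omega
    have hm : under N {a | 1 ≤ a ∧ a ≤ m} 0 (N + a) = {a} :=
      under_leaf (q := a) (al := {a | 1 ≤ a ∧ a ≤ m}) h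
    rw [if_pos h.2] at h1 h2
    constructor
    · rw [hL, hm]
      refine ⟨fun t h1 h2 => ?_, fun t h1 h2 => by omega, ?_, ?_, fun t h1 h2 => by omega⟩
      · obtain rfl : t = 1 := by omega
        rw [hs]
        rfl
      · rintro b rfl
        rw [hs]
        exact ⟨le_rfl, le_rfl⟩
      · rintro b rfl
        rw [hs]
        exact le_rfl
    · rw [hs, if_neg (by omega)]
    · rw [hL, hs, if_neg (by omega)]
    · rw [hs, h1, if_pos rfl]
    · rw [hL, hs, h2, if_pos rfl]
    · intro t h3 h4
      obtain rfl : t = 1 := by omega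
      rw [hs, hs, hs, if_pos rfl, if_neg (by omega), if_neg (by omega), hT.nxt a ha, hT.prv a ha]
      exact ⟨rfl, rfl⟩
  · have hL : (leafData N m).len (N + a) = 0 := if_neg (by omega)
    have hs : ∀ t, (leafData N m).seq (N + a) t = 0 := fun t => if_neg (by omega)
    have hm : under N {a | 1 ≤ a ∧ a ≤ m} 0 (N + a) = ∅ := by
      rw [Set.eq_empty_iff_forall_notMem]
      rintro b ⟨h3, h4⟩
      rw [pow_zero, Nat.div_one] at h4
      obtain rfl : b = a := by omega
      exact h h3
    have h0 : (if a ≤ m then a else 0) = 0 := by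
      split_ifs <;> omega
    rw [h0] at h1 h2
    constructor
    · rw [hL, hm]
      exact ⟨fun t h1 h2 => by omega, fun t h1 h2 => by omega, fun b hb => hb.elim,
        fun b hb => hb.elim, fun t h1 h2 => by omega⟩
    · exact hs _
    · exact hs _
    · rw [hs, h1]
    · rw [hs, h2]
    · intro t h3 h4
      omega

/-- The nodes above `v` whose parents are not above `v` are represented correctly. -/
def ForestOK (N K : ℕ) (F : ℕ → ℝ → ℝ) (c : ℕ → ℕ → ℝ) (al : Set ℕ) (E : EnvData) (v : ℕ)
    (T : TreeMem) : Prop :=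
  ∀ w i j, i + j = K → 2 ^ i ≤ w → w < 2 ^ (i + 1) → v < w → w / 2 ≤ v → TreeOK N F c al E j w T

theorem ForestOK.step {i n : ℕ} {f : ℕ → ℕ} (h : ForestOK N K F c al E v (treeOf s))
    {s' : State} (hij : i + (j + 1) = K) (h1 : 2 ^ i ≤ v) (h2 : v < 2 ^ (i + 1))
    (hJ : Joined N F c al E j v n f s s') :
    ForestOK N K F c al (E.set v n f) (v - 1) (treeOf s') := by
  have hv : 1 ≤ v := Nat.one_le_two_pow.trans h1
  intro w i' j' hij' h1' h2' hw hw'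
  by_cases hwv : w = v
  · subst hwv
    have : i' = i := by
      rw [← Nat.log_eq_of_pow_le_of_lt_pow h1' h2', ← Nat.log_eq_of_pow_le_of_lt_pow h1 h2]
    obtain rfl : j' = j + 1 := by omega
    exact hJ.tree
  · refine (h w i' j' hij' h1' h2' (by omega) (by omega)).congr (hJ.only.agree ?_
      (fun _ _ => Iff.rfl) ?_ ?_)
    · intro x hx
      exact ⟨(Function.update_of_ne hx _ _).symm, (Function.update_of_ne hx _ _).symm⟩
    · intro l hl he
      have := Nat.div_le_self v (2 ^ l)
      omega
    · intro a ha ha'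
      rcases le_or_gt j' (j + 1) with hle | hlt
      · obtain ⟨d, hd⟩ := Nat.exists_eq_add_of_le hle
        rw [hd, pow_add, ← Nat.div_div_eq_div_mul, ha] at ha'
        rcases Nat.eq_zero_or_pos d with rfl | hd'
        · rw [pow_zero, Nat.div_one] at ha'
          omega
        · obtain ⟨d, rfl⟩ : ∃ d', d = d' + 1 := ⟨d - 1, by omega⟩
          rw [pow_succ', ← Nat.div_div_eq_div_mul] at ha'
          have := Nat.div_le_self (w / 2) (2 ^ d)
          omega
      · obtain ⟨d, hd⟩ := Nat.exists_eq_add_of_le hlt.le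
        rw [hd, pow_add, ← Nat.div_div_eq_div_mul, ha'] at ha
        have := Nat.div_le_self v (2 ^ d)
        omega

/-- Join all nodes, from the highest number to the lowest. -/
def joinAll : Program :=
  .setInt 3 (.sub (ireg 10) (.const 1)) ;;
  .loop (.intLt (.const 0) (ireg 3)) (mergeNode ;; .setInt 3 (.sub (ireg 3) (.const 1)))

/-- The joins of all nodes take time linear in the total length of the envelopes, which is at most `N`
per level of the tree. -/
theorem joinAll_runs (hS : Setup M N D F c) (hN : N = 2 ^ K) (hal : al ⊆ D) (hc : crossing s = c)
    (h10 : s.intReg 10 = N) (hF : ForestOK N K F c al E (N - 1) (treeOf s)) :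
    Runs M joinAll s (fun τ s' => ∃ E', TreeOK N F c al E' K 1 (treeOf s') ∧ Keeps 0 s s' ∧
      τ ≤ (joinBound * 5 + 10) * (N * (K + 2))) := by
  have hM := hS.mem
  have hN1 : 1 ≤ N := hN ▸ Nat.one_le_two_pow
  refine Runs.seq_wp ⟨by simp; omega, ?_⟩
  simp only [eval_reg, eval_sub, eval_const, h10]
  refine Runs.loop (I := fun r τ s' => ∃ E', r < N ∧ s'.intReg 3 = r ∧
    ForestOK N K F c al E' r (treeOf s') ∧ Keeps 0 s s' ∧
    τ + (joinBound * 4 + 10) * r ≤ (joinBound * 4 + 10) * (N - 1) +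
      joinBound * ∑ w ∈ Finset.Ico (2 * r + 2) (2 * N), E'.len w)
    (r := N - 1) ?_ ?_ ?_ ?_
  · rintro r τ s' -
    simp
    omega
  · rintro v τ s' ⟨E', hr, h3, hF', hk, hτ⟩ hb
    have hv : 1 ≤ v := by
      have : 0 < s'.intReg 3 := hb
      omega
    have hlog : Nat.log 2 v < K := Nat.log_lt_of_lt_pow (by omega) (by omega)
    obtain ⟨j, hj⟩ : ∃ j, Nat.log 2 v + (j + 1) = K := ⟨K - Nat.log 2 v - 1, by omega⟩
    have l1 : 2 ^ Nat.log 2 v ≤ v := Nat.pow_log_le_self 2 (by omega)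
    have l2 : v < 2 ^ (Nat.log 2 v + 1) := Nat.lt_pow_succ_log_self (by norm_num) v
    have t1 := hF' (2 * v) (Nat.log 2 v + 1) j (by omega) (by rw [pow_succ]; omega)
      (by rw [pow_succ]; omega) (by omega) (by omega)
    have t2 := hF' (2 * v + 1) (Nat.log 2 v + 1) j (by omega) (by rw [pow_succ]; omega)
      (by rw [pow_succ _ (_ + 1)]; omega) (by omega) (by omega)
    apply Runs.seq
    refine (mergeNode_runs hS hal (hk.crossing.trans hc) h3 hv (by omega) t1 t2).mono ?_
    rintro t s2 ⟨n, f, hJ, -, ht⟩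
    have h3' : s2.intReg 3 = v := (hJ.keeps.intReg 3 (by norm_num)).trans h3
    refine Runs.of_wp ⟨by simp; omega, ?_⟩
    intro t' ht'
    refine ⟨v - 1, by omega, E'.set v n f, by omega, by simp [h3'], ?_, ?_, ?_⟩
    · rw [treeOf_mk]
      exact hF'.step hj l1 l2 hJ
    · exact (hk.trans (hJ.keeps.anti (by norm_num))).trans
        ⟨fun i hi => Function.update_of_ne (by omega) _ _, fun _ _ => rfl, fun _ _ => rfl⟩
    · have e1 : ∑ w ∈ Finset.Ico (2 * (v - 1) + 2) (2 * N), (E'.set v n f).len w =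
          E'.len (2 * v) + (E'.len (2 * v + 1) + ∑ w ∈ Finset.Ico (2 * v + 2) (2 * N), E'.len w) := by
        rw [show 2 * (v - 1) + 2 = 2 * v by omega, Finset.sum_eq_sum_Ico_succ_bot (by omega),
          Finset.sum_eq_sum_Ico_succ_bot (by omega)]
        have e2 : ∀ w, v < w → (E'.set v n f).len w = E'.len w := fun w hw =>
          Function.update_of_ne (by omega) _ _
        rw [e2 _ (by omega), e2 _ (by omega)]
        congr 2
        exact Finset.sum_congr rfl fun w hw => e2 w (by
          have := (Finset.mem_Ico.1 hw).1
          omega)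
      rw [e1]
      have c1 : (Test.intLt (.const 0) (ireg 3)).cost = 3 := rfl
      have c3 : (IntExpr.sub (ireg 3) (.const 1)).cost = 3 := rfl
      simp only [Program.bound] at ht'
      obtain ⟨u, rfl⟩ : ∃ u, v = u + 1 := ⟨v - 1, by omega⟩
      simp only [Nat.add_sub_cancel]
      rw [mul_add _ u] at hτ
      simp only [mul_add joinBound, mul_one] at ht hτ ⊢
      omega
  · rintro v τ s' ⟨E', hr, h3, hF', hk, hτ⟩ hb t ht
    have hv : v = 0 := by
      have : ¬ 0 < s'.intReg 3 := hb
      omega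
    subst hv
    have hT := hF' 1 0 K (by omega) le_rfl (by norm_num) (by norm_num) (by norm_num)
    refine ⟨E', hT, hk, ?_⟩
    have htot := hT.total_le hN
    have hsub : ∑ w ∈ Finset.Ico (2 * 0 + 2) (2 * N), E'.len w ≤ E'.total N :=
      Finset.sum_le_sum_of_subset (Finset.Ico_subset_Ico (by norm_num) le_rfl)
    have c1 : (Test.intLt (.const 0) (ireg 3)).cost = 3 := rfl
    have c3 : (IntExpr.sub (ireg 10) (.const 1)).cost = 3 := rfl
    simp only [Program.bound] at ht
    have a1 := Nat.mul_le_mul_left joinBound (hsub.trans htot)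
    have a2 : N * (K + 2) = N * (K + 1) + N := by ring
    have a3 : N ≤ N * (K + 1) := Nat.le_mul_of_pos_right _ (by omega)
    have a4 : (joinBound * 4 + 10) * (N - 1) + (joinBound * 4 + 10) = (joinBound * 4 + 10) * N := by
      obtain ⟨u, rfl⟩ : ∃ u, N = u + 1 := ⟨N - 1, by omega⟩
      rw [Nat.add_sub_cancel]
      ring
    have a5 : (joinBound * 5 + 10) * (N * (K + 2)) = (joinBound * 4 + 10) * N +
      (joinBound * 4 + 10) * (N * (K + 1)) + joinBound * (N * (K + 1)) + joinBound * N := by ring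
    have a6 : 0 ≤ (joinBound * 4 + 10) * (N * (K + 1)) := Nat.zero_le _
    omega
  · refine ⟨E, by omega, by simp, by rwa [treeOf_mk], ⟨fun i hi => ?_, fun _ _ => rfl,
      fun _ _ => rfl⟩, by omega⟩
    exact Function.update_of_ne (by omega) _ _

theorem LeavesOK.forest (hN : N = 2 ^ K) (h : LeavesOK N m T) :
    ForestOK N K F c {a | 1 ≤ a ∧ a ≤ m} (leafData N m) (N - 1) T := by
  intro w i j hij h1 h2 h3 h4
  have hN1 : 1 ≤ N := hN ▸ Nat.one_le_two_pow
  have hK : K = i := by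
    by_contra hne
    have : 2 ^ (i + 1) ≤ N := hN ▸ Nat.pow_le_pow_right (by norm_num) (by omega)
    omega
  obtain rfl : j = 0 := by omega
  obtain ⟨a, rfl⟩ := Nat.exists_eq_add_of_le (show N ≤ w by omega)
  exact h.tree (by omega)

/-- Set up the leaves for the positions `1, …, m`, where `m` is in integer register `11`. -/
def initLeaves : Program :=
  .setInt 3 (ireg 10) ;;
  .loop (.intLt (.const 0) (ireg 3))
    (.setInt 3 (.sub (ireg 3) (.const 1)) ;;
    ist 2 (ireg 3) (.const 0) ;; ist 3 (ireg 3) (.const 0) ;;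
    .cond (.intLt (ireg 11) (ireg 3))
      (ist 4 (.add (ireg 10) (ireg 3)) (.const 0) ;; ist 5 (.add (ireg 10) (ireg 3)) (.const 0))
      (ist 4 (.add (ireg 10) (ireg 3)) (ireg 3) ;; ist 5 (.add (ireg 10) (ireg 3)) (ireg 3)))

theorem initLeaves_runs (hM : 32 * N + 100 ≤ M) (h10 : s.intReg 10 = N) (h11 : s.intReg 11 = m) :
    Runs M initLeaves s (fun τ s' => LeavesOK N m (treeOf s') ∧ Keeps 0 s s' ∧
      τ ≤ 100 * N + 100) := by
  refine Runs.seq_wp ⟨by simp, ?_⟩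
  simp only [eval_reg, h10]
  refine Runs.loop (I := fun r τ s' => r ≤ N ∧ s'.intReg 3 = r ∧ (∀ a < N, r ≤ a →
      s'.int 2 a = 0 ∧ s'.int 3 a = 0 ∧ s'.int 4 (N + a) = (if a ≤ m then a else 0) ∧
      s'.int 5 (N + a) = if a ≤ m then a else 0) ∧ Keeps 0 s s' ∧ τ + 100 * r ≤ 100 * N)
    (r := N) ?_ ?_ ?_ ?_
  · rintro r τ s' -
    simp
    omega
  · rintro r τ s' ⟨hr, h3, hI, hk, hτ⟩ hb
    have hr0 : 0 < r := by
      have : 0 < s'.intReg 3 := hb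
      omega
    have mem : ∀ k < 16, ∀ a < 2 * N, ad k a < M := fun k hk a ha => by simp only [ad]; omega
    have h16 : 16 < M := by omega
    have g10 : s'.intReg 10 = N := (hk.intReg 10 (by norm_num)).trans h10
    have g11 : s'.intReg 11 = m := (hk.intReg 11 (by norm_num)).trans h11
    apply Runs.of_wp
    have mk : ∀ im : ℕ → ℕ, ∀ ir : ℕ → ℕ, (∀ i, 10 ≤ i → ir i = s'.intReg i) →
        Keeps 0 s ⟨ir, s'.realReg, im, s'.realMem⟩ := fun im ir hi =>
      hk.trans ⟨fun i h => hi i (by omega), fun _ _ => rfl, fun _ _ => rfl⟩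
    have ir1 : ∀ e i, 10 ≤ i → Function.update s'.intReg 3 e i = s'.intReg i := fun e i hi =>
      Function.update_of_ne (by omega) _ _
    simp [wp, h3, g10, g11, h16, mem,
      show N + (r - 1) < M by omega, show N + (r - 1) < 2 * N by omega,
      show r - 1 < 2 * N by omega, show (1 : ℕ) < M by omega, show (0 : ℕ) < M by omega]
    refine ⟨fun hm t ht => ?_, fun hm t ht => ?_⟩
    all_goals
      refine ⟨hr0, by omega, fun a ha hra => ?_, mk _ _ (ir1 _), ?_⟩
    · rcases (show a = r - 1 ∨ r ≤ a by omega) with rfl | hlt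
      · simp [int_mk_update_ne, show ¬ (r - 1 ≤ m) by omega]
      · have := hI a ha (by omega)
        simp [int_mk_update_ne, this, show a ≠ r - 1 by omega]
    · simp [Program.bound, IntExpr.cost, Test.cost] at ht ⊢
      omega
    · rcases (show a = r - 1 ∨ r ≤ a by omega) with rfl | hlt
      · simp [int_mk_update_ne, show r - 1 ≤ m by omega]
      · have := hI a ha (by omega)
        simp [int_mk_update_ne, this, show a ≠ r - 1 by omega]
    · simp [Program.bound, IntExpr.cost, Test.cost] at ht ⊢
      omega
  · rintro r τ s' ⟨hr, h3, hI, hk, hτ⟩ hb t ht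
    have hr0 : r = 0 := by
      have : ¬ 0 < s'.intReg 3 := hb
      omega
    subst hr0
    refine ⟨⟨fun a ha => (hI a ha (Nat.zero_le _)).1, fun a ha => (hI a ha (Nat.zero_le _)).2.1,
      fun a ha => (hI a ha (Nat.zero_le _)).2.2.1, fun a ha => (hI a ha (Nat.zero_le _)).2.2.2⟩,
      hk, ?_⟩
    simp [Program.bound, IntExpr.cost, Test.cost] at ht ⊢
    omega
  · refine ⟨le_rfl, by simp, fun a h1 h2 => by omega, ⟨fun i hi => ?_, fun _ _ => rfl,
      fun _ _ => rfl⟩, by omega⟩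
    exact Function.update_of_ne (by omega) _ _

end UnitDisk

namespace UnitDisk

/-! ### Descending to a maximal function -/

variable {M N K : ℕ} {D al : Set ℕ} {F : ℕ → ℝ → ℝ} {c : ℕ → ℕ → ℝ} {E : EnvData} {k v : ℕ}
  {s : State} {T : TreeMem} {X : ℝ}

open Classical in
/-- The child of `v` below which some function is maximal at `X`. -/
noncomputable def TreeMem.choose (T : TreeMem) (v : ℕ) (X : ℝ) : ℕ :=
  if T.fst (2 * v) = 0 ∨ T.fst (2 * v + 1) ≠ 0 ∧ T.xs v < X then 2 * v + 1 else 2 * v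

/-- The abscissa of the bridge decides which child has a maximal function. -/
theorem TreeOK.choose_dominates (hS : Setup M N D F c) (hal : al ⊆ D)
    (h : TreeOK N F c al E (k + 1) v T) {b : ℕ} (hb : b ∈ under N al (k + 1) v) :
    ∃ a ∈ under N al k (T.choose v X), F b X ≤ F a X := by
  obtain ⟨h1, h2⟩ := h.undo
  have hpos : ∀ a ∈ al, 1 ≤ a := fun a ha => (hS.pos a (hal ha)).1
  have e1 := h1.nodeOK.len_ne hpos
  have e2 := h2.nodeOK.len_ne hpos
  rw [undo_fst] at e1 e2
  rw [under_succ] at hb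
  have hbr : E.len (2 * v) ≠ 0 → E.len (2 * v + 1) ≠ 0 → ∃ l ∈ under N al k (2 * v),
      ∃ r ∈ under N al k (2 * v + 1), T.xs v = c l r ∧
        Bridge F c (under N al k (2 * v)) (under N al k (2 * v + 1)) l r := by
    intro n1 n2
    obtain ⟨t, u, t1, t2, u1, u2, -, -, -, -, hx, hB, -⟩ := h.2.1.bridge n1 n2
    exact ⟨_, h1.nodeOK.env.mem t t1 t2, _, h2.nodeOK.env.mem u u1 u2, hx, hB⟩
  have sub : ∀ w, under N al k w ⊆ D := fun w a ha => hal ha.1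
  unfold TreeMem.choose
  split_ifs with hc
  · rcases hb with hb | hb
    · have n1 : E.len (2 * v) ≠ 0 := by
        have := (h1.nodeOK.env.first b hb).1
        omega
      rcases hc with hc | ⟨hc, hx⟩
      · exact absurd hc (e1.1 n1)
      · obtain ⟨l, hl, r, hr, hx', hB⟩ := hbr n1 (e2.2 hc)
        exact ⟨r, hr, hB.le_right hS.sc (sub _) (sub _) under_lt hl hr (hx' ▸ hx.le) b hb⟩
    · exact ⟨b, hb, le_rfl⟩
  · rcases hb with hb | hb
    · exact ⟨b, hb, le_rfl⟩
    · have n2 : E.len (2 * v + 1) ≠ 0 := by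
        have := (h2.nodeOK.env.first b hb).1
        omega
      have n1 : T.fst (2 * v) ≠ 0 := fun h => hc (.inl h)
      have hx : X ≤ T.xs v := not_lt.1 fun h => hc (.inr ⟨e2.1 n2, h⟩)
      obtain ⟨l, hl, r, hr, hx', hB⟩ := hbr (e1.2 n1) n2
      exact ⟨l, hl, hB.le_left hS.sc (sub _) (sub _) under_lt hl hr (hx' ▸ hx) b hb⟩

/-- Descend from the root to a leaf whose function is maximal at the abscissa in real register `5`;
its position is left in integer register `3`. -/
def descend : Program :=
  .setInt 3 (.const 1) ;;
  .loop (.intLt (ireg 3) (ireg 10))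
    (.cond (.disj (.intEq (ild 4 (.mul (.const 2) (ireg 3))) (.const 0))
        (.conj (.neg (.intEq (ild 4 (.add (.mul (.const 2) (ireg 3)) (.const 1))) (.const 0)))
          (.realLt (rld 15 (ireg 3)) (rreg 5))))
      (.setInt 3 (.add (.mul (.const 2) (ireg 3)) (.const 1)))
      (.setInt 3 (.mul (.const 2) (ireg 3)))) ;;
  .setInt 3 (.sub (ireg 3) (ireg 10))

theorem descend_runs (hS : Setup M N D F c) (hN : N = 2 ^ K) (hal : al ⊆ D) (hne : al.Nonempty)
    (hT : TreeOK N F c al E K 1 (treeOf s)) (h10 : s.intReg 10 = N) :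
    Runs M descend s (fun τ s' => ∃ a ∈ al, MaxAt F al a (s.realReg 5) ∧
      s' = { s with intReg := Function.update s.intReg 3 a } ∧ τ ≤ 100 * (K + 1)) := by
  have hM := hS.mem
  have h16 : 16 < M := by omega
  set X := s.realReg 5 with hX
  refine Runs.seq_wp ⟨by simp; omega, ?_⟩
  apply Runs.seq
  refine Runs.loop (I := fun r τ s' => ∃ v T, r ≤ K ∧ 1 ≤ v ∧
      s' = { s with intReg := Function.update s.intReg 3 v } ∧ (r = 0 ↔ N ≤ v) ∧
      v < 2 * N ∧ TreeOK N F c al E r v T ∧ T.fst = (treeOf s).fst ∧ T.xs = (treeOf s).xs ∧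
      (∀ b ∈ al, ∃ a ∈ under N al r v, F b X ≤ F a X) ∧ 2 ^ r * v < 2 * N ∧ N ≤ 2 ^ r * v ∧
      τ + 60 * r ≤ 60 * K)
    (r := K) ?_ ?_ ?_ ?_
  · rintro r τ s' -
    simp
  · rintro r τ s' ⟨v, T, hr, hv1, rfl, hrv, hv, hT, e1, e2, hdom, hp1, hp2, hτ⟩ hb
    have hvN : v < N := by
      have : Function.update s.intReg 3 v 3 < Function.update s.intReg 3 v 10 := hb
      simp [h10] at this
      omega
    obtain ⟨r, rfl⟩ : ∃ r', r = r' + 1 := ⟨r - 1, by omega⟩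
    have mem : ∀ k < 16, ∀ a < 2 * N, ad k a < M := fun k hk a ha => by simp only [ad]; omega
    have key : ∀ s' : State, s' = { s with intReg := Function.update s.intReg 3 (T.choose v X) } →
        ∀ t, t ≤ 50 → ∃ r' < r + 1, ∃ v T, r' ≤ K ∧ 1 ≤ v ∧
      s' = { s with intReg := Function.update s.intReg 3 v } ∧ (r' = 0 ↔ N ≤ v) ∧
      v < 2 * N ∧ TreeOK N F c al E r' v T ∧ T.fst = (treeOf s).fst ∧ T.xs = (treeOf s).xs ∧
      (∀ b ∈ al, ∃ a ∈ under N al r' v, F b X ≤ F a X) ∧ 2 ^ r' * v < 2 * N ∧ N ≤ 2 ^ r' * v ∧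
      τ + ((Test.intLt (ireg 3) (ireg 10)).cost + t + 1) + 60 * r' ≤ 60 * K := by
      intro s' hs' t ht
      have c1 : (Test.intLt (ireg 3) (ireg 10)).cost = 3 := rfl
      have hw : T.choose v X = 2 * v + 1 ∨ T.choose v X = 2 * v := by
        unfold TreeMem.choose
        split_ifs <;> simp
      obtain ⟨t1, t2⟩ := hT.undo
      have hpw := Nat.one_le_two_pow (n := r)
      have hwb : 2 ^ r * T.choose v X < 2 * N ∧ N ≤ 2 ^ r * T.choose v X := by
        obtain ⟨d, hd⟩ : ∃ d, r + 1 + d = K := ⟨K - (r + 1), by omega⟩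
        have hN' : N = 2 ^ r * (2 * 2 ^ d) := by rw [hN, ← hd]; ring
        have h1 : 2 ^ (r + 1) * v = 2 ^ r * (2 * v) := by ring
        rw [h1] at hp1 hp2
        rw [hN'] at hp1 hp2 ⊢
        rw [← mul_assoc 2, mul_comm 2 (2 ^ r), mul_assoc] at hp1 ⊢
        have a1 := lt_of_mul_lt_mul_left hp1 (Nat.zero_le _)
        have a2 := le_of_mul_le_mul_left hp2 hpw
        exact ⟨Nat.mul_lt_mul_of_pos_left (by omega) hpw, Nat.mul_le_mul_left _ (by omega)⟩
      refine ⟨r, by omega, T.choose v X, T.undo v, by omega, by omega, hs', ⟨?_, ?_⟩, by omega, ?_,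
        (undo_fst T v).trans e1, ?_, ?_, hwb.1, hwb.2, by omega⟩
      · rintro rfl
        simpa using hwb.2
      · intro h1
        by_contra h0
        obtain ⟨r, rfl⟩ : ∃ r', r = r' + 1 := ⟨r - 1, by omega⟩
        have : 2 * T.choose v X ≤ 2 ^ (r + 1) * T.choose v X :=
          Nat.mul_le_mul_right _ (by rw [pow_succ]; have := Nat.one_le_two_pow (n := r); omega)
        omega
      · rcases hw with h | h <;> rw [h]
        · exact t2
        · exact t1
      · rw [← e2]
        unfold TreeMem.undo
        split_ifs <;> rfl
      · intro b hb
        obtain ⟨a, ha, hab⟩ := hdom b hb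
        obtain ⟨a', ha', hab'⟩ := hT.choose_dominates hS hal (X := X) ha
        exact ⟨a', ha', hab.trans hab'⟩
    have f1 : s.int 4 = T.fst := e1.symm
    have f2 : s.real 15 = T.xs := e2.symm
    refine Runs.of_wp (wp_mono (Q := fun s' => s' = _) ?_ fun s' h t ht =>
      key s' h t (ht.trans (by decide)))
    simp [wp, h16, mem, show 2 * v < M by omega, show 2 * v + 1 < M by omega,
      show 2 * v < 2 * N by omega, show 2 * v + 1 < 2 * N by omega, show 2 < M by omega,
      show 1 < M by omega, show 0 < M by omega, hv, f1, f2, ← hX]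
    refine ⟨fun hc => ?_, fun n1 hc => ?_⟩
    · rw [TreeMem.choose, if_pos (by tauto)]
    · rw [TreeMem.choose, if_neg]
      rintro (h | ⟨h, h'⟩)
      · exact n1 h
      · exact absurd h' (not_lt.2 (hc h))
  · rintro r τ s' ⟨v, T, hr, hv1, rfl, hrv, hv, hT, e1, e2, hdom, hp1, hp2, hτ⟩ hb
    have hvN : N ≤ v := by
      have : ¬ Function.update s.intReg 3 v 3 < Function.update s.intReg 3 v 10 := hb
      simp [h10] at this
      omega
    obtain rfl : r = 0 := hrv.2 hvN
    obtain ⟨b0, hb0⟩ := hne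
    have hleaf : ∀ a, a ∈ under N al 0 v → a = v - N := by
      rintro a ⟨-, ha⟩
      rw [pow_zero, Nat.div_one] at ha
      omega
    obtain ⟨a, ha, -⟩ := hdom b0 hb0
    have hav := hleaf a ha
    apply Runs.of_wp
    refine ⟨by simp, fun t ht t' ht' => ⟨v - N, hav ▸ ha.1, fun b hb => ?_, ?_, ?_⟩⟩
    · obtain ⟨a', ha', hab⟩ := hdom b hb
      rwa [hleaf a' ha'] at hab
    · simp [h10]
    · simp [Program.bound, IntExpr.cost, Test.cost] at ht ht' ⊢
      omega
  · refine ⟨1, treeOf s, le_rfl, le_rfl, rfl, ?_, ?_, hT, rfl, rfl, ?_, ?_, ?_, by omega⟩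
    · rw [hN]
      constructor
      · rintro rfl
        simp
      · intro h
        by_contra h0
        have := Nat.one_lt_two_pow h0
        omega
    · rw [hN]
      have := Nat.one_le_two_pow (n := K)
      omega
    · intro b hb
      refine ⟨b, ⟨hb, ?_⟩, le_rfl⟩
      exact path_root hN (hS.pos b (hal hb)).2
    · rw [hN]
      have := Nat.one_le_two_pow (n := K)
      omega
    · rw [hN, mul_one]

end UnitDisk

namespace UnitDisk

/-! ### Sorting -/

/-- Keys for the lexicographic order. -/
abbrev Key : Type := ℝ ×ₗ ℝ ×ₗ ℝ

/-- The key with the given components. -/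
def key (y u v : ℝ) : Key := toLex (y, toLex (u, v))

theorem key_lt {y u v y' u' v' : ℝ} : key y u v < key y' u' v' ↔
    y < y' ∨ y = y' ∧ (u < u' ∨ u = u' ∧ v < v') := by
  simp [key, Prod.Lex.lt_iff]

theorem key_le {y u v y' u' v' : ℝ} : key y u v ≤ key y' u' v' ↔
    y < y' ∨ y = y' ∧ (u < u' ∨ u = u' ∧ v ≤ v') := by
  simp [key, Prod.Lex.le_iff]

/-- The test for the lexicographic order. -/
def lexLt (y u v y' u' v' : RealExpr) : Test :=
  .disj (.realLt y y') (.conj (.realLe y y') (.disj (.realLt u u') (.conj (.realLe u u')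
    (.realLt v v'))))

theorem lexLt_holds {y u v y' u' v' : RealExpr} {s : State} : (lexLt y u v y' u' v').Holds s ↔
    key (y.eval s) (u.eval s) (v.eval s) < key (y'.eval s) (u'.eval s) (v'.eval s) := by
  rw [key_lt]
  simp only [lexLt, holds_disj, holds_conj, holds_realLt, holds_realLe]
  constructor
  · rintro (h | ⟨h, h' | ⟨h', h''⟩⟩)
    · exact .inl h
    · exact h.lt_or_eq.imp id fun e => ⟨e, .inl h'⟩
    · exact h.lt_or_eq.imp id fun e => ⟨e, h'.lt_or_eq.imp id fun e' => ⟨e', h''⟩⟩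
  · rintro (h | ⟨h, h' | ⟨h', h''⟩⟩)
    · exact .inl h
    · exact .inr ⟨h.le, .inl h'⟩
    · exact .inr ⟨h.le, .inr ⟨h'.le, h''⟩⟩

/-- The key of an item. -/
noncomputable def itemKey (s : State) (i : ℕ) : Key := key (s.real 2 i) (s.real 0 i) (s.real 1 i)

/-- Compare the keys of two items. -/
def itemLt (a b : IntExpr) : Test :=
  lexLt (rld 2 a) (rld 0 a) (rld 1 a) (rld 2 b) (rld 0 b) (rld 1 b)

/-- The item with the smaller key; `0` stands for no item. -/
noncomputable def pick (κ : ℕ → Key) (a b : ℕ) : ℕ :=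
  if a = 0 ∨ b ≠ 0 ∧ κ b < κ a then b else a

/-- `T` is the tournament tree of the set `A` of items, except at the node `cur`. -/
structure Tourn (N : ℕ) (κ : ℕ → Key) (A : Finset ℕ) (T : ℕ → ℕ) (cur : ℕ) : Prop where
  leaf : ∀ i < N, T (N + i) = if i ∈ A then i else 0
  node : ∀ v, 1 ≤ v → v < N → v ≠ cur → T v = pick κ (T (2 * v)) (T (2 * v + 1))

variable {M N K m : ℕ} {κ κ' : ℕ → Key} {A : Finset ℕ} {T : ℕ → ℕ} {s : State}

theorem Tourn.mem (h : Tourn N κ A T 0) {v : ℕ} (hv : 1 ≤ v) (hvN : v < 2 * N) (h0 : T v ≠ 0) :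
    T v ∈ A := by
  induction hr : 2 * N - v using Nat.strong_induction_on generalizing v with
  | _ r ih =>
    rcases lt_or_ge v N with h1 | h1
    · rw [h.node v hv h1 (by omega)] at h0 ⊢
      unfold pick at h0 ⊢
      split_ifs at h0 ⊢
      · exact ih _ (by omega) (by omega) (by omega) h0 rfl
      · exact ih _ (by omega) (by omega) (by omega) h0 rfl
    · obtain ⟨i, rfl⟩ := Nat.exists_eq_add_of_le h1
      have h2 := h.leaf i (by omega)
      split_ifs at h2 with h3
      · rwa [h2]
      · exact absurd h2 h0

theorem Tourn.zero (h : Tourn N κ ∅ T 0) {v : ℕ} (hv : 1 ≤ v) (hvN : v < 2 * N) : T v = 0 := by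
  by_contra h0
  exact absurd (h.mem hv hvN h0) (Finset.notMem_empty _)

theorem Tourn.le (hN : N = 2 ^ K) (hA : ∀ i ∈ A, 1 ≤ i ∧ i < N) (h : Tourn N κ A T 0) {i : ℕ}
    (hi : i ∈ A) : T 1 ≠ 0 ∧ κ (T 1) ≤ κ i := by
  have hiN := (hA i hi).2
  have key : ∀ k ≤ K, T ((N + i) / 2 ^ k) ≠ 0 ∧ κ (T ((N + i) / 2 ^ k)) ≤ κ i := by
    intro k hk
    induction k with
    | zero =>
      rw [pow_zero, Nat.div_one, h.leaf i hiN, if_pos hi]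
      exact ⟨by have := (hA i hi).1; omega, le_rfl⟩
    | succ k ih =>
      obtain ⟨h0, h1⟩ := ih (by omega)
      have hv := path_pos hN (a := i) (j := k + 1) hk
      rw [h.node _ hv (path_lt hN hiN) (by omega)]
      rw [div_pow_succ] at hv ⊢
      generalize (N + i) / 2 ^ k = w at *
      unfold pick
      rcases Nat.even_or_odd' w with ⟨x, rfl | rfl⟩
      · rw [show 2 * x / 2 = x by omega] at *
        split_ifs with hc
        · exact ⟨(hc.resolve_left h0).1, (hc.resolve_left h0).2.le.trans h1⟩
        · exact ⟨h0, h1⟩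
      · rw [show (2 * x + 1) / 2 = x by omega] at *
        split_ifs with hc
        · exact ⟨h0, h1⟩
        · push Not at hc
          exact ⟨hc.1, (hc.2 h0).trans h1⟩
  have := key K le_rfl
  rwa [path_root hN hiN] at this

/-- The sorting programs change only the tournament tree and the integer registers `3`, `4`, `5`. -/
structure SortFrame (s s' : State) : Prop where
  intReg : ∀ i, i = 2 ∨ 6 ≤ i → s'.intReg i = s.intReg i
  realReg : s'.realReg = s.realReg
  realMem : s'.realMem = s.realMem
  perm : s'.int 1 = s.int 1

/-- Update the tournament tree above the node in integer register `3`. -/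
def fixPath : Program :=
  .loop (.intLt (.const 1) (ireg 3))
    (.setInt 3 (.div (ireg 3) (.const 2)) ;;
    .setInt 4 (ild 0 (.mul (.const 2) (ireg 3))) ;;
    .setInt 5 (ild 0 (.add (.mul (.const 2) (ireg 3)) (.const 1))) ;;
    .cond (.disj (.intEq (ireg 4) (.const 0))
        (.conj (.neg (.intEq (ireg 5) (.const 0))) (itemLt (ireg 5) (ireg 4))))
      (ist 0 (ireg 3) (ireg 5)) (ist 0 (ireg 3) (ireg 4)))

theorem itemKey_congr {s s' : State} (h : s'.realMem = s.realMem) : itemKey s' = itemKey s := by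
  funext i
  simp only [itemKey, State.real, h]

theorem lexLt_ok {y u v y' u' v' : RealExpr} {s : State} (h1 : y.Ok M s) (h2 : u.Ok M s)
    (h3 : v.Ok M s) (h1' : y'.Ok M s) (h2' : u'.Ok M s) (h3' : v'.Ok M s) :
    (lexLt y u v y' u' v').Ok M s := by
  simp only [lexLt, tok_disj, tok_conj, tok_realLt, tok_realLe]
  tauto

theorem fixPath_runs (hM : 32 * N + 100 ≤ M)
    (hT : Tourn N (itemKey s) A (s.int 0) (s.intReg 3 / 2)) (h3 : s.intReg 3 < 2 ^ (K + 1))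
    (hN : N = 2 ^ K) (hz : ∀ v, 1 ≤ v → v < 2 * N → s.int 0 v < N) :
    Runs M fixPath s (fun τ s' => Tourn N (itemKey s) A (s'.int 0) 0 ∧ SortFrame s s' ∧
      (∀ v, 1 ≤ v → v < 2 * N → s'.int 0 v < N) ∧ τ ≤ 200 * (K + 1)) := by
  have h16 : 16 < M := by omega
  have mem : ∀ k < 16, ∀ a < 2 * N, ad k a < M := fun k hk a ha => by simp only [ad]; omega
  refine Runs.loop (I := fun r τ s' => s'.intReg 3 < 2 ^ (r + 1) ∧ s'.intReg 3 < 2 * N ∧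
    Tourn N (itemKey s) A (s'.int 0) (s'.intReg 3 / 2) ∧ SortFrame s s' ∧
    (∀ v, 1 ≤ v → v < 2 * N → s'.int 0 v < N) ∧ τ + 190 * r ≤ 190 * K) (r := K) ?_ ?_ ?_ ?_
  · intro r τ s' h
    simp
    omega
  · rintro r τ s' ⟨h3, h3N, hT, hf, hz, hτ⟩ hb
    have hb' : 1 < s'.intReg 3 := hb
    obtain ⟨r, rfl⟩ : ∃ r', r = r' + 1 := ⟨r - 1, by
      rcases r with - | r
      · rw [zero_add, pow_one] at h3; omega
      · rfl⟩
    set v := s'.intReg 3 / 2 with hv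
    have hvN : v < N := by omega
    have z1 := hz (2 * v) (by omega) (by omega)
    have z2 := hz (2 * v + 1) (by omega) (by omega)
    have hkey : itemKey s' = itemKey s := itemKey_congr hf.realMem
    have lt_iff : ∀ a b, key (s'.real 2 b) (s'.real 0 b) (s'.real 1 b) <
        key (s'.real 2 a) (s'.real 0 a) (s'.real 1 a) ↔ itemKey s b < itemKey s a := by
      intro a b
      rw [← hkey]
      rfl
    refine Runs.of_wp (wp_mono (Q := fun s'' => s''.realReg = s'.realReg ∧
      s''.realMem = s'.realMem ∧ (∀ i, i ≠ 3 → i ≠ 4 → i ≠ 5 → s''.intReg i = s'.intReg i) ∧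
      s''.intReg 3 = v ∧ s''.int 1 = s'.int 1 ∧ s''.int 0 = Function.update (s'.int 0) v
        (pick (itemKey s) (s'.int 0 (2 * v)) (s'.int 0 (2 * v + 1)))) ?_ ?_)
    · have ho : ∀ ir, (itemLt (ireg 5) (ireg 4)).Ok M ⟨ir, s'.realReg, s'.intMem, s'.realMem⟩ ↔
          (ad 2 (ir 5) < M ∧ ad 2 (ir 4) < M ∧ ad 0 (ir 5) < M ∧ ad 0 (ir 4) < M ∧
          ad 1 (ir 5) < M ∧ ad 1 (ir 4) < M) := by
        intro ir
        simp [itemLt, lexLt, h16]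
        tauto
      have hh : ∀ ir, (itemLt (ireg 5) (ireg 4)).Holds ⟨ir, s'.realReg, s'.intMem, s'.realMem⟩ ↔
          itemKey s (ir 5) < itemKey s (ir 4) := by
        intro ir
        rw [itemLt, lexLt_holds, ← lt_iff]
        rfl
      simp [wp, h16, mem, ← hv, hvN.trans_le (by omega : N ≤ 2 * N), ho, hh,
        show 2 * v < M by omega, show 2 * v + 1 < M by omega, show 2 < M by omega,
        show 1 < M by omega, show 0 < M by omega, show 2 * v < 2 * N by omega,
        show 2 * v + 1 < 2 * N by omega, show s'.int 0 (2 * v) < 2 * N by omega,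
        show s'.int 0 (2 * v + 1) < 2 * N by omega]
      refine ⟨fun hc => ⟨?_, ?_, ?_⟩, fun n1 hc => ⟨?_, ?_, ?_⟩⟩
      · intro i h1 h2 h3
        simp [h1, h2, h3]
      · simp [int_mk_update_ne]
      · rw [pick, if_pos (by tauto)]
      · intro i h1 h2 h3
        simp [h1, h2, h3]
      · simp [int_mk_update_ne]
      · rw [pick, if_neg]
        rintro (h | ⟨h, h'⟩)
        · exact n1 h
        · exact absurd h' (not_lt.2 (hc h))
    · rintro s'' ⟨e1, e2, e3, e4, e5, e6⟩ t ht
      have ht' := ht.trans (show _ ≤ 180 by decide)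
      have hp : ∀ a b, a < N → b < N → pick (itemKey s) a b < N := by
        intro a b ha hb
        unfold pick
        split_ifs <;> assumption
      refine ⟨r, Nat.lt_succ_self r, ?_, by omega, ?_, ?_, ?_, ?_⟩
      · rw [e4, hv]
        rw [pow_succ] at h3
        omega
      · rw [e4, e6]
        constructor
        · intro i hi
          rw [Function.update_of_ne (by omega)]
          exact hT.leaf i hi
        · intro w hw hwN hne
          rw [Function.update_of_ne (a := 2 * w) (by omega),
            Function.update_of_ne (a := 2 * w + 1) (by omega)]
          by_cases hwv : w = v
          · rw [hwv, Function.update_self]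
          · rw [Function.update_of_ne hwv]
            exact hT.node w hw hwN hwv
      · exact ⟨fun i hi => (e3 i (by omega) (by omega) (by omega)).trans (hf.intReg i hi),
          e1.trans hf.realReg, e2.trans hf.realMem, e5.trans hf.perm⟩
      · intro w hw hwN
        rw [e6]
        rcases eq_or_ne w v with rfl | hne
        · rw [Function.update_self]
          exact hp _ _ z1 z2
        · rw [Function.update_of_ne hne]
          exact hz w hw hwN
      · have c1 : (Test.intLt (.const 1) (ireg 3)).cost = 3 := rfl
        omega
  · rintro r τ s' ⟨h3, h3N, hT, hf, hz, hτ⟩ hb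
    have hb' : ¬ 1 < s'.intReg 3 := hb
    rw [show s'.intReg 3 / 2 = 0 by omega] at hT
    have c1 : (Test.intLt (.const 1) (ireg 3)).cost = 3 := rfl
    exact ⟨hT, hf, hz, by omega⟩
  · exact ⟨h3, by rw [pow_succ] at h3; omega, hT, ⟨fun _ _ => rfl, rfl, rfl, rfl⟩, hz, by omega⟩

theorem Tourn.update {i : ℕ} {B : Finset ℕ} (h : Tourn N κ A T 0) (hi : i < N) {e : ℕ}
    (he : e = if i ∈ B then i else 0) (hB : ∀ j, j ≠ i → (j ∈ B ↔ j ∈ A)) :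
    Tourn N κ B (Function.update T (N + i) e) ((N + i) / 2) := by
  constructor
  · intro j hj
    rcases eq_or_ne j i with rfl | hne
    · rw [Function.update_self, he]
    · rw [Function.update_of_ne (by omega), h.leaf j hj]
      simp only [hB j hne]
  · intro v hv hvN hne
    rw [Function.update_of_ne (by omega), Function.update_of_ne (by omega),
      Function.update_of_ne (by omega)]
    exact h.node v hv hvN (by omega)

/-- The items `p 1, …, p m` are the items `1, …, m` in the order of their keys. -/
structure Sorted (κ : ℕ → Key) (m : ℕ) (p : ℕ → ℕ) : Prop where
  mem : ∀ t, 1 ≤ t → t ≤ m → 1 ≤ p t ∧ p t ≤ m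
  lt : ∀ t t', 1 ≤ t → t < t' → t' ≤ m → κ (p t) ≤ κ (p t') ∧ p t ≠ p t'
  surj : ∀ i, 1 ≤ i → i ≤ m → ∃ t, 1 ≤ t ∧ t ≤ m ∧ p t = i

/-- Insert the items into the tournament tree. -/
def insertItems : Program :=
  .setInt 2 (ireg 11) ;;
  .loop (.intLt (.const 0) (ireg 2))
    ((.setInt 3 (.add (ireg 10) (ireg 2)) ;; ist 0 (ireg 3) (ireg 2)) ;;
    fixPath ;; .setInt 2 (.sub (ireg 2) (.const 1)))

/-- Extract the items from the tournament tree in the order of their keys. -/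
def extractItems : Program :=
  .setInt 2 (.const 0) ;;
  .loop (.neg (.intEq (ild 0 (.const 1)) (.const 0)))
    ((.setInt 2 (.add (ireg 2) (.const 1)) ;; .setInt 6 (ild 0 (.const 1)) ;;
    ist 1 (ireg 2) (ireg 6) ;; .setInt 3 (.add (ireg 10) (ireg 6)) ;; ist 0 (ireg 3) (.const 0)) ;;
    fixPath)

theorem insertItems_runs (hM : 32 * N + 100 ≤ M) (hN : N = 2 ^ K) (hm : m < N)
    (h10 : s.intReg 10 = N) (h11 : s.intReg 11 = m) (hz : ∀ v, 1 ≤ v → v < 2 * N → s.int 0 v = 0) :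
    Runs M insertItems s (fun τ s' => Tourn N (itemKey s) (Finset.Icc 1 m) (s'.int 0) 0 ∧
      (∀ v, 1 ≤ v → v < 2 * N → s'.int 0 v < N) ∧ (∀ i, 7 ≤ i → s'.intReg i = s.intReg i) ∧
      s'.realReg = s.realReg ∧ s'.realMem = s.realMem ∧ τ ≤ 250 * ((m + 1) * (K + 1))) := by
  have mem : ∀ k < 16, ∀ a < 2 * N, ad k a < M := fun k hk a ha => by simp only [ad]; omega
  have h16 : 16 < M := by omega
  refine Runs.seq_wp ⟨by simp, ?_⟩
  simp only [eval_reg, h11]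
  refine Runs.loop (I := fun r τ s' => r ≤ m ∧ s'.intReg 2 = r ∧
    Tourn N (itemKey s) (Finset.Ioc r m) (s'.int 0) 0 ∧
    (∀ v, 1 ≤ v → v < 2 * N → s'.int 0 v < N) ∧ (∀ i, 7 ≤ i → s'.intReg i = s.intReg i) ∧
    s'.realReg = s.realReg ∧ s'.realMem = s.realMem ∧ τ + (200 * (K + 1) + 40) * r ≤
      (200 * (K + 1) + 40) * m) (r := m) ?_ ?_ ?_ ?_
  · rintro r τ s' -
    simp
    omega
  · rintro r τ s' ⟨hr, h2, hT, hz, hi, hrr, hrm, hτ⟩ hb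
    obtain ⟨r, rfl⟩ : ∃ r', r = r' + 1 := ⟨r - 1, by have : 0 < s'.intReg 2 := hb; omega⟩
    have g10 : s'.intReg 10 = N := (hi 10 (by norm_num)).trans h10
    apply Runs.seq
    refine Runs.of_wp (wp_mono (Q := fun s'' => s'' = ⟨Function.update s'.intReg 3 (N + (r + 1)),
      s'.realReg, Function.update s'.intMem (ad 0 (N + (r + 1))) (r + 1), s'.realMem⟩) ?_ ?_)
    · simp [wp, h2, g10, h16, mem, show N + (r + 1) < M by omega,
        show N + (r + 1) < 2 * N by omega]
    rintro s'' rfl t ht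
    have ht' := ht.trans (show _ ≤ 20 by decide)
    apply Runs.seq
    refine (fixPath_runs (A := Finset.Ioc r m) (K := K) hM ?_ ?_ hN ?_).mono ?_
    · simp only [int_mk_update, int_mk, Function.update_self]
      rw [itemKey_congr (s := s) (by exact hrm)]
      refine hT.update (by omega) ?_ ?_
      · rw [if_pos (Finset.mem_Ioc.2 ⟨by omega, hr⟩)]
      · intro j hj
        simp only [Finset.mem_Ioc]
        omega
    · simp [pow_succ, ← hN]
      omega
    · intro v hv hvN
      simp only [int_mk_update, int_mk]
      rcases eq_or_ne v (N + (r + 1)) with rfl | hne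
      · rw [Function.update_self]
        omega
      · rw [Function.update_of_ne hne]
        exact hz v hv hvN
    rintro t2 s2 ⟨hT2, hf, hz2, ht2⟩
    have g2 : s2.intReg 2 = r + 1 := by
      rw [hf.intReg 2 (.inl rfl)]
      simp [h2]
    refine Runs.of_wp ⟨by simp; omega, fun t3 ht3 => ⟨r, Nat.lt_succ_self r, by omega, by simp [g2],
      ?_, hz2, ?_, hf.realReg.trans hrr, hf.realMem.trans hrm, ?_⟩⟩
    · rw [itemKey_congr (s := s) (by exact hrm)] at hT2
      exact hT2
    · intro i h7
      have := hf.intReg i (.inr (by omega))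
      simp [show i ≠ 2 by omega, this, show i ≠ 3 by omega, hi i h7]
    · have c1 : (Test.intLt (.const 0) (ireg 2)).cost = 3 := rfl
      have ht3' := ht3.trans (show _ ≤ 10 by decide)
      rw [mul_add _ r] at hτ
      omega
  · rintro r τ s' ⟨hr, h2, hT, hz, hi, hrr, hrm, hτ⟩ hb t ht
    obtain rfl : r = 0 := by
      have : ¬ 0 < s'.intReg 2 := hb
      omega
    refine ⟨hT, hz, hi, hrr, hrm, ?_⟩
    have c1 : (Test.intLt (.const 0) (ireg 2)).cost = 3 := rfl
    have ht' := ht.trans (show _ ≤ 10 by decide)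
    have e1 : 250 * ((m + 1) * (K + 1)) = (200 * (K + 1) + 40) * m + (50 * K + 10) * m +
      250 * (K + 1) := by ring
    omega
  · refine ⟨le_rfl, by simp, ?_, fun v hv hvN => ?_, fun i hi => ?_, rfl, rfl, by omega⟩
    · rw [Finset.Ioc_self]
      constructor
      · intro i hi
        simp only [int_mk, Finset.notMem_empty, if_false]
        exact hz _ (by omega) (by omega)
      · intro v hv hvN _
        simp only [int_mk]
        rw [hz v hv (by omega), hz (2 * v) (by omega) (by omega),
          hz (2 * v + 1) (by omega) (by omega)]
        simp [pick]
    · simp only [int_mk]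
      rw [hz v hv hvN]
      omega
    · exact Function.update_of_ne (by omega) _ _

theorem extractItems_runs (hM : 32 * N + 100 ≤ M) (hN : N = 2 ^ K) (hm : m < N)
    (h10 : s.intReg 10 = N) (hT : Tourn N (itemKey s) (Finset.Icc 1 m) (s.int 0) 0)
    (hz : ∀ v, 1 ≤ v → v < 2 * N → s.int 0 v < N) :
    Runs M extractItems s (fun τ s' => Sorted (itemKey s) m (s'.int 1) ∧
      (∀ v, 1 ≤ v → v < 2 * N → s'.int 0 v = 0) ∧ (∀ i, 7 ≤ i → s'.intReg i = s.intReg i) ∧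
      s'.realReg = s.realReg ∧ s'.realMem = s.realMem ∧ τ ≤ 300 * ((m + 1) * (K + 1))) := by
  have mem : ∀ k < 16, ∀ a < 2 * N, ad k a < M := fun k hk a ha => by simp only [ad]; omega
  have h16 : 16 < M := by omega
  refine Runs.seq_wp ⟨by simp; omega, ?_⟩
  simp only [eval_const]
  refine Runs.loop (I := fun r τ s' => ∃ A ⊆ Finset.Icc 1 m, A.card = r ∧ s'.intReg 2 + r = m ∧
    Tourn N (itemKey s) A (s'.int 0) 0 ∧
    (∀ t, 1 ≤ t → t ≤ s'.intReg 2 → (1 ≤ s'.int 1 t ∧ s'.int 1 t ≤ m) ∧ s'.int 1 t ∉ A ∧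
      ∀ i ∈ A, itemKey s (s'.int 1 t) ≤ itemKey s i) ∧
    (∀ t t', 1 ≤ t → t < t' → t' ≤ s'.intReg 2 →
      itemKey s (s'.int 1 t) ≤ itemKey s (s'.int 1 t') ∧ s'.int 1 t ≠ s'.int 1 t') ∧
    (∀ i, 1 ≤ i → i ≤ m → i ∉ A → ∃ t, 1 ≤ t ∧ t ≤ s'.intReg 2 ∧ s'.int 1 t = i) ∧
    (∀ v, 1 ≤ v → v < 2 * N → s'.int 0 v < N) ∧ (∀ i, 7 ≤ i → s'.intReg i = s.intReg i) ∧
    s'.realReg = s.realReg ∧ s'.realMem = s.realMem ∧ τ + (200 * (K + 1) + 60) * r ≤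
      (200 * (K + 1) + 60) * m) (r := m) ?_ ?_ ?_ ?_
  · rintro r τ s' -
    simp [h16, mem 0 (by norm_num) 1 (by omega)]
    omega
  · rintro r τ s' ⟨A, hA, hc, h2, hT, hold, hlt, hsurj, hz, hi, hrr, hrm, hτ⟩ hb
    have hA' : ∀ i ∈ A, 1 ≤ i ∧ i < N := fun i hi => by
      have := Finset.mem_Icc.1 (hA hi)
      omega
    set x := s'.int 0 1 with hx
    have hxA : x ∈ A := hT.mem le_rfl (by omega) hb
    have hxm := Finset.mem_Icc.1 (hA hxA)
    have hmin := fun i hi => (hT.le hN hA' (i := i) hi).2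
    have hcard := Finset.card_erase_of_mem hxA
    have hpos := Finset.card_pos.2 ⟨x, hxA⟩
    have g10 : s'.intReg 10 = N := (hi 10 (by norm_num)).trans h10
    set n := s'.intReg 2 with hn
    apply Runs.seq
    refine Runs.of_wp (wp_mono (Q := fun s'' => (∀ i, 7 ≤ i → s''.intReg i = s'.intReg i) ∧
      s''.intReg 2 = n + 1 ∧ s''.intReg 3 = N + x ∧ s''.realReg = s'.realReg ∧
      s''.realMem = s'.realMem ∧ s''.int 1 = Function.update (s'.int 1) (n + 1) x ∧
      s''.int 0 = Function.update (s'.int 0) (N + x) 0) ?_ ?_)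
    · simp [wp, ← hn, ← hx, g10, h16, mem, show N + x < M by omega, show n + 1 < M by omega,
        show N + x < 2 * N by omega, show n + 1 < 2 * N by omega, show 1 < M by omega,
        show 0 < M by omega, show 1 < 2 * N by omega]
      refine ⟨?_, ?_, ?_⟩
      · intro i h7
        simp [show i ≠ 2 by omega, show i ≠ 3 by omega, show i ≠ 6 by omega]
      · simp [int_mk_update_ne]
      · simp [int_mk_update_ne]
    rintro s1 ⟨e1, e2, e3, e4, e5, e6, e7⟩ t ht
    have ht' := ht.trans (show _ ≤ 36 by decide)
    have hkey1 : itemKey s1 = itemKey s := itemKey_congr (e5.trans hrm)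
    refine (fixPath_runs (A := A.erase x) (K := K) hM ?_ ?_ hN ?_).mono ?_
    · rw [hkey1, e7, e3]
      refine hT.update (by omega) ?_ ?_
      · rw [if_neg (Finset.notMem_erase _ _)]
      · intro j hj
        simp [hj]
    · rw [e3, pow_succ, ← hN]
      omega
    · intro v hv hvN
      rw [e7]
      rcases eq_or_ne v (N + x) with rfl | hne
      · rw [Function.update_self]
        omega
      · rw [Function.update_of_ne hne]
        exact hz v hv hvN
    rintro t2 s2 ⟨hT2, hf, hz2, ht2⟩
    have g2 : s2.intReg 2 = n + 1 := (hf.intReg 2 (.inl rfl)).trans e2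
    have gp : s2.int 1 = Function.update (s'.int 1) (n + 1) x := hf.perm.trans e6
    have gold : ∀ t, t ≤ n → s2.int 1 t = s'.int 1 t := fun t ht => by
      rw [gp, Function.update_of_ne (by omega)]
    have gnew : s2.int 1 (n + 1) = x := by rw [gp, Function.update_self]
    rw [hkey1] at hT2
    refine ⟨r - 1, by omega, A.erase x, (Finset.erase_subset _ _).trans hA, by omega, by omega,
      hT2, ?_, ?_, ?_, hz2, ?_, hf.realReg.trans (e4.trans hrr), hf.realMem.trans (e5.trans hrm),
      ?_⟩
    · intro t h1 h2
      rcases (show t = n + 1 ∨ t ≤ n by omega) with rfl | h2'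
      · rw [gnew]
        exact ⟨hxm, Finset.notMem_erase _ _, fun i hi => hmin i (Finset.mem_of_mem_erase hi)⟩
      · rw [gold t h2']
        obtain ⟨o1, o2, o3⟩ := hold t h1 h2'
        exact ⟨o1, fun h => o2 (Finset.mem_of_mem_erase h),
          fun i hi => o3 i (Finset.mem_of_mem_erase hi)⟩
    · intro t t' h1 h2 h3
      rw [gold t (by omega)]
      rcases (show t' = n + 1 ∨ t' ≤ n by omega) with rfl | h3'
      · rw [gnew]
        obtain ⟨o1, o2, o3⟩ := hold t h1 (by omega)
        exact ⟨o3 x hxA, fun h => o2 (h ▸ hxA)⟩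
      · rw [gold t' h3']
        exact hlt t t' h1 h2 h3'
    · intro i h1 h2 h3
      by_cases hix : i = x
      · exact ⟨n + 1, by omega, by omega, gnew.trans hix.symm⟩
      · obtain ⟨t, t1, t2, t3⟩ := hsurj i h1 h2 fun h => h3 (Finset.mem_erase.2 ⟨hix, h⟩)
        exact ⟨t, t1, by omega, (gold t t2).trans t3⟩
    · intro i h7
      rw [hf.intReg i (.inr (by omega)), e1 i h7, hi i h7]
    · have c1 : (Test.neg (.intEq (ild 0 (.const 1)) (.const 0))).cost = 9 := rfl
      obtain ⟨r, rfl⟩ : ∃ r', r = r' + 1 := ⟨r - 1, by omega⟩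
      rw [mul_add _ r] at hτ
      rw [Nat.add_sub_cancel]
      omega
  · rintro r τ s' ⟨A, hA, hc, h2, hT, hold, hlt, hsurj, hz, hi, hrr, hrm, hτ⟩ hb t ht
    have h0 : s'.int 0 1 = 0 := by
      by_contra h
      exact hb h
    obtain rfl : A = ∅ := by
      rw [Finset.eq_empty_iff_forall_notMem]
      intro i hiA
      refine (hT.le hN (fun i hi => ?_) hiA).1 h0
      have := Finset.mem_Icc.1 (hA hi)
      omega
    rw [Finset.card_empty] at hc
    obtain rfl := hc
    rw [add_zero] at h2
    rw [h2] at hold hlt hsurj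
    refine ⟨⟨fun t h1 h2 => (hold t h1 h2).1, hlt, fun i h1 h2 => hsurj i h1 h2 (by simp)⟩,
      fun v hv hvN => hT.zero hv hvN, hi, hrr, hrm, ?_⟩
    have c1 : (Test.neg (.intEq (ild 0 (.const 1)) (.const 0))).cost = 9 := rfl
    have ht' := ht.trans (show _ ≤ 10 by decide)
    have e1 : 300 * ((m + 1) * (K + 1)) = (200 * (K + 1) + 60) * m + (100 * K + 40) * m +
      300 * (K + 1) := by ring
    omega
  · refine ⟨Finset.Icc 1 m, Finset.Subset.refl _, by simp, by simp, by simpa using hT, ?_, ?_, ?_,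
      hz, fun i hi => Function.update_of_ne (by omega) _ _, rfl, rfl, by omega⟩
    · intro t h1 h2
      simp at h2
      omega
    · intro t t' h1 h2 h3
      simp at h3
      omega
    · intro i h1 h2 h3
      exact absurd (Finset.mem_Icc.2 ⟨h1, h2⟩) h3

/-- Sort the items. -/
def sortItems : Program := insertItems ;; extractItems

theorem sortItems_runs (hM : 32 * N + 100 ≤ M) (hN : N = 2 ^ K) (hm : m < N)
    (h10 : s.intReg 10 = N) (h11 : s.intReg 11 = m) (hz : ∀ v, 1 ≤ v → v < 2 * N → s.int 0 v = 0) :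
    Runs M sortItems s (fun τ s' => Sorted (itemKey s) m (s'.int 1) ∧
      (∀ v, 1 ≤ v → v < 2 * N → s'.int 0 v = 0) ∧ (∀ i, 7 ≤ i → s'.intReg i = s.intReg i) ∧
      s'.realReg = s.realReg ∧ s'.realMem = s.realMem ∧ τ ≤ 550 * ((m + 1) * (K + 1))) := by
  apply Runs.seq
  refine (insertItems_runs hM hN hm h10 h11 hz).mono ?_
  rintro t s1 ⟨hT, hz1, hi, hrr, hrm, ht⟩
  rw [← itemKey_congr hrm] at hT ⊢
  refine (extractItems_runs hM hN hm ((hi 10 (by norm_num)).trans h10) hT hz1).mono ?_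
  rintro t' s2 ⟨hS, hz2, hi', hrr', hrm', ht'⟩
  exact ⟨hS, hz2, fun i h => (hi' i h).trans (hi i h), hrr'.trans hrr, hrm'.trans hrm, by omega⟩

end UnitDisk

namespace UnitDisk

/-! ### Directions, rows and cells -/

/-- The abscissa of the point `(x, y)` in the frame of the direction `d`. -/
noncomputable def frameU (d : ℕ) (x y : ℝ) : ℝ := if d < 2 then x else y

/-- The ordinate of the point `(x, y)` in the frame of the direction `d`.  The four directions are
up, down, right and left; multiples of `G` keep them apart. -/
noncomputable def frameV (G : ℝ) (d : ℕ) (x y : ℝ) : ℝ :=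
  if d = 0 then y else if d = 1 then G - y else if d = 2 then 2 * G + x else 3 * G - x

/-- A bound for the coordinates for which the directions are kept apart by `G`. -/
structure Apart (lam G : ℝ) (n : ℕ) (X Y : ℕ → ℝ) : Prop where
  pos : 0 < lam
  sep : ∀ j < n, ∀ j' < n, |X j| + |X j'| + 3 * lam ≤ G ∧ |X j| + |Y j'| + 3 * lam ≤ G ∧
    |Y j| + |Y j'| + 3 * lam ≤ G

theorem Apart.frameV_sep {lam G : ℝ} {n : ℕ} {X Y : ℕ → ℝ} (h : Apart lam G n X Y) {j j' d d' : ℕ}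
    (hj : j < n) (hj' : j' < n) (hd' : d' < 4) (hdd : d < d') :
    frameV G d (X j) (Y j) + 3 * lam ≤ frameV G d' (X j') (Y j') := by
  obtain ⟨a1, a2, a3⟩ := h.sep j hj j' hj'
  obtain ⟨b1, b2, b3⟩ := h.sep j' hj' j hj
  have hp := h.pos
  have x1 := abs_le.1 (le_refl |X j|)
  have x2 := abs_le.1 (le_refl |X j'|)
  have y1 := abs_le.1 (le_refl |Y j|)
  have y2 := abs_le.1 (le_refl |Y j'|)
  have : 0 ≤ |X j| := abs_nonneg _
  have : 0 ≤ |X j'| := abs_nonneg _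
  have : 0 ≤ |Y j| := abs_nonneg _
  have : 0 ≤ |Y j'| := abs_nonneg _
  have hd : d < 3 := by omega
  interval_cases d' <;> interval_cases d <;> simp [frameV] <;> linarith

theorem Apart.dir_eq {lam G : ℝ} {n : ℕ} {X Y : ℕ → ℝ} (h : Apart lam G n X Y) {j j' d d' : ℕ}
    (hj : j < n) (hj' : j' < n) (hd : d < 4) (hd' : d' < 4)
    (h1 : frameV G d (X j) (Y j) < frameV G d' (X j') (Y j') + 3 * lam)
    (h2 : frameV G d' (X j') (Y j') < frameV G d (X j) (Y j) + 3 * lam) : d = d' := by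
  rcases lt_trichotomy d d' with hlt | heq | hgt
  · exact absurd (h.frameV_sep hj hj' hd' hlt) (not_le.2 h2)
  · exact heq
  · exact absurd (h.frameV_sep hj' hj hd hgt) (not_le.2 h1)

theorem frame_inj {G : ℝ} {d : ℕ} {x y x' y' : ℝ}
    (hu : frameU d x y = frameU d x' y') (hv : frameV G d x y = frameV G d x' y') :
    x = x' ∧ y = y' := by
  simp only [frameU, frameV] at hu hv
  split_ifs at hu hv <;> first
    | exact ⟨hu, hv⟩
    | exact ⟨by linarith, by linarith⟩
    | omega

section Greedy

open Classical in
/-- Greedy intervals of length `h`: `greedy h κ x t` is the left end of the interval of `x t`.  An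
interval ends where the key `κ` changes. -/
noncomputable def greedy (h : ℝ) (κ x : ℕ → ℝ) : ℕ → ℝ
  | 0 => 0
  | t + 1 => if t ≠ 0 ∧ κ t = κ (t + 1) ∧ x (t + 1) ≤ greedy h κ x t + h then greedy h κ x t
      else x (t + 1)

open Classical in
/-- A place on a line for each greedy interval; places of different intervals have distance `g`. -/
noncomputable def place (g h : ℝ) (κ x : ℕ → ℝ) : ℕ → ℝ
  | 0 => 0
  | t + 1 => if t ≠ 0 ∧ κ t = κ (t + 1) ∧ x (t + 1) ≤ greedy h κ x t + h then place g h κ x t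
      else place g h κ x t + g

variable {g h : ℝ} {κ x : ℕ → ℝ} {m : ℕ}

theorem greedy_mem (hh : 0 ≤ h) (hx : ∀ t, 1 ≤ t → t < m → κ t = κ (t + 1) → x t ≤ x (t + 1))
    {t : ℕ} (ht : 1 ≤ t) (htm : t ≤ m) : greedy h κ x t ≤ x t ∧ x t ≤ greedy h κ x t + h := by
  induction t, ht using Nat.le_induction with
  | base => simp [greedy, hh]
  | succ t ht ih =>
    rw [greedy]
    split_ifs with hc
    · exact ⟨(ih (by omega)).1.trans (hx t ht htm hc.2.1), hc.2.2⟩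
    · exact ⟨le_rfl, by linarith⟩

/-- Two abscissae belong to the same greedy interval, or their places have distance at least `g`. -/
theorem greedy_place (hg : 0 ≤ g) (hh : 0 ≤ h)
    (hκ : ∀ t t', 1 ≤ t → t < t' → t' ≤ m → κ t ≤ κ t') {t t' : ℕ} (ht : 1 ≤ t) (htt : t < t')
    (htm : t' ≤ m) :
    (κ t = κ t' ∧ greedy h κ x t = greedy h κ x t' ∧ place g h κ x t = place g h κ x t') ∨
      (place g h κ x t + g ≤ place g h κ x t' ∧
        (κ t = κ t' → greedy h κ x t + h < greedy h κ x t')) := by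
  induction t', htt using Nat.le_induction with
  | base =>
    rw [greedy, place]
    split_ifs with hc
    · exact .inl ⟨hc.2.1, rfl, rfl⟩
    · exact .inr ⟨le_rfl, fun he => not_le.1 fun h => hc ⟨by omega, he, h⟩⟩
  | succ t' htt ih =>
    have hb := hκ t' (t' + 1) (by omega) (by omega) htm
    have ha := hκ t t' ht htt (by omega)
    rw [greedy, place]
    split_ifs with hc
    · rw [← hc.2.1]
      exact ih (by omega)
    · refine .inr ⟨?_, fun he => ?_⟩
      · rcases ih (by omega) with ⟨-, -, h3⟩ | ⟨h3, -⟩ <;> linarith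
      · have hk : κ t' = κ (t' + 1) := le_antisymm hb (he ▸ ha)
        have h1 : greedy h κ x t' + h < x (t' + 1) := not_le.1 fun h => hc ⟨by omega, hk, h⟩
        rcases ih (by omega) with ⟨-, h2, -⟩ | ⟨-, h2⟩
        · linarith
        · linarith [h2 (he.trans hk.symm)]

end Greedy

/-- The positions `1, …, 4 n` carry the `n` points in the four directions, in lexicographic order
and divided into rows and cells. -/
structure Layout (lam G : ℝ) (n : ℕ) (X Y : ℕ → ℝ) (f : ℕ → ℕ → ℝ) (org dir : ℕ → ℕ) : Prop where
  org_lt : ∀ t, 1 ≤ t → t ≤ 4 * n → org t < n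
  dir_lt : ∀ t, 1 ≤ t → t ≤ 4 * n → dir t < 4
  u : ∀ t, 1 ≤ t → t ≤ 4 * n → f 9 t = frameU (dir t) (X (org t)) (Y (org t))
  v : ∀ t, 1 ≤ t → t ≤ 4 * n → f 10 t = frameV G (dir t) (X (org t)) (Y (org t))
  ox : ∀ t, 1 ≤ t → t ≤ 4 * n → f 13 t = X (org t)
  oy : ∀ t, 1 ≤ t → t ≤ 4 * n → f 14 t = Y (org t)
  row : ∀ t, 1 ≤ t → t ≤ 4 * n → f 11 t ≤ f 10 t ∧ f 10 t ≤ f 11 t + lam / 10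
  cell : ∀ t, 1 ≤ t → t ≤ 4 * n → f 12 t ≤ f 9 t ∧ f 9 t ≤ f 12 t + lam / 10
  s : ∀ t, 1 ≤ t → t ≤ 4 * n → f 5 t = f 9 t - f 12 t
  w : ∀ t, 1 ≤ t → t ≤ 4 * n → f 6 t = f 10 t - f 11 t
  rank : ∀ t, 1 ≤ t → t ≤ 4 * n → f 8 t = t
  sorted : ∀ t t', 1 ≤ t → t < t' → t' ≤ 4 * n →
    key (f 11 t) (f 9 t) (f 10 t) < key (f 11 t') (f 9 t') (f 10 t')
  rows : ∀ t t', 1 ≤ t → t ≤ 4 * n → 1 ≤ t' → t' ≤ 4 * n → f 11 t < f 11 t' →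
    f 11 t + lam / 10 < f 11 t'
  cells : ∀ t t', 1 ≤ t → t < t' → t' ≤ 4 * n →
    (f 11 t = f 11 t' ∧ f 12 t = f 12 t' ∧ f 7 t = f 7 t') ∨
      (f 7 t + 10 * lam ≤ f 7 t' ∧ (f 11 t = f 11 t' → f 12 t + lam / 10 < f 12 t'))
  surj : ∀ j < n, ∀ d < 4, ∃ t, 1 ≤ t ∧ t ≤ 4 * n ∧ org t = j ∧ dir t = d

/-- The functions of the positions. -/
noncomputable def posFun (lam S : ℝ) (f : ℕ → ℕ → ℝ) (t : ℕ) : ℝ → ℝ :=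
  arcFun lam S (f 5 t) (f 6 t) (f 7 t) (f 8 t)

section Layout

variable {lam G : ℝ} {n : ℕ} {X Y : ℕ → ℝ} {f f' : ℕ → ℕ → ℝ} {org dir : ℕ → ℕ}

theorem Layout.congr (h : Layout lam G n X Y f org dir) (hf : ∀ k < 15, f' k = f k) :
    Layout lam G n X Y f' org dir := by
  obtain ⟨h1, h2, h3, h4, h5, h6, h7, h8, h9, h10, h11, h12, h13, h14, h15⟩ := h
  constructor <;> try simp only [hf 5 (by norm_num), hf 6 (by norm_num), hf 7 (by norm_num),
    hf 8 (by norm_num), hf 9 (by norm_num), hf 10 (by norm_num), hf 11 (by norm_num),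
    hf 12 (by norm_num), hf 13 (by norm_num), hf 14 (by norm_num)]
  all_goals assumption

theorem Layout.singleCrossing (h : Layout lam G n X Y f org dir) (hl : 0 < lam) :
    SingleCrossing {a | 1 ≤ a ∧ a ≤ 4 * n} (posFun lam (4 * n + 1) f) fun a b =>
      arcCross lam (4 * n + 1) (f 5 a) (f 6 a) (f 7 a) (f 8 a) (f 5 b) (f 6 b) (f 7 b) (f 8 b) := by
  rintro a ⟨a1, a2⟩ b ⟨b1, b2⟩ hab
  have ra := h.row a a1 a2
  have rb := h.row b b1 b2
  have ca := h.cell a a1 a2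
  have cb := h.cell b b1 b2
  have hb2 : (b : ℝ) ≤ 4 * n := by exact_mod_cast b2
  have ha1 : (1 : ℝ) ≤ a := by exact_mod_cast a1
  have hab' : (a : ℝ) < b := by exact_mod_cast hab
  refine arcFun_cross (w := f 6 a) (w' := f 6 b) ⟨hl, ?_, ?_, ?_, ?_, ?_, ?_, ?_, ?_, ?_, ?_, ?_, ?_⟩
  · rw [h.s a a1 a2]; linarith
  · rw [h.s a a1 a2]; linarith
  · rw [h.w a a1 a2]; linarith
  · rw [h.w a a1 a2]; linarith
  · rw [h.s b b1 b2]; linarith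
  · rw [h.s b b1 b2]; linarith
  · rw [h.w b b1 b2]; linarith
  · rw [h.w b b1 b2]; linarith
  · rw [h.rank a a1 a2]; exact ha1
  · rw [h.rank b b1 b2]; linarith
  · rw [h.rank a a1 a2, h.rank b b1 b2]; exact hab'
  · refine (h.cells a b a1 hab b2).imp (fun ⟨e1, e2, e3⟩ => ⟨e3, ?_⟩) And.left
    have hk := h.sorted a b a1 hab b2
    rw [key_lt, e1] at hk
    rw [h.s a a1 a2, h.s b b1 b2, h.w a a1 a2, h.w b b1 b2, e1, e2]
    rcases hk with hk | ⟨-, hk | ⟨hk, hk'⟩⟩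
    · exact absurd hk (lt_irrefl _)
    · left; linarith
    · right
      refine ⟨by rw [hk], fun h => ?_⟩
      linarith

/-- The layout that results from sorting and from the greedy division into rows and cells. -/
theorem Layout.of_sorted (hA : Apart lam G n X Y)
    (hinj : ∀ j < n, ∀ j' < n, X j = X j' → Y j = Y j' → j = j') {U V R : ℕ → ℝ} {p : ℕ → ℕ}
    (hU : ∀ i, 1 ≤ i → i ≤ 4 * n → U i = frameU ((i - 1) % 4) (X ((i - 1) / 4)) (Y ((i - 1) / 4)))
    (hV : ∀ i, 1 ≤ i → i ≤ 4 * n →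
      V i = frameV G ((i - 1) % 4) (X ((i - 1) / 4)) (Y ((i - 1) / 4)))
    (hR : ∀ i, 1 ≤ i → i ≤ 4 * n → R i ≤ V i ∧ V i ≤ R i + lam / 10)
    (hR' : ∀ i j, 1 ≤ i → i ≤ 4 * n → 1 ≤ j → j ≤ 4 * n → R i < R j → R i + lam / 10 < R j)
    (hp : Sorted (fun i => key (R i) (U i) (V i)) (4 * n) p)
    (h9 : ∀ t, 1 ≤ t → t ≤ 4 * n → f 9 t = U (p t)) (h10 : ∀ t, 1 ≤ t → t ≤ 4 * n → f 10 t = V (p t))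
    (h11 : ∀ t, 1 ≤ t → t ≤ 4 * n → f 11 t = R (p t))
    (h12 : ∀ t, 1 ≤ t → t ≤ 4 * n → f 12 t = greedy (lam / 10) (R ∘ p) (U ∘ p) t)
    (h7 : ∀ t, 1 ≤ t → t ≤ 4 * n → f 7 t = place (10 * lam) (lam / 10) (R ∘ p) (U ∘ p) t)
    (h13 : ∀ t, 1 ≤ t → t ≤ 4 * n → f 13 t = X ((p t - 1) / 4))
    (h14 : ∀ t, 1 ≤ t → t ≤ 4 * n → f 14 t = Y ((p t - 1) / 4))
    (h5 : ∀ t, 1 ≤ t → t ≤ 4 * n → f 5 t = f 9 t - f 12 t)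
    (h6 : ∀ t, 1 ≤ t → t ≤ 4 * n → f 6 t = f 10 t - f 11 t)
    (h8 : ∀ t, 1 ≤ t → t ≤ 4 * n → f 8 t = t) :
    Layout lam G n X Y f (fun t => (p t - 1) / 4) (fun t => (p t - 1) % 4) := by
  have hl := hA.pos
  have hlt : ∀ t t', 1 ≤ t → t < t' → t' ≤ 4 * n →
      key (R (p t)) (U (p t)) (V (p t)) < key (R (p t')) (U (p t')) (V (p t')) := by
    intro t t' h1 h2 h3
    obtain ⟨a, b⟩ := hp.lt t t' h1 h2 h3
    refine lt_of_le_of_ne a fun he => b ?_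
    obtain ⟨m1, m2⟩ := hp.mem t h1 (by omega)
    obtain ⟨m1', m2'⟩ := hp.mem t' (by omega) h3
    have he' : R (p t) = R (p t') ∧ U (p t) = U (p t') ∧ V (p t) = V (p t') := by
      simpa [key] using he
    obtain ⟨-, e2, e3⟩ := he'
    rw [hU _ m1 m2, hU _ m1' m2'] at e2
    rw [hV _ m1 m2, hV _ m1' m2'] at e3
    have hd : (p t - 1) % 4 = (p t' - 1) % 4 :=
      hA.dir_eq (j := (p t - 1) / 4) (j' := (p t' - 1) / 4) (by omega) (by omega) (by omega)
        (by omega) (by rw [e3]; linarith)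
        (by rw [e3]; linarith)
    rw [hd] at e2 e3
    obtain ⟨f1, f2⟩ := frame_inj e2 e3
    have := hinj ((p t - 1) / 4) (by omega) ((p t' - 1) / 4) (by omega) f1 f2
    omega
  have hle : ∀ t t', 1 ≤ t → t < t' → t' ≤ 4 * n → (R ∘ p) t ≤ (R ∘ p) t' := by
    intro t t' h1 h2 h3
    have := hlt t t' h1 h2 h3
    rw [key_lt] at this
    exact this.elim le_of_lt fun h => h.1.le
  have hUle : ∀ t, 1 ≤ t → t < 4 * n → (R ∘ p) t = (R ∘ p) (t + 1) → (U ∘ p) t ≤ (U ∘ p) (t + 1) := by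
    intro t h1 h2 h3
    have := hlt t (t + 1) h1 (by omega) h2
    rw [key_lt] at this
    rcases this with h | ⟨-, h | h⟩
    · exact absurd h3 h.ne
    · exact h.le
    · exact h.1.le
  constructor
  · intro t h1 h2
    have := hp.mem t h1 h2
    omega
  · intro t h1 h2
    omega
  · intro t h1 h2
    rw [h9 t h1 h2, hU _ (hp.mem t h1 h2).1 (hp.mem t h1 h2).2]
  · intro t h1 h2
    rw [h10 t h1 h2, hV _ (hp.mem t h1 h2).1 (hp.mem t h1 h2).2]
  · exact h13
  · exact h14
  · intro t h1 h2
    rw [h10 t h1 h2, h11 t h1 h2]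
    exact hR _ (hp.mem t h1 h2).1 (hp.mem t h1 h2).2
  · intro t h1 h2
    rw [h9 t h1 h2, h12 t h1 h2]
    exact greedy_mem (by linarith) hUle h1 h2
  · exact h5
  · exact h6
  · exact h8
  · intro t t' h1 h2 h3
    rw [h9 t h1 (by omega), h10 t h1 (by omega), h11 t h1 (by omega), h9 t' (by omega) h3,
      h10 t' (by omega) h3, h11 t' (by omega) h3]
    exact hlt t t' h1 h2 h3
  · intro t t' h1 h2 h3 h4
    rw [h11 t h1 h2, h11 t' h3 h4]
    exact hR' _ _ (hp.mem t h1 h2).1 (hp.mem t h1 h2).2 (hp.mem t' h3 h4).1 (hp.mem t' h3 h4).2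
  · intro t t' h1 h2 h3
    rw [h11 t h1 (by omega), h11 t' (by omega) h3, h12 t h1 (by omega), h12 t' (by omega) h3,
      h7 t h1 (by omega), h7 t' (by omega) h3]
    exact greedy_place (by linarith) (by linarith) hle h1 h2 h3
  · intro j hj d hd
    obtain ⟨t, h1, h2, h3⟩ := hp.surj (4 * j + d + 1) (by omega) (by omega)
    exact ⟨t, h1, h2, by rw [h3]; omega, by rw [h3]; omega⟩

end Layout

end UnitDisk

namespace UnitDisk

/-! ### The construction: items -/

variable {M N K m n : ℕ} {lam G : ℝ} {X Y : ℕ → ℝ} {s : State}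

/-- The real registers `2` and `3` get the coordinates of the point in the real registers `0` and
`1` in the frame of the direction in integer register `4`. -/
def frame : Program :=
  .cond (.intLt (ireg 4) (.const 2)) (.setReal 2 (rreg 0)) (.setReal 2 (rreg 1)) ;;
  .cond (.intEq (ireg 4) (.const 0)) (.setReal 3 (rreg 1))
    (.cond (.intEq (ireg 4) (.const 1)) (.setReal 3 (.sub (rreg 11) (rreg 1)))
      (.cond (.intEq (ireg 4) (.const 2))
        (.setReal 3 (.add (.mul (.const 2) (rreg 11)) (rreg 0)))
        (.setReal 3 (.sub (.mul (.const 3) (rreg 11)) (rreg 0)))))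

theorem frame_wp {Q : State → Prop} (hM : 16 < M)
    (h : Q ⟨s.intReg, Function.update (Function.update s.realReg 2
      (frameU (s.intReg 4) (s.realReg 0) (s.realReg 1))) 3
      (frameV (s.realReg 11) (s.intReg 4) (s.realReg 0) (s.realReg 1)), s.intMem, s.realMem⟩) :
    wp M frame s Q := by
  refine wp_mono (Q := fun s' => s' = _) ?_ (fun s' hs' => hs' ▸ h)
  simp [frame, wp, show 0 < M by omega, show 1 < M by omega, show 2 < M by omega]
  simp only [frameU, frameV]
  grind

/-- The coordinates of the points are stored one after the other, and the memory suffices. -/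
structure Coords (M n : ℕ) (X Y : ℕ → ℝ) (s : State) : Prop where
  mem : 2 * n + 20 ≤ M
  x : ∀ j < n, s.realMem (2 * j) = X j
  y : ∀ j < n, s.realMem (2 * j + 1) = Y j

/-- Move the arguments into place and find a number that keeps the directions apart. -/
def initParams : Program :=
  (.setReal 10 (rreg 0) ;; .setInt 11 (.mul (.const 4) (ireg 0)) ;; .setReal 11 (.const 0) ;;
  .setInt 2 (ireg 0)) ;;
  .loop (.intLt (.const 0) (ireg 2))
    (.setInt 2 (.sub (ireg 2) (.const 1)) ;;
    .setReal 0 (.load (.mul (.const 2) (ireg 2))) ;;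
    .setReal 1 (.load (.add (.mul (.const 2) (ireg 2)) (.const 1))) ;;
    .setReal 11 (.add (rreg 11) (.add (.sqrt (.mul (rreg 0) (rreg 0)))
      (.sqrt (.mul (rreg 1) (rreg 1)))))) ;;
  .setReal 11 (.add (.mul (.const 2) (rreg 11)) (.mul (.const 3) (rreg 10)))

theorem initParams_runs (hI : Coords M n X Y s) (hM : 4 * n + 20 ≤ M) (hl : 0 < lam)
    (h0 : s.intReg 0 = n) (h0' : s.realReg 0 = lam) :
    Runs M initParams s (fun τ s' => s'.intReg 11 = 4 * n ∧ s'.realReg 10 = lam ∧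
      Apart lam (s'.realReg 11) n X Y ∧ s'.intMem = s.intMem ∧ s'.realMem = s.realMem ∧
      τ ≤ 100 * (n + 1)) := by
  apply Runs.seq_wp
  refine wp_mono (Q := fun s' => s' = ⟨Function.update (Function.update s.intReg 11 (4 * n)) 2 n,
    Function.update (Function.update s.realReg 10 lam) 11 0, s.intMem, s.realMem⟩) ?_ ?_
  · simp [wp, h0, h0', show 4 < M by omega, show 4 * n < M by omega]
  rintro s1 rfl
  apply Runs.seq
  refine Runs.loop (I := fun r τ s' => r ≤ n ∧ s'.intReg 2 = r ∧ s'.intReg 11 = 4 * n ∧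
    s'.realReg 10 = lam ∧ 0 ≤ s'.realReg 11 ∧ (∀ j < n, r ≤ j → |X j| ≤ s'.realReg 11 ∧
    |Y j| ≤ s'.realReg 11) ∧ s'.intMem = s.intMem ∧ s'.realMem = s.realMem ∧
    τ + 60 * r ≤ 60 * n) (r := n) ?_ ?_ ?_ ?_
  · rintro r τ s' -
    simp
    omega
  · rintro r τ s' ⟨hr, h2, h11, h10, hp, hb, hi, hm, hτ⟩ hb'
    obtain ⟨r, rfl⟩ : ∃ r', r = r' + 1 := ⟨r - 1, by have : 0 < s'.intReg 2 := hb'; omega⟩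
    have hM' := hI.mem
    have hx := hI.x r (by omega)
    have hy := hI.y r (by omega)
    refine Runs.of_wp (wp_mono (Q := fun s'' => s''.intReg 2 = r ∧ s''.intReg 11 = 4 * n ∧
      s''.realReg 10 = lam ∧ s''.realReg 11 = s'.realReg 11 + (|X r| + |Y r|) ∧
      s''.intMem = s.intMem ∧ s''.realMem = s.realMem) ?_ ?_)
    · simp [wp, h2, IntExpr.Ok, RealExpr.Ok, RealExpr.eval, hx, hy, hi, hm, h10, h11,
        show 2 * r < M by omega, show 2 * r + 1 < M by omega, show 1 < M by omega,
        show 2 < M by omega, Real.sqrt_mul_self_eq_abs]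
    rintro s2 ⟨e1, e2, e3, e4, e5, e6⟩ t ht
    have hax := abs_nonneg (X r)
    have hay := abs_nonneg (Y r)
    refine ⟨r, Nat.lt_succ_self r, by omega, e1, e2, e3, by rw [e4]; positivity, fun j hj hrj => ?_,
      e5, e6, ?_⟩
    · rw [e4]
      rcases Nat.eq_or_lt_of_le hrj with rfl | hlt
      · constructor <;> linarith
      · obtain ⟨b1, b2⟩ := hb j hj hlt
        constructor <;> linarith
    · have ht' := ht.trans (show _ ≤ 50 by decide)
      have c1 : (Test.intLt (.const 0) (ireg 2)).cost = 3 := rfl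
      omega
  · rintro r τ s' ⟨hr, h2, h11, h10, hp, hb, hi, hm, hτ⟩ hb'
    obtain rfl : r = 0 := by
      have : ¬ 0 < s'.intReg 2 := hb'
      omega
    apply Runs.of_wp
    refine ⟨by simp, fun t ht t1 ht1 => ⟨h11, by simpa using h10, ⟨hl, fun j hj j' hj' => ?_⟩, hi, hm,
      ?_⟩⟩
    · obtain ⟨b1, b2⟩ := hb j hj (Nat.zero_le _)
      obtain ⟨b3, b4⟩ := hb j' hj' (Nat.zero_le _)
      simp only [Function.update_self, reval_add, reval_mul, reval_const, reval_reg, h10]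
      push_cast
      refine ⟨?_, ?_, ?_⟩ <;> linarith
    · have ht' := ht.trans (show _ ≤ 10 by decide)
      have ht1' := ht1.trans (show _ ≤ 10 by decide)
      have c1 : (Test.intLt (.const 0) (ireg 2)).cost = 3 := rfl
      omega
  · exact ⟨le_rfl, by simp, by simp, by simp, by simp, fun j h1 h2 => by omega, rfl, rfl, by omega⟩

/-- Integer register `10` gets the number of leaves, a power of two. -/
def initSize : Program :=
  .setInt 10 (.const 1) ;;
  .loop (.neg (.intLt (ireg 11) (ireg 10))) (.setInt 10 (.mul (.const 2) (ireg 10)))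

theorem initSize_runs (hM : 2 * m + 20 ≤ M) (h11 : s.intReg 11 = m) :
    Runs M initSize s (fun τ s' => ∃ K, m < 2 ^ K ∧ 2 ^ K ≤ 2 * m + 1 ∧
      s' = { s with intReg := Function.update s.intReg 10 (2 ^ K) } ∧ τ ≤ 20 * (K + 1)) := by
  refine Runs.seq_wp ⟨by simp; omega, ?_⟩
  refine Runs.loop (I := fun r τ s' => ∃ K, r + K = m + 1 ∧ 2 ^ K ≤ 2 * m + 1 ∧ K < 2 ^ K ∧
    s' = { s with intReg := Function.update s.intReg 10 (2 ^ K) } ∧ τ ≤ 20 * K)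
    (r := m + 1) ?_ ?_ ?_ ?_
  · rintro r τ s' -
    simp
  · rintro r τ s' ⟨K, hK, h1, h2, rfl, hτ⟩ hb
    have hb' : 2 ^ K ≤ m := by
      simp [h11] at hb
      exact hb
    refine Runs.of_wp ⟨?_, fun t ht => ⟨r - 1, by omega, K + 1, by omega, ?_, Nat.lt_two_pow_self,
      ?_, ?_⟩⟩
    · simp
      omega
    · rw [pow_succ]
      omega
    · simp [pow_succ']
    · have ht' := ht.trans (show _ ≤ 10 by decide)
      have c1 : (Test.neg (.intLt (ireg 11) (ireg 10))).cost = 4 := rfl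
      omega
  · rintro r τ s' ⟨K, hK, h1, h2, rfl, hτ⟩ hb t ht
    refine ⟨K, ?_, h1, rfl, ?_⟩
    · simp [h11] at hb
      exact hb
    · have ht' := ht.trans (show _ ≤ 3 by decide)
      have c1 : (Test.neg (.intLt (ireg 11) (ireg 10))).cost = 4 := rfl
      omega
  · exact ⟨0, by omega, by simp, by simp, by simp, by omega⟩

/-- Turn the points into items: the items `4 j + 1, …, 4 j + 4` are the point `j` in the four
directions.  The last items are made first, for the records of the items overlap with the input. -/
def makeItems : Program :=
  .setInt 2 (ireg 11) ;;
  .loop (.intLt (.const 0) (ireg 2))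
    (.setInt 3 (.div (.sub (ireg 2) (.const 1)) (.const 4)) ;;
    .setInt 4 (.sub (.sub (ireg 2) (.const 1)) (.mul (.const 4) (ireg 3))) ;;
    .setReal 0 (.load (.mul (.const 2) (ireg 3))) ;;
    .setReal 1 (.load (.add (.mul (.const 2) (ireg 3)) (.const 1))) ;;
    frame ;;
    rst 0 (ireg 2) (rreg 2) ;; rst 1 (ireg 2) (rreg 3) ;; rst 2 (ireg 2) (rreg 3) ;;
    rst 3 (ireg 2) (rreg 0) ;; rst 4 (ireg 2) (rreg 1) ;; .setInt 2 (.sub (ireg 2) (.const 1)))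

/-- Item `i` is a point in a direction. -/
structure ItemOK (G : ℝ) (X Y : ℕ → ℝ) (f : ℕ → ℕ → ℝ) (i : ℕ) : Prop where
  u : f 0 i = frameU ((i - 1) % 4) (X ((i - 1) / 4)) (Y ((i - 1) / 4))
  v : f 1 i = frameV G ((i - 1) % 4) (X ((i - 1) / 4)) (Y ((i - 1) / 4))
  y : f 2 i = f 1 i
  ox : f 3 i = X ((i - 1) / 4)
  oy : f 4 i = Y ((i - 1) / 4)

theorem makeItems_runs (hI : Coords M n X Y s) (hM : 16 * (4 * n) + 20 ≤ M)
    (h11 : s.intReg 11 = 4 * n) :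
    Runs M makeItems s (fun τ s' => (∀ i, 1 ≤ i → i ≤ 4 * n →
      ItemOK (s.realReg 11) X Y s'.real i) ∧ s'.intMem = s.intMem ∧
      (∀ i, 10 ≤ i → s'.intReg i = s.intReg i) ∧ (∀ i, 10 ≤ i → s'.realReg i = s.realReg i) ∧
      τ ≤ 200 * (4 * n + 1)) := by
  refine Runs.seq_wp ⟨by simp, ?_⟩
  simp only [eval_reg, h11]
  refine Runs.loop (I := fun r τ s' => r ≤ 4 * n ∧ s'.intReg 2 = r ∧
    (∀ i, r < i → i ≤ 4 * n → ItemOK (s.realReg 11) X Y s'.real i) ∧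
    (∀ a < 16 * (r + 1), s'.realMem a = s.realMem a) ∧ s'.intMem = s.intMem ∧
    (∀ i, 10 ≤ i → s'.intReg i = s.intReg i) ∧ (∀ i, 10 ≤ i → s'.realReg i = s.realReg i) ∧
    τ + 180 * r ≤ 180 * (4 * n)) (r := 4 * n) ?_ ?_ ?_ ?_
  · rintro r τ s' -
    simp
    omega
  · rintro r τ s' ⟨hr, h2, hit, hm, him, hi, hrr, hτ⟩ hb
    obtain ⟨r, rfl⟩ : ∃ r', r = r' + 1 := ⟨r - 1, by have : 0 < s'.intReg 2 := hb; omega⟩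
    have hx := hI.x (r / 4) (by omega)
    have hy := hI.y (r / 4) (by omega)
    rw [← hm (2 * (r / 4)) (by omega)] at hx
    rw [← hm (2 * (r / 4) + 1) (by omega)] at hy
    have hd : r - 4 * (r / 4) = r % 4 := by omega
    set u := frameU (r % 4) (X (r / 4)) (Y (r / 4)) with hu
    set v := frameV (s.realReg 11) (r % 4) (X (r / 4)) (Y (r / 4)) with hv
    have mem : ∀ k < 16, ad k (r + 1) < M := fun k hk => by simp only [ad]; omega
    refine Runs.of_wp (wp_mono (Q := fun s'' => s''.intReg 2 = r ∧ s''.intMem = s'.intMem ∧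
      (∀ i, 10 ≤ i → s''.intReg i = s'.intReg i) ∧ (∀ i, 10 ≤ i → s''.realReg i = s'.realReg i) ∧
      s''.realMem = Function.update (Function.update (Function.update (Function.update
        (Function.update s'.realMem (ad 0 (r + 1)) u) (ad 1 (r + 1)) v) (ad 2 (r + 1)) v)
        (ad 3 (r + 1)) (X (r / 4))) (ad 4 (r + 1)) (Y (r / 4))) ?_ ?_)
    · refine wp_seq ⟨by simp; omega, ?_⟩
      refine wp_seq ⟨by simp [h2]; omega, ?_⟩
      refine wp_seq ⟨by simp [h2, RealExpr.Ok]; omega, ?_⟩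
      refine wp_seq ⟨by simp [h2, RealExpr.Ok]; omega, ?_⟩
      refine wp_seq (frame_wp (by omega) ?_)
      simp [RealExpr.eval, h2, hd, hx, hy, hrr 11, ← hu, ← hv, wp, show 16 < M by omega, mem,
        show 1 < M by omega]
      exact ⟨fun i h => by simp [show i ≠ 2 by omega, show i ≠ 3 by omega, show i ≠ 4 by omega],
        fun i h => by simp [show i ≠ 2 by omega, show i ≠ 3 by omega, show i ≠ 0 by omega,
          show i ≠ 1 by omega]⟩
    rintro s2 ⟨e1, e2, e3, e4, e5⟩ t ht
    refine ⟨r, Nat.lt_succ_self r, by omega, e1, fun i h1 h2 => ?_, fun a ha => ?_, e2.trans him,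
      fun i h => (e3 i h).trans (hi i h), fun i h => (e4 i h).trans (hrr i h), ?_⟩
    · rcases (show i = r + 1 ∨ r + 1 < i by omega) with rfl | hlt
      · constructor <;> simp only [State.real, e5, Nat.add_sub_cancel] <;> simp [ad, ← hu, ← hv]
      · have : ∀ k, k < 16 → s2.real k i = s'.real k i := fun k hk => by
          simp only [State.real, e5]
          have : ∀ k' < 16, ad k i ≠ ad k' (r + 1) := fun k' hk' h => by
            simp only [ad] at h; omega
          simp [this]
        obtain ⟨a1, a2, a3, a4, a5⟩ := hit i hlt h2
        constructor <;> rw [this _ (by norm_num)]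
        · exact a1
        · exact a2
        · rw [this _ (by norm_num)]; exact a3
        · exact a4
        · exact a5
    · rw [e5]
      have : ∀ k', a ≠ ad k' (r + 1) := fun k' h => by
        simp only [ad] at h; omega
      simp only [Function.update_of_ne (this _)]
      exact hm a (by omega)
    · have ht' := ht.trans (show _ ≤ 170 by decide)
      have c1 : (Test.intLt (.const 0) (ireg 2)).cost = 3 := rfl
      omega
  · rintro r τ s' ⟨hr, h2, hit, hm, him, hi, hrr, hτ⟩ hb t ht
    obtain rfl : r = 0 := by
      have : ¬ 0 < s'.intReg 2 := hb
      omega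
    refine ⟨fun i h1 => hit i (by omega), him, hi, hrr, ?_⟩
    have ht' := ht.trans (show _ ≤ 10 by decide)
    have c1 : (Test.intLt (.const 0) (ireg 2)).cost = 3 := rfl
    omega
  · exact ⟨le_rfl, by simp, fun i h1 h2 => by omega, fun a _ => rfl, rfl,
      fun i h => Function.update_of_ne (by omega) _ _, fun i h => rfl, by omega⟩

end UnitDisk

namespace UnitDisk

/-! ### The construction: rows and cells -/

variable {M N K m n : ℕ} {lam G : ℝ} {X Y : ℕ → ℝ} {κ : ℕ → Key} {p : ℕ → ℕ} {s : State}

/-- Divide the items, sorted by their ordinates, into rows. -/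
def rowPass : Program :=
  (.setInt 2 (.const 1) ;; .setReal 2 (.const 0)) ;;
  .loop (.neg (.intLt (ireg 11) (ireg 2)))
    (.setInt 3 (ild 1 (ireg 2)) ;;
    .cond (.conj (.neg (.intEq (ireg 2) (.const 1)))
        (.realLe (rld 1 (ireg 3)) (.add (rreg 2) (.div (rreg 10) (.const 10)))))
      .skip (.setReal 2 (rld 1 (ireg 3))) ;;
    rst 2 (ireg 3) (rreg 2) ;; .setInt 2 (.add (ireg 2) (.const 1)))

theorem rowPass_runs (hM : 16 * (m + 1) + 20 ≤ M) (h11 : s.intReg 11 = m)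
    (h10 : s.realReg 10 = lam) (hp : s.int 1 = p) (hS : Sorted κ m p) :
    Runs M rowPass s (fun τ s' => (∀ t, 1 ≤ t → t ≤ m →
        s'.real 2 (p t) = greedy (lam / 10) (fun _ => 0) (s.real 1 ∘ p) t) ∧
      (∀ k < 16, k ≠ 2 → s'.real k = s.real k) ∧ s'.intMem = s.intMem ∧
      (∀ i, 10 ≤ i → s'.intReg i = s.intReg i) ∧ (∀ i, 10 ≤ i → s'.realReg i = s.realReg i) ∧
      τ ≤ 100 * (m + 1)) := by
  have h16 : 16 < M := by omega
  apply Runs.seq_wp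
  refine wp_mono (Q := fun s' => s' = ⟨Function.update s.intReg 2 1,
    Function.update s.realReg 2 0, s.intMem, s.realMem⟩) (by simp [wp]; omega) ?_
  rintro s1 rfl
  refine Runs.loop (I := fun r τ s' => ∃ t, r + t = m ∧ s'.intReg 2 = t + 1 ∧
    s'.realReg 2 = greedy (lam / 10) (fun _ => 0) (s.real 1 ∘ p) t ∧
    (∀ t', 1 ≤ t' → t' ≤ t →
      s'.real 2 (p t') = greedy (lam / 10) (fun _ => 0) (s.real 1 ∘ p) t') ∧
    (∀ k < 16, k ≠ 2 → s'.real k = s.real k) ∧ s'.intMem = s.intMem ∧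
    (∀ i, 10 ≤ i → s'.intReg i = s.intReg i) ∧ (∀ i, 10 ≤ i → s'.realReg i = s.realReg i) ∧
    τ ≤ 80 * t) (r := m) ?_ ?_ ?_ ?_
  · rintro r τ s' -
    simp
  · rintro r τ s' ⟨t, ht, h2, hy, hold, hk, him, hi, hrr, hτ⟩ hb
    have hint : s'.int 1 = p := by
      rw [← hp]
      funext i
      simp only [State.int, him]
    have htm : t + 1 ≤ m := by
      have : ¬ s'.intReg 11 < s'.intReg 2 := hb
      rw [hi 11 (by norm_num), h11] at this
      omega
    have hpm := hS.mem (t + 1) (by omega) htm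
    have mem : ∀ k < 16, ∀ a ≤ m, ad k a < M := fun k hk a ha => by simp only [ad]; omega
    have g10 : s'.realReg 10 = lam := (hrr 10 (by norm_num)).trans h10
    have hk1 := hk 1 (by norm_num) (by norm_num)
    refine Runs.of_wp (wp_mono (Q := fun s'' => s''.intReg 2 = t + 2 ∧
      s''.realReg 2 = greedy (lam / 10) (fun _ => 0) (s.real 1 ∘ p) (t + 1) ∧
      s''.real 2 = Function.update (s'.real 2) (p (t + 1))
        (greedy (lam / 10) (fun _ => 0) (s.real 1 ∘ p) (t + 1)) ∧
      (∀ k < 16, k ≠ 2 → s''.real k = s'.real k) ∧ s''.intMem = s'.intMem ∧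
      (∀ i, 10 ≤ i → s''.intReg i = s'.intReg i) ∧
      (∀ i, 10 ≤ i → s''.realReg i = s'.realReg i)) ?_ ?_)
    · refine wp_seq ⟨by simp [h2, h16, mem _ _ _ htm], ?_⟩
      refine wp_seq (wp_mono (Q := fun s2 => s2 = ⟨Function.update s'.intReg 3 (p (t + 1)),
        Function.update s'.realReg 2 (greedy (lam / 10) (fun _ => 0) (s.real 1 ∘ p) (t + 1)),
        s'.intMem, s'.realMem⟩) ?_ ?_)
      · simp [wp, h2, h16, hint, mem, hpm, show 1 < M by omega, hk1, hy, g10, greedy]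
        grind
      rintro s2 rfl
      simp [wp, h2, h16, mem, hpm, show 1 < M by omega, show t + 1 + 1 < M by omega]
      refine ⟨fun k hk hk2 => real_mk_update_ne _ _ _ _ _ _ (by norm_num) hk hk2,
        fun i h => ?_, fun i h => ?_⟩
      · simp [show i ≠ 2 by omega, show i ≠ 3 by omega]
      · simp [show i ≠ 2 by omega]
    rintro s2 ⟨e1, e2, e3, e4, e5, e6, e7⟩ τ' hτ'
    refine ⟨r - 1, by omega, t + 1, by omega, e1, e2, fun t' h1 h3 => ?_,
      fun k hk' hk2 => (e4 k hk' hk2).trans (hk k hk' hk2), e5.trans him,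
      fun i h => (e6 i h).trans (hi i h), fun i h => (e7 i h).trans (hrr i h), ?_⟩
    · rw [e3]
      rcases (show t' = t + 1 ∨ t' ≤ t by omega) with rfl | hle
      · rw [Function.update_self]
      · rw [Function.update_of_ne (hS.lt t' (t + 1) h1 (by omega) htm).2]
        exact hold t' h1 hle
    · have ht' := hτ'.trans (show _ ≤ 70 by decide)
      have c1 : (Test.neg (.intLt (ireg 11) (ireg 2))).cost = 4 := rfl
      omega
  · rintro r τ s' ⟨t, ht, h2, hy, hold, hk, him, hi, hrr, hτ⟩ hb t2 ht2
    have hmt : m < t + 1 := by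
      simp only [holds_neg, holds_intLt, eval_reg, not_not, h2, hi 11 (by norm_num), h11] at hb
      exact hb
    refine ⟨fun t' h1 h3 => hold t' h1 (by omega), hk, him, hi, hrr, ?_⟩
    have ht' := ht2.trans (show _ ≤ 10 by decide)
    have c1 : (Test.neg (.intLt (ireg 11) (ireg 2))).cost = 4 := rfl
    omega
  · exact ⟨0, by omega, by simp, by simp [greedy], fun t' h1 h3 => by omega, fun _ _ _ => rfl, rfl,
      fun i h => Function.update_of_ne (by omega) _ _,
      fun i h => Function.update_of_ne (by omega) _ _, by omega⟩

/-- Divide the sorted items into cells and set the parameters of the positions. -/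
def cellPass : Program :=
  (.setInt 2 (.const 1) ;; .setReal 2 (.const 0) ;; .setReal 4 (.const 0) ;;
  .setReal 12 (.const 1)) ;;
  .loop (.neg (.intLt (ireg 11) (ireg 2)))
    (.setInt 3 (ild 1 (ireg 2)) ;;
    .cond (.conj (.neg (.intEq (ireg 2) (.const 1)))
        (.conj (.conj (.realLe (rreg 3) (rld 2 (ireg 3))) (.realLe (rld 2 (ireg 3)) (rreg 3)))
        (.realLe (rld 0 (ireg 3)) (.add (rreg 2) (.div (rreg 10) (.const 10))))))
      .skip
      (.setReal 2 (rld 0 (ireg 3)) ;; .setReal 4 (.add (rreg 4) (.mul (.const 10) (rreg 10)))) ;;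
    .setReal 3 (rld 2 (ireg 3)) ;;
    rst 5 (ireg 2) (.sub (rld 0 (ireg 3)) (rreg 2)) ;;
    rst 6 (ireg 2) (.sub (rld 1 (ireg 3)) (rreg 3)) ;;
    rst 7 (ireg 2) (rreg 4) ;; rst 8 (ireg 2) (rreg 12) ;;
    rst 9 (ireg 2) (rld 0 (ireg 3)) ;; rst 10 (ireg 2) (rld 1 (ireg 3)) ;;
    rst 11 (ireg 2) (rreg 3) ;; rst 12 (ireg 2) (rreg 2) ;;
    rst 13 (ireg 2) (rld 3 (ireg 3)) ;; rst 14 (ireg 2) (rld 4 (ireg 3)) ;;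
    .setReal 12 (.add (rreg 12) (.const 1)) ;; .setInt 2 (.add (ireg 2) (.const 1)))

/-- The parameters of the position `t`, in terms of the items `g`. -/
structure Placed (lam : ℝ) (p : ℕ → ℕ) (g f : ℕ → ℕ → ℝ) (t : ℕ) : Prop where
  s : f 5 t = g 0 (p t) - greedy (lam / 10) (g 2 ∘ p) (g 0 ∘ p) t
  w : f 6 t = g 1 (p t) - g 2 (p t)
  z : f 7 t = place (10 * lam) (lam / 10) (g 2 ∘ p) (g 0 ∘ p) t
  rank : f 8 t = t
  u : f 9 t = g 0 (p t)
  v : f 10 t = g 1 (p t)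
  y : f 11 t = g 2 (p t)
  c : f 12 t = greedy (lam / 10) (g 2 ∘ p) (g 0 ∘ p) t
  ox : f 13 t = g 3 (p t)
  oy : f 14 t = g 4 (p t)

theorem cellPass_runs (hM : 16 * (m + 1) + 20 ≤ M) (h11 : s.intReg 11 = m)
    (h10 : s.realReg 10 = lam) (hp : s.int 1 = p) (hpm : ∀ t, 1 ≤ t → t ≤ m → p t ≤ m) :
    Runs M cellPass s (fun τ s' => (∀ t, 1 ≤ t → t ≤ m → Placed lam p s.real s'.real t) ∧
      s'.realReg 12 = m + 1 ∧ s'.intMem = s.intMem ∧ (∀ i, 10 ≤ i → s'.intReg i = s.intReg i) ∧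
      s'.realReg 10 = lam ∧ s'.realReg 11 = s.realReg 11 ∧ τ ≤ 400 * (m + 1)) := by
  have h16 : 16 < M := by omega
  apply Runs.seq_wp
  refine wp_mono (Q := fun s' => s' = ⟨Function.update s.intReg 2 1,
    Function.update (Function.update (Function.update s.realReg 2 0) 4 0) 12 1, s.intMem,
    s.realMem⟩) (by simp [wp]; omega) ?_
  rintro s1 rfl
  refine Runs.loop (I := fun r τ s' => ∃ t, r + t = m ∧ s'.intReg 2 = t + 1 ∧
    s'.realReg 2 = greedy (lam / 10) (s.real 2 ∘ p) (s.real 0 ∘ p) t ∧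
    s'.realReg 4 = place (10 * lam) (lam / 10) (s.real 2 ∘ p) (s.real 0 ∘ p) t ∧
    (t ≠ 0 → s'.realReg 3 = s.real 2 (p t)) ∧ s'.realReg 12 = t + 1 ∧
    (∀ t', 1 ≤ t' → t' ≤ t → Placed lam p s.real s'.real t') ∧
    (∀ k < 5, s'.real k = s.real k) ∧ s'.intMem = s.intMem ∧
    (∀ i, 10 ≤ i → s'.intReg i = s.intReg i) ∧
    s'.realReg 10 = lam ∧ s'.realReg 11 = s.realReg 11 ∧ τ ≤ 350 * t) (r := m) ?_ ?_ ?_ ?_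
  · rintro r τ s' -
    simp
  · rintro r τ s' ⟨t, ht, h2, hc, hz, hy, h12, hold, hk, him, hi, g10, g11, hτ⟩ hb
    have hint : s'.int 1 = p := by
      rw [← hp]
      funext i
      simp only [State.int, him]
    have htm : t + 1 ≤ m := by
      have : ¬ s'.intReg 11 < s'.intReg 2 := hb
      rw [hi 11 (by norm_num), h11] at this
      omega
    have hpm' := hpm (t + 1) (by omega) htm
    have mem : ∀ k < 16, ∀ a ≤ m, ad k a < M := fun k hk a ha => by simp only [ad]; omega
    have k0 := hk 0 (by norm_num)
    have k1 := hk 1 (by norm_num)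
    have k2 := hk 2 (by norm_num)
    have k3 := hk 3 (by norm_num)
    have k4 := hk 4 (by norm_num)
    refine Runs.of_wp (wp_mono (Q := fun s'' => s''.intReg 2 = t + 2 ∧
      s''.realReg 2 = greedy (lam / 10) (s.real 2 ∘ p) (s.real 0 ∘ p) (t + 1) ∧
      s''.realReg 4 = place (10 * lam) (lam / 10) (s.real 2 ∘ p) (s.real 0 ∘ p) (t + 1) ∧
      s''.realReg 3 = s.real 2 (p (t + 1)) ∧ s''.realReg 12 = t + 1 + 1 ∧
      Placed lam p s.real s''.real (t + 1) ∧
      (∀ k < 16, ∀ a ≠ t + 1, s''.real k a = s'.real k a) ∧ (∀ k < 5, s''.real k = s'.real k) ∧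
      s''.intMem = s'.intMem ∧ (∀ i, 10 ≤ i → s''.intReg i = s'.intReg i) ∧
      s''.realReg 10 = lam ∧ s''.realReg 11 = s.realReg 11) ?_ ?_)
    · refine wp_seq ⟨by simp [h2, h16, mem _ _ _ htm], ?_⟩
      refine wp_seq (wp_mono (Q := fun s2 => s2.intReg = Function.update s'.intReg 3 (p (t + 1)) ∧
        s2.realReg 2 = greedy (lam / 10) (s.real 2 ∘ p) (s.real 0 ∘ p) (t + 1) ∧
        s2.realReg 4 = place (10 * lam) (lam / 10) (s.real 2 ∘ p) (s.real 0 ∘ p) (t + 1) ∧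
        s2.realReg 10 = lam ∧ s2.realReg 11 = s.realReg 11 ∧ s2.realReg 12 = t + 1 ∧
        s2.intMem = s'.intMem ∧ s2.realMem = s'.realMem) ?_ ?_)
      · simp [wp, h2, h16, hint, mem, hpm', show 1 < M by omega, k0, k2, hc, hz, g10, g11, h12,
          greedy, place]
        grind
      rintro ⟨ir, rr, im, rm⟩ ⟨rfl, e2, e4, e10, e11, e12, rfl, rfl⟩
      simp only at e2 e4 e10 e11 e12
      have hp1 : ∀ i, 10 ≤ i → i ≠ 2 ∧ i ≠ 3 := fun i hi => by omega
      simp [wp, h2, h16, mem, hpm', htm, show 1 < M by omega, show t + 1 + 1 < M by omega,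
        real_mk_update_ne, k0, k1, k2, k3, k4, e2, e4, e10, e11, e12]
      refine ⟨by constructor <;> simp [real_mk_update_ne], fun k hk a ha => ?_, fun k hk => ?_,
        fun i hi => by simp [hp1 i hi]⟩
      · have : ∀ k' < 16, ad k a ≠ ad k' (t + 1) := fun k' hk' h => by
          simp only [ad] at h; omega
        simp [State.real, this]
      · have : ∀ k', 5 ≤ k' → k' < 16 → ∀ a, ad k a ≠ ad k' (t + 1) := fun k' hk' _ a h => by
          simp only [ad] at h; omega
        funext a
        simp [State.real, this]
    rintro s2 ⟨e1, e2, e3, e4, e5, e6, e7, e8, e9, e10, e11, e12⟩ τ' hτ'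
    refine ⟨r - 1, by omega, t + 1, by omega, e1, e2, e3, fun _ => e4, by push_cast; exact e5,
      fun t' h1 h3 => ?_, fun k hk' => (e8 k hk').trans (hk k hk'), e9.trans him,
      fun i h => (e10 i h).trans (hi i h), e11, e12, ?_⟩
    · rcases (show t' = t + 1 ∨ t' ≤ t by omega) with rfl | hle
      · exact e6
      · obtain ⟨a1, a2, a3, a4, a5, a6, a7, a8, a9, a10⟩ := hold t' h1 hle
        have hne : t' ≠ t + 1 := by omega
        constructor <;> rw [e7 _ (by norm_num) _ hne] <;> assumption
    · have ht' := hτ'.trans (show _ ≤ 300 by decide)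
      have c1 : (Test.neg (.intLt (ireg 11) (ireg 2))).cost = 4 := rfl
      omega
  · rintro r τ s' ⟨t, ht, h2, hc, hz, hy, h12, hold, hk, him, hi, g10, g11, hτ⟩ hb t2 ht2
    have hmt : m < t + 1 := by
      simp only [holds_neg, holds_intLt, eval_reg, not_not, h2, hi 11 (by norm_num), h11] at hb
      exact hb
    obtain rfl : t = m := by omega
    refine ⟨hold, h12, him, hi, g10, g11, ?_⟩
    have ht' := ht2.trans (show _ ≤ 20 by decide)
    have c1 : (Test.neg (.intLt (ireg 11) (ireg 2))).cost = 4 := rfl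
    omega
  · exact ⟨0, by omega, by simp, by simp [greedy], by simp [place], fun h => absurd rfl h, by simp,
      fun t' h1 h3 => by omega, fun _ _ => rfl, rfl,
      fun i h => Function.update_of_ne (by omega) _ _, by simpa using h10, by simp, by omega⟩

end UnitDisk

namespace UnitDisk

/-! ### The construction -/

variable {M N K n : ℕ} {lam : ℝ} {X Y : ℕ → ℝ} {al : Set ℕ} {E : EnvData} {org dir : ℕ → ℕ}
  {s s' : State}

/-- The state of the data structure between two operations, if `al` is the set of the alive
positions. -/
structure Ready (M N K n : ℕ) (lam : ℝ) (X Y : ℕ → ℝ) (org dir : ℕ → ℕ) (al : Set ℕ) (E : EnvData)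
    (s : State) : Prop where
  size : N = 2 ^ K
  room : 4 * n < N
  mem : 32 * N + 100 ≤ M
  radius : s.realReg 10 = lam
  apart : Apart lam (s.realReg 11) n X Y
  slope : s.realReg 12 = 4 * n + 1
  leaves : s.intReg 10 = N
  count : s.intReg 11 = 4 * n
  layout : Layout lam (s.realReg 11) n X Y s.real org dir
  alive : al ⊆ {a | 1 ≤ a ∧ a ≤ 4 * n}
  tree : TreeOK N (posFun lam (4 * n + 1) s.real) (crossing s) al E K 1 (treeOf s)

theorem Ready.setup (h : Ready M N K n lam X Y org dir al E s) :
    Setup M N {a | 1 ≤ a ∧ a ≤ 4 * n} (posFun lam (4 * n + 1) s.real) (crossing s) := by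
  refine ⟨h.mem, ?_, fun a ha => ⟨ha.1, ha.2.trans_lt h.room⟩⟩
  have := h.layout.singleCrossing h.apart.pos
  rw [← h.slope, ← h.radius] at this
  rw [← h.slope, ← h.radius]
  exact this

theorem posFun_congr {S : ℝ} {f f' : ℕ → ℕ → ℝ} (h : ∀ k < 15, f' k = f k) :
    posFun lam S f' = posFun lam S f := by
  funext t
  simp only [posFun, h 5 (by norm_num), h 6 (by norm_num), h 7 (by norm_num), h 8 (by norm_num)]

/-- The tree programs lead from ready states to ready states. -/
theorem Ready.keeps {al' : Set ℕ} {E' : EnvData} {c : ℕ → ℕ → ℝ}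
    (h : Ready M N K n lam X Y org dir al E s) (hk : Keeps 0 s s') (hal : al' ⊆ al)
    (hc : c = crossing s)
    (hT : TreeOK N (posFun lam (4 * n + 1) s.real) c al' E' K 1 (treeOf s')) :
    Ready M N K n lam X Y org dir al' E' s' := by
  have r10 := hk.realReg 10 (by norm_num)
  have r11 := hk.realReg 11 (by norm_num)
  have r12 := hk.realReg 12 (by norm_num)
  refine ⟨h.size, h.room, h.mem, r10.trans h.radius, r11 ▸ h.apart, r12.trans h.slope,
    (hk.intReg 10 (by norm_num)).trans h.leaves, (hk.intReg 11 (by norm_num)).trans h.count,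
    r11 ▸ h.layout.congr hk.real, hal.trans h.alive, ?_⟩
  rw [posFun_congr hk.real, hk.crossing, ← hc]
  exact hT

/-- The division into rows of items that are sorted by their ordinates. -/
theorem row_of_greedy {m : ℕ} {h : ℝ} {V R U W : ℕ → ℝ} {p : ℕ → ℕ} (hh : 0 ≤ h)
    (hS : Sorted (fun i => key (V i) (U i) (W i)) m p)
    (hR : ∀ t, 1 ≤ t → t ≤ m → R (p t) = greedy h (fun _ => 0) (V ∘ p) t) :
    (∀ i, 1 ≤ i → i ≤ m → R i ≤ V i ∧ V i ≤ R i + h) ∧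
    ∀ i j, 1 ≤ i → i ≤ m → 1 ≤ j → j ≤ m → R i < R j → R i + h < R j := by
  constructor
  · intro i h1 h2
    obtain ⟨t, t1, t2, rfl⟩ := hS.surj i h1 h2
    rw [hR t t1 t2]
    refine greedy_mem (x := V ∘ p) hh (fun t h1 h2 _ => ?_) t1 t2
    have := (hS.lt t (t + 1) h1 (by omega) h2).1
    rw [key_le] at this
    exact this.elim le_of_lt fun h => h.1.le
  · intro i j h1 h2 h3 h4 hlt
    obtain ⟨t, t1, t2, rfl⟩ := hS.surj i h1 h2
    obtain ⟨t', t1', t2', rfl⟩ := hS.surj j h3 h4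
    rw [hR t t1 t2, hR t' t1' t2'] at hlt ⊢
    have key := fun t t' h1 h2 h3 => greedy_place (g := 0) (h := h) (κ := fun _ => (0 : ℝ))
      (x := V ∘ p) (m := m) le_rfl hh (fun _ _ _ _ _ => le_rfl) (t := t) (t' := t') h1 h2 h3
    rcases lt_trichotomy t t' with h | rfl | h
    · exact ((key t t' t1 h t2').resolve_left fun h => hlt.ne h.2.1).2 rfl
    · exact absurd hlt (lt_irrefl _)
    · rcases key t' t t1' h t2 with ⟨-, h', -⟩ | ⟨-, h'⟩
      · linarith
      · linarith [h' rfl]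

/-- The construction. -/
def build : Program :=
  initParams ;; initSize ;; makeItems ;; sortItems ;; rowPass ;; sortItems ;; cellPass ;;
  initLeaves ;; joinAll

/-- The time for the construction, per node and level of the tree. -/
def buildBound : ℕ := joinBound * 5 + 3000

theorem buildBound_mul (x : ℕ) : buildBound * x = (joinBound * 5 + 10) * x + 2990 * x := by
  rw [← Nat.add_mul]
  rfl

theorem build_runs (hI : Coords M n X Y s) (hM : 300 * (n + 1) ≤ M) (hl : 0 < lam)
    (h0 : s.intReg 0 = n) (h0' : s.realReg 0 = lam) (hz : ∀ a, s.intMem a = 0)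
    (hinj : ∀ j < n, ∀ j' < n, X j = X j' → Y j = Y j' → j = j') :
    Runs M build s (fun τ s' => ∃ N K org dir E,
      Ready M N K n lam X Y org dir {a | 1 ≤ a ∧ a ≤ 4 * n} E s' ∧ N ≤ 8 * n + 1 ∧
      τ ≤ buildBound * (N * (K + 2))) := by
  apply Runs.seq
  refine (initParams_runs hI (by omega) hl h0 h0').mono ?_
  rintro τ1 s1 ⟨a11, a10, hA, aim, arm, ht1⟩
  apply Runs.seq
  refine (initSize_runs (M := M) (by omega) a11).mono ?_
  rintro τ2 s2 ⟨K, hK1, hK2, rfl, ht2⟩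
  obtain ⟨N, hN⟩ : ∃ N, N = 2 ^ K := ⟨_, rfl⟩
  rw [← hN] at hK1 hK2 ⊢
  have hmem : 32 * N + 100 ≤ M := by omega
  apply Runs.seq
  refine (makeItems_runs (X := X) (Y := Y) ⟨hI.mem, fun j hj => ?_, fun j hj => ?_⟩ (by omega) ?_).mono ?_
  · rw [← hI.x j hj, arm]
  · rw [← hI.y j hj, arm]
  · simp [a11]
  rintro τ3 s3 ⟨hit, bim, bir, brr, ht3⟩
  have b10 : s3.intReg 10 = N := by rw [bir 10 (by norm_num)]; simp
  have b11 : s3.intReg 11 = 4 * n := by rw [bir 11 (by norm_num)]; simpa using a11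
  simp only at hit brr bim
  generalize hG : s1.realReg 11 = G at *
  apply Runs.seq
  refine (sortItems_runs hmem hN hK1 b10 b11 fun v h1 h2 => ?_).mono ?_
  · simp only [State.int, bim, aim, hz]
  rintro τ4 s4 ⟨hS4, hz4, ir4, rr4, rm4, ht4⟩
  have real4 : s4.real = s3.real := by
    funext k a
    simp only [State.real, rm4]
  have c10 : s4.realReg 10 = lam := by rw [rr4, brr 10 (by norm_num), a10]
  apply Runs.seq
  refine (rowPass_runs (M := M) (by omega) ((ir4 11 (by norm_num)).trans b11) c10 rfl hS4).mono ?_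
  rintro τ5 s5 ⟨hrow, real5, im5, ir5, rr5, ht5⟩
  rw [real4] at hrow real5
  -- the rows are not known in the first sorting: the ordinate stands for the base of the row
  have hV3 : ∀ i, 1 ≤ i → i ≤ 4 * n → s3.real 2 i = s3.real 1 i := fun i h1 h2 => (hit i h1 h2).y
  have hS4' : Sorted (fun i => key (s3.real 1 i) (s3.real 0 i) (s3.real 1 i)) (4 * n)
      (s4.int 1) := by
    refine ⟨hS4.mem, fun t t' h1 h2 h3 => ?_, hS4.surj⟩
    have m1 := hS4.mem t h1 (by omega)
    have m2 := hS4.mem t' (by omega) h3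
    have := hS4.lt t t' h1 h2 h3
    simp only [itemKey, hV3 _ m1.1 m1.2, hV3 _ m2.1 m2.2] at this
    exact this
  obtain ⟨hR1, hR2⟩ := row_of_greedy (h := lam / 10) (by linarith) hS4' hrow
  apply Runs.seq
  refine (sortItems_runs hmem hN hK1 (s := s5) ?_ ?_ fun v h1 h2 => ?_).mono ?_
  · rw [ir5 10 (by norm_num), ir4 10 (by norm_num), b10]
  · rw [ir5 11 (by norm_num), ir4 11 (by norm_num), b11]
  · simp only [State.int, im5]
    exact hz4 v h1 h2
  rintro τ6 s6 ⟨hS6, hz6, ir6, rr6, rm6, ht6⟩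
  have real6 : s6.real = s5.real := by
    funext k a
    simp only [State.real, rm6]
  apply Runs.seq
  refine (cellPass_runs (M := M) (m := 4 * n) (lam := lam) (p := s6.int 1) (by omega) ?_ ?_ rfl
    fun t h1 h2 => (hS6.mem t h1 h2).2).mono ?_
  · rw [ir6 11 (by norm_num), ir5 11 (by norm_num), ir4 11 (by norm_num), b11]
  · rw [rr6, rr5 10 (by norm_num), c10]
  rintro τ7 s7 ⟨hpl, rr12, im7, ir7, rr10, rr11, ht7⟩
  have r0 : s6.real 0 = s3.real 0 := by rw [real6, real5 0 (by norm_num) (by norm_num)]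
  have r1 : s6.real 1 = s3.real 1 := by rw [real6, real5 1 (by norm_num) (by norm_num)]
  have r2 : s6.real 2 = s5.real 2 := by rw [real6]
  have r3 : s6.real 3 = s3.real 3 := by rw [real6, real5 3 (by norm_num) (by norm_num)]
  have r4 : s6.real 4 = s3.real 4 := by rw [real6, real5 4 (by norm_num) (by norm_num)]
  have hS6' : Sorted (fun i => key (s5.real 2 i) (s3.real 0 i) (s3.real 1 i)) (4 * n)
      (s6.int 1) := by
    have : itemKey s5 = fun i => key (s5.real 2 i) (s3.real 0 i) (s3.real 1 i) := by
      funext i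
      rw [itemKey, ← r0, ← r1, real6]
    rwa [this] at hS6
  have g11 : s7.realReg 11 = G := by
    rw [rr11, rr6, rr5 11 (by norm_num), rr4, brr 11 (by norm_num), hG]
  have hL : Layout lam G n X Y s7.real (fun t => (s6.int 1 t - 1) / 4)
      (fun t => (s6.int 1 t - 1) % 4) := by
    refine Layout.of_sorted (f := s7.real) hA hinj (fun i h1 h2 => (hit i h1 h2).u)
      (fun i h1 h2 => (hit i h1 h2).v) hR1 hR2 hS6' ?_ ?_ ?_ ?_ ?_ ?_ ?_ ?_ ?_ ?_
    · exact fun t h1 h2 => by rw [(hpl t h1 h2).u, r0]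
    · exact fun t h1 h2 => by rw [(hpl t h1 h2).v, r1]
    · exact fun t h1 h2 => by rw [(hpl t h1 h2).y, r2]
    · exact fun t h1 h2 => by rw [(hpl t h1 h2).c, r2, r0]
    · exact fun t h1 h2 => by rw [(hpl t h1 h2).z, r2, r0]
    · exact fun t h1 h2 => by
        rw [(hpl t h1 h2).ox, r3, (hit _ (hS6.mem t h1 h2).1 (hS6.mem t h1 h2).2).ox]
    · exact fun t h1 h2 => by
        rw [(hpl t h1 h2).oy, r4, (hit _ (hS6.mem t h1 h2).1 (hS6.mem t h1 h2).2).oy]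
    · exact fun t h1 h2 => by rw [(hpl t h1 h2).s, (hpl t h1 h2).u, (hpl t h1 h2).c]
    · exact fun t h1 h2 => by rw [(hpl t h1 h2).w, (hpl t h1 h2).v, (hpl t h1 h2).y]
    · exact fun t h1 h2 => (hpl t h1 h2).rank
  have d10 : s7.intReg 10 = N := by
    rw [ir7 10 (by norm_num), ir6 10 (by norm_num), ir5 10 (by norm_num), ir4 10 (by norm_num), b10]
  have d11 : s7.intReg 11 = 4 * n := by
    rw [ir7 11 (by norm_num), ir6 11 (by norm_num), ir5 11 (by norm_num), ir4 11 (by norm_num), b11]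
  apply Runs.seq
  refine (initLeaves_runs hmem d10 d11).mono ?_
  rintro τ8 s8 ⟨hleaf, hk8, ht8⟩
  have e12 : s8.realReg 12 = 4 * n + 1 := by
    rw [hk8.realReg 12 (by norm_num), rr12]
    push_cast
    ring
  have e11 : s8.realReg 11 = G := (hk8.realReg 11 (by norm_num)).trans g11
  have e10 : s8.realReg 10 = lam := (hk8.realReg 10 (by norm_num)).trans rr10
  have hL8 := hL.congr hk8.real
  have hset : Setup M N {a | 1 ≤ a ∧ a ≤ 4 * n} (posFun lam (4 * n + 1) s8.real) (crossing s8) := by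
    refine ⟨hmem, ?_, fun a ha => ⟨ha.1, ha.2.trans_lt hK1⟩⟩
    have := hL8.singleCrossing hl
    rw [← e12, ← e10] at this ⊢
    exact this
  refine (joinAll_runs hset hN subset_rfl rfl ((hk8.intReg 10 (by norm_num)).trans d10)
    (hleaf.forest hN)).mono ?_
  rintro τ9 s9 ⟨E', hT, hk9, ht9⟩
  have f11 : s9.realReg 11 = G := (hk9.realReg 11 (by norm_num)).trans e11
  have hL9 := hL8.congr hk9.real
  rw [← f11] at hL9
  refine ⟨N, K, _, _, E', ⟨hN, hK1, hmem, ?_, ?_, ?_, ?_, ?_, hL9, subset_rfl, ?_⟩, by omega, ?_⟩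
  · exact (hk9.realReg 10 (by norm_num)).trans e10
  · rw [f11]
    exact hA
  · exact (hk9.realReg 12 (by norm_num)).trans e12
  · exact (hk9.intReg 10 (by norm_num)).trans ((hk8.intReg 10 (by norm_num)).trans d10)
  · exact (hk9.intReg 11 (by norm_num)).trans ((hk8.intReg 11 (by norm_num)).trans d11)
  · rw [posFun_congr hk9.real, hk9.crossing]
    exact hT
  · have q1 : (4 * n + 1) * (K + 1) ≤ N * (K + 2) := Nat.mul_le_mul hK1 (by omega)
    have q2 : N * 2 ≤ N * (K + 2) := Nat.mul_le_mul_left _ (by omega)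
    have q3 : 1 * (K + 2) ≤ N * (K + 2) := Nat.mul_le_mul_right _ (by omega)
    rw [buildBound_mul]
    omega

end UnitDisk

namespace UnitDisk

/-! ### Searching among the positions -/

variable {M N K m n : ℕ} {lam : ℝ} {s : State}

/-- Binary search for the last position that passes the test `b`, in which integer register `7`
stands for the position.  The result is in integer register `5`; it is `0` if there is no such
position. -/
def search (b : Test) : Program :=
  (.setInt 5 (.const 0) ;; .setInt 6 (.add (ireg 11) (.const 1))) ;;
  .loop (.intLt (.add (ireg 5) (.const 1)) (ireg 6))
    (.setInt 7 (.div (.add (ireg 5) (ireg 6)) (.const 2)) ;;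
    .cond b (.setInt 5 (ireg 7)) (.setInt 6 (ireg 7)))

/-- The searches change only the integer registers `5`, `6`, `7`. -/
def SameRegs (ir ir' : ℕ → ℕ) : Prop := ∀ i, i < 5 ∨ 8 ≤ i → ir' i = ir i

theorem SameRegs.update {ir ir' : ℕ → ℕ} (h : SameRegs ir ir') {j e : ℕ} (hj : 5 ≤ j) (hj' : j < 8) :
    SameRegs ir (Function.update ir' j e) := fun i hi => by
  rw [Function.update_of_ne (by omega)]
  exact h i hi

theorem search_runs {b : Test} {P : ℕ → Prop}
    (hb : ∀ ir, SameRegs s.intReg ir → 1 ≤ ir 7 → ir 7 ≤ m →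
      b.Ok M ⟨ir, s.realReg, s.intMem, s.realMem⟩ ∧
      (b.Holds ⟨ir, s.realReg, s.intMem, s.realMem⟩ ↔ P (ir 7)))
    (hP : ∀ t t', 1 ≤ t → t < t' → t' ≤ m → P t' → P t) (h11 : s.intReg 11 = m) (hm : m < 2 ^ K)
    (hM : 2 * m + 20 ≤ M) :
    Runs M (search b) s (fun τ s' => ∃ ir, s' = ⟨ir, s.realReg, s.intMem, s.realMem⟩ ∧
      SameRegs s.intReg ir ∧ ir 5 ≤ m ∧ (∀ t, 1 ≤ t → t ≤ m → (P t ↔ t ≤ ir 5)) ∧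
      τ ≤ (b.cost + 30) * (K + 1)) := by
  apply Runs.seq_wp
  refine wp_mono (Q := fun s' => s' = ⟨Function.update (Function.update s.intReg 5 0) 6 (m + 1),
    s.realReg, s.intMem, s.realMem⟩) ?_ ?_
  · simp [wp, h11, show 0 < M by omega, show 1 < M by omega, show m + 1 < M by omega]
  rintro s1 rfl
  have start : SameRegs s.intReg s.intReg := fun _ _ => rfl
  refine Runs.loop (I := fun r τ s' => ∃ ir, s' = ⟨ir, s.realReg, s.intMem, s.realMem⟩ ∧
    SameRegs s.intReg ir ∧ ir 5 < ir 6 ∧ ir 6 ≤ m + 1 ∧ ir 6 - ir 5 ≤ 2 ^ r ∧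
    (1 ≤ ir 5 → P (ir 5)) ∧ (ir 6 ≤ m → ¬ P (ir 6)) ∧
    τ + (b.cost + 25) * r ≤ (b.cost + 25) * K) (r := K) ?_ ?_ ?_ ?_
  · rintro r τ s' ⟨ir, rfl, hir, h1, h2, h3, h4, h5, hτ⟩
    simp
    omega
  · rintro r τ s' ⟨ir, rfl, hir, h1, h2, h3, h4, h5, hτ⟩ hb'
    have hlt : ir 5 + 1 < ir 6 := hb'
    obtain ⟨r, rfl⟩ : ∃ r', r = r' + 1 := ⟨r - 1, by
      rcases r with - | r
      · rw [pow_zero] at h3; omega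
      · rfl⟩
    rw [pow_succ] at h3
    have hir' : SameRegs s.intReg (Function.update ir 7 ((ir 5 + ir 6) / 2)) :=
      hir.update (by norm_num) (by norm_num)
    obtain ⟨hok, hh⟩ := hb _ hir' (by simp; omega) (by simp; omega)
    simp only [Function.update_self] at hh
    have c1 : (Test.intLt (.add (ireg 5) (.const 1)) (ireg 6)).cost = 5 := rfl
    apply Runs.of_wp
    refine wp_seq ⟨by simp; omega, hok, fun hc => ?_, fun hc => ?_⟩ <;>
    · simp only [eval_div, eval_add, eval_reg, eval_const] at hc
      rw [hh] at hc
      refine ⟨trivial, fun t ht => ⟨r, Nat.lt_succ_self r, _, rfl,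
        hir'.update (by norm_num) (by norm_num), ?_⟩⟩
      simp only [Program.bound, IntExpr.cost] at ht
      rw [mul_add _ r] at hτ
      simp
      refine ⟨by omega, by omega, by omega, ?_, ?_, by omega⟩ <;> first | exact fun _ => hc | assumption
  · rintro r τ s' ⟨ir, rfl, hir, h1, h2, h3, h4, h5, hτ⟩ hb' t ht
    have hlt : ¬ ir 5 + 1 < ir 6 := hb'
    refine ⟨ir, rfl, hir, by omega, fun t t1 t2 => ⟨fun hp => ?_, fun hle => ?_⟩, ?_⟩
    · by_contra hc
      rcases (show t = ir 6 ∨ ir 6 < t by omega) with rfl | h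
      · exact h5 t2 hp
      · exact h5 (by omega) (hP _ _ (by omega) h t2 hp)
    · rcases Nat.eq_or_lt_of_le hle with rfl | h
      · exact h4 t1
      · exact hP _ _ t1 h (by omega) (h4 (by omega))
    · have ht' := ht.trans (show _ ≤ 10 by decide)
      have c1 : (Test.intLt (.add (ireg 5) (.const 1)) (ireg 6)).cost = 5 := rfl
      have e1 : (b.cost + 30) * (K + 1) = (b.cost + 25) * K + 5 * K + b.cost + 30 := by ring
      omega
  · refine ⟨_, rfl, (start.update (by norm_num) (by norm_num)).update (by norm_num) (by norm_num),
      ?_⟩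
    simp
    omega

/-- Search for the last row whose base is at most the real register `6`, and in this row, for the
last position that passes the test `b`, in which real register `9` stands for the base. -/
def locate (b : Test) : Program :=
  search (.realLe (rld 11 (ireg 7)) (rreg 6)) ;;
  .cond (.intEq (ireg 5) (.const 0)) .skip (.setReal 9 (rld 11 (ireg 5)) ;; search b)

theorem locate_runs {b : Test} {P : ℝ → ℕ → Prop}
    (hb : ∀ y ir, SameRegs s.intReg ir → 1 ≤ ir 7 → ir 7 ≤ m →
      b.Ok M ⟨ir, Function.update s.realReg 9 y, s.intMem, s.realMem⟩ ∧
      (b.Holds ⟨ir, Function.update s.realReg 9 y, s.intMem, s.realMem⟩ ↔ P y (ir 7)))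
    (hP : ∀ y t t', 1 ≤ t → t < t' → t' ≤ m → P y t' → P y t)
    (hrow : ∀ t t', 1 ≤ t → t < t' → t' ≤ m → s.real 11 t ≤ s.real 11 t')
    (h11 : s.intReg 11 = m) (hm : m < 2 ^ K) (hM : 16 * m + 20 ≤ M) :
    Runs M (locate b) s (fun τ s' => ∃ ir rr, s' = ⟨ir, rr, s.intMem, s.realMem⟩ ∧
      SameRegs s.intReg ir ∧ (∀ i, i ≠ 9 → rr i = s.realReg i) ∧ ir 5 ≤ m ∧
      (∀ a, 1 ≤ a → a ≤ m → s.real 11 a ≤ s.realReg 6 →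
        (∀ t, 1 ≤ t → t ≤ m → s.real 11 t ≤ s.realReg 6 → s.real 11 t ≤ s.real 11 a) →
        ∀ t, 1 ≤ t → t ≤ m → (P (s.real 11 a) t ↔ t ≤ ir 5)) ∧
      τ ≤ (b.cost + 100) * (K + 1)) := by
  have h16 : 16 < M := by omega
  have mem : ∀ t ≤ m, ad 11 t < M := fun t ht => by simp only [ad]; omega
  apply Runs.seq
  refine (search_runs (m := m) (K := K) (P := fun t => s.real 11 t ≤ s.realReg 6)
    (fun ir _ h1 h2 => ⟨by simp [h16, mem _ h2], Iff.rfl⟩)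
    (fun t t' h1 h2 h3 h => (hrow t t' h1 h2 h3).trans h) h11 hm (by omega)).mono ?_
  rintro τ s1 ⟨ir, rfl, hir, h5, hchar, hτ⟩
  have c1 : (Test.realLe (rld 11 (ireg 7)) (rreg 6)).cost = 8 := rfl
  have c2 : (Test.intEq (ireg 5) (.const 0)).cost = 3 := rfl
  rw [c1] at hτ
  have e1 : (b.cost + 100) * (K + 1) = 38 * (K + 1) + (b.cost + 30) * (K + 1) + 32 * (K + 1) := by
    ring
  refine Runs.cond (by simp; omega) (fun h0 => ?_) fun h0 => ?_
  · have h0' : ir 5 = 0 := h0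
    refine ⟨1, _, .skip _, ir, s.realReg, rfl, hir, fun _ _ => rfl, h5, fun a a1 a2 a3 => ?_, ?_⟩
    · have := (hchar a a1 a2).1 a3
      omega
    · omega
  · have h0' : ir 5 ≠ 0 := h0
    refine Runs.seq_wp ⟨by simp [h16, mem _ h5], ?_⟩
    simp only [reval_rld, real_mk, eval_reg]
    refine (search_runs (m := m) (K := K) (P := P (s.real 11 (ir 5)))
      (fun ir' hir' h1 h2 => hb _ ir' (fun i hi => (hir' i hi).trans (hir i hi)) h1 h2)
      (hP _) ((hir 11 (by norm_num)).trans h11) hm (by omega)).mono ?_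
    rintro τ' s2 ⟨ir2, rfl, hir2, h52, hchar2, hτ'⟩ t ht
    refine ⟨ir2, _, rfl, fun i hi => (hir2 i hi).trans (hir i hi),
      fun i hi => Function.update_of_ne hi _ _, h52, fun a a1 a2 a3 a4 => ?_, ?_⟩
    · have b1 := a4 (ir 5) (by omega) h5 ((hchar _ (by omega) h5).2 le_rfl)
      have b2 : s.real 11 a ≤ s.real 11 (ir 5) := by
        rcases Nat.eq_or_lt_of_le ((hchar a a1 a2).1 a3) with h | h
        · rw [h]
        · exact hrow _ _ a1 h h5
      rw [le_antisymm b2 b1]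
      exact hchar2
    · have ht' := ht.trans (show _ ≤ 10 by decide)
      omega

end UnitDisk

namespace UnitDisk

/-! ### Geometry of a query -/

variable {lam G : ℝ} {n : ℕ} {X Y : ℕ → ℝ} {f : ℕ → ℕ → ℝ} {org dir : ℕ → ℕ} {al : Set ℕ} {q a : ℕ}

/-- The point `(x, y)` lies in the box of side `lam / 10` at the base of the cell of `q`. -/
structure Hits (lam : ℝ) (f : ℕ → ℕ → ℝ) (q : ℕ) (x y : ℝ) : Prop where
  left : f 12 q ≤ x
  right : x ≤ f 12 q + lam / 10
  bot : f 11 q ≤ y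
  top : y ≤ f 11 q + lam / 10

/-- In the window of the cell of `q`, the functions of the other cells are negative; hence a
function that is maximal there belongs to the cell of `q`. -/
theorem Layout.same_cell (h : Layout lam G n X Y f org dir) (hl : 0 < lam)
    (hal : al ⊆ {a | 1 ≤ a ∧ a ≤ 4 * n}) (hq : q ∈ al) (ha : a ∈ al) {ξ : ℝ}
    (h1 : -(9 / 10 * lam) ≤ ξ) (h2 : ξ ≤ 9 / 10 * lam)
    (hmax : MaxAt (posFun lam (4 * n + 1) f) al a (f 7 q + ξ)) :
    f 11 a = f 11 q ∧ f 12 a = f 12 q ∧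
      arc lam (f 5 q) (f 6 q) ξ ≤ arc lam (f 5 a) (f 6 a) ξ := by
  obtain ⟨q1, q2⟩ := hal hq
  obtain ⟨a1, a2⟩ := hal ha
  have hqa := hmax q hq
  have eq : posFun lam (4 * n + 1) f q (f 7 q + ξ) = arc lam (f 5 q) (f 6 q) ξ := by
    rw [posFun, arcFun, halfWindow, if_neg (by linarith), if_neg (by linarith)]
    ring_nf
  have wq : 0 ≤ f 6 q := by rw [h.w q q1 q2]; linarith [h.row q q1 q2]
  have wa : f 6 a ≤ lam / 10 := by rw [h.w a a1 a2]; linarith [h.row a a1 a2]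
  have hpos := arc_nonneg (lam := lam) (s := f 5 q) (x := ξ) wq
  have hle : ∀ x, arc lam (f 5 a) (f 6 a) x ≤ 11 / 10 * lam := fun x => arc_le hl wa
  have hra : (1 : ℝ) ≤ f 8 a := by rw [h.rank a a1 a2]; exact_mod_cast a1
  have hra' : f 8 a ≤ 4 * n := by rw [h.rank a a1 a2]; exact_mod_cast a2
  rw [eq] at hqa
  have key : f 11 a = f 11 q ∧ f 12 a = f 12 q ∧ f 7 a = f 7 q := by
    rcases lt_trichotomy a q with hlt | rfl | hlt
    · refine (h.cells a q a1 hlt q2).resolve_right fun ⟨hz, _⟩ => ?_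
      have : posFun lam (4 * n + 1) f a (f 7 q + ξ) < 0 := by
        rw [posFun, arcFun, halfWindow, if_neg (by linarith), if_pos (by linarith)]
        have := hle (9 / 10 * lam)
        nlinarith
      linarith
    · exact ⟨rfl, rfl, rfl⟩
    · have h' := h.cells q a q1 hlt a2
      refine (h'.imp (fun ⟨b1, b2, b3⟩ => ⟨b1.symm, b2.symm, b3.symm⟩) id).resolve_right
        fun ⟨hz, _⟩ => ?_
      have : posFun lam (4 * n + 1) f a (f 7 q + ξ) < 0 := by
        rw [posFun, arcFun, halfWindow, if_pos (by linarith)]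
        have := hle (-(9 / 10 * lam))
        nlinarith
      linarith
  refine ⟨key.1, key.2.1, hqa.trans_eq ?_⟩
  rw [posFun, arcFun, halfWindow, key.2.2, if_neg (by linarith), if_neg (by linarith)]
  ring_nf

/-- The circle of radius `lam` around `q` passes above the query point `(x, y)`, hence so does the
circle around `a`; if `(x, y)` is close to `q`, every point of the cell will do. -/
theorem near_of_arc_le {x y u v u' v' : ℝ} (hl : 0 < lam)
    (hd : (x - u) * (x - u) + (y - v) * (y - v) ≤ lam * lam)
    (hu : |u' - u| ≤ lam / 10) (hv : |v' - v| ≤ lam / 10)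
    (hc : 3 / 5 * lam ≤ y - v ∨ |x - u| ≤ 3 / 5 * lam ∧ |y - v| ≤ 3 / 5 * lam)
    (harc : v + √(lam * lam - (x - u) * (x - u)) ≤ v' + √(lam * lam - (x - u') * (x - u'))) :
    (x - u') * (x - u') + (y - v') * (y - v') ≤ lam * lam := by
  rw [abs_le] at hu hv
  rcases hc with hc | ⟨h1, h2⟩
  · have h1 : y - v ≤ √(lam * lam - (x - u) * (x - u)) := Real.le_sqrt_of_sq_le (by nlinarith)
    have h2 : y - v' ≤ √(lam * lam - (x - u') * (x - u')) := by linarith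
    have h3 : 0 < y - v' := by linarith
    have h4 := (Real.le_sqrt' h3).1 h2
    nlinarith
  · rw [abs_le] at h1 h2
    have e1 : (x - u') * (x - u') ≤ (7 / 10 * lam) * (7 / 10 * lam) := by nlinarith
    have e2 : (y - v') * (y - v') ≤ (7 / 10 * lam) * (7 / 10 * lam) := by nlinarith
    nlinarith

theorem frame_dist (d : ℕ) (x y x' y' : ℝ) :
    (frameU d x y - frameU d x' y') * (frameU d x y - frameU d x' y') +
      (frameV G d x y - frameV G d x' y') * (frameV G d x y - frameV G d x' y') =
      (x - x') * (x - x') + (y - y') * (y - y') := by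
  simp only [frameU, frameV]
  split_ifs <;> first | omega | ring

/-- From some direction, the point `(x, y)` is well above the point `(x', y')`, unless they are
close. -/
theorem exists_dir (x y x' y' : ℝ) : ∃ d < 4,
    3 / 5 * lam ≤ frameV G d x y - frameV G d x' y' ∨
      |frameU d x y - frameU d x' y'| ≤ 3 / 5 * lam ∧
      |frameV G d x y - frameV G d x' y'| ≤ 3 / 5 * lam := by
  by_cases h0 : 3 / 5 * lam ≤ y - y'
  · exact ⟨0, by norm_num, .inl (by simpa [frameV] using h0)⟩
  by_cases h1 : 3 / 5 * lam ≤ y' - y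
  · exact ⟨1, by norm_num, .inl (by simpa [frameV] using h1)⟩
  by_cases h2 : 3 / 5 * lam ≤ x - x'
  · exact ⟨2, by norm_num, .inl (by simpa [frameV] using h2)⟩
  by_cases h3 : 3 / 5 * lam ≤ x' - x
  · exact ⟨3, by norm_num, .inl (by simpa [frameV] using h3)⟩
  refine ⟨0, by norm_num, .inr ?_⟩
  simp only [frameU, frameV, if_true, show (0 : ℕ) < 2 by norm_num, abs_le]
  exact ⟨⟨by linarith, by linarith⟩, by linarith, by linarith⟩

theorem exists_grid {h t : ℝ} (hh : 0 < h) (h1 : -11 * h ≤ t) (h2 : t ≤ 8 * h) :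
    ∃ j : ℤ, (-11 ≤ j ∧ j ≤ 8) ∧ t ≤ j * h ∧ j * h ≤ t + h := by
  have e1 := Int.le_ceil (t / h)
  have e2 := Int.ceil_lt_add_one (t / h)
  refine ⟨⌈t / h⌉, ⟨?_, ?_⟩, ?_, ?_⟩
  · have : (-11 : ℝ) ≤ t / h := by rwa [le_div_iff₀ hh]
    exact_mod_cast this.trans e1
  · rw [Int.ceil_le]
    push_cast
    rwa [div_le_iff₀ hh]
  · rwa [div_le_iff₀ hh] at e1
  · have := mul_lt_mul_of_pos_right e2 hh
    rw [add_mul, div_mul_cancel₀ _ hh.ne', one_mul] at this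
    exact this.le

/-- If the point `j` is within reach of the query point, some probe hits the cell of this point in
some direction and finds a point within reach. -/
theorem Layout.exists_probe (h : Layout lam G n X Y f org dir) (hA : Apart lam G n X Y) {x y : ℝ}
    {j : ℕ} (hj : j < n) (hal : al ⊆ {a | 1 ≤ a ∧ a ≤ 4 * n})
    (hjal : ∀ t, 1 ≤ t → t ≤ 4 * n → org t = j → t ∈ al)
    (hd : (x - X j) * (x - X j) + (y - Y j) * (y - Y j) ≤ lam * lam) :
    ∃ d < 4, ∃ i k : ℤ, (-11 ≤ i ∧ i ≤ 8) ∧ (-11 ≤ k ∧ k ≤ 8) ∧ ∃ q ∈ al,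
      Hits lam f q (frameU d x y + i * (lam / 10)) (frameV G d x y + k * (lam / 10)) ∧
      ∀ a ∈ al, MaxAt (posFun lam (4 * n + 1) f) al a (f 7 q + (frameU d x y - f 12 q)) →
        (x - f 13 a) * (x - f 13 a) + (y - f 14 a) * (y - f 14 a) ≤ lam * lam := by
  have hl := hA.pos
  obtain ⟨d, hd4, hdir⟩ := exists_dir (lam := lam) (G := G) x y (X j) (Y j)
  obtain ⟨q, q1, q2, rfl, rfl⟩ := h.surj j hj d hd4
  have hq := hjal q q1 q2 rfl
  rw [← frame_dist (G := G) (dir q)] at hd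
  obtain ⟨r1, r2⟩ := h.row q q1 q2
  obtain ⟨c1, c2⟩ := h.cell q q1 q2
  rw [← h.u q q1 q2, ← h.v q q1 q2] at hdir hd
  set x0 := frameU (dir q) x y with hx0
  set y0 := frameV G (dir q) x y with hy0
  have hx : |x0 - f 9 q| ≤ 4 / 5 * lam := by
    rcases hdir with h | h
    · exact abs_le_of_sq_le_sq (by nlinarith) (by linarith)
    · linarith [h.1]
  have hy : y0 - f 10 q ≤ lam := (abs_le.1 (abs_le_of_sq_le_sq (a := y0 - f 10 q) (b := lam)
    (by nlinarith [mul_self_nonneg (x0 - f 9 q)]) hl.le)).2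
  have hy' : -(3 / 5 * lam) ≤ y0 - f 10 q := by
    rcases hdir with h | h
    · linarith
    · exact (abs_le.1 h.2).1
  rw [abs_le] at hx
  obtain ⟨i, hi, i1, i2⟩ := exists_grid (h := lam / 10) (t := f 12 q - x0) (by linarith)
    (by linarith) (by linarith)
  obtain ⟨k, hk, k1, k2⟩ := exists_grid (h := lam / 10) (t := f 11 q - y0) (by linarith)
    (by linarith) (by linarith)
  refine ⟨dir q, hd4, i, k, hi, hk, q, hq, ⟨by linarith, by linarith, by linarith, by linarith⟩,
    fun a ha hmax => ?_⟩
  obtain ⟨a1, a2⟩ := hal ha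
  obtain ⟨e1, e2, e3⟩ := h.same_cell hl hal hq ha (by linarith) (by linarith) hmax
  obtain ⟨r1', r2'⟩ := h.row a a1 a2
  obtain ⟨c1', c2'⟩ := h.cell a a1 a2
  have hdd : dir a = dir q := by
    refine hA.dir_eq (h.org_lt a a1 a2) (h.org_lt q q1 q2) (h.dir_lt a a1 a2) hd4 ?_ ?_ <;>
    · rw [← h.v a a1 a2, ← h.v q q1 q2]
      linarith
  rw [h.ox a a1 a2, h.oy a a1 a2, ← frame_dist (G := G) (dir q)]
  have hu := h.u a a1 a2
  have hv := h.v a a1 a2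
  rw [hdd] at hu hv
  rw [← hu, ← hv]
  refine near_of_arc_le hl hd ?_ ?_ hdir ?_
  · rw [abs_le]
    constructor <;> linarith
  · rw [abs_le]
    constructor <;> linarith
  · simp only [arc, h.s q q1 q2, h.s a a1 a2, h.w q q1 q2, h.w a a1 a2, e1, e2] at e3
    rw [show x0 - f 12 q - (f 9 q - f 12 q) = x0 - f 9 q by ring,
      show x0 - f 12 q - (f 9 a - f 12 q) = x0 - f 9 a by ring] at e3
    linarith

end UnitDisk

namespace UnitDisk

/-! ### The query -/

variable {M N K n : ℕ} {lam : ℝ} {X Y : ℕ → ℝ} {al : Set ℕ} {E : EnvData} {org dir : ℕ → ℕ}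
  {x y : ℝ} {s0 s s' : State}

/-- The query programs change only the registers below `10` and the real registers below `10`. -/
structure MemSame (s s' : State) : Prop where
  intReg : ∀ i, 10 ≤ i → s'.intReg i = s.intReg i
  realReg : ∀ i, 10 ≤ i → s'.realReg i = s.realReg i
  intMem : s'.intMem = s.intMem
  realMem : s'.realMem = s.realMem

theorem MemSame.trans {s'' : State} (h : MemSame s s') (h' : MemSame s' s'') : MemSame s s'' :=
  ⟨fun i hi => (h'.intReg i hi).trans (h.intReg i hi),
    fun i hi => (h'.realReg i hi).trans (h.realReg i hi), h'.intMem.trans h.intMem,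
    h'.realMem.trans h.realMem⟩

theorem MemSame.real (h : MemSame s s') : s'.real = s.real := by
  funext k a
  simp only [State.real, h.realMem]

theorem MemSame.treeOf (h : MemSame s s') : treeOf s' = treeOf s := by
  have hint : s'.int = s.int := by
    funext k a
    simp only [State.int, h.intMem]
  simp only [UnitDisk.treeOf, h.real, hint]

theorem MemSame.crossing (h : MemSame s s') : crossing s' = crossing s := by
  funext a b
  simp only [UnitDisk.crossing, h.real, h.realReg 10 le_rfl, h.realReg 12 (by norm_num)]

theorem Ready.memSame (h : Ready M N K n lam X Y org dir al E s) (hs : MemSame s s') :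
    Ready M N K n lam X Y org dir al E s' := by
  have r11 := hs.realReg 11 (by norm_num)
  refine ⟨h.size, h.room, h.mem, (hs.realReg 10 le_rfl).trans h.radius, r11 ▸ h.apart,
    (hs.realReg 12 (by norm_num)).trans h.slope, (hs.intReg 10 le_rfl).trans h.leaves,
    (hs.intReg 11 (by norm_num)).trans h.count, ?_, h.alive, ?_⟩
  · rw [r11, hs.real]
    exact h.layout
  · rw [hs.real, hs.crossing, hs.treeOf]
    exact h.tree

theorem Layout.row_le {G : ℝ} {f : ℕ → ℕ → ℝ} (h : Layout lam G n X Y f org dir) {t t' : ℕ}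
    (h1 : 1 ≤ t) (h2 : t < t') (h3 : t' ≤ 4 * n) : f 11 t ≤ f 11 t' := by
  have := h.sorted t t' h1 h2 h3
  rw [key_lt] at this
  exact this.elim le_of_lt fun h => h.1.le

/-- The cells of a row are searched by their bases. -/
def cellTest : Test :=
  .neg (lexLt (rreg 9) (rreg 7) (.const 0) (rld 11 (ireg 7)) (rld 12 (ireg 7)) (.const 0))

theorem Layout.cell_mono {G : ℝ} {f : ℕ → ℕ → ℝ} (h : Layout lam G n X Y f org dir) (hl : 0 < lam)
    {t t' : ℕ} (h1 : 1 ≤ t) (h2 : t < t') (h3 : t' ≤ 4 * n) :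
    key (f 11 t) (f 12 t) 0 ≤ key (f 11 t') (f 12 t') 0 := by
  rw [key_le]
  rcases (h.row_le h1 h2 h3).lt_or_eq with hlt | heq
  · exact .inl hlt
  · refine .inr ⟨heq, ?_⟩
    rcases h.cells t t' h1 h2 h3 with ⟨-, hc, -⟩ | ⟨-, hc⟩
    · exact .inr ⟨hc, le_rfl⟩
    · exact .inl (by linarith [hc heq])

/-- The probe in direction `d` at the point that is displaced by multiples of `lam / 10`. -/
def probe (d : ℕ) (i k : ℤ) : Program :=
  .cond (.intEq (ireg 0) (.const 0))
    ((.setInt 4 (.const d) ;; frame ;;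
      .setReal 6 (.add (rreg 3) (.mul (.const k) (.div (rreg 10) (.const 10)))) ;;
      .setReal 7 (.add (rreg 2) (.mul (.const i) (.div (rreg 10) (.const 10))))) ;;
    locate cellTest ;;
    .cond (.intEq (ireg 5) (.const 0)) .skip
      (.setReal 5 (.add (rld 7 (ireg 5)) (.sub (rreg 2) (rld 12 (ireg 5)))) ;;
      descend ;;
      .cond (.realLe (.add
          (.mul (.sub (rreg 0) (rld 13 (ireg 3))) (.sub (rreg 0) (rld 13 (ireg 3))))
          (.mul (.sub (rreg 1) (rld 14 (ireg 3))) (.sub (rreg 1) (rld 14 (ireg 3)))))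
          (.mul (rreg 10) (rreg 10)))
        (.setInt 0 (.const 1) ;; .setReal 0 (rld 13 (ireg 3)) ;; .setReal 1 (rld 14 (ireg 3)))
        .skip))
    .skip

/-- An alive position within reach of `(x, y)` has been found. -/
def Found (lam x y : ℝ) (al : Set ℕ) (s : State) : Prop :=
  s.intReg 0 = 1 ∧ ∃ a ∈ al, s.realReg 0 = s.real 13 a ∧ s.realReg 1 = s.real 14 a ∧
    (x - s.real 13 a) * (x - s.real 13 a) + (y - s.real 14 a) * (y - s.real 14 a) ≤ lam * lam

/-- Nothing has been found so far. -/
def Missing (x y : ℝ) (s : State) : Prop :=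
  s.intReg 0 = 0 ∧ s.realReg 0 = x ∧ s.realReg 1 = y

/-- If the probe hits the cell of an alive position, then a maximal function at the query point does
not belong to a point within reach. -/
def Failed (lam G x y : ℝ) (n : ℕ) (al : Set ℕ) (f : ℕ → ℕ → ℝ) (d : ℕ) (i k : ℤ) : Prop :=
  ∀ q ∈ al, Hits lam f q (frameU d x y + i * (lam / 10)) (frameV G d x y + k * (lam / 10)) →
    ∃ a ∈ al, MaxAt (posFun lam (4 * n + 1) f) al a (f 7 q + (frameU d x y - f 12 q)) ∧
      ¬ (x - f 13 a) * (x - f 13 a) + (y - f 14 a) * (y - f 14 a) ≤ lam * lam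

/-- The time for a probe, per level of the tree. -/
def probeBound : ℕ := cellTest.cost + 600

theorem cellTest_spec {m : ℕ} {ir : ℕ → ℕ} (y : ℝ) (h16 : 16 < M)
    (hM : ∀ k < 16, ∀ t ≤ m, ad k t < M) (h : ir 7 ≤ m) :
    cellTest.Ok M ⟨ir, Function.update s.realReg 9 y, s.intMem, s.realMem⟩ ∧
    (cellTest.Holds ⟨ir, Function.update s.realReg 9 y, s.intMem, s.realMem⟩ ↔
      key (s.real 11 (ir 7)) (s.real 12 (ir 7)) 0 ≤ key y (s.realReg 7) 0) := by
  constructor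
  · refine lexLt_ok ?_ ?_ ?_ ?_ ?_ ?_ <;> simp [h16, hM _ _ _ h]
  · rw [cellTest, holds_neg, lexLt_holds, not_lt]
    simp

theorem probe_runs (hR : Ready M N K n lam X Y org dir al E s) (hne : al.Nonempty) {d : ℕ}
    (hd : d < 4) (i k : ℤ) (hs : Missing x y s) :
    Runs M (probe d i k) s (fun τ s' => MemSame s s' ∧
      (Found lam x y al s' ∨ Missing x y s' ∧
        Failed lam (s.realReg 11) x y n al s.real d i k) ∧ τ ≤ probeBound * (K + 1)) := by
  obtain ⟨h0, hx, hy⟩ := hs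
  have hM := hR.mem
  have hroom := hR.room
  have hL := hR.layout
  have hl := hR.apart.pos
  have h16 : 16 < M := by omega
  have mem : ∀ k < 16, ∀ t ≤ 4 * n, ad k t < M := fun k hk t ht => by simp only [ad]; omega
  set G := s.realReg 11 with hG
  set u := frameU d x y with hu
  set v := frameV G d x y with hv
  have hpb : probeBound * (K + 1) = (cellTest.cost + 100) * (K + 1) + 500 * (K + 1) := by
    rw [← Nat.add_mul]
    rfl
  have cT : (Test.intEq (ireg 0) (.const 0)).cost = 3 := rfl
  refine Runs.cond (by simp; omega) (fun _ => ?_) fun h => absurd (by simpa using h0) h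
  apply Runs.seq
  refine Runs.of_wp (wp_mono (Q := fun s1 => MemSame s s1 ∧ s1.intReg 0 = 0 ∧
    s1.realReg 0 = x ∧ s1.realReg 1 = y ∧ s1.realReg 2 = u ∧
    s1.realReg 6 = v + k * (lam / 10) ∧ s1.realReg 7 = u + i * (lam / 10)) ?_ ?_)
  · refine wp_seq ⟨by simp; omega, ?_⟩
    refine wp_seq (frame_wp h16 ?_)
    simp [wp, hx, hy, h0, hR.radius, ← hu, ← hv, ← hG]
    constructor
    · intro i hi
      simp [show i ≠ 4 by omega]
    · intro i hi
      simp [show i ≠ 2 by omega, show i ≠ 3 by omega, show i ≠ 6 by omega, show i ≠ 7 by omega]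
    · rfl
    · rfl
  rintro s1 ⟨hs1, a0, ax, ay, au, a6, a7⟩ τ1 hτ1
  have hreal := hs1.real
  apply Runs.seq
  refine (locate_runs (m := 4 * n) (K := K) (b := cellTest)
    (P := fun y t => key (s1.real 11 t) (s1.real 12 t) 0 ≤ key y (s1.realReg 7) 0)
    (fun y ir _ _ h2 => cellTest_spec y h16 mem h2) (fun y t t' t1 t2 t3 h => ?_)
    (fun t t' t1 t2 t3 => ?_) ((hs1.intReg 11 (by norm_num)).trans hR.count)
    (hR.size ▸ hroom) (by omega)).mono ?_
  · rw [hreal] at h ⊢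
    exact (hL.cell_mono hl t1 t2 t3).trans h
  · rw [hreal]
    exact hL.row_le t1 t2 t3
  rintro τ2 s2 ⟨ir, rr, rfl, hir, hrr, h5, hloc, hτ2⟩
  have hs2 : MemSame s ⟨ir, rr, s1.intMem, s1.realMem⟩ := hs1.trans
    ⟨fun i hi => hir i (by omega), fun i hi => hrr i (by omega), rfl, rfl⟩
  have b0 : ir 0 = 0 := (hir 0 (by norm_num)).trans a0
  have bx : rr 0 = x := (hrr 0 (by norm_num)).trans ax
  have by' : rr 1 = y := (hrr 1 (by norm_num)).trans ay
  -- a cell that is hit is found by the search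
  have hcell : ∀ q ∈ al, Hits lam s.real q (u + i * (lam / 10)) (v + k * (lam / 10)) →
      ir 5 ≠ 0 ∧ s.real 12 (ir 5) = s.real 12 q ∧ s.real 7 (ir 5) = s.real 7 q := by
    intro q hq hh
    obtain ⟨q1, q2⟩ := hR.alive hq
    rw [hreal, a6, a7] at hloc
    have hch := hloc q q1 q2 hh.bot fun t t1 t2 h => by
      by_contra hc
      have := hL.rows q t q1 q2 t1 t2 (not_le.1 hc)
      linarith [hh.top]
    have hq5 : q ≤ ir 5 := (hch q q1 q2).1 (by
      rw [key_le]
      refine .inr ⟨rfl, hh.left.lt_or_eq.imp id fun h => ⟨h, le_rfl⟩⟩)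
    refine ⟨by omega, ?_⟩
    rcases Nat.eq_or_lt_of_le hq5 with h | h
    · rw [← h]
      exact ⟨rfl, rfl⟩
    have h6 := (hch (ir 5) (by omega) h5).2 le_rfl
    rw [key_le] at h6
    have hrow := hL.row_le q1 h h5
    obtain ⟨e1, e2⟩ := h6.resolve_left (not_lt.2 hrow)
    have e3 : s.real 12 (ir 5) ≤ u + i * (lam / 10) := e2.elim le_of_lt fun h => h.1.le
    rcases hL.cells q (ir 5) q1 h h5 with ⟨-, c1, c2⟩ | ⟨-, c1⟩
    · exact ⟨c1.symm, c2.symm⟩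
    · linarith [c1 e1.symm, hh.right]
  have hτ1' := hτ1.trans (show _ ≤ 100 from by
    simp [Program.bound, frame, Test.cost, IntExpr.cost, RealExpr.cost])
  have cU : (Test.intEq (ireg 5) (.const 0)).cost = 3 := rfl
  refine Runs.cond (by simp; omega) (fun h => ?_) fun h => ?_
  · have h' : ir 5 = 0 := h
    refine ⟨1, _, .skip _, hs2, .inr ⟨⟨b0, bx, by'⟩, fun q hq hh => absurd h' (hcell q hq hh).1⟩, ?_⟩
    omega
  refine Runs.seq_wp ⟨by simp [h16, mem _ _ _ h5], ?_⟩
  have hs3 : MemSame s ⟨ir, Function.update rr 5 (s.real 7 (ir 5) + (u - s.real 12 (ir 5))),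
      s1.intMem, s1.realMem⟩ := hs2.trans ⟨fun _ _ => rfl,
    fun i hi => Function.update_of_ne (by omega) _ _, rfl, rfl⟩
  simp only [reval_add, reval_sub, reval_rld, reval_reg, eval_reg, real_mk, hreal,
    (hrr 2 (by norm_num)).trans au]
  have hR3 := hR.memSame hs3
  apply Runs.seq
  refine (descend_runs hR3.setup hR.size hR3.alive hne hR3.tree hR3.leaves).mono ?_
  rintro τ3 s3 ⟨a, ha, hmax, rfl, hτ3⟩
  rw [hs3.real] at hmax
  simp only [Function.update_self] at hmax
  have ham := (hR.alive ha).2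
  refine Runs.of_wp (wp_mono (Q := fun s4 => MemSame s s4 ∧ (Found lam x y al s4 ∨
    Missing x y s4 ∧ ¬ (x - s.real 13 a) * (x - s.real 13 a) + (y - s.real 14 a) *
      (y - s.real 14 a) ≤ lam * lam)) ?_ ?_)
  · have r10 : rr 10 = lam := (hs2.realReg 10 le_rfl).trans hR.radius
    have fin : ∀ ir' rr', (∀ i, 10 ≤ i → ir' i = ir i) → (∀ i, 10 ≤ i → rr' i = rr i) →
        MemSame s ⟨ir', rr', s1.intMem, s1.realMem⟩ := fun ir' rr' h1 h2 =>
      hs2.trans ⟨h1, h2, rfl, rfl⟩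
    simp [wp, h16, mem _ _ _ ham, hreal, bx, by', show 1 < M by omega, r10]
    refine ⟨fun hc => ⟨fin _ _ (fun i hi => ?_) (fun i hi => ?_), .inl ⟨?_, a, ha, ?_, ?_, ?_⟩⟩,
      fun hc => ⟨fin _ _ (fun i hi => ?_) (fun i hi => ?_), .inr ⟨⟨?_, ?_, ?_⟩, hc⟩⟩⟩
    · simp [show i ≠ 0 by omega, show i ≠ 3 by omega]
    · simp [show i ≠ 0 by omega, show i ≠ 1 by omega, show i ≠ 5 by omega]
    · simp
    · simp [hreal]
    · simp [hreal]
    · simpa [hreal] using hc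
    · simp [show i ≠ 3 by omega]
    · simp [show i ≠ 5 by omega]
    · simpa using b0
    · simpa using bx
    · simpa using by'
  rintro s4 ⟨hs4, hres⟩ t ht t' ht'
  have ht2 := ht.trans (show _ ≤ 80 by decide)
  have ht2' := ht'.trans (show _ ≤ 30 by decide)
  refine ⟨hs4, hres.imp id fun ⟨hm, hfar⟩ => ⟨hm, fun q hq hh => ⟨a, ha, ?_, hfar⟩⟩, by omega⟩
  obtain ⟨-, e1, e2⟩ := hcell q hq hh
  rwa [e1, e2] at hmax

/-- Probe until something has been found. -/
def probes : List (ℕ × ℤ × ℤ) → Program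
  | [] => .skip
  | (d, i, k) :: l => probe d i k ;; probes l

theorem probes_found (hR : Ready M N K n lam X Y org dir al E s) (l : List (ℕ × ℤ × ℤ))
    (hs : Found lam x y al s) : Runs M (probes l) s (fun τ s' => s' = s ∧ τ ≤ 5 * l.length + 1) := by
  induction l with
  | nil => exact ⟨1, s, .skip s, rfl, by omega⟩
  | cons p l ih =>
    obtain ⟨d, i, k⟩ := p
    have hM := hR.mem
    have cT : (Test.intEq (ireg 0) (.const 0)).cost = 3 := rfl
    apply Runs.seq
    refine Runs.cond (by simp; omega) (fun h => ?_) fun _ => ⟨1, s, .skip s, ih.mono ?_⟩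
    · have h0 : s.intReg 0 = 0 := h
      rw [hs.1] at h0
      omega
    · rintro τ s' ⟨rfl, hτ⟩
      refine ⟨rfl, ?_⟩
      rw [List.length_cons]
      omega

theorem probes_runs (l : List (ℕ × ℤ × ℤ)) (hl : ∀ p ∈ l, p.1 < 4)
    (hR : Ready M N K n lam X Y org dir al E s) (hne : al.Nonempty) (hs : Missing x y s) :
    Runs M (probes l) s (fun τ s' => MemSame s s' ∧ (Found lam x y al s' ∨ Missing x y s' ∧
      ∀ p ∈ l, Failed lam (s.realReg 11) x y n al s.real p.1 p.2.1 p.2.2) ∧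
      τ ≤ (probeBound + 5) * (l.length * (K + 1)) + 1) := by
  induction l generalizing s with
  | nil => exact ⟨1, s, .skip s, ⟨fun _ _ => rfl, fun _ _ => rfl, rfl, rfl⟩, .inr ⟨hs, by simp⟩,
      by omega⟩
  | cons p l ih =>
    obtain ⟨d, i, k⟩ := p
    apply Runs.seq
    refine (probe_runs hR hne (hl _ List.mem_cons_self) i k hs).mono ?_
    rintro τ s1 ⟨hs1, hres, hτ⟩
    have e1 : (probeBound + 5) * (((d, i, k) :: l).length * (K + 1)) =
        (probeBound + 5) * (l.length * (K + 1)) + probeBound * (K + 1) + 5 * (K + 1) := by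
      rw [List.length_cons]
      ring
    have hR1 := hR.memSame hs1
    rcases hres with hres | ⟨hm, hf⟩
    · refine (probes_found hR1 l hres).mono ?_
      rintro τ' s' ⟨rfl, hτ'⟩
      refine ⟨hs1, .inl hres, ?_⟩
      have : 5 * l.length ≤ (probeBound + 5) * (l.length * (K + 1)) := by
        refine Nat.mul_le_mul (by omega) (Nat.le_mul_of_pos_right _ (by omega))
      omega
    · refine (ih (fun p hp => hl p (List.mem_cons_of_mem _ hp)) hR1 hm).mono ?_
      rintro τ' s' ⟨hs2, hres, hτ'⟩
      refine ⟨hs1.trans hs2, hres.imp id fun ⟨hm', hf'⟩ => ⟨hm', fun p hp => ?_⟩, by omega⟩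
      rcases List.mem_cons.1 hp with rfl | hp
      · exact hf
      · have := hf' p hp
        rwa [hs1.real, hs1.realReg 11 (by norm_num)] at this

/-- The displacements of the probes, in units of `lam / 10`. -/
def grid : List ℤ := (List.range 20).map fun j : ℕ => (j : ℤ) - 11

theorem mem_grid {i : ℤ} (h1 : -11 ≤ i) (h2 : i ≤ 8) : i ∈ grid := by
  rw [grid, List.mem_map]
  have hlt : (i + 11).toNat < 20 := by omega
  refine ⟨(i + 11).toNat, List.mem_range.2 hlt, ?_⟩
  omega

/-- All probes. -/
def allProbes : List (ℕ × ℤ × ℤ) := List.range 4 ×ˢ grid ×ˢ grid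

/-- The query for the point in the real registers `0` and `1`. -/
def query : Program :=
  .setInt 0 (.const 0) ;; .cond (.intEq (ild 4 (.const 1)) (.const 0)) .skip (probes allProbes)

/-- The time for a query, per level of the tree. -/
def queryBound : ℕ := (probeBound + 5) * allProbes.length + 20

theorem query_runs {A : Set ℕ} (hR : Ready M N K n lam X Y org dir al E s)
    (hal : al = {t | (1 ≤ t ∧ t ≤ 4 * n) ∧ org t ∈ A}) (hA : ∀ j ∈ A, j < n) :
    Runs M query s (fun τ s' => MemSame s s' ∧ τ ≤ queryBound * (K + 1) ∧
      ((s'.intReg 0 = 1 ∧ ∃ j ∈ A, s'.realReg 0 = X j ∧ s'.realReg 1 = Y j ∧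
        (s.realReg 0 - X j) * (s.realReg 0 - X j) + (s.realReg 1 - Y j) * (s.realReg 1 - Y j) ≤
          lam * lam) ∨
      (s'.intReg 0 = 0 ∧ ∀ j ∈ A, ¬ (s.realReg 0 - X j) * (s.realReg 0 - X j) +
        (s.realReg 1 - Y j) * (s.realReg 1 - Y j) ≤ lam * lam))) := by
  have hM := hR.mem
  have hroom := hR.room
  set s1 : State := ⟨Function.update s.intReg 0 0, s.realReg, s.intMem, s.realMem⟩ with hs1
  have hms : MemSame s s1 := ⟨fun i hi => Function.update_of_ne (by omega) _ _, fun _ _ => rfl, rfl,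
    rfl⟩
  have hR1 := hR.memSame hms
  have hq : queryBound * (K + 1) =
      (probeBound + 5) * (allProbes.length * (K + 1)) + 20 * (K + 1) := by
    rw [queryBound]
    ring
  refine Runs.seq_wp ⟨by simp; omega, ?_⟩
  change Runs M _ s1 _
  have cT : (Test.intEq (ild 4 (.const 1)) (.const 0)).cost = 8 := rfl
  have cU : (Program.setInt 0 (.const 0)).bound = 2 := rfl
  have mem1 : ad 4 1 < M := by simp only [ad]; omega
  have hroot := hR1.tree.nodeOK
  have hlen := hroot.len_ne fun a ha => (hR1.alive ha).1
  refine Runs.cond (by simp [mem1]; omega) (fun h => ?_) fun h => ?_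
  · have h0 : (treeOf s1).fst 1 = 0 := h
    refine ⟨1, _, .skip _, fun t ht => ⟨hms, by omega, .inr ⟨by simp [hs1], fun j hj => ?_⟩⟩⟩
    obtain ⟨t, t1, t2, t3, -⟩ := hR.layout.surj j (hA j hj) 0 (by norm_num)
    have htal : t ∈ al := hal ▸ ⟨⟨t1, t2⟩, t3 ▸ hj⟩
    have := (hroot.env.first t ⟨htal, path_root hR.size (by omega)⟩).1
    exact absurd h0 (hlen.1 (by omega))
  · have h0 : (treeOf s1).fst 1 ≠ 0 := h
    have hne : al.Nonempty := ⟨_, (hroot.env.mem 1 le_rfl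
      (Nat.one_le_iff_ne_zero.2 (hlen.2 h0))).1⟩
    refine (probes_runs (x := s.realReg 0) (y := s.realReg 1) allProbes (fun p hp => ?_) hR1 hne
      ⟨by simp [hs1], rfl, rfl⟩).mono ?_
    · exact List.mem_range.1 (List.pair_mem_product.1 (show (p.1, p.2) ∈ _ from hp)).1
    rintro τ s2 ⟨hms2, hres, hτ⟩ t ht
    refine ⟨hms.trans hms2, by omega, hres.imp (fun ⟨h1, a, ha, e1, e2, e3⟩ => ?_)
      fun ⟨hm, hf⟩ => ⟨hm.1, fun j hj hd => ?_⟩⟩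
    · rw [hal] at ha
      rw [hms2.real, hms.real, hR.layout.ox a ha.1.1 ha.1.2] at e1 e3
      rw [hms2.real, hms.real, hR.layout.oy a ha.1.1 ha.1.2] at e2
      rw [hR.layout.oy a ha.1.1 ha.1.2] at e3
      exact ⟨h1, org a, ha.2, e1, e2, e3⟩
    · obtain ⟨d, hd4, i, k, hi, hk, q, hq, hh, hclose⟩ := hR.layout.exists_probe hR.apart (al := al)
        (hA j hj) hR.alive (fun t t1 t2 t3 => hal ▸ ⟨⟨t1, t2⟩, t3 ▸ hj⟩) hd
      have := hf (d, i, k) (List.pair_mem_product.2 ⟨List.mem_range.2 hd4,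
        List.pair_mem_product.2 ⟨mem_grid hi.1 hi.2, mem_grid hk.1 hk.2⟩⟩)
      obtain ⟨a, ha, hmax, hfar⟩ := this q hq hh
      exact hfar (hclose a ha hmax)

end UnitDisk

namespace UnitDisk

/-! ### The deletion -/

variable {M N K n : ℕ} {lam : ℝ} {X Y : ℕ → ℝ} {al A : Set ℕ} {E : EnvData} {org dir : ℕ → ℕ}
  {s : State}

theorem Layout.base_le {G : ℝ} {f : ℕ → ℕ → ℝ} (h : Layout lam G n X Y f org dir) {t t' : ℕ}
    (h1 : 1 ≤ t) (h2 : t ≤ 4 * n) (h3 : 1 ≤ t') (h4 : t' ≤ 4 * n) (hle : f 11 t' ≤ f 10 t) :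
    f 11 t' ≤ f 11 t := by
  by_contra hc
  have := h.rows t t' h1 h2 h3 h4 (not_le.1 hc)
  linarith [(h.row t h1 h2).2]

theorem Layout.unique {G : ℝ} {f : ℕ → ℕ → ℝ} (h : Layout lam G n X Y f org dir) {t t' : ℕ}
    (h1 : 1 ≤ t) (h2 : t ≤ 4 * n) (h3 : 1 ≤ t') (h4 : t' ≤ 4 * n) (ho : org t = org t')
    (hd : dir t = dir t') : t = t' := by
  have e9 : f 9 t = f 9 t' := by rw [h.u t h1 h2, h.u t' h3 h4, ho, hd]
  have e10 : f 10 t = f 10 t' := by rw [h.v t h1 h2, h.v t' h3 h4, ho, hd]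
  have e11 : f 11 t = f 11 t' := le_antisymm
    (h.base_le h3 h4 h1 h2 (e10 ▸ (h.row t h1 h2).1))
    (h.base_le h1 h2 h3 h4 (e10 ▸ (h.row t' h3 h4).1))
  rcases lt_trichotomy t t' with hlt | heq | hlt
  · have := h.sorted t t' h1 hlt h4
    rw [e9, e10, e11] at this
    exact absurd this (lt_irrefl _)
  · exact heq
  · have := h.sorted t' t h3 hlt h2
    rw [e9, e10, e11] at this
    exact absurd this (lt_irrefl _)

/-- The positions are searched by their keys. -/
def keyTest : Test :=
  .neg (lexLt (rreg 9) (rreg 7) (rreg 8) (rld 11 (ireg 7)) (rld 9 (ireg 7)) (rld 10 (ireg 7)))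

theorem keyTest_spec {m : ℕ} {ir : ℕ → ℕ} (y : ℝ) (h16 : 16 < M)
    (hM : ∀ k < 16, ∀ t ≤ m, ad k t < M) (h : ir 7 ≤ m) :
    keyTest.Ok M ⟨ir, Function.update s.realReg 9 y, s.intMem, s.realMem⟩ ∧
    (keyTest.Holds ⟨ir, Function.update s.realReg 9 y, s.intMem, s.realMem⟩ ↔
      key (s.real 11 (ir 7)) (s.real 9 (ir 7)) (s.real 10 (ir 7)) ≤
        key y (s.realReg 7) (s.realReg 8)) := by
  constructor
  · refine lexLt_ok ?_ ?_ ?_ ?_ ?_ ?_ <;> simp [h16, hM _ _ _ h]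
  · rw [keyTest, holds_neg, lexLt_holds, not_lt]
    simp

/-- Delete the position that carries the point in the real registers `0` and `1` in direction
`d`. -/
def removeDir (d : ℕ) : Program :=
  (.setInt 4 (.const d) ;; frame ;; .setReal 6 (rreg 3) ;; .setReal 7 (rreg 2) ;;
    .setReal 8 (rreg 3)) ;;
  locate keyTest ;; .setInt 2 (ireg 5) ;; deletePos

/-- The time for the deletion of a position, per level of the tree. -/
def removeBound : ℕ := deleteBound + (keyTest.cost + 300)

theorem removeDir_runs (hR : Ready M N K n lam X Y org dir al E s) {d q : ℕ} (hd : d < 4)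
    (hq : q ∈ al) (hqd : dir q = d) (hx : s.realReg 0 = X (org q)) (hy : s.realReg 1 = Y (org q)) :
    Runs M (removeDir d) s (fun τ s' => ∃ E', Ready M N K n lam X Y org dir (al \ {q}) E' s' ∧
      s'.realReg 0 = s.realReg 0 ∧ s'.realReg 1 = s.realReg 1 ∧
      τ + 2 * sweepBound * E.total N ≤ removeBound * (K + 2) + 2 * sweepBound * E'.total N) := by
  have hM := hR.mem
  have hroom := hR.room
  have hL := hR.layout
  have h16 : 16 < M := by omega
  have mem : ∀ k < 16, ∀ t ≤ 4 * n, ad k t < M := fun k hk t ht => by simp only [ad]; omega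
  obtain ⟨q1, q2⟩ := hR.alive hq
  apply Runs.seq
  refine Runs.of_wp (wp_mono (Q := fun s1 => MemSame s s1 ∧ s1.realReg 0 = s.realReg 0 ∧
    s1.realReg 1 = s.realReg 1 ∧ s1.realReg 6 = s.real 10 q ∧ s1.realReg 7 = s.real 9 q ∧
    s1.realReg 8 = s.real 10 q) ?_ ?_)
  · refine wp_seq ⟨by simp; omega, ?_⟩
    refine wp_seq (frame_wp h16 ?_)
    rw [hL.u q q1 q2, hL.v q q1 q2, hqd]
    simp [wp, hx, hy]
    constructor
    · intro i hi
      simp [show i ≠ 4 by omega]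
    · intro i hi
      simp [show i ≠ 2 by omega, show i ≠ 3 by omega, show i ≠ 6 by omega, show i ≠ 7 by omega,
        show i ≠ 8 by omega]
    · rfl
    · rfl
  rintro s1 ⟨hs1, ax, ay, a6, a7, a8⟩ τ1 hτ1
  have hτ1' := hτ1.trans (show _ ≤ 100 from by
    simp [Program.bound, frame, Test.cost, IntExpr.cost, RealExpr.cost])
  have hreal := hs1.real
  apply Runs.seq
  refine (locate_runs (m := 4 * n) (K := K) (b := keyTest)
    (P := fun y t => key (s1.real 11 t) (s1.real 9 t) (s1.real 10 t) ≤
      key y (s1.realReg 7) (s1.realReg 8))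
    (fun y ir _ _ h2 => keyTest_spec y h16 mem h2) (fun y t t' t1 t2 t3 h => ?_)
    (fun t t' t1 t2 t3 => ?_) ((hs1.intReg 11 (by norm_num)).trans hR.count)
    (hR.size ▸ hroom) (by omega)).mono ?_
  · rw [hreal] at h ⊢
    exact (hL.sorted t t' t1 t2 t3).le.trans h
  · rw [hreal]
    exact hL.row_le t1 t2 t3
  rintro τ2 s2 ⟨ir, rr, rfl, hir, hrr, h5, hloc, hτ2⟩
  rw [hreal, a6, a7, a8] at hloc
  have hch := hloc q q1 q2 (hL.row q q1 q2).1 fun t t1 t2 h => hL.base_le q1 q2 t1 t2 h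
  have hq5 : ir 5 = q := by
    have h1 := (hch q q1 q2).1 le_rfl
    by_contra hc
    exact absurd ((hch (ir 5) (by omega) h5).2 le_rfl)
      (not_le.2 (hL.sorted q (ir 5) q1 (by omega) h5))
  refine Runs.seq_wp ⟨trivial, ?_⟩
  simp only [eval_reg]
  rw [hq5]
  have hs3 : MemSame s ⟨Function.update ir 2 q, rr, s1.intMem, s1.realMem⟩ := hs1.trans
    ⟨fun i hi => (Function.update_of_ne (by omega) _ _).trans (hir i (by omega)),
      fun i hi => hrr i (by omega), rfl, rfl⟩
  have hR3 := hR.memSame hs3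
  refine (deletePos_runs hR3.setup hR.size hR3.alive hq rfl hR3.tree hR3.leaves (by simp)).mono ?_
  rintro τ3 s3 ⟨E', hT, hk, hτ3⟩ t ht
  have ht' : t ≤ 2 := ht.trans (show _ ≤ 2 by decide)
  refine ⟨E', hR3.keeps hk Set.sdiff_subset rfl hT, ?_, ?_, ?_⟩
  · rw [hk.realReg 0 (by norm_num), ← ax, ← hrr 0 (by norm_num)]
  · rw [hk.realReg 1 (by norm_num), ← ay, ← hrr 1 (by norm_num)]
  · have e1 : removeBound * (K + 2) =
        deleteBound * (K + 2) + (keyTest.cost + 300) * (K + 2) := by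
      rw [← Nat.add_mul]
      rfl
    have e2 : (keyTest.cost + 300) * (K + 2) =
        (keyTest.cost + 100) * (K + 1) + (keyTest.cost + 100) + 200 * (K + 2) := by
      generalize keyTest.cost = x
      ring
    omega

/-- Delete the positions that carry the point in the real registers `0` and `1` in the given
directions. -/
def removeDirs : List ℕ → Program
  | [] => .skip
  | d :: l => removeDir d ;; removeDirs l

theorem removeDirs_runs {j : ℕ} (hj : j ∈ A) (hA : ∀ j ∈ A, j < n) (l : List ℕ) (hl : l.Nodup)
    (hd : ∀ d ∈ l, d < 4) (hR : Ready M N K n lam X Y org dir al E s)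
    (hal : al = {t | (1 ≤ t ∧ t ≤ 4 * n) ∧ org t ∈ A ∧ (org t = j → dir t ∈ l)})
    (hx : s.realReg 0 = X j) (hy : s.realReg 1 = Y j) :
    Runs M (removeDirs l) s (fun τ s' => ∃ E',
      Ready M N K n lam X Y org dir {t | (1 ≤ t ∧ t ≤ 4 * n) ∧ org t ∈ A \ {j}} E' s' ∧
      τ + 2 * sweepBound * E.total N ≤
        removeBound * (K + 2) * l.length + 1 + 2 * sweepBound * E'.total N) := by
  induction l generalizing s al E with
  | nil =>
    refine ⟨1, s, .skip s, E, ?_, by omega⟩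
    convert hR using 1
    rw [hal]
    ext t
    simp
  | cons d l ih =>
    obtain ⟨q, q1, q2, qo, qd⟩ := hR.layout.surj j (hA j hj) d (hd d List.mem_cons_self)
    have hq : q ∈ al := by
      rw [hal]
      exact ⟨⟨q1, q2⟩, qo ▸ hj, fun _ => qd ▸ List.mem_cons_self⟩
    rw [List.nodup_cons] at hl
    apply Runs.seq
    refine (removeDir_runs hR (hd d List.mem_cons_self) hq qd (qo ▸ hx) (qo ▸ hy)).mono ?_
    rintro τ1 s1 ⟨E1, hR1, hx1, hy1, hτ1⟩
    refine (ih hl.2 (fun d hd' => hd d (List.mem_cons_of_mem _ hd')) hR1 ?_ (hx1.trans hx)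
      (hy1.trans hy)).mono ?_
    · rw [hal]
      ext t
      constructor
      · rintro ⟨⟨h1, h2, h3⟩, h4⟩
        refine ⟨h1, h2, fun h => (List.mem_cons.1 (h3 h)).resolve_left fun hdt => h4 ?_⟩
        exact hR.layout.unique h1.1 h1.2 q1 q2 (h.trans qo.symm) (hdt.trans qd.symm)
      · rintro ⟨h1, h2, h3⟩
        refine ⟨⟨h1, h2, fun h => List.mem_cons_of_mem _ (h3 h)⟩, ?_⟩
        rintro rfl
        exact hl.1 (qd ▸ h3 qo)
    · rintro τ2 s2 ⟨E2, hR2, hτ2⟩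
      refine ⟨E2, hR2, ?_⟩
      rw [List.length_cons, mul_add _ l.length]
      omega

/-- The deletion of the point in the real registers `0` and `1`. -/
def delete : Program := removeDirs (List.range 4)

theorem delete_runs {j : ℕ} (hj : j ∈ A) (hA : ∀ j ∈ A, j < n)
    (hR : Ready M N K n lam X Y org dir al E s)
    (hal : al = {t | (1 ≤ t ∧ t ≤ 4 * n) ∧ org t ∈ A}) (hx : s.realReg 0 = X j)
    (hy : s.realReg 1 = Y j) :
    Runs M delete s (fun τ s' => ∃ E',
      Ready M N K n lam X Y org dir {t | (1 ≤ t ∧ t ≤ 4 * n) ∧ org t ∈ A \ {j}} E' s' ∧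
      τ + 2 * sweepBound * E.total N ≤
        removeBound * (K + 2) * 4 + 1 + 2 * sweepBound * E'.total N) := by
  refine removeDirs_runs hj hA _ List.nodup_range (fun d hd => List.mem_range.1 hd) hR ?_ hx hy
  rw [hal]
  ext t
  constructor
  · rintro ⟨h1, h2⟩
    exact ⟨h1, h2, fun _ => List.mem_range.2 (hR.layout.dir_lt t h1.1 h1.2)⟩
  · rintro ⟨h1, h2, -⟩
    exact ⟨h1, h2⟩

end UnitDisk

namespace UnitDisk

/-! ### Sequences of operations -/

variable {M N K n : ℕ} {lam : ℝ} {X Y : ℕ → ℝ} {al A : Set ℕ} {E : EnvData} {org dir : ℕ → ℕ}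
  {s : State} {P : Fin n → Plane}

theorem dist_le_iff (hl : 0 ≤ lam) (p q : Plane) : dist p q ≤ lam ↔
    (p 0 - q 0) * (p 0 - q 0) + (p 1 - q 1) * (p 1 - q 1) ≤ lam * lam := by
  rw [EuclideanSpace.dist_eq, Real.sqrt_le_iff, Fin.sum_univ_two, Real.dist_eq, Real.dist_eq,
    sq_abs, sq_abs, and_iff_right hl]
  simp only [sq]

/-- The coordinates of the points as sequences. -/
noncomputable def coord (P : Fin n → Plane) (i : Fin 2) (j : ℕ) : ℝ :=
  if h : j < n then P ⟨j, h⟩ i else 0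

theorem coord_val (P : Fin n → Plane) (i : Fin 2) (j : Fin n) : coord P i j = P j i :=
  dif_pos j.2

theorem memSame_withArg (s : State) (p : Plane) : MemSame s (withArg s p) := by
  refine ⟨fun _ _ => rfl, fun i hi => ?_, rfl, rfl⟩
  simp [withArg, show i ≠ 0 by omega, show i ≠ 1 by omega]

/-- The deletions are paid for by the growth of the total length of the envelopes. -/
theorem Ready.serves {Q : Set Plane} (ops : List Operation) (hP : Function.Injective P)
    (hR : Ready M N K n lam (coord P 0) (coord P 1) org dir al E s)
    (hal : al = {t | (1 ≤ t ∧ t ≤ 4 * n) ∧ org t ∈ A}) (hA : ∀ j ∈ A, j < n)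
    (hQ : Q = P '' {j | (j : ℕ) ∈ A}) (hleg : Legal Q ops) :
    ∃ d, Serves M ⟨build, query, delete⟩ lam (queryBound * (K + 1)) Q s ops d ∧
      d + 2 * sweepBound * E.total N ≤
        (removeBound * (K + 2) * 4 + 1) * deletions ops + 2 * sweepBound * (N * (K + 1)) := by
  have hl := hR.apart.pos
  induction ops generalizing s al A E Q with
  | nil =>
    refine ⟨0, .nil Q s, ?_⟩
    have := Nat.mul_le_mul_left (2 * sweepBound) (hR.tree.total_le hR.size)
    omega
  | cons o ops ih =>
    cases o with
    | query p =>
      obtain ⟨t, s', hex, hms, ht, hans⟩ :=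
        query_runs (hR.memSame (memSame_withArg s p)) hal hA
      obtain ⟨d, hd, hb⟩ := ih (hR.memSame ((memSame_withArg s p).trans hms)) hal hA hQ hleg
      refine ⟨d, .query hex ht ?_ hd, hb⟩
      have e0 : (withArg s p).realReg 0 = p 0 := by simp [withArg]
      have e1 : (withArg s p).realReg 1 = p 1 := by simp [withArg]
      rw [e0, e1] at hans
      refine hans.imp (fun ⟨h, j, hj, hx, hy, hd⟩ => ⟨h, P ⟨j, hA j hj⟩, ?_, ?_, ?_, ?_⟩)
        fun ⟨h, hf⟩ => ⟨h, fun q hq => ?_⟩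
      · rw [hQ]
        exact ⟨_, hj, rfl⟩
      · rw [dist_le_iff hl.le, ← coord_val, ← coord_val]
        exact hd
      · rw [hx, ← coord_val]
      · rw [hy, ← coord_val]
      · rw [hQ] at hq
        obtain ⟨j, hj, rfl⟩ := hq
        rw [dist_le_iff hl.le, ← coord_val, ← coord_val]
        exact hf j hj
    | delete q =>
      obtain ⟨hq, hleg⟩ := hleg
      rw [hQ] at hq
      obtain ⟨j, hj, rfl⟩ := hq
      obtain ⟨t, s', hex, E', hR', hb'⟩ :=
        delete_runs hj hA (hR.memSame (memSame_withArg s (P j))) hal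
          (by rw [coord_val]; simp [withArg]) (by rw [coord_val]; simp [withArg])
      have hQ' : Q \ {P j} = P '' {i | (i : ℕ) ∈ A \ {(j : ℕ)}} := by
        rw [hQ]
        ext q
        constructor
        · rintro ⟨⟨i, hi, rfl⟩, hne⟩
          exact ⟨i, ⟨hi, fun h => hne (congrArg P (Fin.ext h))⟩, rfl⟩
        · rintro ⟨i, ⟨hi, hne⟩, rfl⟩
          exact ⟨⟨i, hi, rfl⟩, fun h => hne (congrArg Fin.val (hP h))⟩
      obtain ⟨d, hd, hb⟩ := ih hR' rfl (fun i hi => hA i hi.1) hQ' hleg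
      refine ⟨t + d, .delete hex hd, ?_⟩
      rw [deletions, mul_add_one]
      omega

theorem coords_input (lam : ℝ) (P : Fin n → Plane) (hM : 2 * n + 20 ≤ M) :
    Coords M n (coord P 0) (coord P 1) (input lam P) := by
  refine ⟨hM, fun j hj => ?_, fun j hj => ?_⟩
  · have e : 2 * j / 2 = j := by omega
    simp [input, coord, e, hj]
  · have e : (2 * j + 1) / 2 = j := by omega
    simp [input, coord, e, hj, show (2 * j + 1) % 2 = 1 by omega]

/-- The constant of the theorem. -/
def totalBound : ℕ :=
  300 + 48 * buildBound + 6 * queryBound + 96 * sweepBound + (24 * removeBound + 1)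

theorem height_le (hN : N = 2 ^ K) (h : N ≤ 8 * n + 1) : K + 2 ≤ 6 * Nat.log 2 (n + 2) := by
  have h1 : n + 2 < 2 ^ (Nat.log 2 (n + 2) + 1) := Nat.lt_pow_succ_log_self (by norm_num) _
  have h2 : 1 ≤ Nat.log 2 (n + 2) := Nat.log_pos (by norm_num) (by omega)
  have h3 : 2 ^ K < 2 ^ (Nat.log 2 (n + 2) + 4) := by
    rw [show Nat.log 2 (n + 2) + 4 = Nat.log 2 (n + 2) + 1 + 3 by ring, pow_add _ _ 3, ← hN]
    omega
  have := (Nat.pow_lt_pow_iff_right (by norm_num : 1 < 2)).1 h3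
  omega

theorem Serves.mono {D : DataStructure} {T T' d : ℕ} {Q : Set Plane} {ops : List Operation}
    (h : Serves M D lam T Q s ops d) (hT : T ≤ T') : Serves M D lam T' Q s ops d := by
  induction h with
  | nil Q s => exact .nil Q s
  | query hrun ht hans _ ih => exact .query hrun (ht.trans hT) hans ih
  | delete hrun _ ih => exact .delete hrun ih

end UnitDisk

/-- There are fixed programs and a constant `K` such that, for every radius and every set of `n`
points, using `K (n + 1)` memory cells throughout (with words that just suffice to address them):
the construction takes `O(n log n)` steps; afterwards, in every sequence of queries and deletions,
every query is answered within `O(log n)` steps, and the construction and the `k` deletions of the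
sequence take `O(n log n + k log n)` steps together. -/
theorem theorem1 :
    ∃ (D : DataStructure) (K : ℕ), ∀ (lam : ℝ), 0 < lam → ∀ (n : ℕ) (P : Fin n → Plane),
      Function.Injective P →
      ∃ (s : State) (b : ℕ),
        Exec (K * (n + 1)) D.build (input lam P) b s ∧
        b ≤ K * ((n + 1) * Nat.log 2 (n + 2)) ∧
        ∀ ops : List Operation, Legal (Set.range P) ops →
          ∃ d : ℕ,
            Serves (K * (n + 1)) D lam (K * Nat.log 2 (n + 2)) (Set.range P) s ops d ∧
            b + d ≤ K * ((n + 1) * Nat.log 2 (n + 2)) + K * (deletions ops * Nat.log 2 (n + 2)) := by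
  refine ⟨⟨build, query, delete⟩, totalBound, fun lam hl n P hP => ?_⟩
  obtain ⟨B, hB⟩ : ∃ B, B = buildBound := ⟨_, rfl⟩
  obtain ⟨W, hW⟩ : ∃ W, W = queryBound := ⟨_, rfl⟩
  obtain ⟨V, hV⟩ : ∃ V, V = sweepBound := ⟨_, rfl⟩
  obtain ⟨R, hR⟩ : ∃ R, R = removeBound := ⟨_, rfl⟩
  obtain ⟨C, hC⟩ : ∃ C, C = totalBound := ⟨_, rfl⟩
  have hC' : C = 300 + 48 * B + 6 * W + 96 * V + (24 * R + 1) := by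
    rw [hC, hB, hW, hV, hR]
    rfl
  rw [← hC]
  have hM : 300 * (n + 1) ≤ C * (n + 1) := Nat.mul_le_mul_right _ (by omega)
  obtain ⟨b, s, hex, N, K, org, dir, E, hready, hN, hb⟩ :=
    build_runs (X := coord P 0) (Y := coord P 1) (coords_input lam P (by omega)) hM hl
      (by simp [input]) (by simp [input]) (fun _ => rfl) fun j hj j' hj' hx hy => by
        simp only [coord, hj, hj', dif_pos] at hx hy
        refine congrArg Fin.val (hP (a₁ := ⟨j, hj⟩) (a₂ := ⟨j', hj'⟩) ?_)
        ext i
        fin_cases i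
        · exact hx
        · exact hy
  have hK := height_le hready.size hN
  have hNK : N * (K + 2) ≤ 48 * ((n + 1) * Nat.log 2 (n + 2)) :=
    (Nat.mul_le_mul (by omega : N ≤ 8 * (n + 1)) hK).trans (le_of_eq (by ring))
  have hL : 1 ≤ Nat.log 2 (n + 2) := Nat.log_pos (by norm_num) (by omega)
  generalize Nat.log 2 (n + 2) = L at *
  rw [← hB] at hb
  have hb' := hb.trans (Nat.mul_le_mul_left B hNK)
  generalize hx : (n + 1) * L = x at *
  have hCx : C * x = 300 * x + B * (48 * x) + 6 * (W * x) + V * (96 * x) + (24 * R + 1) * x := by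
    rw [hC']
    ring
  refine ⟨s, b, hex, by omega, fun ops hops => ?_⟩
  obtain ⟨d, hd, hbd⟩ := hready.serves (A := {j | j < n}) ops hP
    (Set.ext fun t => ⟨fun h => ⟨h, hready.layout.org_lt t h.1 h.2⟩, fun h => h.1⟩)
    (fun _ h => h) (by simp [Set.image_univ]) hops
  rw [← hV, ← hR] at hbd
  have hT : queryBound * (K + 1) ≤ C * L := by
    rw [← hW]
    calc W * (K + 1) ≤ W * (6 * L) := Nat.mul_le_mul_left _ (by omega)
      _ = 6 * W * L := by ring
      _ ≤ C * L := Nat.mul_le_mul_right _ (by omega)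
  refine ⟨d, hd.mono hT, ?_⟩
  have h1 : 2 * V * (N * (K + 1)) ≤ V * (96 * x) :=
    calc 2 * V * (N * (K + 1)) ≤ 2 * V * (48 * x) :=
        Nat.mul_le_mul_left _ ((Nat.mul_le_mul_left _ (by omega)).trans hNK)
      _ = V * (96 * x) := by ring
  have h2 : (R * (K + 2) * 4 + 1) * deletions ops ≤ C * (deletions ops * L) :=
    calc (R * (K + 2) * 4 + 1) * deletions ops ≤ (R * (6 * L) * 4 + L) * deletions ops :=
        Nat.mul_le_mul_right _ (Nat.add_le_add (Nat.mul_le_mul_right _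
          (Nat.mul_le_mul_left _ hK)) hL)
      _ = (24 * R + 1) * (deletions ops * L) := by ring
      _ ≤ C * (deletions ops * L) := Nat.mul_le_mul_right _ (by omega)
  omega
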